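/- All algebras are over $\mathbb C$. A quasi-Hopf algebra $(H,\Delta,\varepsilon,\Phi,S,\alpha,\beta)$ is understood in the sense of Drinfeld (with bijective antipode). A twist of $H$ is an invertible $F\in H\otimes H$ with $(\varepsilon\otimes \mathrm{id})(F)=(\mathrm{id}\otimes\varepsilon)(F)=1$; the twisted quasi-Hopf algebra $H^F$ has the same algebra structure, counit and antipode as $H$, and $$\Delta^F(h)=F\Delta(h)F^{-1},\qquad \Phi^F=(1\otimes F)(\mathrm{id}\otimes\Delta)(F)\,\Phi\,(\Delta\otimes \mathrm{id})(F^{-1})(F^{-1}\otimes 1),$$ $\alpha^F=\sum S(d_i)\alpha e_i$, $\beta^F=\sum f_i\beta S(g_i)$, where $F=\sum f_i\otimes g_i$, $F^{-1}=\sum d_i\otimes e_i$. An isomorphism of quasi-Hopf algebras is an algebra isomorphism compatible with $\Delta,\varepsilon,\Phi$ and, up to the usual equivalence $(S,\alpha,\beta)\sim(uS(\cdot)u^{-1},u\alpha,\beta u^{-1})$ with $u$ invertible, with $(S,\alpha,\beta)$. A finite dimensional algebra is basic if its quotient by the radical is a product of copies of $\mathbb C$; the radical of a finite dimensional basic quasi-Hopf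 algebra $H$ is a quasi-Hopf ideal, and $\operatorname{gr}H$ denotes the associated graded quasi-Hopf algebra of $H$ with respect to the radical filtration. Let $H_0$ be one of the following Hopf algebras (viewed as quasi-Hopf algebras with $\Phi=1$, $\alpha=\beta=1$). 1. The Taft Hopf algebra of dimension $n^4$, $n\ge 2$: generated by $g,x$ with $g^{n^2}=1$, $x^{n^2}=0$, $gx=qxg$, where $q$ is a primitive root of unity of order $n^2$, and $\Delta(g)=g\otimes g$, $\Delta(x)=x\otimes g+1\otimes x$; graded by $\deg g=0$, $\deg x=1$. 2. The book Hopf algebra of dimension $64$: generated by $g,x_+,x_-$ with $g^4=1$, $x_+^4=x_-^4=0$, $gx_+g^{-1}=ix_+$, $gx_-g^{-1}=-ix_-$, $x_+x_-=x_-x_+$, and $\Delta(g)=g\otimes g$, $\Delta(x_+)=x_+\otimes g+1\otimes x_+$, $\Delta(x_-)=x_-\otimes 1+g^{-1}\otimes x_-$; graded by $\deg g=0$, $\deg x_\pm=1$. **Theorem.** Let $H$ be a finite dimensional basic quasi-Hopf algebra such that $\operatorname{gr}H\cong H_0$ as quasi-Hopf algebras. Then there is a twist $F\in H_0\otimes H_0$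 of $H_0$ such that $F-1$ is a sum of homogeneous elements of positive degree in $H_0\otimes H_0$ (that is, $F=1$ modulo higher degree terms) and $H\cong H_0^F$ as quasi-Hopf algebras. -/

import Mathlib

open scoped TensorProduct DirectSum

/-! ## Quasi-Hopf algebras, isomorphisms, twists -/

/-- The structure maps of a quasi-Hopf algebra on a complex algebra `A`: the coproduct `Δ`, the
counit `ε`, the associator `Φ ∈ A ⊗ A ⊗ A`, the antipode `S`, and the distinguished elements
`α`, `β`. The axioms are `QuasiHopfData.IsQuasiHopf`. -/
structure QuasiHopfData (A : Type*) [Ring A] [Algebra ℂ A] where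
  /-- coproduct -/
  comul : A →ₗ[ℂ] A ⊗[ℂ] A
  /-- counit -/
  counit : A →ₗ[ℂ] ℂ
  /-- associator -/
  assoc : A ⊗[ℂ] (A ⊗[ℂ] A)
  /-- antipode -/
  antipode : A →ₗ[ℂ] A
  /-- the distinguished element `α` -/
  alpha : A
  /-- the distinguished element `β` -/
  beta : A

namespace QuasiHopfData

section Basic

variable {A : Type*} [Ring A] [Algebra ℂ A]

/-- `x ⊗ y ↦ x ⊗ y ⊗ 1`. -/
noncomputable def tensorOne : A ⊗[ℂ] A →ₗ[ℂ] A ⊗[ℂ] (A ⊗[ℂ] A) :=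
  LinearMap.lTensor A ((TensorProduct.mk ℂ A A).flip 1)

/-- `x ⊗ y ⊗ z ↦ x ⊗ y ⊗ z ⊗ 1`. -/
noncomputable def tensorOne₃ :
    A ⊗[ℂ] (A ⊗[ℂ] A) →ₗ[ℂ] A ⊗[ℂ] (A ⊗[ℂ] (A ⊗[ℂ] A)) :=
  LinearMap.lTensor A tensorOne

variable (Q : QuasiHopfData A)

/-- `Δ ⊗ id : A ⊗ A → A ⊗ A ⊗ A`. -/
noncomputable def comulLeft : A ⊗[ℂ] A →ₗ[ℂ] A ⊗[ℂ] (A ⊗[ℂ] A) :=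
  (TensorProduct.assoc ℂ A A A).toLinearMap ∘ₗ LinearMap.rTensor A Q.comul

/-- `id ⊗ Δ : A ⊗ A → A ⊗ A ⊗ A`. -/
noncomputable def comulRight : A ⊗[ℂ] A →ₗ[ℂ] A ⊗[ℂ] (A ⊗[ℂ] A) :=
  LinearMap.lTensor A Q.comul

/-- `Δ ⊗ id ⊗ id : A ⊗ A ⊗ A → A ⊗ A ⊗ A ⊗ A`. -/
noncomputable def comul₁ : A ⊗[ℂ] (A ⊗[ℂ] A) →ₗ[ℂ] A ⊗[ℂ] (A ⊗[ℂ] (A ⊗[ℂ] A)) :=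
  (TensorProduct.assoc ℂ A A (A ⊗[ℂ] A)).toLinearMap ∘ₗ LinearMap.rTensor (A ⊗[ℂ] A) Q.comul

/-- `id ⊗ Δ ⊗ id : A ⊗ A ⊗ A → A ⊗ A ⊗ A ⊗ A`. -/
noncomputable def comul₂ : A ⊗[ℂ] (A ⊗[ℂ] A) →ₗ[ℂ] A ⊗[ℂ] (A ⊗[ℂ] (A ⊗[ℂ] A)) :=
  LinearMap.lTensor A Q.comulLeft

/-- `id ⊗ id ⊗ Δ : A ⊗ A ⊗ A → A ⊗ A ⊗ A ⊗ A`. -/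
noncomputable def comul₃ : A ⊗[ℂ] (A ⊗[ℂ] A) →ₗ[ℂ] A ⊗[ℂ] (A ⊗[ℂ] (A ⊗[ℂ] A)) :=
  LinearMap.lTensor A Q.comulRight

/-- `x ⊗ y ↦ ε(x) y`. -/
noncomputable def counitLeft : A ⊗[ℂ] A →ₗ[ℂ] A :=
  (TensorProduct.lid ℂ A).toLinearMap ∘ₗ LinearMap.rTensor A Q.counit

/-- `x ⊗ y ↦ x ε(y)`. -/
noncomputable def counitRight : A ⊗[ℂ] A →ₗ[ℂ] A :=
  (TensorProduct.rid ℂ A).toLinearMap ∘ₗ LinearMap.lTensor A Q.counit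

/-- `x ⊗ y ↦ S(x) c y`. -/
noncomputable def antipodeLeft (c : A) : A ⊗[ℂ] A →ₗ[ℂ] A :=
  LinearMap.mul' ℂ A ∘ₗ TensorProduct.map (LinearMap.mulRight ℂ c ∘ₗ Q.antipode) LinearMap.id

/-- `x ⊗ y ↦ x c S(y)`. -/
noncomputable def antipodeRight (c : A) : A ⊗[ℂ] A →ₗ[ℂ] A :=
  LinearMap.mul' ℂ A ∘ₗ TensorProduct.map (LinearMap.mulRight ℂ c) Q.antipode

/-- `x ⊗ y ⊗ z ↦ x β S(y) α z`. -/
noncomputable def zigzag : A ⊗[ℂ] (A ⊗[ℂ] A) →ₗ[ℂ] A :=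
  LinearMap.mul' ℂ A ∘ₗ TensorProduct.map (LinearMap.mulRight ℂ Q.beta) (Q.antipodeLeft Q.alpha)

/-- `x ⊗ y ⊗ z ↦ S(x) α y β S(z)`. -/
noncomputable def zagzig : A ⊗[ℂ] (A ⊗[ℂ] A) →ₗ[ℂ] A :=
  LinearMap.mul' ℂ A ∘ₗ
    TensorProduct.map (LinearMap.mulRight ℂ Q.alpha ∘ₗ Q.antipode) (Q.antipodeRight Q.beta)

/-- Drinfeld's axioms of a quasi-Hopf algebra (with bijective antipode). -/
structure IsQuasiHopf : Prop where
  comul_one : Q.comul 1 = 1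
  comul_mul : ∀ a b, Q.comul (a * b) = Q.comul a * Q.comul b
  counit_one : Q.counit 1 = 1
  counit_mul : ∀ a b, Q.counit (a * b) = Q.counit a * Q.counit b
  isUnit_assoc : IsUnit Q.assoc
  quasi_coassoc : ∀ a,
    Q.comulRight (Q.comul a) * Q.assoc = Q.assoc * Q.comulLeft (Q.comul a)
  pentagon : Q.comul₃ Q.assoc * Q.comul₁ Q.assoc =
    (1 ⊗ₜ[ℂ] Q.assoc) * Q.comul₂ Q.assoc * tensorOne₃ Q.assoc
  counitLeft_comul : ∀ a, Q.counitLeft (Q.comul a) = a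
  counitRight_comul : ∀ a, Q.counitRight (Q.comul a) = a
  counit_assoc : LinearMap.lTensor A Q.counitLeft Q.assoc = 1
  antipode_one : Q.antipode 1 = 1
  antipode_mul : ∀ a b, Q.antipode (a * b) = Q.antipode b * Q.antipode a
  antipode_bijective : Function.Bijective Q.antipode
  antipode_left : ∀ a, Q.antipodeLeft Q.alpha (Q.comul a) = Q.counit a • Q.alpha
  antipode_right : ∀ a, Q.antipodeRight Q.beta (Q.comul a) = Q.counit a • Q.beta
  zigzag_assoc : Q.zigzag Q.assoc = 1
  zagzig_assoc_inv : Q.zagzig (Ring.inverse Q.assoc) = 1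

/-- A twist of a quasi-Hopf algebra: an invertible `F ∈ A ⊗ A` with
`(ε ⊗ id)(F) = (id ⊗ ε)(F) = 1`. -/
def IsTwist (F : (A ⊗[ℂ] A)ˣ) : Prop :=
  Q.counitLeft (F : A ⊗[ℂ] A) = 1 ∧ Q.counitRight (F : A ⊗[ℂ] A) = 1

/-- The twisted quasi-Hopf algebra `A^F`: same algebra, counit and antipode,
`Δ^F(a) = F Δ(a) F⁻¹`, `Φ^F = (1 ⊗ F)(id ⊗ Δ)(F) Φ (Δ ⊗ id)(F⁻¹)(F⁻¹ ⊗ 1)`, and, writing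
`F = ∑ fᵢ ⊗ gᵢ` and `F⁻¹ = ∑ dᵢ ⊗ eᵢ`, `α^F = ∑ S(dᵢ) α eᵢ` and `β^F = ∑ fᵢ β S(gᵢ)`. -/
noncomputable def twist (F : (A ⊗[ℂ] A)ˣ) : QuasiHopfData A where
  comul := LinearMap.mulLeft ℂ (F : A ⊗[ℂ] A) ∘ₗ
    LinearMap.mulRight ℂ ((F⁻¹ : (A ⊗[ℂ] A)ˣ) : A ⊗[ℂ] A) ∘ₗ Q.comul
  counit := Q.counit
  assoc := (1 ⊗ₜ[ℂ] (F : A ⊗[ℂ] A)) * Q.comulRight (F : A ⊗[ℂ] A) * Q.assoc *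
    Q.comulLeft ((F⁻¹ : (A ⊗[ℂ] A)ˣ) : A ⊗[ℂ] A) * tensorOne ((F⁻¹ : (A ⊗[ℂ] A)ˣ) : A ⊗[ℂ] A)
  antipode := Q.antipode
  alpha := Q.antipodeLeft Q.alpha ((F⁻¹ : (A ⊗[ℂ] A)ˣ) : A ⊗[ℂ] A)
  beta := Q.antipodeRight Q.beta (F : A ⊗[ℂ] A)

/-- Isomorphism of quasi-Hopf algebras: an algebra isomorphism that respects the coproducts, the
counits and the associators, and carries the triple `(S, α, β)` to the other one up to the usual
equivalence `(S, α, β) ∼ (u S(·) u⁻¹, u α, β u⁻¹)`, `u` invertible (the antipode of a quasi-Hopf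
algebra is only determined up to this equivalence). -/
def Isomorphic {B : Type*} [Ring B] [Algebra ℂ B] (Q : QuasiHopfData A) (Q' : QuasiHopfData B) :
    Prop :=
  ∃ φ : A ≃ₐ[ℂ] B,
    (∀ a, Q'.comul (φ a) =
      TensorProduct.map φ.toLinearMap φ.toLinearMap (Q.comul a)) ∧
    (∀ a, Q'.counit (φ a) = Q.counit a) ∧
    Q'.assoc = TensorProduct.map φ.toLinearMap
      (TensorProduct.map φ.toLinearMap φ.toLinearMap) Q.assoc ∧
    ∃ u : Bˣ, (∀ a, φ (Q.antipode a) = (u : B) * Q'.antipode (φ a) * ((u⁻¹ : Bˣ) : B)) ∧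
      φ Q.alpha = (u : B) * Q'.alpha ∧ φ Q.beta = Q'.beta * ((u⁻¹ : Bˣ) : B)

/-- The radical of `A` is a quasi-Hopf ideal: `Δ(J) ⊆ J ⊗ A + A ⊗ J`, `ε(J) = 0`, `S(J) ⊆ J`. -/
structure RadicalIsQuasiHopfIdeal : Prop where
  comul_mem : ∀ a ∈ Ring.jacobson A, Q.comul a ∈ Submodule.span ℂ
    {t : A ⊗[ℂ] A | ∃ b c, (b ∈ Ring.jacobson A ∨ c ∈ Ring.jacobson A) ∧ t = b ⊗ₜ[ℂ] c}
  counit_eq_zero : ∀ a ∈ Ring.jacobson A, Q.counit a = 0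
  antipode_mem : ∀ a ∈ Ring.jacobson A, Q.antipode a ∈ Ring.jacobson A

end Basic

end QuasiHopfData

/-- A finite dimensional complex algebra is basic if all its irreducible representations are
one-dimensional, that is, if `A / Rad A ≅ ℂ × ⋯ × ℂ` as algebras. -/
def IsBasicAlgebra (A : Type*) [Ring A] [Algebra ℂ A] : Prop :=
  ∃ m : ℕ, Nonempty ((A ⧸ Ring.jacobson A) ≃ₐ[ℂ] (Fin m → ℂ))

theorem QuasiHopfData.IsQuasiHopf.radicalIsQuasiHopfIdeal {A : Type*} [Ring A] [Algebra ℂ A]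
    [FiniteDimensional ℂ A] {Q : QuasiHopfData A} (hQ : Q.IsQuasiHopf) (hA : IsBasicAlgebra A) :
    Q.RadicalIsQuasiHopfIdeal := by
  obtain ⟨m, ⟨e⟩⟩ := hA
  have : IsArtinianRing A := IsArtinianRing.of_finite ℂ A
  obtain ⟨N, hN⟩ : IsNilpotent (Ring.jacobson A) := IsSemiprimaryRing.isNilpotent
  have hnil : ∀ a ∈ Ring.jacobson A, a ^ N = 0 := fun a ha => by
    have h := Ideal.pow_mem_pow ha N
    rw [hN] at h
    simpa using h
  let f : A →ₐ[ℂ] (Fin m → ℂ) := e.toAlgHom.comp (Ideal.Quotient.mkₐ ℂ (Ring.jacobson A))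
  have hf : ∀ a, f a = 0 ↔ a ∈ Ring.jacobson A := fun a => by
    simp [f, Ideal.Quotient.eq_zero_iff_mem]
  have hfs : Function.Surjective f :=
    e.surjective.comp (Ideal.Quotient.mkₐ_surjective ℂ (Ring.jacobson A))
  have hpow : ∀ a (k : ℕ), Q.antipode (a ^ k) = Q.antipode a ^ k := fun a k => by
    induction k with
    | zero => simp [hQ.antipode_one]
    | succ k ih => rw [pow_succ, hQ.antipode_mul, ih, ← pow_succ']
  let D : A →ₐ[ℂ] A ⊗[ℂ] A := AlgHom.ofLinearMap Q.comul hQ.comul_one hQ.comul_mul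
  let E : A →ₐ[ℂ] ℂ := AlgHom.ofLinearMap Q.counit hQ.counit_one hQ.counit_mul
  refine ⟨fun a ha => ?_, fun a ha => ?_, fun a ha => ?_⟩
  · have key : TensorProduct.map f.toLinearMap f.toLinearMap (Q.comul a) = 0 := by
      have h1 : (Algebra.TensorProduct.map f f (D a)) ^ N = 0 := by
        rw [← map_pow, ← map_pow, hnil a ha, map_zero, map_zero]
      set z := Algebra.TensorProduct.map f f (D a) with hz
      have hz' : z = TensorProduct.map f.toLinearMap f.toLinearMap (Q.comul a) := rfl
      rw [← hz']
      let b := (Pi.basisFun ℂ (Fin m)).tensorProduct (Pi.basisFun ℂ (Fin m))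
      apply b.repr.injective
      ext ⟨i, j⟩
      let p : (Fin m → ℂ) ⊗[ℂ] (Fin m → ℂ) →ₐ[ℂ] ℂ :=
        Algebra.TensorProduct.lift (Pi.evalAlgHom ℂ (fun _ => ℂ) i)
          (Pi.evalAlgHom ℂ (fun _ => ℂ) j) (fun _ _ => Commute.all _ _)
      have hp : ∀ t, b.repr t (i, j) = p t := fun t => by
        induction t using TensorProduct.induction_on with
        | zero => simp
        | tmul x y => simp [b, p, Module.Basis.tensorProduct_repr_tmul_apply, mul_comm]
        | add x y hx hy => rw [map_add, Finsupp.add_apply, hx, hy, map_add]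
      rw [hp, map_zero, Finsupp.zero_apply]
      have h2 : (p z) ^ N = 0 := by rw [← map_pow, h1, map_zero]
      exact eq_zero_of_pow_eq_zero h2
    have h3 : Q.comul a ∈ LinearMap.ker (TensorProduct.map f.toLinearMap f.toLinearMap) := key
    have hex : Function.Exact (LinearMap.ker f.toLinearMap).subtype f.toLinearMap :=
      LinearMap.exact_subtype_ker_map f.toLinearMap
    rw [TensorProduct.map_ker hex hfs hex hfs] at h3
    refine (sup_le ?_ ?_ : _ ≤ Submodule.span ℂ _) h3
    · rintro _ ⟨t, rfl⟩
      induction t using TensorProduct.induction_on with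
      | zero => simp
      | tmul x y => exact Submodule.subset_span ⟨x, y, Or.inr ((hf _).1 y.2), rfl⟩
      | add x y hx hy => rw [map_add]; exact add_mem hx hy
    · rintro _ ⟨t, rfl⟩
      induction t using TensorProduct.induction_on with
      | zero => simp
      | tmul x y => exact Submodule.subset_span ⟨x, y, Or.inl ((hf _).1 x.2), rfl⟩
      | add x y hx hy => rw [map_add]; exact add_mem hx hy
  · have h2 : (E a) ^ N = 0 := by rw [← map_pow, hnil a ha, map_zero]
    exact eq_zero_of_pow_eq_zero h2
  · rw [← hf]
    have h2 : (f (Q.antipode a)) ^ N = 0 := by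
      rw [← map_pow, ← hpow, hnil a ha, map_zero, map_zero]
    exact eq_zero_of_pow_eq_zero h2

/-! ## The associated graded quasi-Hopf algebra of the radical filtration -/

namespace RadGr

variable (A : Type*) [Ring A] [Algebra ℂ A]

/-- The `k`-th power `J ^ k` of the radical `J` of `A` (with `J ^ 0 = A`). -/
def radPow (k : ℕ) : Submodule ℂ A := (Ring.jacobson A ^ k).restrictScalars ℂ

/-- The component `J ^ k / J ^ (k + 1)` of degree `k`. -/
def Piece (k : ℕ) : Type _ := radPow A k ⧸ (radPow A (k + 1)).submoduleOf (radPow A k)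

noncomputable instance (k : ℕ) : AddCommGroup (Piece A k) :=
  inferInstanceAs (AddCommGroup (radPow A k ⧸ (radPow A (k + 1)).submoduleOf (radPow A k)))

noncomputable instance (k : ℕ) : Module ℂ (Piece A k) :=
  inferInstanceAs (Module ℂ (radPow A k ⧸ (radPow A (k + 1)).submoduleOf (radPow A k)))

/-- The associated graded space `gr A = ⨁ₖ J ^ k / J ^ (k + 1)`. -/
abbrev Gr : Type _ := ⨁ k : ℕ, Piece A k

variable {A}

theorem radPow_anti {i j : ℕ} (h : i ≤ j) : radPow A j ≤ radPow A i := fun _ hx =>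
  Ideal.pow_le_pow_right (I := Ring.jacobson A) h hx

theorem mem_radPow_zero (a : A) : a ∈ radPow A 0 := by
  change a ∈ Ring.jacobson A ^ 0
  rw [Submodule.pow_zero, Ideal.one_eq_top]
  exact Submodule.mem_top

theorem mul_mem_radPow {i j : ℕ} {a b : A} (ha : a ∈ radPow A i) (hb : b ∈ radPow A j) :
    a * b ∈ radPow A (i + j) := by
  change a * b ∈ Ring.jacobson A ^ (i + j)
  rw [Ideal.IsTwoSided.pow_add]
  exact Ideal.mul_mem_mul ha hb

/-- The quotient map `J ^ k → J ^ k / J ^ (k + 1)`. -/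
noncomputable def toPiece (k : ℕ) : radPow A k →ₗ[ℂ] Piece A k :=
  Submodule.mkQ ((radPow A (k + 1)).submoduleOf (radPow A k))

theorem toPiece_surjective (k : ℕ) : Function.Surjective (toPiece (A := A) k) :=
  Submodule.mkQ_surjective _

theorem toPiece_eq_zero {k : ℕ} {a : radPow A k} : toPiece k a = 0 ↔ (a : A) ∈ radPow A (k + 1) :=
  Submodule.Quotient.mk_eq_zero ((radPow A (k + 1)).submoduleOf (radPow A k))

/-- The linear map on `J ^ k / J ^ (k + 1)` induced by a linear map on `J ^ k`. -/
noncomputable def lift {M : Type*} [AddCommGroup M] [Module ℂ M] (k : ℕ)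
    (f : radPow A k →ₗ[ℂ] M) (hf : ∀ a : radPow A k, (a : A) ∈ radPow A (k + 1) → f a = 0) :
    Piece A k →ₗ[ℂ] M :=
  Submodule.liftQ ((radPow A (k + 1)).submoduleOf (radPow A k)) f (fun a ha => hf a ha)

theorem lift_toPiece {M : Type*} [AddCommGroup M] [Module ℂ M] (k : ℕ)
    (f : radPow A k →ₗ[ℂ] M) (hf : ∀ a : radPow A k, (a : A) ∈ radPow A (k + 1) → f a = 0)
    (a : radPow A k) : lift k f hf (toPiece k a) = f a := rfl

/-- The product `J ^ i × J ^ j → J ^ (i + j)`. -/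
noncomputable def mulPow (i j : ℕ) : radPow A i →ₗ[ℂ] radPow A j →ₗ[ℂ] radPow A (i + j) :=
  LinearMap.mk₂ ℂ (fun a b => ⟨(a : A) * b, mul_mem_radPow a.2 b.2⟩)
    (fun _ _ _ => Subtype.ext (add_mul _ _ _)) (fun _ _ _ => Subtype.ext (smul_mul_assoc _ _ _))
    (fun _ _ _ => Subtype.ext (mul_add _ _ _)) (fun _ _ _ => Subtype.ext (mul_smul_comm _ _ _))

/-- The product `J ^ i / J ^ (i + 1) × J ^ j / J ^ (j + 1) → J ^ (i + j) / J ^ (i + j + 1)`. -/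
noncomputable def mulPiece (i j : ℕ) : Piece A i →ₗ[ℂ] Piece A j →ₗ[ℂ] Piece A (i + j) :=
  lift i
    (LinearMap.flip (lift j (LinearMap.flip ((mulPow i j).compr₂ (toPiece (i + j))))
      (fun b hb => LinearMap.ext fun a => toPiece_eq_zero.2 (by
        have h : (a : A) * (b : A) ∈ radPow A (i + (j + 1)) := mul_mem_radPow a.2 hb
        exact h))))
    (fun a ha => LinearMap.ext fun y => by
      obtain ⟨b, rfl⟩ := toPiece_surjective j y
      refine toPiece_eq_zero.2 ?_
      have h : (a : A) * (b : A) ∈ radPow A (i + 1 + j) := mul_mem_radPow ha b.2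
      rw [show i + 1 + j = i + j + 1 by ring] at h
      exact h)

theorem mulPiece_toPiece (i j : ℕ) (a : radPow A i) (b : radPow A j) :
    mulPiece i j (toPiece i a) (toPiece j b) = toPiece (i + j) ⟨(a : A) * b, mul_mem_radPow a.2 b.2⟩ := rfl

theorem gradedMk_eq {i j : ℕ} (h : i = j) {a : radPow A i} {b : radPow A j}
    (hab : (a : A) = b) :
    GradedMonoid.mk (A := Piece A) i (toPiece i a) =
      GradedMonoid.mk (A := Piece A) j (toPiece j b) := by
  subst h
  obtain rfl : a = b := Subtype.ext hab
  rfl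

noncomputable instance : GradedMonoid.GOne (Piece A) where
  one := toPiece 0 ⟨1, mem_radPow_zero 1⟩

noncomputable instance : GradedMonoid.GMul (Piece A) where
  mul {i j} a b := mulPiece i j a b

noncomputable instance : GradedMonoid.GMonoid (Piece A) where
  one_mul := by
    rintro ⟨i, a⟩
    obtain ⟨a, rfl⟩ := toPiece_surjective i a
    exact gradedMk_eq (zero_add i) (one_mul (a : A))
  mul_one := by
    rintro ⟨i, a⟩
    obtain ⟨a, rfl⟩ := toPiece_surjective i a
    exact gradedMk_eq (add_zero i) (mul_one (a : A))
  mul_assoc := by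
    rintro ⟨i, a⟩ ⟨j, b⟩ ⟨k, c⟩
    obtain ⟨a, rfl⟩ := toPiece_surjective i a
    obtain ⟨b, rfl⟩ := toPiece_surjective j b
    obtain ⟨c, rfl⟩ := toPiece_surjective k c
    exact gradedMk_eq (add_assoc i j k) (mul_assoc (a : A) b c)

noncomputable instance : DirectSum.GRing (Piece A) where
  mul_zero a := map_zero (mulPiece _ _ a)
  zero_mul b := by
    change mulPiece _ _ 0 b = 0
    rw [map_zero, LinearMap.zero_apply]
  mul_add a b c := map_add (mulPiece _ _ a) b c
  add_mul a b c := by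
    change mulPiece _ _ (a + b) c = mulPiece _ _ a c + mulPiece _ _ b c
    rw [map_add, LinearMap.add_apply]
  natCast n := toPiece 0 ⟨(n : A), mem_radPow_zero _⟩
  natCast_zero := by
    refine toPiece_eq_zero.2 ?_
    simp
  natCast_succ n := by
    change _ = _ + toPiece 0 ⟨1, mem_radPow_zero 1⟩
    rw [← map_add]
    exact congrArg (toPiece 0) (Subtype.ext (Nat.cast_succ n))
  intCast n := toPiece 0 ⟨(n : A), mem_radPow_zero _⟩
  intCast_ofNat n := congrArg (toPiece 0) (Subtype.ext (Int.cast_natCast n))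
  intCast_negSucc_ofNat n := by
    rw [← map_neg]
    exact congrArg (toPiece 0) (Subtype.ext (Int.cast_negSucc n))

noncomputable instance : DirectSum.GAlgebra ℂ (Piece A) where
  toFun :=
    { toFun := fun c => toPiece 0 ⟨algebraMap ℂ A c, mem_radPow_zero _⟩
      map_zero' := by
        refine toPiece_eq_zero.2 ?_
        simp
      map_add' := fun c d => by
        rw [← map_add]
        exact congrArg (toPiece 0) (Subtype.ext (map_add (algebraMap ℂ A) c d)) }
  map_one := congrArg (toPiece 0) (Subtype.ext (map_one (algebraMap ℂ A)))
  map_mul c d := gradedMk_eq (zero_add 0).symm (map_mul (algebraMap ℂ A) c d)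
  commutes := by
    rintro c ⟨i, a⟩
    obtain ⟨a, rfl⟩ := toPiece_surjective i a
    exact gradedMk_eq (Nat.add_comm 0 i) (Algebra.commutes c (a : A))
  smul_def := by
    rintro c ⟨i, a⟩
    obtain ⟨a, rfl⟩ := toPiece_surjective i a
    exact gradedMk_eq (a := c • a) (zero_add i).symm (Algebra.smul_def c (a : A))

/-- The symbol map `J ^ k → J ^ k / J ^ (k + 1) ⊆ gr A`. -/
noncomputable def symbol (k : ℕ) : radPow A k →ₗ[ℂ] Gr A :=
  DirectSum.lof ℂ ℕ (Piece A) k ∘ₗ toPiece k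

/-- Multiplication of symbols. -/
theorem symbol_mul_symbol (i j : ℕ) (a : radPow A i) (b : radPow A j) :
    symbol i a * symbol j b = symbol (i + j) ⟨(a : A) * b, mul_mem_radPow a.2 b.2⟩ :=
  DirectSum.of_mul_of _ _

/-- The symbol in degree zero of an arbitrary element. -/
noncomputable def symbolZero : A →ₗ[ℂ] Gr A :=
  symbol 0 ∘ₗ LinearMap.codRestrict (radPow A 0) LinearMap.id mem_radPow_zero

/-- An auxiliary linear extension of the quotient map `J ^ k → J ^ k / J ^ (k + 1)` to `A`. -/
noncomputable def extend (k : ℕ) : A →ₗ[ℂ] Piece A k :=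
  (LinearMap.exists_extend (toPiece (A := A) k)).choose

theorem extend_apply (k : ℕ) (a : radPow A k) : extend k (a : A) = toPiece k a :=
  LinearMap.congr_fun (LinearMap.exists_extend (toPiece (A := A) k)).choose_spec a

theorem extend_eq_zero {k l : ℕ} (h : k < l) {a : A} (ha : a ∈ radPow A l) :
    extend k a = 0 := by
  have h1 : a ∈ radPow A (k + 1) := radPow_anti h ha
  exact (extend_apply k ⟨a, radPow_anti (Nat.le_succ k) h1⟩).trans (toPiece_eq_zero.2 h1)

/-- The tensor product filtration: the span of the `b ⊗ c` with `b ∈ J ^ i`, `c ∈ J ^ j`,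
`i + j = k`. -/
def tensorFil (A : Type*) [Ring A] [Algebra ℂ A] (k : ℕ) : Submodule ℂ (A ⊗[ℂ] A) :=
  Submodule.span ℂ {t | ∃ i j b c, i + j = k ∧ b ∈ radPow A i ∧ c ∈ radPow A j ∧
    t = b ⊗ₜ[ℂ] c}

/-- A linear map on `A ⊗ A` whose restriction to the `k`-th term of the tensor product filtration
is the symbol map `b ⊗ c ↦ symbol i b ⊗ symbol j c` (`b ∈ J ^ i`, `c ∈ J ^ j`, `i + j = k`), see
`tensorSymbol_tmul`. Only this restriction, which involves no choice, is used. -/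
noncomputable def tensorSymbol (k : ℕ) : A ⊗[ℂ] A →ₗ[ℂ] Gr A ⊗[ℂ] Gr A :=
  ∑ p ∈ Finset.HasAntidiagonal.antidiagonal k,
    TensorProduct.map (DirectSum.lof ℂ ℕ (Piece A) p.1 ∘ₗ extend p.1)
      (DirectSum.lof ℂ ℕ (Piece A) p.2 ∘ₗ extend p.2)

theorem tensorSymbol_tmul (i j : ℕ) (b : radPow A i) (c : radPow A j) :
    tensorSymbol (i + j) ((b : A) ⊗ₜ[ℂ] (c : A)) = symbol i b ⊗ₜ[ℂ] symbol j c := by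
  rw [tensorSymbol, LinearMap.sum_apply, Finset.sum_eq_single (i, j)]
  · simp [symbol, extend_apply]
  · rintro ⟨i', j'⟩ hp hne
    rw [Finset.HasAntidiagonal.mem_antidiagonal] at hp
    simp only at hp
    rcases lt_trichotomy i' i with h | h | h
    · simp [extend_eq_zero h b.2]
    · exact absurd (Prod.ext h (by simp only; omega)) hne
    · simp [extend_eq_zero (show j' < j by omega) c.2]
  · intro h
    exact absurd (Finset.HasAntidiagonal.mem_antidiagonal.2 (rfl : (i, j).1 + (i, j).2 = i + j)) h

theorem tensorSymbol_eq_zero {k : ℕ} {t : A ⊗[ℂ] A} (ht : t ∈ tensorFil A (k + 1)) :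
    tensorSymbol k t = 0 := by
  refine (Submodule.span_le (p := LinearMap.ker (tensorSymbol k))).2 ?_ ht
  rintro _ ⟨i, j, b, c, hij, hb, hc, rfl⟩
  rw [SetLike.mem_coe, LinearMap.mem_ker, tensorSymbol, LinearMap.sum_apply]
  refine Finset.sum_eq_zero ?_
  rintro ⟨i', j'⟩ hp
  rw [Finset.HasAntidiagonal.mem_antidiagonal] at hp
  simp only at hp
  rcases lt_or_ge i' i with h | h
  · simp [extend_eq_zero h hb]
  · simp [extend_eq_zero (show j' < j by omega) hc]

theorem mul_mem_tensorFil {k l : ℕ} {s t : A ⊗[ℂ] A} (hs : s ∈ tensorFil A k)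
    (ht : t ∈ tensorFil A l) : s * t ∈ tensorFil A (k + l) := by
  have h := Submodule.mul_mem_mul hs ht
  rw [tensorFil, tensorFil, Submodule.span_mul_span] at h
  refine Submodule.span_mono ?_ h
  rintro _ ⟨_, ⟨i, j, b, c, hij, hb, hc, rfl⟩, _, ⟨i', j', b', c', hij', hb', hc', rfl⟩, rfl⟩
  exact ⟨i + i', j + j', b * b', c * c', by omega, mul_mem_radPow hb hb', mul_mem_radPow hc hc',
    Algebra.TensorProduct.tmul_mul_tmul _ _ _ _⟩

end RadGr

namespace QuasiHopfData

open RadGr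

variable {A : Type*} [Ring A] [Algebra ℂ A] {Q : QuasiHopfData A}

theorem comul_mem_tensorFil (hQ : Q.IsQuasiHopf) (hJ : Q.RadicalIsQuasiHopfIdeal) (k : ℕ) :
    ∀ a ∈ radPow A k, Q.comul a ∈ tensorFil A k := by
  induction k with
  | zero =>
    intro a _
    induction Q.comul a using TensorProduct.induction_on with
    | zero => exact zero_mem _
    | tmul x y =>
      exact Submodule.subset_span ⟨0, 0, x, y, rfl, mem_radPow_zero _, mem_radPow_zero _, rfl⟩
    | add x y hx hy => exact add_mem hx hy
  | succ k ih =>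
    intro a ha
    change a ∈ Ring.jacobson A ^ (k + 1) at ha
    rw [Ideal.IsTwoSided.pow_succ] at ha
    refine Submodule.smul_induction_on ha (fun r hr s hs => ?_) (fun x y hx hy => ?_)
    · rw [smul_eq_mul, hQ.comul_mul, add_comm]
      refine mul_mem_tensorFil ?_ (ih s hs)
      refine Submodule.span_mono ?_ (hJ.comul_mem r hr)
      rintro _ ⟨b, c, h | h, rfl⟩
      · refine ⟨1, 0, b, c, rfl, ?_, mem_radPow_zero _, rfl⟩
        change b ∈ Ring.jacobson A ^ 1
        rwa [Submodule.pow_one]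
      · refine ⟨0, 1, b, c, rfl, mem_radPow_zero _, ?_, rfl⟩
        change c ∈ Ring.jacobson A ^ 1
        rwa [Submodule.pow_one]
    · rw [map_add]
      exact add_mem hx hy

theorem antipode_mem_radPow (hQ : Q.IsQuasiHopf) (hJ : Q.RadicalIsQuasiHopfIdeal) (k : ℕ) :
    ∀ a ∈ radPow A k, Q.antipode a ∈ radPow A k := by
  induction k with
  | zero => exact fun a _ => mem_radPow_zero _
  | succ k ih =>
    intro a ha
    change a ∈ Ring.jacobson A ^ (k + 1) at ha
    rw [Ideal.IsTwoSided.pow_succ] at ha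
    refine Submodule.smul_induction_on ha (fun r hr s hs => ?_) (fun x y hx hy => ?_)
    · rw [smul_eq_mul, hQ.antipode_mul]
      refine mul_mem_radPow (ih s hs) ?_
      change Q.antipode r ∈ Ring.jacobson A ^ 1
      rw [Submodule.pow_one]
      exact hJ.antipode_mem r hr
    · rw [map_add]
      exact add_mem hx hy

/-- The associated graded quasi-Hopf algebra `gr A` of a quasi-Hopf algebra whose radical is a
quasi-Hopf ideal, with respect to the radical filtration: the structure maps are the ones induced
on symbols. -/
noncomputable def gr (hQ : Q.IsQuasiHopf) (hJ : Q.RadicalIsQuasiHopfIdeal) :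
    QuasiHopfData (Gr A) where
  comul := DirectSum.toModule ℂ ℕ _ fun k =>
    lift k (tensorSymbol k ∘ₗ Q.comul ∘ₗ (radPow A k).subtype)
      (fun a ha => tensorSymbol_eq_zero (comul_mem_tensorFil hQ hJ (k + 1) a ha))
  counit :=
    lift 0 (Q.counit ∘ₗ (radPow A 0).subtype)
      (fun a ha => hJ.counit_eq_zero (a : A) (by
        have h : (a : A) ∈ Ring.jacobson A ^ 1 := ha
        rwa [Submodule.pow_one] at h)) ∘ₗ
    DirectSum.component ℂ ℕ (Piece A) 0
  assoc := TensorProduct.map symbolZero (TensorProduct.map symbolZero symbolZero) Q.assoc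
  antipode := DirectSum.toModule ℂ ℕ _ fun k =>
    lift k (symbol k ∘ₗ Q.antipode.restrict (antipode_mem_radPow hQ hJ k))
      (fun a ha => by
        have h : toPiece k (Q.antipode.restrict (antipode_mem_radPow hQ hJ k) a) = 0 :=
          toPiece_eq_zero.2 (antipode_mem_radPow hQ hJ (k + 1) a ha)
        simp [symbol, h])
  alpha := symbolZero Q.alpha
  beta := symbolZero Q.beta

end QuasiHopfData

/-! ## Taft algebras and the book algebra -/

/-- `q`-binomial coefficients. -/
def qBinom (q : ℂ) : ℕ → ℕ → ℂ
  | _, 0 => 1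
  | 0, _ + 1 => 0
  | n + 1, k + 1 => qBinom q n k + q ^ (k + 1) * qBinom q n (k + 1)

theorem qBinom_zero_right (q : ℂ) (n : ℕ) : qBinom q n 0 = 1 := by
  cases n <;> rfl

theorem qBinom_succ (q : ℂ) (n k : ℕ) :
    qBinom q (n + 1) (k + 1) = qBinom q n k + q ^ (k + 1) * qBinom q n (k + 1) := rfl

theorem qBinom_eq_zero (q : ℂ) (n : ℕ) : ∀ k, n < k → qBinom q n k = 0 := by
  induction n with
  | zero =>
    intro k hk
    obtain ⟨k, rfl⟩ := Nat.exists_eq_succ_of_ne_zero hk.ne'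
    rfl
  | succ n ih =>
    intro k hk
    obtain ⟨k, rfl⟩ := Nat.exists_eq_succ_of_ne_zero (Nat.ne_zero_of_lt hk)
    rw [Nat.succ_eq_add_one, qBinom_succ, ih k (by omega), ih (k + 1) (by omega)]
    ring

theorem qBinom_self (q : ℂ) (n : ℕ) : qBinom q n n = 1 := by
  induction n with
  | zero => rfl
  | succ n ih => rw [qBinom_succ, ih, qBinom_eq_zero q n (n + 1) (by omega)]; ring

theorem qBinom_mul (q : ℂ) (n : ℕ) : ∀ k,
    (1 - q ^ (k + 1)) * qBinom q (n + 1) (k + 1) = (1 - q ^ (n + 1)) * qBinom q n k := by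
  induction n with
  | zero =>
    intro k
    cases k with
    | zero => simp [qBinom]
    | succ k => simp [qBinom]
  | succ n ih =>
    intro k
    rw [qBinom_succ, mul_add, mul_left_comm, ih k]
    cases k with
    | zero =>
      simp only [qBinom_zero_right]
      ring
    | succ k =>
      have h1 := ih k
      have h2 := qBinom_succ q n k
      have h3 : q ^ (k + 1) * qBinom q n (k + 1) = qBinom q (n + 1) (k + 1) - qBinom q n k := by
        rw [h2]; ring
      calc _ = (1 - q ^ (k + 1 + 1)) * qBinom q (n + 1) (k + 1) +
            q * (1 - q ^ (n + 1)) * (q ^ (k + 1) * qBinom q n (k + 1)) := by ring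
        _ = (1 - q ^ (k + 1 + 1)) * qBinom q (n + 1) (k + 1) +
            q * (1 - q ^ (n + 1)) * qBinom q (n + 1) (k + 1) -
            q * ((1 - q ^ (n + 1)) * qBinom q n k) := by rw [h3]; ring
        _ = _ := by rw [← h1]; ring

section SkewCommuting

variable {B : Type*} [Ring B] [Algebra ℂ B]

theorem skew_pow_mul {q : ℂ} {u v : B} (h : u * v = q • (v * u)) (k : ℕ) :
    u ^ k * v = q ^ k • (v * u ^ k) := by
  induction k with
  | zero => simp
  | succ k ih =>
    rw [pow_succ, mul_assoc, h, mul_smul_comm, ← mul_assoc, ih, smul_mul_assoc, smul_smul,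
      mul_assoc, ← pow_succ']

theorem skew_mul_pow {q : ℂ} {u v : B} (h : u * v = q • (v * u)) (k : ℕ) :
    u * v ^ k = q ^ k • (v ^ k * u) := by
  induction k with
  | zero => simp
  | succ k ih =>
    rw [pow_succ, ← mul_assoc, ih, smul_mul_assoc, mul_assoc, h, mul_smul_comm, smul_smul,
      ← mul_assoc, ← pow_succ]

theorem skew_prod_pow_eq_zero {q : ℂ} {u v : B} (h : u * v = q • (v * u)) {N : ℕ}
    (hv : v ^ N = 0) : (v * u) ^ N = 0 := by
  have key : ∀ k, ∃ s : ℂ, (v * u) ^ k = s • (v ^ k * u ^ k) := by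
    intro k
    induction k with
    | zero => exact ⟨1, by simp⟩
    | succ k ih =>
      obtain ⟨s, hs⟩ := ih
      refine ⟨s * q ^ k, ?_⟩
      rw [pow_succ, hs, smul_mul_assoc, mul_assoc, ← mul_assoc (u ^ k), skew_pow_mul h k,
        smul_mul_assoc, mul_smul_comm, smul_smul, mul_assoc v, ← pow_succ, ← mul_assoc (v ^ k),
        ← pow_succ]
  obtain ⟨s, hs⟩ := key N
  rw [hs, hv, zero_mul, smul_zero]

theorem skew_add_pow {q : ℂ} {u v : B} (h : u * v = q • (v * u)) (n : ℕ) :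
    (v + u) ^ n = ∑ k ∈ Finset.range (n + 1), qBinom q n k • (v ^ k * u ^ (n - k)) := by
  induction n with
  | zero => simp [qBinom]
  | succ n ih =>
    have h1 : ∀ k ∈ Finset.range (n + 1), (v + u) * (qBinom q n k • (v ^ k * u ^ (n - k))) =
        qBinom q n k • (v ^ (k + 1) * u ^ (n - k)) +
          (q ^ k * qBinom q n k) • (v ^ k * u ^ (n + 1 - k)) := by
      intro k hk
      rw [Finset.mem_range] at hk
      rw [mul_smul_comm, add_mul, smul_add, ← mul_assoc, ← pow_succ', ← mul_assoc,
        skew_mul_pow h k, smul_mul_assoc, smul_smul, mul_assoc, ← pow_succ', mul_comm (q ^ k),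
        show n - k + 1 = n + 1 - k by omega]
    rw [pow_succ', ih, Finset.mul_sum, Finset.sum_congr rfl h1, Finset.sum_add_distrib,
      Finset.sum_range_succ' _ (n + 1)]
    have h2 : ∑ k ∈ Finset.range (n + 1), (q ^ k * qBinom q n k) • (v ^ k * u ^ (n + 1 - k)) =
        ∑ k ∈ Finset.range (n + 1), (q ^ (k + 1) * qBinom q n (k + 1)) •
          (v ^ (k + 1) * u ^ (n - k)) + u ^ (n + 1) := by
      have h3 := Finset.sum_range_succ'
        (fun k => (q ^ k * qBinom q n k) • (v ^ k * u ^ (n + 1 - k))) (n + 1)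
      rw [Finset.sum_range_succ, qBinom_eq_zero q n (n + 1) (by omega)] at h3
      simpa [qBinom_zero_right, Nat.add_sub_add_right] using h3
    rw [h2, ← add_assoc, ← Finset.sum_add_distrib]
    congr 1
    · refine Finset.sum_congr rfl fun k _ => ?_
      rw [qBinom_succ, add_smul, Nat.add_sub_add_right]
    · simp [qBinom_zero_right]

/-- If `u v = q v u` with `q` a primitive `N`-th root of unity and `u ^ N = v ^ N = 0`, then
`(v + u) ^ N = 0`. -/
theorem skew_add_pow_eq_zero {q : ℂ} {N : ℕ} (hN : N ≠ 0) (hq : IsPrimitiveRoot q N) {u v : B}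
    (h : u * v = q • (v * u)) (hu : u ^ N = 0) (hv : v ^ N = 0) : (v + u) ^ N = 0 := by
  rw [skew_add_pow h N]
  refine Finset.sum_eq_zero fun k hk => ?_
  rw [Finset.mem_range] at hk
  rcases Nat.eq_zero_or_pos k with rfl | hk0
  · simp [hu]
  rcases Nat.lt_or_ge k N with hkN | hkN
  · obtain ⟨k, rfl⟩ := Nat.exists_eq_succ_of_ne_zero hk0.ne'
    obtain ⟨M, rfl⟩ := Nat.exists_eq_succ_of_ne_zero hN
    have h1 := qBinom_mul q M k
    rw [hq.pow_eq_one, sub_self, zero_mul] at h1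
    have h2 : (1 : ℂ) - q ^ (k + 1) ≠ 0 := fun h3 =>
      hq.pow_ne_one_of_pos_of_lt (Nat.succ_ne_zero k) hkN (sub_eq_zero.1 h3).symm
    rw [(mul_eq_zero.1 h1).resolve_left h2, zero_smul]
  · rw [show k = N by omega, hv, zero_mul, smul_zero]

end SkewCommuting

/-- Generators of the Taft algebra. -/
inductive TaftGen : Type
  | g : TaftGen
  | x : TaftGen

/-- The relations `g ^ N = 1`, `x ^ N = 0`, `g x = q x g`. -/
inductive TaftRel (N : ℕ) (q : ℂ) : FreeAlgebra ℂ TaftGen → FreeAlgebra ℂ TaftGen → Prop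
  | g_pow : TaftRel N q (FreeAlgebra.ι ℂ TaftGen.g ^ N) 1
  | x_pow : TaftRel N q (FreeAlgebra.ι ℂ TaftGen.x ^ N) 0
  | comm : TaftRel N q (FreeAlgebra.ι ℂ TaftGen.g * FreeAlgebra.ι ℂ TaftGen.x)
      (q • (FreeAlgebra.ι ℂ TaftGen.x * FreeAlgebra.ι ℂ TaftGen.g))

/-- The algebra underlying the Taft Hopf algebra: generators `g`, `x` and relations `g ^ N = 1`,
`x ^ N = 0`, `g x = q x g`. For `q` a primitive `N`-th root of unity its dimension is `N ^ 2`. -/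
def Taft (N : ℕ) (q : ℂ) : Type := RingQuot (TaftRel N q)

namespace Taft

noncomputable instance (N : ℕ) (q : ℂ) : Ring (Taft N q) :=
  inferInstanceAs (Ring (RingQuot (TaftRel N q)))

noncomputable instance (N : ℕ) (q : ℂ) : Algebra ℂ (Taft N q) :=
  inferInstanceAs (Algebra ℂ (RingQuot (TaftRel N q)))

/-- The projection from the free algebra. -/
noncomputable def proj (N : ℕ) (q : ℂ) : FreeAlgebra ℂ TaftGen →ₐ[ℂ] Taft N q :=
  RingQuot.mkAlgHom ℂ (TaftRel N q)

variable {N : ℕ} {q : ℂ}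

theorem proj_rel {a b : FreeAlgebra ℂ TaftGen} (h : TaftRel N q a b) :
    proj N q a = proj N q b := RingQuot.mkAlgHom_rel ℂ h

/-- The generator `g`. -/
noncomputable def g : Taft N q := proj N q (FreeAlgebra.ι ℂ TaftGen.g)

/-- The generator `x`. -/
noncomputable def x : Taft N q := proj N q (FreeAlgebra.ι ℂ TaftGen.x)

theorem g_pow : (g : Taft N q) ^ N = 1 := by
  simpa [g] using proj_rel (TaftRel.g_pow (N := N) (q := q))

theorem x_pow : (x : Taft N q) ^ N = 0 := by
  simpa [x] using proj_rel (TaftRel.x_pow (N := N) (q := q))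

theorem g_mul_x : (g : Taft N q) * x = q • (x * g) := by
  simpa [x, g] using proj_rel (TaftRel.comm (N := N) (q := q))

/-- The algebra map with `g ↦ a`, `x ↦ b`. -/
noncomputable def lift {B : Type*} [Ring B] [Algebra ℂ B] (a b : B) (ha : a ^ N = 1)
    (hb : b ^ N = 0) (hab : a * b = q • (b * a)) : Taft N q →ₐ[ℂ] B :=
  RingQuot.liftAlgHom ℂ
    ⟨FreeAlgebra.lift ℂ (fun t => TaftGen.casesOn t a b), fun _ _ h => by
      cases h <;> simp [ha, hb, hab]⟩

theorem lift_g {B : Type*} [Ring B] [Algebra ℂ B] (a b : B) (ha : a ^ N = 1)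
    (hb : b ^ N = 0) (hab : a * b = q • (b * a)) : lift a b ha hb hab g = a := by
  refine (RingQuot.liftAlgHom_mkAlgHom_apply ℂ _ _ _).trans ?_
  simp

theorem lift_x {B : Type*} [Ring B] [Algebra ℂ B] (a b : B) (ha : a ^ N = 1)
    (hb : b ^ N = 0) (hab : a * b = q • (b * a)) : lift a b ha hb hab x = b := by
  refine (RingQuot.liftAlgHom_mkAlgHom_apply ℂ _ _ _).trans ?_
  simp

/-- The coproduct: `Δ(g) = g ⊗ g`, `Δ(x) = x ⊗ g + 1 ⊗ x`. -/
noncomputable def comul (hN : N ≠ 0) (hq : IsPrimitiveRoot q N) :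
    Taft N q →ₐ[ℂ] Taft N q ⊗[ℂ] Taft N q :=
  lift (g ⊗ₜ g) (x ⊗ₜ g + 1 ⊗ₜ x)
    (by rw [Algebra.TensorProduct.tmul_pow, g_pow]; rfl)
    (by
      rw [add_comm]
      refine skew_add_pow_eq_zero hN hq ?_ ?_ ?_
      · simp [g_mul_x]
      · rw [Algebra.TensorProduct.tmul_pow, x_pow, TensorProduct.zero_tmul]
      · rw [Algebra.TensorProduct.tmul_pow, x_pow, TensorProduct.tmul_zero])
    (by simp [mul_add, add_mul, g_mul_x, TensorProduct.smul_tmul'])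

/-- The counit: `ε(g) = 1`, `ε(x) = 0`. -/
noncomputable def counit (hN : N ≠ 0) : Taft N q →ₐ[ℂ] ℂ :=
  lift 1 0 (one_pow N) (zero_pow hN) (by simp)

theorem g_inv_mul_x (hN : N ≠ 0) (hq : IsPrimitiveRoot q N) :
    q • ((g : Taft N q) ^ (N - 1) * x) = x * g ^ (N - 1) := by
  rw [skew_pow_mul g_mul_x, smul_smul, mul_pow_sub_one hN, hq.pow_eq_one, one_smul]

/-- The antipode, as an algebra map to the opposite algebra: `S(g) = g⁻¹`, `S(x) = -x g⁻¹`
(where `g⁻¹ = g ^ (N - 1)`). -/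
noncomputable def antipode (hN : N ≠ 0) (hq : IsPrimitiveRoot q N) :
    Taft N q →ₐ[ℂ] (Taft N q)ᵐᵒᵖ :=
  lift (MulOpposite.op (g ^ (N - 1))) (MulOpposite.op (-(x * g ^ (N - 1))))
    (by rw [← MulOpposite.op_pow, ← pow_mul, mul_comm, pow_mul, g_pow, one_pow]; rfl)
    (by
      rw [← MulOpposite.op_pow, neg_pow, skew_prod_pow_eq_zero (skew_pow_mul g_mul_x _) x_pow,
        mul_zero]
      rfl)
    (by
      rw [← MulOpposite.op_mul, ← MulOpposite.op_mul, ← MulOpposite.op_smul]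
      congr 1
      rw [neg_mul, mul_neg, smul_neg, ← mul_assoc, ← smul_mul_assoc, g_inv_mul_x hN hq])

/-- The Taft Hopf algebra of dimension `N ^ 2`, as a quasi-Hopf algebra with trivial associator
and `α = β = 1`. -/
noncomputable def quasiHopf (hN : N ≠ 0) (hq : IsPrimitiveRoot q N) :
    QuasiHopfData (Taft N q) where
  comul := (comul hN hq).toLinearMap
  counit := (counit hN).toLinearMap
  assoc := 1
  antipode := (MulOpposite.opLinearEquiv ℂ).symm.toLinearMap ∘ₗ (antipode hN hq).toLinearMap
  alpha := 1
  beta := 1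

/-- The component of degree `d` of the grading with `deg g = 0`, `deg x = 1`. -/
noncomputable def grade (N : ℕ) (q : ℂ) (d : ℕ) : Submodule ℂ (Taft N q) :=
  Submodule.span ℂ {t | ∃ i : ℕ, t = g ^ i * x ^ d}

end Taft

/-- Generators of the book algebra of dimension `64`. -/
inductive BookGen : Type
  | g : BookGen
  | x : BookGen
  | y : BookGen

/-- The relations `g ^ 4 = 1`, `x ^ 4 = 0`, `y ^ 4 = 0`, `g x = i x g`, `g y = -i y g`,
`x y = y x`. -/
inductive BookRel : FreeAlgebra ℂ BookGen → FreeAlgebra ℂ BookGen → Prop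
  | g_pow : BookRel (FreeAlgebra.ι ℂ BookGen.g ^ 4) 1
  | x_pow : BookRel (FreeAlgebra.ι ℂ BookGen.x ^ 4) 0
  | y_pow : BookRel (FreeAlgebra.ι ℂ BookGen.y ^ 4) 0
  | comm_x : BookRel (FreeAlgebra.ι ℂ BookGen.g * FreeAlgebra.ι ℂ BookGen.x)
      (Complex.I • (FreeAlgebra.ι ℂ BookGen.x * FreeAlgebra.ι ℂ BookGen.g))
  | comm_y : BookRel (FreeAlgebra.ι ℂ BookGen.g * FreeAlgebra.ι ℂ BookGen.y)
      ((-Complex.I) • (FreeAlgebra.ι ℂ BookGen.y * FreeAlgebra.ι ℂ BookGen.g))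
  | comm_xy : BookRel (FreeAlgebra.ι ℂ BookGen.x * FreeAlgebra.ι ℂ BookGen.y)
      (FreeAlgebra.ι ℂ BookGen.y * FreeAlgebra.ι ℂ BookGen.x)

/-- The algebra underlying the book Hopf algebra of dimension `64`: generators `g`, `x = x₊`,
`y = x₋` and relations `g ^ 4 = 1`, `x ^ 4 = y ^ 4 = 0`, `g x g⁻¹ = i x`, `g y g⁻¹ = -i y`,
`x y = y x`. -/
def Book : Type := RingQuot BookRel

namespace Book

noncomputable instance : Ring Book := inferInstanceAs (Ring (RingQuot BookRel))

noncomputable instance : Algebra ℂ Book := inferInstanceAs (Algebra ℂ (RingQuot BookRel))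

/-- The projection from the free algebra. -/
noncomputable def proj : FreeAlgebra ℂ BookGen →ₐ[ℂ] Book := RingQuot.mkAlgHom ℂ BookRel

theorem proj_rel {a b : FreeAlgebra ℂ BookGen} (h : BookRel a b) : proj a = proj b :=
  RingQuot.mkAlgHom_rel ℂ h

/-- The generator `g`. -/
noncomputable def g : Book := proj (FreeAlgebra.ι ℂ BookGen.g)

/-- The generator `x = x₊`. -/
noncomputable def x : Book := proj (FreeAlgebra.ι ℂ BookGen.x)

/-- The generator `y = x₋`. -/
noncomputable def y : Book := proj (FreeAlgebra.ι ℂ BookGen.y)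

theorem g_pow : g ^ 4 = 1 := by simpa [g] using proj_rel BookRel.g_pow

theorem x_pow : x ^ 4 = 0 := by simpa [x] using proj_rel BookRel.x_pow

theorem y_pow : y ^ 4 = 0 := by simpa [y] using proj_rel BookRel.y_pow

theorem g_mul_x : g * x = Complex.I • (x * g) := by
  simpa only [x, g, map_mul, map_smul] using proj_rel BookRel.comm_x

theorem g_mul_y : g * y = (-Complex.I) • (y * g) := by
  simpa only [y, g, map_mul, map_smul] using proj_rel BookRel.comm_y

theorem x_mul_y : x * y = y * x := by
  simpa only [x, y, map_mul] using proj_rel BookRel.comm_xy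

/-- The algebra map with `g ↦ a`, `x ↦ b`, `y ↦ c`. -/
noncomputable def lift {B : Type*} [Ring B] [Algebra ℂ B] (a b c : B) (ha : a ^ 4 = 1)
    (hb : b ^ 4 = 0) (hc : c ^ 4 = 0) (hab : a * b = Complex.I • (b * a))
    (hac : a * c = (-Complex.I) • (c * a)) (hbc : b * c = c * b) : Book →ₐ[ℂ] B :=
  RingQuot.liftAlgHom ℂ
    ⟨FreeAlgebra.lift ℂ (fun t => BookGen.casesOn t a b c), fun _ _ h => by
      cases h
      · simp [ha]
      · simp [hb]
      · simp [hc]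
      · simp only [map_mul, map_smul, FreeAlgebra.lift_ι_apply]; exact hab
      · simp only [map_mul, map_smul, FreeAlgebra.lift_ι_apply]; exact hac
      · simp only [map_mul, FreeAlgebra.lift_ι_apply]; exact hbc⟩

theorem isPrimitiveRoot_I : IsPrimitiveRoot Complex.I 4 := Complex.isPrimitiveRoot_I

theorem isPrimitiveRoot_neg_I : IsPrimitiveRoot (-Complex.I) 4 := by
  simpa using Complex.isPrimitiveRoot_I.inv

theorem g_cube_mul_x : g ^ 3 * x = (-Complex.I) • (x * g ^ 3) := by
  rw [skew_pow_mul g_mul_x, Complex.I_pow_three]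

theorem g_cube_mul_y : g ^ 3 * y = Complex.I • (y * g ^ 3) := by
  rw [skew_pow_mul g_mul_y]
  congr 1
  rw [neg_pow, Complex.I_pow_three]
  norm_num

theorem g_mul_g_cube : g * g ^ 3 = 1 := by rw [← pow_succ', g_pow]

theorem g_cube_mul_g : g ^ 3 * g = 1 := by rw [← pow_succ, g_pow]

/-- The coproduct: `Δ(g) = g ⊗ g`, `Δ(x) = x ⊗ g + 1 ⊗ x`, `Δ(y) = y ⊗ 1 + g⁻¹ ⊗ y`
(where `g⁻¹ = g ^ 3`). -/
noncomputable def comul : Book →ₐ[ℂ] Book ⊗[ℂ] Book :=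
  lift (g ⊗ₜ g) (x ⊗ₜ g + 1 ⊗ₜ x) (y ⊗ₜ 1 + (g ^ 3) ⊗ₜ y)
    (by rw [Algebra.TensorProduct.tmul_pow, g_pow]; rfl)
    (by
      rw [add_comm]
      refine skew_add_pow_eq_zero (by norm_num) isPrimitiveRoot_I ?_ ?_ ?_
      · simp [g_mul_x]
      · rw [Algebra.TensorProduct.tmul_pow, x_pow, TensorProduct.zero_tmul]
      · rw [Algebra.TensorProduct.tmul_pow, x_pow, TensorProduct.tmul_zero])
    (by
      refine skew_add_pow_eq_zero (by norm_num) isPrimitiveRoot_I ?_ ?_ ?_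
      · simp [g_cube_mul_y, TensorProduct.smul_tmul']
      · rw [Algebra.TensorProduct.tmul_pow, y_pow, TensorProduct.tmul_zero]
      · rw [Algebra.TensorProduct.tmul_pow, y_pow, TensorProduct.zero_tmul])
    (by simp [mul_add, add_mul, g_mul_x, TensorProduct.smul_tmul'])
    (by
      simp only [mul_add, add_mul, Algebra.TensorProduct.tmul_mul_tmul, g_mul_y, mul_one, one_mul,
        TensorProduct.tmul_smul, smul_add, TensorProduct.smul_tmul', g_mul_g_cube, g_cube_mul_g])
    (by
      simp only [mul_add, add_mul, Algebra.TensorProduct.tmul_mul_tmul, mul_one, one_mul, x_mul_y,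
        g_mul_y, g_cube_mul_x, TensorProduct.tmul_smul, TensorProduct.smul_tmul']
      abel)

/-- The counit: `ε(g) = 1`, `ε(x) = ε(y) = 0`. -/
noncomputable def counit : Book →ₐ[ℂ] ℂ :=
  lift 1 0 0 (one_pow 4) (zero_pow four_ne_zero) (zero_pow four_ne_zero) (by simp) (by simp) rfl

/-- The antipode, as an algebra map to the opposite algebra: `S(g) = g⁻¹`, `S(x) = -x g⁻¹`,
`S(y) = -g y` (where `g⁻¹ = g ^ 3`). -/
noncomputable def antipode : Book →ₐ[ℂ] Bookᵐᵒᵖ :=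
  lift (MulOpposite.op (g ^ 3)) (MulOpposite.op (-(x * g ^ 3))) (MulOpposite.op (-(g * y)))
    (by rw [← MulOpposite.op_pow, ← pow_mul, mul_comm, pow_mul, g_pow, one_pow]; rfl)
    (by
      rw [← MulOpposite.op_pow, neg_pow, skew_prod_pow_eq_zero g_cube_mul_x x_pow, mul_zero]
      rfl)
    (by
      rw [← MulOpposite.op_pow, neg_pow, g_mul_y, smul_pow, skew_prod_pow_eq_zero g_mul_y y_pow,
        smul_zero, mul_zero]
      rfl)
    (by
      rw [← MulOpposite.op_mul, ← MulOpposite.op_mul, ← MulOpposite.op_smul]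
      congr 1
      rw [neg_mul, mul_neg, smul_neg, ← mul_assoc, g_cube_mul_x, smul_mul_assoc, smul_smul]
      simp)
    (by
      rw [← MulOpposite.op_mul, ← MulOpposite.op_mul, ← MulOpposite.op_smul]
      congr 1
      rw [neg_mul, mul_neg, smul_neg, ← mul_assoc, g_cube_mul_g, one_mul, mul_assoc,
        show y * g ^ 3 = (-Complex.I) • (g ^ 3 * y) by rw [g_cube_mul_y, smul_smul]; simp,
        mul_smul_comm, ← mul_assoc, g_mul_g_cube, one_mul])
    (by
      rw [← MulOpposite.op_mul, ← MulOpposite.op_mul]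
      congr 1
      rw [neg_mul_neg, neg_mul_neg, mul_assoc x, ← mul_assoc (g ^ 3), g_cube_mul_g, one_mul,
        mul_assoc g, ← mul_assoc y, ← x_mul_y, mul_assoc x,
        show y * g ^ 3 = (-Complex.I) • (g ^ 3 * y) by rw [g_cube_mul_y, smul_smul]; simp,
        mul_smul_comm, mul_smul_comm, ← mul_assoc, g_mul_x, smul_mul_assoc, smul_smul, mul_assoc x,
        ← mul_assoc g, g_mul_g_cube, one_mul]
      simp)

/-- The book Hopf algebra of dimension `64`, as a quasi-Hopf algebra with trivial associator
and `α = β = 1`. -/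
noncomputable def quasiHopf : QuasiHopfData Book where
  comul := comul.toLinearMap
  counit := counit.toLinearMap
  assoc := 1
  antipode := (MulOpposite.opLinearEquiv ℂ).symm.toLinearMap ∘ₗ antipode.toLinearMap
  alpha := 1
  beta := 1

/-- The component of degree `d` of the grading with `deg g = 0`, `deg x = deg y = 1`. -/
noncomputable def grade (d : ℕ) : Submodule ℂ Book :=
  Submodule.span ℂ {t | ∃ i j k : ℕ, j + k = d ∧ t = g ^ i * x ^ j * y ^ k}

end Book

/-- For an algebra `A` graded by the subspaces `𝒜 d`, the elements of `A ⊗ A` all of whose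
components have positive degree (where `deg (b ⊗ c) = deg b + deg c`). -/
def higherDegree {A : Type*} [Ring A] [Algebra ℂ A] (𝒜 : ℕ → Submodule ℂ A) :
    Submodule ℂ (A ⊗[ℂ] A) :=
  Submodule.span ℂ {t | ∃ i j b c, 0 < i + j ∧ b ∈ 𝒜 i ∧ c ∈ 𝒜 j ∧ t = b ⊗ₜ[ℂ] c}

/-! The argument is deformation theory along the radical filtration of `H`. Write `A` for the given
Hopf algebra. A linear isomorphism `s : A → H` that splits the filtration respects all structure
maps to leading order (`exists_filteredIso`), and since `gr H` has trivial associator, `Φ = 1`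
modulo positive degree.

Removing the associator. If `Φ - 1` has degree `d ≥ 1`, the pentagon equation is linear in `Φ - 1`
up to terms of degree `2 d`, so the leading term of `Φ - 1` is a 3-cocycle of the cobar complex of
the coalgebra `A`. A twist by `1 - f` subtracts from it the coboundary of `f`. If the third
cohomology vanishes, the associator can thus be pushed into ever higher degree, and since the
radical is nilpotent it becomes `1` after finitely many steps
(`IsFiltered.exists_twist_assoc_eq_one`).

The cohomology. The cobar complex of `A` computes the cohomology of the dual algebra, which is a
truncated polynomial algebra in one or two variables crossed with `ℤ / N`. There the tensor product
of two periodic resolutions is available. Its terms of total degree three carry nonzero weights for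
`ℤ / N`, whereas only weight zero contributes; hence the third cohomology is zero
(`KoszulComodule.exists_cobarTrivial₂_eq`, with the resolution supplied by
`IsBookAlgebra.koszulComodule`).

Rigidity. After the twist by `F`, `H` is a bialgebra that agrees with `A` to leading order, and it
must be shown to be isomorphic to `A`. This is done on the dual side: functionals are realised as
left comodule endomorphisms of `H`. The functionals dual to `g`, `x`, `y` vanish in degree two, and
`s` is multiplicative modulo degree two, so the lifted operators `C`, `X`, `Y` keep their product
rules exactly. The defect of each relation between them is a skew derivation into characters. One
between two distinct characters that vanishes in positive degree is inner, and is removed by adding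
a multiple of `C - 1`; one from a character to itself is zero, because `g` is diagonalisable and
`x`, `y` have nontrivial weights. So both bialgebras have the same dual (`exists_dualGenerators`,
`exists_algEquiv`).

Conclusion. An isomorphism `Ψ` from the twisted `H` to `A` turns `H` into the twist of `A` by
`Ψ(F⁻¹)`; uniqueness of convolution inverses matches the antipodes (`isomorphic_twist`). `Ψ` maps
the radical to nilpotent elements, which have positive degree, so this twist is `1` modulo higher
degree.

Both families are treated at once by `IsBookAlgebra`; the Taft algebras are the case `M = 1`, `y =
0`. -/

/-! ## Twists of quasi-bialgebras -/

namespace QuasiHopfData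

variable {A : Type*} [Ring A] [Algebra ℂ A]

noncomputable instance : Ring (A ⊗[ℂ] (A ⊗[ℂ] A)) := Algebra.TensorProduct.instRing

noncomputable instance : Ring (A ⊗[ℂ] (A ⊗[ℂ] (A ⊗[ℂ] A))) := Algebra.TensorProduct.instRing

/-- The axioms of a quasi-bialgebra: the part of Drinfeld's axioms that does not involve the
antipode. -/
structure IsQuasiBialgebra (Q : QuasiHopfData A) : Prop where
  comul_one : Q.comul 1 = 1
  comul_mul : ∀ a b, Q.comul (a * b) = Q.comul a * Q.comul b
  counit_one : Q.counit 1 = 1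
  counit_mul : ∀ a b, Q.counit (a * b) = Q.counit a * Q.counit b
  isUnit_assoc : IsUnit Q.assoc
  quasi_coassoc : ∀ a,
    Q.comulRight (Q.comul a) * Q.assoc = Q.assoc * Q.comulLeft (Q.comul a)
  pentagon : Q.comul₃ Q.assoc * Q.comul₁ Q.assoc =
    (1 ⊗ₜ[ℂ] Q.assoc) * Q.comul₂ Q.assoc * tensorOne₃ Q.assoc
  counitLeft_comul : ∀ a, Q.counitLeft (Q.comul a) = a
  counitRight_comul : ∀ a, Q.counitRight (Q.comul a) = a
  counit_assoc : LinearMap.lTensor A Q.counitLeft Q.assoc = 1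

theorem IsQuasiHopf.isQuasiBialgebra {Q : QuasiHopfData A} (h : Q.IsQuasiHopf) :
    Q.IsQuasiBialgebra :=
  ⟨h.1, h.2, h.3, h.4, h.5, h.6, h.7, h.8, h.9, h.10⟩

section TensorOne

theorem tensorOne_tmul (a b : A) : tensorOne (a ⊗ₜ[ℂ] b) = a ⊗ₜ[ℂ] (b ⊗ₜ[ℂ] (1 : A)) := rfl

/-- `x ⊗ y ↦ x ⊗ y ⊗ 1` as an algebra map. -/
noncomputable def tensorOneHom (A : Type*) [Ring A] [Algebra ℂ A] :
    A ⊗[ℂ] A →ₐ[ℂ] A ⊗[ℂ] (A ⊗[ℂ] A) :=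
  Algebra.TensorProduct.map (AlgHom.id ℂ A) Algebra.TensorProduct.includeLeft

/-- `x ⊗ y ⊗ z ↦ x ⊗ y ⊗ z ⊗ 1` as an algebra map. -/
noncomputable def tensorOne₃Hom (A : Type*) [Ring A] [Algebra ℂ A] :
    A ⊗[ℂ] (A ⊗[ℂ] A) →ₐ[ℂ] A ⊗[ℂ] (A ⊗[ℂ] (A ⊗[ℂ] A)) :=
  Algebra.TensorProduct.map (AlgHom.id ℂ A) (tensorOneHom A)

end TensorOne

namespace IsQuasiBialgebra

variable {Q : QuasiHopfData A} (hQ : Q.IsQuasiBialgebra)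

/-- The coproduct as an algebra map. -/
noncomputable def comulHom : A →ₐ[ℂ] A ⊗[ℂ] A :=
  AlgHom.ofLinearMap Q.comul hQ.comul_one hQ.comul_mul

/-- The counit as an algebra map. -/
noncomputable def counitHom : A →ₐ[ℂ] ℂ :=
  AlgHom.ofLinearMap Q.counit hQ.counit_one hQ.counit_mul

/-- `Δ ⊗ id` as an algebra map. -/
noncomputable def comulLeftHom : A ⊗[ℂ] A →ₐ[ℂ] A ⊗[ℂ] (A ⊗[ℂ] A) :=
  (Algebra.TensorProduct.assoc ℂ ℂ ℂ A A A).toAlgHom.comp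
    (Algebra.TensorProduct.map hQ.comulHom (AlgHom.id ℂ A))

/-- `id ⊗ Δ` as an algebra map. -/
noncomputable def comulRightHom : A ⊗[ℂ] A →ₐ[ℂ] A ⊗[ℂ] (A ⊗[ℂ] A) :=
  Algebra.TensorProduct.map (AlgHom.id ℂ A) hQ.comulHom

/-- `Δ ⊗ id ⊗ id` as an algebra map. -/
noncomputable def comul₁Hom : A ⊗[ℂ] (A ⊗[ℂ] A) →ₐ[ℂ] A ⊗[ℂ] (A ⊗[ℂ] (A ⊗[ℂ] A)) :=
  (Algebra.TensorProduct.assoc ℂ ℂ ℂ A A (A ⊗[ℂ] A)).toAlgHom.comp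
    (Algebra.TensorProduct.map hQ.comulHom (AlgHom.id ℂ (A ⊗[ℂ] A)))

/-- `id ⊗ Δ ⊗ id` as an algebra map. -/
noncomputable def comul₂Hom : A ⊗[ℂ] (A ⊗[ℂ] A) →ₐ[ℂ] A ⊗[ℂ] (A ⊗[ℂ] (A ⊗[ℂ] A)) :=
  Algebra.TensorProduct.map (AlgHom.id ℂ A) hQ.comulLeftHom

/-- `id ⊗ id ⊗ Δ` as an algebra map. -/
noncomputable def comul₃Hom : A ⊗[ℂ] (A ⊗[ℂ] A) →ₐ[ℂ] A ⊗[ℂ] (A ⊗[ℂ] (A ⊗[ℂ] A)) :=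
  Algebra.TensorProduct.map (AlgHom.id ℂ A) hQ.comulRightHom

/-- `ε ⊗ id` as an algebra map. -/
noncomputable def counitLeftHom : A ⊗[ℂ] A →ₐ[ℂ] A :=
  (Algebra.TensorProduct.lid ℂ A).toAlgHom.comp
    (Algebra.TensorProduct.map hQ.counitHom (AlgHom.id ℂ A))

/-- `id ⊗ ε` as an algebra map. -/
noncomputable def counitRightHom : A ⊗[ℂ] A →ₐ[ℂ] A :=
  (Algebra.TensorProduct.rid ℂ ℂ A).toAlgHom.comp
    (Algebra.TensorProduct.map (AlgHom.id ℂ A) hQ.counitHom)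

theorem comulLeft_mul (hQ : Q.IsQuasiBialgebra) (s t : A ⊗[ℂ] A) :
    Q.comulLeft (s * t) = Q.comulLeft s * Q.comulLeft t := map_mul hQ.comulLeftHom s t
theorem comulRight_mul (hQ : Q.IsQuasiBialgebra) (s t : A ⊗[ℂ] A) :
    Q.comulRight (s * t) = Q.comulRight s * Q.comulRight t := map_mul hQ.comulRightHom s t
theorem comul₁_mul (hQ : Q.IsQuasiBialgebra) (s t : A ⊗[ℂ] (A ⊗[ℂ] A)) :
    Q.comul₁ (s * t) = Q.comul₁ s * Q.comul₁ t := map_mul hQ.comul₁Hom s t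
theorem comul₂_mul (hQ : Q.IsQuasiBialgebra) (s t : A ⊗[ℂ] (A ⊗[ℂ] A)) :
    Q.comul₂ (s * t) = Q.comul₂ s * Q.comul₂ t := map_mul hQ.comul₂Hom s t
theorem comul₃_mul (hQ : Q.IsQuasiBialgebra) (s t : A ⊗[ℂ] (A ⊗[ℂ] A)) :
    Q.comul₃ (s * t) = Q.comul₃ s * Q.comul₃ t := map_mul hQ.comul₃Hom s t
theorem counitLeft_mul (hQ : Q.IsQuasiBialgebra) (s t : A ⊗[ℂ] A) :
    Q.counitLeft (s * t) = Q.counitLeft s * Q.counitLeft t := map_mul hQ.counitLeftHom s t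
theorem counitRight_mul (hQ : Q.IsQuasiBialgebra) (s t : A ⊗[ℂ] A) :
    Q.counitRight (s * t) = Q.counitRight s * Q.counitRight t := map_mul hQ.counitRightHom s t
theorem comulLeft_one (hQ : Q.IsQuasiBialgebra) : Q.comulLeft (1 : A ⊗[ℂ] A) = 1 :=
  map_one hQ.comulLeftHom
theorem comulRight_one (hQ : Q.IsQuasiBialgebra) : Q.comulRight (1 : A ⊗[ℂ] A) = 1 :=
  map_one hQ.comulRightHom
theorem comul₁_one (hQ : Q.IsQuasiBialgebra) : Q.comul₁ (1 : A ⊗[ℂ] (A ⊗[ℂ] A)) = 1 :=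
  map_one hQ.comul₁Hom
theorem counitLeft_one (hQ : Q.IsQuasiBialgebra) : Q.counitLeft (1 : A ⊗[ℂ] A) = 1 :=
  map_one hQ.counitLeftHom
theorem counitRight_one (hQ : Q.IsQuasiBialgebra) : Q.counitRight (1 : A ⊗[ℂ] A) = 1 :=
  map_one hQ.counitRightHom

end IsQuasiBialgebra

theorem tensorOne_mul (s t : A ⊗[ℂ] A) : tensorOne (s * t) = tensorOne s * tensorOne t :=
  map_mul (tensorOneHom A) s t
theorem tensorOne₃_mul (s t : A ⊗[ℂ] (A ⊗[ℂ] A)) :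
    tensorOne₃ (s * t) = tensorOne₃ s * tensorOne₃ t := map_mul (tensorOne₃Hom A) s t
theorem tensorOne_one : tensorOne (1 : A ⊗[ℂ] A) = 1 := map_one (tensorOneHom A)
theorem tensorOne₃_one : tensorOne₃ (1 : A ⊗[ℂ] (A ⊗[ℂ] A)) = 1 := map_one (tensorOne₃Hom A)

theorem one_tmul_mul {B : Type*} [Ring B] [Algebra ℂ B] (s t : B) :
    (1 : A) ⊗ₜ[ℂ] (s * t) = ((1 : A) ⊗ₜ[ℂ] s) * ((1 : A) ⊗ₜ[ℂ] t) := by simp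

/-! ### Relations between the iterated coproducts. -/

section Identities

variable (Q : QuasiHopfData A)

theorem comul₃_one_tmul (t : A ⊗[ℂ] A) :
    Q.comul₃ (1 ⊗ₜ[ℂ] t) = 1 ⊗ₜ[ℂ] Q.comulRight t := rfl

theorem comul₂_one_tmul (t : A ⊗[ℂ] A) :
    Q.comul₂ (1 ⊗ₜ[ℂ] t) = 1 ⊗ₜ[ℂ] Q.comulLeft t := rfl

theorem comul₁_one_tmul (h : Q.comul 1 = 1) (t : A ⊗[ℂ] A) :
    Q.comul₁ (1 ⊗ₜ[ℂ] t) = 1 ⊗ₜ[ℂ] (1 ⊗ₜ[ℂ] t) := by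
  simp [comul₁, h, Algebra.TensorProduct.one_def]

theorem comul₃_tensorOne (h : Q.comul 1 = 1) (t : A ⊗[ℂ] A) :
    Q.comul₃ (tensorOne t) = tensorOne₃ (tensorOne t) := by
  induction t using TensorProduct.induction_on with
  | zero => simp
  | add x y hx hy => simp only [map_add, hx, hy]
  | tmul x y => simp [comul₃, tensorOne₃, tensorOne, comulRight, h, Algebra.TensorProduct.one_def]

theorem comul₂_tensorOne (t : A ⊗[ℂ] A) :
    Q.comul₂ (tensorOne t) = tensorOne₃ (Q.comulRight t) := by
  induction t using TensorProduct.induction_on with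
  | zero => simp
  | add x y hx hy => simp only [map_add, hx, hy]
  | tmul x y =>
    simp only [comul₂, tensorOne₃, tensorOne_tmul, comulRight, LinearMap.lTensor_tmul]
    congr 1
    simp only [comulLeft, LinearMap.coe_comp, LinearEquiv.coe_coe, Function.comp_apply,
      LinearMap.rTensor_tmul]
    induction Q.comul y using TensorProduct.induction_on with
    | zero => simp
    | add x y hx hy => simp only [map_add, hx, hy, TensorProduct.add_tmul]
    | tmul x y => simp [tensorOne]

theorem comul₁_tensorOne (t : A ⊗[ℂ] A) :
    Q.comul₁ (tensorOne t) = tensorOne₃ (Q.comulLeft t) := by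
  induction t using TensorProduct.induction_on with
  | zero => simp
  | add x y hx hy => simp only [map_add, hx, hy]
  | tmul x y =>
    simp only [comul₁, tensorOne_tmul, comulLeft, LinearMap.coe_comp, LinearEquiv.coe_coe,
      Function.comp_apply, LinearMap.rTensor_tmul]
    induction Q.comul x using TensorProduct.induction_on with
    | zero => simp
    | add x y hx hy => simp only [map_add, hx, hy, TensorProduct.add_tmul]
    | tmul x y => simp [tensorOne₃, tensorOne]

theorem comul₃_comulLeft (t : A ⊗[ℂ] A) :
    Q.comul₃ (Q.comulLeft t) = Q.comul₁ (Q.comulRight t) := by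
  induction t using TensorProduct.induction_on with
  | zero => simp
  | add x y hx hy => simp only [map_add, hx, hy]
  | tmul x y =>
    simp only [comul₁, comulRight, comulLeft, comul₃, LinearMap.coe_comp, LinearEquiv.coe_coe,
      Function.comp_apply, LinearMap.rTensor_tmul, LinearMap.lTensor_tmul]
    induction Q.comul x using TensorProduct.induction_on with
    | zero => simp
    | add x y hx hy => simp only [map_add, hx, hy, TensorProduct.add_tmul]
    | tmul x y => simp

/-- Quasi-coassociativity in the last three legs. Together with `comul₂_comulLeft_mul`, which uses
it in the first three legs, it carries the iterated coproducts of a twist past the associators in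
the pentagon. -/
theorem comul₂_comulRight_mul (hc : ∀ a, Q.comulRight (Q.comul a) * Q.assoc =
    Q.assoc * Q.comulLeft (Q.comul a)) (t : A ⊗[ℂ] A) :
    (1 ⊗ₜ[ℂ] Q.assoc) * Q.comul₂ (Q.comulRight t) =
      Q.comul₃ (Q.comulRight t) * (1 ⊗ₜ[ℂ] Q.assoc) := by
  induction t using TensorProduct.induction_on with
  | zero => simp
  | add x y hx hy => simp only [map_add, mul_add, add_mul, hx, hy]
  | tmul x y =>
    have h := hc y
    simp only [comul₂, comul₃, comulRight, LinearMap.lTensor_tmul,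
      Algebra.TensorProduct.tmul_mul_tmul, one_mul, mul_one] at h ⊢
    rw [h]

/-- Splitting off the last leg leaves an expression in the first three legs to which
quasi-coassociativity applies. -/
theorem comul₂_comulLeft_tmul (a b : A) :
    Q.comul₂ (Q.comulLeft (a ⊗ₜ[ℂ] b)) =
      tensorOne₃ (Q.comulRight (Q.comul a)) * (1 ⊗ₜ[ℂ] (1 ⊗ₜ[ℂ] (1 ⊗ₜ[ℂ] b))) := by
  simp only [comulLeft, comul₂, LinearMap.coe_comp, LinearEquiv.coe_coe,
    Function.comp_apply, LinearMap.rTensor_tmul]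
  induction Q.comul a using TensorProduct.induction_on with
  | zero => simp
  | add x y hx hy => simp only [map_add, TensorProduct.add_tmul, add_mul, hx, hy]
  | tmul x y =>
    simp only [TensorProduct.assoc_tmul, LinearMap.lTensor_tmul, comulRight,
      LinearMap.coe_comp, LinearEquiv.coe_coe, Function.comp_apply, LinearMap.rTensor_tmul,
      tensorOne₃]
    induction Q.comul y using TensorProduct.induction_on with
    | zero => simp
    | add x y hx hy => simp only [map_add, TensorProduct.add_tmul, TensorProduct.tmul_add,
        add_mul, hx, hy]
    | tmul y z => simp [tensorOne]

theorem comul₁_comulLeft_tmul (a b : A) :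
    Q.comul₁ (Q.comulLeft (a ⊗ₜ[ℂ] b)) =
      tensorOne₃ (Q.comulLeft (Q.comul a)) * (1 ⊗ₜ[ℂ] (1 ⊗ₜ[ℂ] (1 ⊗ₜ[ℂ] b))) := by
  simp only [comulLeft, comul₁, LinearMap.coe_comp, LinearEquiv.coe_coe,
    Function.comp_apply, LinearMap.rTensor_tmul]
  induction Q.comul a using TensorProduct.induction_on with
  | zero => simp
  | add x y hx hy => simp only [map_add, TensorProduct.add_tmul, add_mul, hx, hy]
  | tmul x y =>
    simp only [TensorProduct.assoc_tmul, LinearMap.rTensor_tmul]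
    induction Q.comul x using TensorProduct.induction_on with
    | zero => simp
    | add x y hx hy => simp only [map_add, TensorProduct.add_tmul, TensorProduct.tmul_add,
        add_mul, hx, hy]
    | tmul y z => simp [tensorOne, tensorOne₃]

theorem comul₂_comulLeft_mul (hc : ∀ a, Q.comulRight (Q.comul a) * Q.assoc =
    Q.assoc * Q.comulLeft (Q.comul a)) (t : A ⊗[ℂ] A) :
    Q.comul₂ (Q.comulLeft t) * tensorOne₃ Q.assoc =
      tensorOne₃ Q.assoc * Q.comul₁ (Q.comulLeft t) := by
  induction t using TensorProduct.induction_on with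
  | zero => simp
  | add x y hx hy => simp only [map_add, mul_add, add_mul, hx, hy]
  | tmul x y =>
    rw [comul₂_comulLeft_tmul, comul₁_comulLeft_tmul, ← mul_assoc (tensorOne₃ Q.assoc),
      ← tensorOne₃_mul, ← hc x, tensorOne₃_mul, mul_assoc, mul_assoc]
    congr 1
    generalize Q.assoc = t
    induction t using TensorProduct.induction_on with
    | zero => simp
    | add x y hx hy => simp only [map_add, mul_add, add_mul, hx, hy]
    | tmul x y =>
      induction y using TensorProduct.induction_on with
      | zero => simp
      | add x y hx hy => simp only [map_add, TensorProduct.tmul_add, mul_add, add_mul, hx, hy]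
      | tmul y z => simp [tensorOne, tensorOne₃]

end Identities

end QuasiHopfData

/-! ### The structure maps of a twist and the axioms they satisfy. -/

namespace QuasiHopfData

variable {A : Type*} [Ring A] [Algebra ℂ A]

theorem assoc_tmul_one (t : A ⊗[ℂ] A) :
    Algebra.TensorProduct.assoc ℂ ℂ ℂ A A A (t ⊗ₜ[ℂ] (1 : A)) = tensorOne t := by
  induction t using TensorProduct.induction_on with
  | zero => simp
  | add x y hx hy => simp only [map_add, TensorProduct.add_tmul, hx, hy]
  | tmul x y => simp [tensorOne]

theorem assoc_tmul_one₃ (t : A ⊗[ℂ] A) :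
    Algebra.TensorProduct.assoc ℂ ℂ ℂ A A (A ⊗[ℂ] A) (t ⊗ₜ[ℂ] (1 : A ⊗[ℂ] A)) =
      tensorOne₃ (tensorOne t) := by
  induction t using TensorProduct.induction_on with
  | zero => simp
  | add x y hx hy => simp only [map_add, TensorProduct.add_tmul, hx, hy]
  | tmul x y => simp [tensorOne, tensorOne₃, Algebra.TensorProduct.one_def]

section TwistMaps

variable (Q : QuasiHopfData A) (F : (A ⊗[ℂ] A)ˣ)

theorem twist_comul (a : A) :
    (Q.twist F).comul a = (F : A ⊗[ℂ] A) * Q.comul a * ((F⁻¹ : (A ⊗[ℂ] A)ˣ) : A ⊗[ℂ] A) := by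
  rw [mul_assoc]
  rfl

theorem twist_comulRight (t : A ⊗[ℂ] A) : (Q.twist F).comulRight t =
    (1 ⊗ₜ[ℂ] (F : A ⊗[ℂ] A)) * Q.comulRight t *
      (1 ⊗ₜ[ℂ] ((F⁻¹ : (A ⊗[ℂ] A)ˣ) : A ⊗[ℂ] A)) := by
  induction t using TensorProduct.induction_on with
  | zero => simp
  | add x y hx hy => simp only [map_add, hx, hy, mul_add, add_mul]
  | tmul x y => simp [comulRight, twist_comul]

theorem twist_comulLeft (t : A ⊗[ℂ] A) : (Q.twist F).comulLeft t =
    tensorOne (F : A ⊗[ℂ] A) * Q.comulLeft t *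
      tensorOne ((F⁻¹ : (A ⊗[ℂ] A)ˣ) : A ⊗[ℂ] A) := by
  induction t using TensorProduct.induction_on with
  | zero => simp
  | add x y hx hy => simp only [map_add, hx, hy, mul_add, add_mul]
  | tmul x y =>
    have h1 : (Q.twist F).comulLeft (x ⊗ₜ[ℂ] y) =
        Algebra.TensorProduct.assoc ℂ ℂ ℂ A A A ((Q.twist F).comul x ⊗ₜ[ℂ] y) := rfl
    have h2 : Q.comulLeft (x ⊗ₜ[ℂ] y) =
        Algebra.TensorProduct.assoc ℂ ℂ ℂ A A A (Q.comul x ⊗ₜ[ℂ] y) := rfl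
    rw [h1, h2, ← assoc_tmul_one, ← assoc_tmul_one, ← map_mul, ← map_mul, twist_comul]
    simp

theorem twist_comul₁ (t : A ⊗[ℂ] (A ⊗[ℂ] A)) : (Q.twist F).comul₁ t =
    tensorOne₃ (tensorOne (F : A ⊗[ℂ] A)) * Q.comul₁ t *
      tensorOne₃ (tensorOne ((F⁻¹ : (A ⊗[ℂ] A)ˣ) : A ⊗[ℂ] A)) := by
  induction t using TensorProduct.induction_on with
  | zero => rw [map_zero, map_zero, mul_zero, zero_mul]
  | add x y hx hy => simp only [map_add, hx, hy, mul_add, add_mul]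
  | tmul x y =>
    have h1 : (Q.twist F).comul₁ (x ⊗ₜ[ℂ] y) =
        Algebra.TensorProduct.assoc ℂ ℂ ℂ A A (A ⊗[ℂ] A) ((Q.twist F).comul x ⊗ₜ[ℂ] y) := rfl
    have h2 : Q.comul₁ (x ⊗ₜ[ℂ] y) =
        Algebra.TensorProduct.assoc ℂ ℂ ℂ A A (A ⊗[ℂ] A) (Q.comul x ⊗ₜ[ℂ] y) := rfl
    rw [h1, h2, ← assoc_tmul_one₃, ← assoc_tmul_one₃, ← map_mul, ← map_mul, twist_comul]
    simp

theorem twist_comul₂ (t : A ⊗[ℂ] (A ⊗[ℂ] A)) : (Q.twist F).comul₂ t =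
    (1 ⊗ₜ[ℂ] tensorOne (F : A ⊗[ℂ] A)) * Q.comul₂ t *
      (1 ⊗ₜ[ℂ] tensorOne ((F⁻¹ : (A ⊗[ℂ] A)ˣ) : A ⊗[ℂ] A)) := by
  induction t using TensorProduct.induction_on with
  | zero => rw [map_zero, map_zero, mul_zero, zero_mul]
  | add x y hx hy => simp only [map_add, hx, hy, mul_add, add_mul]
  | tmul x y =>
    have h1 : (Q.twist F).comul₂ (x ⊗ₜ[ℂ] y) = x ⊗ₜ[ℂ] (Q.twist F).comulLeft y := rfl
    have h2 : Q.comul₂ (x ⊗ₜ[ℂ] y) = x ⊗ₜ[ℂ] Q.comulLeft y := rfl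
    rw [h1, h2, twist_comulLeft, Algebra.TensorProduct.tmul_mul_tmul,
      Algebra.TensorProduct.tmul_mul_tmul, one_mul, mul_one]

theorem twist_comul₃ (t : A ⊗[ℂ] (A ⊗[ℂ] A)) : (Q.twist F).comul₃ t =
    (1 ⊗ₜ[ℂ] (1 ⊗ₜ[ℂ] (F : A ⊗[ℂ] A))) * Q.comul₃ t *
      (1 ⊗ₜ[ℂ] (1 ⊗ₜ[ℂ] ((F⁻¹ : (A ⊗[ℂ] A)ˣ) : A ⊗[ℂ] A))) := by
  induction t using TensorProduct.induction_on with
  | zero => rw [map_zero, map_zero, mul_zero, zero_mul]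
  | add x y hx hy => simp only [map_add, hx, hy, mul_add, add_mul]
  | tmul x y =>
    have h1 : (Q.twist F).comul₃ (x ⊗ₜ[ℂ] y) = x ⊗ₜ[ℂ] (Q.twist F).comulRight y := rfl
    have h2 : Q.comul₃ (x ⊗ₜ[ℂ] y) = x ⊗ₜ[ℂ] Q.comulRight y := rfl
    rw [h1, h2, twist_comulRight, Algebra.TensorProduct.tmul_mul_tmul,
      Algebra.TensorProduct.tmul_mul_tmul, one_mul, mul_one]

end TwistMaps

/-- The pentagon for a twist is a cancellation of words. Here `a`, `b`, `c` stand for the twist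
placed in legs 3 and 4, 1 and 2, 2 and 3; the other letters are its images under coproducts, primed
ones come from the inverse twist, and `p1`, `p2`, `p3`, `oP`, `tP` are the images of the old
associator. The moves `hR` and `hL` are quasi-coassociativity. -/
theorem pentagon_word {B : Type*} [Monoid B]
    {a a' b b' c c' oR R3 p3 K K' p1 L1' tL' oP oL oL' R2 p2 L2' tR tR' tP : B}
    (hab : b' * a' * b * a = 1) (hK : K' * K = 1) (hc : c' * c = 1) (hoL : oL' * oL = 1)
    (htR : tR' * tR = 1) (hpent : p3 * p1 = oP * p2 * tP) (hR : oP * R2 = R3 * oP)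
    (hL : L2' * tP = tP * L1') :
    (a * (oR * R3 * p3 * K' * b') * a') * (b * (a * K * p1 * L1' * tL') * b') =
      (a * oR * oP * oL' * c') * (c * (oL * R2 * p2 * L2' * tR') * c') *
        (c * tR * tP * tL' * b') := by
  calc _ = a * oR * R3 * p3 * K' * (b' * a' * b * a) * K * p1 * L1' * tL' * b' := by
        simp only [mul_assoc]
    _ = a * oR * R3 * p3 * (K' * K) * p1 * L1' * tL' * b' := by
        rw [hab, mul_one]; simp only [mul_assoc]
    _ = a * oR * R3 * (p3 * p1) * L1' * tL' * b' := by
        rw [hK, mul_one]; simp only [mul_assoc]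
    _ = a * oR * (R3 * oP) * p2 * (tP * L1') * tL' * b' := by
        rw [hpent]; simp only [mul_assoc]
    _ = a * oR * (oP * R2) * p2 * (L2' * tP) * tL' * b' := by rw [hR, hL]
    _ = a * oR * oP * (oL' * (c' * c) * oL) * R2 * p2 * L2' * (tR' * (c' * c) * tR) *
          tP * tL' * b' := by
        rw [hc, mul_one, mul_one, hoL, htR, mul_one, mul_one]; simp only [mul_assoc]
    _ = _ := by simp only [mul_assoc]

theorem comulRight_word {B : Type*} [Monoid B] {o o' R R' P L L' t t' x y : B}
    (ho : o' * o = 1) (hR : R' * R = 1) (hL : L' * L = 1) (ht : t' * t = 1)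
    (h : x * P = P * y) :
    (o * (R * x * R') * o') * (o * R * P * L' * t') =
      (o * R * P * L' * t') * (t * (L * y * L') * t') := by
  calc _ = o * R * x * R' * (o' * o) * R * P * L' * t' := by simp only [mul_assoc]
    _ = o * R * x * (R' * R) * P * L' * t' := by rw [ho, mul_one]; simp only [mul_assoc]
    _ = o * R * (x * P) * L' * t' := by rw [hR, mul_one]; simp only [mul_assoc]
    _ = o * R * P * (L' * (t' * t) * L) * y * L' * t' := by
        rw [h, ht, mul_one, hL, mul_one]; simp only [mul_assoc]
    _ = _ := by simp only [mul_assoc]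

section

variable {Q : QuasiHopfData A}

theorem lTensor_counitLeft_comulRight (hc : ∀ a, Q.counitLeft (Q.comul a) = a) (t : A ⊗[ℂ] A) :
    LinearMap.lTensor A Q.counitLeft (Q.comulRight t) = t := by
  induction t using TensorProduct.induction_on with
  | zero => simp
  | add x y hx hy => simp only [map_add, hx, hy]
  | tmul x y => simp [comulRight, hc]

theorem lTensor_counitLeft_assoc (t : A ⊗[ℂ] A) (b : A) :
    LinearMap.lTensor A Q.counitLeft (TensorProduct.assoc ℂ A A A (t ⊗ₜ[ℂ] b)) =
      Q.counitRight t ⊗ₜ[ℂ] b := by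
  induction t using TensorProduct.induction_on with
  | zero => simp
  | add x y hx hy => simp only [map_add, hx, hy, TensorProduct.add_tmul]
  | tmul x y => simp [counitLeft, counitRight, TensorProduct.smul_tmul]

theorem lTensor_counitLeft_comulLeft (hc : ∀ a, Q.counitRight (Q.comul a) = a) (t : A ⊗[ℂ] A) :
    LinearMap.lTensor A Q.counitLeft (Q.comulLeft t) = t := by
  induction t using TensorProduct.induction_on with
  | zero => simp
  | add x y hx hy => simp only [map_add, hx, hy]
  | tmul x y =>
    refine (lTensor_counitLeft_assoc (Q := Q) (Q.comul x) y).trans ?_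
    rw [hc]

theorem lTensor_counitLeft_tensorOne (t : A ⊗[ℂ] A) :
    LinearMap.lTensor A Q.counitLeft (tensorOne t) = Q.counitRight t ⊗ₜ[ℂ] 1 := by
  induction t using TensorProduct.induction_on with
  | zero => simp
  | add x y hx hy => simp only [map_add, hx, hy, TensorProduct.add_tmul]
  | tmul x y => simp [counitLeft, counitRight, tensorOne, TensorProduct.smul_tmul]

theorem IsQuasiBialgebra.isTwist_inv (hQ : Q.IsQuasiBialgebra) {F : (A ⊗[ℂ] A)ˣ}
    (hF : Q.IsTwist F) : Q.IsTwist F⁻¹ := by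
  constructor
  · have h := hQ.counitLeft_mul F (F⁻¹ : (A ⊗[ℂ] A)ˣ)
    rwa [Units.mul_inv, hQ.counitLeft_one, hF.1, one_mul, eq_comm] at h
  · have h := hQ.counitRight_mul F (F⁻¹ : (A ⊗[ℂ] A)ˣ)
    rwa [Units.mul_inv, hQ.counitRight_one, hF.2, one_mul, eq_comm] at h

/-- A twist of a quasi-bialgebra is a quasi-bialgebra. -/
theorem IsQuasiBialgebra.twist (hQ : Q.IsQuasiBialgebra) {F : (A ⊗[ℂ] A)ˣ} (hF : Q.IsTwist F) :
    (Q.twist F).IsQuasiBialgebra := by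
  have hF' := hQ.isTwist_inv hF
  have e1 : (F : A ⊗[ℂ] A) * ((F⁻¹ : (A ⊗[ℂ] A)ˣ) : A ⊗[ℂ] A) = 1 := Units.mul_inv F
  have e2 : ((F⁻¹ : (A ⊗[ℂ] A)ˣ) : A ⊗[ℂ] A) * (F : A ⊗[ℂ] A) = 1 := Units.inv_mul F
  have hassoc : (Q.twist F).assoc = (1 ⊗ₜ[ℂ] (F : A ⊗[ℂ] A)) * Q.comulRight (F : A ⊗[ℂ] A) *
    Q.assoc * Q.comulLeft ((F⁻¹ : (A ⊗[ℂ] A)ˣ) : A ⊗[ℂ] A) *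
      tensorOne ((F⁻¹ : (A ⊗[ℂ] A)ˣ) : A ⊗[ℂ] A) := rfl
  have hcl : (Q.twist F).counitLeft = Q.counitLeft := rfl
  have hcr : (Q.twist F).counitRight = Q.counitRight := rfl
  generalize hf : (F : A ⊗[ℂ] A) = f at *
  generalize hf' : ((F⁻¹ : (A ⊗[ℂ] A)ˣ) : A ⊗[ℂ] A) = f' at *
  have hFf : Q.counitLeft f = 1 := hf ▸ hF.1
  have hFf2 : Q.counitRight f = 1 := hf ▸ hF.2
  have hFf' : Q.counitLeft f' = 1 := hf' ▸ hF'.1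
  have hFf2' : Q.counitRight f' = 1 := hf' ▸ hF'.2
  have o12 {B : Type _} [Ring B] [Algebra ℂ B] (x y : B) (h : x * y = 1) :
      ((1 : A) ⊗ₜ[ℂ] x) * ((1 : A) ⊗ₜ[ℂ] y) = 1 := by
    rw [← one_tmul_mul, h]; rfl
  refine ⟨?_, fun a b => ?_, hQ.counit_one, hQ.counit_mul, ?_, fun a => ?_, ?_, fun a => ?_,
    fun a => ?_, ?_⟩
  · rw [twist_comul, hf, hf', hQ.comul_one, mul_one, e1]
  · rw [twist_comul, twist_comul, twist_comul, hf, hf', hQ.comul_mul]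
    simp only [mul_assoc]
    rw [← mul_assoc f' f, e2, one_mul]
  · rw [hassoc]
    refine ((((isUnit_iff_exists.2 ⟨1 ⊗ₜ f', o12 _ _ e1, o12 _ _ e2⟩).mul
      (isUnit_iff_exists.2 ⟨Q.comulRight f', ?_, ?_⟩)).mul hQ.isUnit_assoc).mul
      (isUnit_iff_exists.2 ⟨Q.comulLeft f, ?_, ?_⟩)).mul
      (isUnit_iff_exists.2 ⟨tensorOne f, ?_, ?_⟩)
    · rw [← hQ.comulRight_mul, e1, hQ.comulRight_one]
    · rw [← hQ.comulRight_mul, e2, hQ.comulRight_one]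
    · rw [← hQ.comulLeft_mul, e2, hQ.comulLeft_one]
    · rw [← hQ.comulLeft_mul, e1, hQ.comulLeft_one]
    · rw [← tensorOne_mul, e2, tensorOne_one]
    · rw [← tensorOne_mul, e1, tensorOne_one]
  · rw [twist_comulRight, twist_comulLeft, hassoc, twist_comul, hf, hf', hQ.comulRight_mul,
      hQ.comulRight_mul, hQ.comulLeft_mul, hQ.comulLeft_mul]
    refine comulRight_word (o12 _ _ e2) ?_ ?_ ?_ (hQ.quasi_coassoc a)
    · rw [← hQ.comulRight_mul, e2, hQ.comulRight_one]
    · rw [← hQ.comulLeft_mul, e2, hQ.comulLeft_one]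
    · rw [← tensorOne_mul, e2, tensorOne_one]
  · have h1 : (Q.twist F).comul₁ (Q.twist F).assoc = tensorOne₃ (tensorOne f) *
        ((1 ⊗ₜ (1 ⊗ₜ f)) * Q.comul₁ (Q.comulRight f) * Q.comul₁ Q.assoc *
          Q.comul₁ (Q.comulLeft f') * tensorOne₃ (Q.comulLeft f')) *
          tensorOne₃ (tensorOne f') := by
      rw [twist_comul₁, hassoc, hQ.comul₁_mul, hQ.comul₁_mul, hQ.comul₁_mul, hQ.comul₁_mul,
        comul₁_one_tmul _ hQ.comul_one, comul₁_tensorOne, hf, hf']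
    have h2 : (Q.twist F).comul₂ (Q.twist F).assoc = (1 ⊗ₜ tensorOne f) *
        ((1 ⊗ₜ Q.comulLeft f) * Q.comul₂ (Q.comulRight f) * Q.comul₂ Q.assoc *
          Q.comul₂ (Q.comulLeft f') * tensorOne₃ (Q.comulRight f')) *
          (1 ⊗ₜ tensorOne f') := by
      rw [twist_comul₂, hassoc, hQ.comul₂_mul, hQ.comul₂_mul, hQ.comul₂_mul, hQ.comul₂_mul,
        comul₂_one_tmul, comul₂_tensorOne, hf, hf']
    have h3 : (Q.twist F).comul₃ (Q.twist F).assoc = (1 ⊗ₜ (1 ⊗ₜ f)) *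
        ((1 ⊗ₜ Q.comulRight f) * Q.comul₃ (Q.comulRight f) * Q.comul₃ Q.assoc *
          Q.comul₃ (Q.comulLeft f') * tensorOne₃ (tensorOne f')) *
          (1 ⊗ₜ (1 ⊗ₜ f')) := by
      rw [twist_comul₃, hassoc, hQ.comul₃_mul, hQ.comul₃_mul, hQ.comul₃_mul, hQ.comul₃_mul,
        comul₃_one_tmul, comul₃_tensorOne _ hQ.comul_one, hf, hf']
    have h4 : (1 : A) ⊗ₜ[ℂ] (Q.twist F).assoc = (1 ⊗ₜ (1 ⊗ₜ f)) * (1 ⊗ₜ Q.comulRight f) *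
        (1 ⊗ₜ Q.assoc) * (1 ⊗ₜ Q.comulLeft f') * (1 ⊗ₜ tensorOne f') := by
      rw [hassoc, one_tmul_mul, one_tmul_mul, one_tmul_mul, one_tmul_mul]
    have h5 : tensorOne₃ (Q.twist F).assoc = (1 ⊗ₜ tensorOne f) * tensorOne₃ (Q.comulRight f) *
        tensorOne₃ Q.assoc * tensorOne₃ (Q.comulLeft f') * tensorOne₃ (tensorOne f') := by
      rw [hassoc, tensorOne₃_mul, tensorOne₃_mul, tensorOne₃_mul, tensorOne₃_mul]
      rfl
    rw [h1, h2, h3, h4, h5]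
    refine pentagon_word ?_ ?_ ?_ ?_ ?_ hQ.pentagon (comul₂_comulRight_mul Q hQ.quasi_coassoc f)
      (comul₂_comulLeft_mul Q hQ.quasi_coassoc f')
    -- The twist in the last two legs commutes with its inverse in the first two, since the legs are
    -- disjoint.
    · have hcomm : ∀ s t : A ⊗[ℂ] A, (1 ⊗ₜ (1 ⊗ₜ s)) * tensorOne₃ (tensorOne t) =
          tensorOne₃ (tensorOne t) * ((1 : A) ⊗ₜ[ℂ] ((1 : A) ⊗ₜ[ℂ] s)) := by
        intro s t
        rw [← assoc_tmul_one₃]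
        have hs : (1 : A) ⊗ₜ[ℂ] ((1 : A) ⊗ₜ[ℂ] s) = Algebra.TensorProduct.assoc ℂ ℂ ℂ A A (A ⊗[ℂ] A)
            (1 ⊗ₜ[ℂ] s) := rfl
        rw [hs, ← map_mul, ← map_mul]
        simp
      rw [mul_assoc (tensorOne₃ (tensorOne f')), hcomm, ← mul_assoc, mul_assoc, ← tensorOne₃_mul,
        ← tensorOne_mul, e2, tensorOne_one, tensorOne₃_one, one_mul, o12 _ _ (o12 _ _ e2)]
    -- Both letters are values of `Δ ⊗ Δ`, at the twist and at its inverse.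
    · rw [comul₃_comulLeft, ← hQ.comul₁_mul, ← hQ.comulRight_mul, e2, hQ.comulRight_one,
        hQ.comul₁_one]
    · exact o12 _ _ (by rw [← tensorOne_mul, e2, tensorOne_one])
    · exact o12 _ _ (by rw [← hQ.comulLeft_mul, e2, hQ.comulLeft_one])
    · rw [← tensorOne₃_mul, ← hQ.comulRight_mul, e2, hQ.comulRight_one, tensorOne₃_one]
  · rw [hcl, twist_comul, hf, hf', hQ.counitLeft_mul, hQ.counitLeft_mul, hQ.counitLeft_comul,
      hFf, hFf', one_mul, mul_one]
  · rw [hcr, twist_comul, hf, hf', hQ.counitRight_mul, hQ.counitRight_mul,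
      hQ.counitRight_comul, hFf2, hFf2', one_mul, mul_one]
  · let E : A ⊗[ℂ] (A ⊗[ℂ] A) →ₐ[ℂ] A ⊗[ℂ] A :=
      Algebra.TensorProduct.map (AlgHom.id ℂ A) hQ.counitLeftHom
    have hE : ∀ t, LinearMap.lTensor A Q.counitLeft t = E t := fun _ => rfl
    rw [hcl, hassoc, hE, map_mul, map_mul, map_mul, map_mul, ← hE, ← hE, ← hE, ← hE, ← hE,
      lTensor_counitLeft_comulRight hQ.counitLeft_comul, hQ.counit_assoc,
      lTensor_counitLeft_comulLeft hQ.counitRight_comul, lTensor_counitLeft_tensorOne, hFf2',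
      LinearMap.lTensor_tmul, hFf, ← Algebra.TensorProduct.one_def, one_mul, mul_one, mul_one, e1]

/-- Composition of twists allows the corrections made in successive degrees to be collected into a
single one. -/
theorem IsQuasiBialgebra.twist_twist_assoc (hQ : Q.IsQuasiBialgebra) (F G : (A ⊗[ℂ] A)ˣ) :
    ((Q.twist F).twist G).assoc = (Q.twist (G * F)).assoc := by
  have o12 : (((1 : A) ⊗ₜ[ℂ] ((F⁻¹ : (A ⊗[ℂ] A)ˣ) : A ⊗[ℂ] A)) * (1 ⊗ₜ[ℂ] (F : A ⊗[ℂ] A))) = 1 := by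
    rw [← one_tmul_mul, Units.inv_mul]; rfl
  have t12 : tensorOne ((F⁻¹ : (A ⊗[ℂ] A)ˣ) : A ⊗[ℂ] A) * tensorOne (F : A ⊗[ℂ] A) = 1 := by
    rw [← tensorOne_mul, Units.inv_mul, tensorOne_one]
  change (1 ⊗ₜ[ℂ] (G : A ⊗[ℂ] A)) * (Q.twist F).comulRight (G : A ⊗[ℂ] A) *
    ((1 ⊗ₜ[ℂ] (F : A ⊗[ℂ] A)) * Q.comulRight (F : A ⊗[ℂ] A) *
    Q.assoc * Q.comulLeft ((F⁻¹ : (A ⊗[ℂ] A)ˣ) : A ⊗[ℂ] A) *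
      tensorOne ((F⁻¹ : (A ⊗[ℂ] A)ˣ) : A ⊗[ℂ] A)) *
      (Q.twist F).comulLeft ((G⁻¹ : (A ⊗[ℂ] A)ˣ) : A ⊗[ℂ] A) *
      tensorOne ((G⁻¹ : (A ⊗[ℂ] A)ˣ) : A ⊗[ℂ] A) =
    (1 ⊗ₜ[ℂ] ((G : A ⊗[ℂ] A) * F)) * Q.comulRight ((G : A ⊗[ℂ] A) * F) *
    Q.assoc * Q.comulLeft (((G * F)⁻¹ : (A ⊗[ℂ] A)ˣ) : A ⊗[ℂ] A) *
      tensorOne (((G * F)⁻¹ : (A ⊗[ℂ] A)ˣ) : A ⊗[ℂ] A)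
  rw [mul_inv_rev, Units.val_mul, hQ.comulRight_mul, hQ.comulLeft_mul, one_tmul_mul, tensorOne_mul,
    twist_comulRight, twist_comulLeft]
  simp only [mul_assoc]
  rw [← mul_assoc ((1 : A) ⊗ₜ[ℂ] ((F⁻¹ : (A ⊗[ℂ] A)ˣ) : A ⊗[ℂ] A))
      ((1 : A) ⊗ₜ[ℂ] (F : A ⊗[ℂ] A)), o12, one_mul,
    ← mul_assoc (tensorOne ((F⁻¹ : (A ⊗[ℂ] A)ˣ) : A ⊗[ℂ] A)), t12, one_mul]

end

end QuasiHopfData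

/-! ## Filtered vector spaces -/

section Filtrations

variable {U V W X Y : Type*} [AddCommGroup U] [Module ℂ U] [AddCommGroup V] [Module ℂ V]
  [AddCommGroup W] [Module ℂ W] [AddCommGroup X] [Module ℂ X] [AddCommGroup Y] [Module ℂ Y]

/-- The tensor product of two filtrations. -/
def tensorFiltration (P : ℕ → Submodule ℂ V) (R : ℕ → Submodule ℂ W) (k : ℕ) :
    Submodule ℂ (V ⊗[ℂ] W) :=
  Submodule.span ℂ {t | ∃ i j b c, i + j = k ∧ b ∈ P i ∧ c ∈ R j ∧ t = b ⊗ₜ[ℂ] c}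

/-- A linear map that respects filtrations. -/
def FilteredMap (P : ℕ → Submodule ℂ V) (R : ℕ → Submodule ℂ W) (f : V →ₗ[ℂ] W) : Prop :=
  ∀ k, ∀ v ∈ P k, f v ∈ R k

/-- Two linear maps that agree modulo terms of higher filtration degree. -/
def FilteredEq (P : ℕ → Submodule ℂ V) (R : ℕ → Submodule ℂ W) (f g : V →ₗ[ℂ] W) : Prop :=
  ∀ k, ∀ v ∈ P k, f v - g v ∈ R (k + 1)

variable {O : ℕ → Submodule ℂ U} {P : ℕ → Submodule ℂ V} {R : ℕ → Submodule ℂ W}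
  {S : ℕ → Submodule ℂ X} {T : ℕ → Submodule ℂ Y}

theorem tmul_mem_tensorFiltration {i j k : ℕ} (h : i + j = k) {b : V} {c : W} (hb : b ∈ P i)
    (hc : c ∈ R j) : b ⊗ₜ[ℂ] c ∈ tensorFiltration P R k :=
  Submodule.subset_span ⟨i, j, b, c, h, hb, hc, rfl⟩

theorem tensorFiltration_le {k : ℕ} {Z : Submodule ℂ (V ⊗[ℂ] W)}
    (h : ∀ i j b c, i + j = k → b ∈ P i → c ∈ R j → b ⊗ₜ[ℂ] c ∈ Z) :
    tensorFiltration P R k ≤ Z := by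
  refine Submodule.span_le.2 ?_
  rintro _ ⟨i, j, b, c, hij, hb, hc, rfl⟩
  exact h i j b c hij hb hc

theorem tensorFiltration_antitone (hP : Antitone P) (hR : Antitone R) :
    Antitone (tensorFiltration P R) := by
  refine antitone_nat_of_succ_le fun k => tensorFiltration_le fun i j b c hij hb hc => ?_
  rcases Nat.eq_zero_or_pos i with rfl | hi
  · exact tmul_mem_tensorFiltration (by omega : 0 + (j - 1) = k) hb (hR (Nat.sub_le j 1) hc)
  · exact tmul_mem_tensorFiltration (by omega : (i - 1) + j = k) (hP (Nat.sub_le i 1) hb) hc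

theorem tensorFiltration_zero (hP : P 0 = ⊤) (hR : R 0 = ⊤) : tensorFiltration P R 0 = ⊤ := by
  rw [eq_top_iff]
  rintro t -
  induction t using TensorProduct.induction_on with
  | zero => exact zero_mem _
  | add x y hx hy => exact add_mem hx hy
  | tmul x y =>
    exact tmul_mem_tensorFiltration (zero_add 0) (hP ▸ Submodule.mem_top)
      (hR ▸ Submodule.mem_top)

theorem tensorFiltration_eq_bot (hP : Antitone P) (hR : Antitone R) {m n : ℕ} (hm : P m = ⊥)
    (hn : R n = ⊥) : tensorFiltration P R (m + n) = ⊥ := by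
  rw [eq_bot_iff]
  refine tensorFiltration_le fun i j b c hij hb hc => ?_
  rcases le_or_gt m i with h | h
  · have h1 : b ∈ P m := hP h hb
    rw [hm, Submodule.mem_bot] at h1
    simp [h1]
  · have h1 : c ∈ R n := hR (by omega) hc
    rw [hn, Submodule.mem_bot] at h1
    simp [h1]

theorem FilteredMap.comp {f : V →ₗ[ℂ] W} {g : W →ₗ[ℂ] X} (hg : FilteredMap R S g)
    (hf : FilteredMap P R f) : FilteredMap P S (g ∘ₗ f) := fun k v hv => hg k _ (hf k v hv)

theorem FilteredMap.id : FilteredMap P P LinearMap.id := fun _ _ hv => hv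

theorem FilteredEq.refl (f : V →ₗ[ℂ] W) : FilteredEq P R f f := fun k v _ => by
  rw [sub_self]; exact zero_mem _

theorem FilteredEq.symm {f g : V →ₗ[ℂ] W} (h : FilteredEq P R f g) : FilteredEq P R g f :=
  fun k v hv => by rw [← neg_sub]; exact neg_mem (h k v hv)

theorem FilteredEq.trans {f g h : V →ₗ[ℂ] W} (h1 : FilteredEq P R f g) (h2 : FilteredEq P R g h) :
    FilteredEq P R f h := fun k v hv => by
  rw [← sub_add_sub_cancel]; exact add_mem (h1 k v hv) (h2 k v hv)

theorem FilteredEq.comp_left {f g : V →ₗ[ℂ] W} (h : FilteredEq P R f g) {l : W →ₗ[ℂ] X}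
    (hl : FilteredMap R S l) : FilteredEq P S (l ∘ₗ f) (l ∘ₗ g) := fun k v hv => by
  rw [LinearMap.comp_apply, LinearMap.comp_apply, ← map_sub]
  exact hl _ _ (h k v hv)

theorem FilteredEq.comp_right {f g : W →ₗ[ℂ] X} (h : FilteredEq R S f g) {l : V →ₗ[ℂ] W}
    (hl : FilteredMap P R l) : FilteredEq P S (f ∘ₗ l) (g ∘ₗ l) := fun k v hv =>
  h k _ (hl k v hv)

theorem FilteredEq.filteredMap (hR : Antitone R) {f g : V →ₗ[ℂ] W} (h : FilteredEq P R f g)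
    (hg : FilteredMap P R g) : FilteredMap P R f := fun k v hv => by
  rw [← sub_add_cancel (f v) (g v)]
  exact add_mem (hR (Nat.le_succ k) (h k v hv)) (hg k v hv)

theorem FilteredMap.tensorMap {f : U →ₗ[ℂ] W} {g : V →ₗ[ℂ] X} (hf : FilteredMap O R f)
    (hg : FilteredMap P S g) :
    FilteredMap (tensorFiltration O P) (tensorFiltration R S) (TensorProduct.map f g) := by
  intro k
  change tensorFiltration O P k ≤ (tensorFiltration R S k).comap _
  refine tensorFiltration_le fun i j b c hij hb hc => ?_
  exact tmul_mem_tensorFiltration hij (hf i b hb) (hg j c hc)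

theorem FilteredEq.tensorMap {f f' : U →ₗ[ℂ] W} {g g' : V →ₗ[ℂ] X} (hf : FilteredEq O R f f')
    (hg : FilteredEq P S g g') (hf' : FilteredMap O R f') (hg1 : FilteredMap P S g) :
    FilteredEq (tensorFiltration O P) (tensorFiltration R S) (TensorProduct.map f g)
      (TensorProduct.map f' g') := by
  intro k
  change tensorFiltration O P k ≤ (tensorFiltration R S (k + 1)).comap
    (TensorProduct.map f g - TensorProduct.map f' g')
  refine tensorFiltration_le fun i j b c hij hb hc => ?_
  have h : (TensorProduct.map f g - TensorProduct.map f' g') (b ⊗ₜ[ℂ] c) =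
      (f b - f' b) ⊗ₜ[ℂ] g c + f' b ⊗ₜ[ℂ] (g c - g' c) := by
    simp [TensorProduct.sub_tmul, TensorProduct.tmul_sub]
  rw [Submodule.mem_comap, h]
  exact add_mem (tmul_mem_tensorFiltration (by omega) (hf i b hb) (hg1 j c hc))
    (tmul_mem_tensorFiltration (by omega) (hf' i b hb) (hg j c hc))

theorem filteredMap_assoc : FilteredMap (tensorFiltration (tensorFiltration O P) R)
    (tensorFiltration O (tensorFiltration P R)) (TensorProduct.assoc ℂ U V W).toLinearMap := by
  intro k
  change _ ≤ (tensorFiltration O (tensorFiltration P R) k).comap _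
  refine tensorFiltration_le fun i j b c hij hb hc => ?_
  have h : tensorFiltration O P i ≤ (tensorFiltration O (tensorFiltration P R) k).comap
      ((TensorProduct.assoc ℂ U V W).toLinearMap ∘ₗ (TensorProduct.mk ℂ _ _).flip c) := by
    refine tensorFiltration_le fun i' j' b' c' hij' hb' hc' => ?_
    exact tmul_mem_tensorFiltration (j := j' + j) (by omega) hb'
      (tmul_mem_tensorFiltration rfl hc' hc)
  exact h hb

/-- A linear map that agrees with a filtered isomorphism modulo higher degree terms is itself a
filtered isomorphism. -/
theorem FilteredEq.exists_equiv {f : V →ₗ[ℂ] W} {g : V ≃ₗ[ℂ] W}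
    (h : FilteredEq P R f g.toLinearMap)
    (hg : FilteredMap P R g.toLinearMap) (hg' : FilteredMap R P g.symm.toLinearMap)
    (hR : Antitone R) (hR0 : R 0 = ⊤) {m : ℕ} (hm : R m = ⊥) :
    ∃ e : V ≃ₗ[ℂ] W, e.toLinearMap = f ∧ FilteredMap P R e.toLinearMap ∧
      FilteredMap R P e.symm.toLinearMap := by
  -- If `f v` lies in `R (k + 1)`, then by induction `v` lies in `P k`, where `f` and `g` differ
  -- only by terms in `R (k + 1)`.
  have key : ∀ v, ∀ k, f v ∈ R k → g v ∈ R k := by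
    intro v k hk
    induction k with
    | zero => rw [hR0]; exact Submodule.mem_top
    | succ k ih =>
      have h1 : g v ∈ R k := ih (hR (Nat.le_succ k) hk)
      have h2 : v ∈ P k := by simpa using hg' k _ h1
      have h3 := h k v h2
      have h4 := sub_mem hk h3
      simpa using h4
  have hinj : Function.Injective f := by
    rw [← LinearMap.ker_eq_bot, LinearMap.ker_eq_bot']
    intro v hv
    have h1 : g v ∈ R m := key v m (by rw [hv]; exact zero_mem _)
    rw [hm, Submodule.mem_bot] at h1
    simpa using h1
  -- Successive approximation: `g.symm w` solves the equation up to an error of higher degree. The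
  -- induction runs downwards from `m`, where the filtration vanishes, and `j` counts the remaining
  -- degrees.
  have hsurj : ∀ j k, j + k = m → ∀ w ∈ R k, ∃ v, f v = w := by
    intro j
    induction j with
    | zero =>
      intro k hk w hw
      rw [show k = m by omega, hm, Submodule.mem_bot] at hw
      exact ⟨0, by rw [map_zero, hw]⟩
    | succ j ih =>
      intro k hk w hw
      have h1 : g.symm w ∈ P k := hg' k w hw
      have h2 := h k _ h1
      simp only [LinearEquiv.coe_coe, LinearEquiv.apply_symm_apply] at h2
      obtain ⟨v, hv⟩ := ih (k + 1) (by omega) _ h2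
      exact ⟨g.symm w - v, by rw [map_sub, hv]; abel⟩
  have hbij : Function.Bijective f :=
    ⟨hinj, fun w => hsurj m 0 rfl w (by rw [hR0]; exact Submodule.mem_top)⟩
  refine ⟨LinearEquiv.ofBijective f hbij, rfl, h.filteredMap hR hg, fun k w hw => ?_⟩
  have h1 := key ((LinearEquiv.ofBijective f hbij).symm w) k (by
    have h2 := LinearEquiv.apply_symm_apply (LinearEquiv.ofBijective f hbij) w
    rw [LinearEquiv.ofBijective_apply] at h2
    rwa [h2])
  simpa using hg' k _ h1

/-- A filtration spanned by eigenvectors of an operator `θ`, the eigenvalues in degree `j`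
being `2 ^ j`, with all degrees at most `B`. -/
def SpannedByEigenvectors (θ : V →ₗ[ℂ] V) (B : ℕ) (P : ℕ → Submodule ℂ V) : Prop :=
  ∀ k, ∀ v ∈ P k, v ∈ Submodule.span ℂ {u | ∃ j, k ≤ j ∧ j ≤ B ∧ u ∈ P j ∧ θ u = (2 : ℂ) ^ j • u}

theorem SpannedByEigenvectors.mono {θ : V →ₗ[ℂ] V} {B C : ℕ} (h : SpannedByEigenvectors θ B P)
    (hBC : B ≤ C) : SpannedByEigenvectors θ C P := fun k v hv => by
  refine Submodule.span_mono ?_ (h k v hv)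
  rintro u ⟨j, h1, h2, h3⟩
  exact ⟨j, h1, h2.trans hBC, h3⟩

/-- Eigenvalues multiply under tensor products while degrees add, which is why degree `j` is encoded
by the eigenvalue `2 ^ j`. -/
theorem SpannedByEigenvectors.tensor {θ : V →ₗ[ℂ] V} {B : ℕ} (h : SpannedByEigenvectors θ B P)
    {θ' : W →ₗ[ℂ] W} {B' : ℕ} (h' : SpannedByEigenvectors θ' B' R) :
    SpannedByEigenvectors (TensorProduct.map θ θ') (B + B') (tensorFiltration P R) := by
  intro k
  change _ ≤ Submodule.span ℂ _
  refine tensorFiltration_le fun i j b c hij hb hc => ?_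
  have h1 := h i b hb
  have h2 := h' j c hc
  clear hb hc
  induction h1 using Submodule.span_induction with
  | zero => rw [TensorProduct.zero_tmul]; exact zero_mem _
  | add x y _ _ hx hy => rw [TensorProduct.add_tmul]; exact add_mem hx hy
  | smul a x _ hx => rw [← TensorProduct.smul_tmul']; exact Submodule.smul_mem _ _ hx
  | mem u hu =>
    induction h2 using Submodule.span_induction with
    | zero => rw [TensorProduct.tmul_zero]; exact zero_mem _
    | add x y _ _ hx hy => rw [TensorProduct.tmul_add]; exact add_mem hx hy
    | smul a x _ hx => rw [TensorProduct.tmul_smul]; exact Submodule.smul_mem _ _ hx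
    | mem w hw =>
      obtain ⟨j1, h11, h12, h13, h14⟩ := hu
      obtain ⟨j2, h21, h22, h23, h24⟩ := hw
      refine Submodule.subset_span ⟨j1 + j2, by omega, by omega,
        tmul_mem_tensorFiltration rfl h13 h23, ?_⟩
      rw [TensorProduct.map_tmul, h14, h24, TensorProduct.smul_tmul_smul, pow_add]

/-- The polynomial that is `1` at `2 ^ d` and `0` at `2 ^ j` for the other `j ≤ B`. -/
noncomputable def degreePolynomial (B d : ℕ) : Polynomial ℂ :=
  Lagrange.basis (Finset.range (B + 1)) (fun j => (2 : ℂ) ^ j) d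

theorem two_pow_complex_injective : Function.Injective (fun j : ℕ => (2 : ℂ) ^ j) := by
  intro i j h
  have h1 : ((2 ^ i : ℕ) : ℂ) = ((2 ^ j : ℕ) : ℂ) := by push_cast; exact h
  exact Nat.pow_right_injective le_rfl (Nat.cast_injective h1)

theorem aeval_apply_eigenvector {θ : V →ₗ[ℂ] V} {v : V} {c : ℂ} (h : θ v = c • v)
    (L : Polynomial ℂ) : Polynomial.aeval θ L v = L.eval c • v := by
  induction L using Polynomial.induction_on' with
  | add p r hp hr => rw [map_add, LinearMap.add_apply, hp, hr, Polynomial.eval_add, add_smul]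
  | monomial n a =>
    have h1 : ∀ n : ℕ, (θ ^ n) v = c ^ n • v := by
      intro n
      induction n with
      | zero => simp
      | succ n ih => rw [pow_succ', Module.End.mul_apply, ih, map_smul, h, smul_smul, pow_succ]
    rw [Polynomial.aeval_monomial, Module.End.mul_apply, h1, Polynomial.eval_monomial,
      Module.algebraMap_end_apply, smul_smul]

/-- Projections to homogeneous components are polynomials in the grading operator, so every map that
intertwines the gradings commutes with them. -/
theorem aeval_comm_apply {θ : V →ₗ[ℂ] V} {θ' : W →ₗ[ℂ] W} {f : V →ₗ[ℂ] W}
    (h : ∀ v, f (θ v) = θ' (f v)) (L : Polynomial ℂ) (v : V) :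
    f (Polynomial.aeval θ L v) = Polynomial.aeval θ' L (f v) := by
  induction L using Polynomial.induction_on' with
  | add p r hp hr => simp only [map_add, LinearMap.add_apply, hp, hr]
  | monomial n a =>
    have h1 : ∀ n : ℕ, f ((θ ^ n) v) = (θ' ^ n) (f v) := by
      intro n
      induction n with
      | zero => simp
      | succ n ih => rw [pow_succ', Module.End.mul_apply, h, ih, pow_succ', Module.End.mul_apply]
    rw [Polynomial.aeval_monomial, Polynomial.aeval_monomial, Module.End.mul_apply,
      Module.End.mul_apply, Module.algebraMap_end_apply, Module.algebraMap_end_apply, map_smul, h1]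

theorem aeval_degreePolynomial_eigenvector {θ : V →ₗ[ℂ] V} {v : V} {B d j : ℕ} (hj : j ≤ B)
    (hd : d ≤ B) (h : θ v = (2 : ℂ) ^ j • v) :
    Polynomial.aeval θ (degreePolynomial B d) v = if j = d then v else 0 := by
  rw [aeval_apply_eigenvector h, degreePolynomial]
  split_ifs with hjd
  · subst hjd
    rw [Lagrange.eval_basis_self (two_pow_complex_injective.injOn) (by simp; omega), one_smul]
  · rw [Lagrange.eval_basis_of_ne (v := fun j : ℕ => (2 : ℂ) ^ j) (Ne.symm hjd)
      (by simp; omega), zero_smul]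

section Component

variable {θ : V →ₗ[ℂ] V} {B d : ℕ}

/-- The polynomial in `θ` is the projection to the component of degree `d`. This lemma and the next
two say that it kills higher degrees, is the identity on `P d` modulo higher degree, and takes
values in homogeneous elements of degree `d`. -/
theorem SpannedByEigenvectors.component_eq_zero (h : SpannedByEigenvectors θ B P) (hd : d ≤ B)
    {v : V} (hv : v ∈ P (d + 1)) : Polynomial.aeval θ (degreePolynomial B d) v = 0 := by
  have h1 := h _ _ hv
  clear hv
  induction h1 using Submodule.span_induction with
  | zero => rw [map_zero]
  | add x y _ _ hx hy => rw [map_add, hx, hy, add_zero]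
  | smul a x _ hx => rw [map_smul, hx, smul_zero]
  | mem u hu =>
    obtain ⟨j, hj1, hj2, -, hj4⟩ := hu
    rw [aeval_degreePolynomial_eigenvector hj2 hd hj4, if_neg (by omega)]

theorem SpannedByEigenvectors.sub_component_mem (h : SpannedByEigenvectors θ B P)
    (hP : Antitone P) (hd : d ≤ B) {v : V} (hv : v ∈ P d) :
    v - Polynomial.aeval θ (degreePolynomial B d) v ∈ P (d + 1) := by
  have h1 := h _ _ hv
  clear hv
  induction h1 using Submodule.span_induction with
  | zero => rw [map_zero, sub_zero]; exact zero_mem _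
  | add x y _ _ hx hy => rw [map_add, add_sub_add_comm]; exact add_mem hx hy
  | smul a x _ hx => rw [map_smul, ← smul_sub]; exact Submodule.smul_mem _ _ hx
  | mem u hu =>
    obtain ⟨j, hj1, hj2, hj3, hj4⟩ := hu
    rw [aeval_degreePolynomial_eigenvector hj2 hd hj4]
    split_ifs with hjd
    · rw [sub_self]; exact zero_mem _
    · rw [sub_zero]; exact hP (by omega) hj3

theorem SpannedByEigenvectors.component_mem (h : SpannedByEigenvectors θ B P) (hP0 : P 0 = ⊤)
    (hd : d ≤ B) (v : V) : Polynomial.aeval θ (degreePolynomial B d) v ∈ P d ∧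
      θ (Polynomial.aeval θ (degreePolynomial B d) v) =
        (2 : ℂ) ^ d • Polynomial.aeval θ (degreePolynomial B d) v := by
  have h1 := h 0 v (hP0 ▸ Submodule.mem_top)
  induction h1 using Submodule.span_induction with
  | zero => rw [map_zero]; exact ⟨zero_mem _, by rw [map_zero, smul_zero]⟩
  | add x y _ _ hx hy =>
    rw [map_add]
    exact ⟨add_mem hx.1 hy.1, by rw [map_add, hx.2, hy.2, smul_add]⟩
  | smul a x _ hx =>
    rw [map_smul]
    exact ⟨Submodule.smul_mem _ _ hx.1, by rw [map_smul, hx.2, smul_comm]⟩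
  | mem u hu =>
    obtain ⟨j, hj1, hj2, hj3, hj4⟩ := hu
    rw [aeval_degreePolynomial_eigenvector hj2 hd hj4]
    split_ifs with hjd
    · subst hjd; exact ⟨hj3, hj4⟩
    · exact ⟨zero_mem _, by rw [map_zero, smul_zero]⟩

end Component

end Filtrations

/-- A multiplicative filtration. -/
def MulFiltration {A : Type*} [Ring A] [Algebra ℂ A] (P : ℕ → Submodule ℂ A) : Prop :=
  ∀ i j, ∀ a ∈ P i, ∀ b ∈ P j, a * b ∈ P (i + j)

theorem MulFiltration.tensor {A B : Type*} [Ring A] [Algebra ℂ A] [Ring B] [Algebra ℂ B]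
    {P : ℕ → Submodule ℂ A} {R : ℕ → Submodule ℂ B} (hP : MulFiltration P)
    (hR : MulFiltration R) : MulFiltration (tensorFiltration P R) := by
  intro k l s hs t ht
  have h := Submodule.mul_mem_mul hs ht
  rw [tensorFiltration, tensorFiltration, Submodule.span_mul_span] at h
  refine Submodule.span_mono ?_ h
  rintro _ ⟨_, ⟨i, j, b, c, hij, hb, hc, rfl⟩, _, ⟨i', j', b', c', hij', hb', hc', rfl⟩, rfl⟩
  exact ⟨i + i', j + j', b * b', c * c', by omega, hP _ _ _ hb _ hb', hR _ _ _ hc _ hc',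
    Algebra.TensorProduct.tmul_mul_tmul _ _ _ _⟩

/-! ## Vanishing of the third cohomology of the cobar complex -/

/-- The operators of a two-variable periodic Koszul type resolution together with contractions. -/
structure KoszulData (R : Type*) [Ring R] where
  /-- the first differential in the first variable -/
  ξ : R
  /-- the second differential in the first variable -/
  ξ' : R
  /-- contraction for `ξ` -/
  σ : R
  /-- contraction for `ξ'` -/
  τ : R
  /-- the first differential in the second variable -/
  η : R
  /-- the second differential in the second variable -/
  η' : R
  /-- contraction for `η` -/
  μ : R
  /-- contraction for `η'` -/
  ν : R
  -- In each variable the two differentials alternate in an exact complex of period two, and the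
  -- contractions witness exactness. The variables are required to commute only as far as the chases
  -- below use it.
  ξ_ξ' : ξ * ξ' = 0
  ξ'_ξ : ξ' * ξ = 0
  σ_ξ : σ * ξ + ξ' * τ = 1
  τ_ξ' : τ * ξ' + ξ * σ = 1
  η_η' : η * η' = 0
  η'_η : η' * η = 0
  μ_η : μ * η + η' * ν = 1
  ν_η' : ν * η' + η * μ = 1
  ξ_η : ξ * η = η * ξ
  ξ_η' : ξ * η' = η' * ξ
  ξ'_η : ξ' * η = η * ξ'
  ξ_μ : ξ * μ = μ * ξ
  ξ_ν : ξ * ν = ν * ξ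

namespace KoszulData

/-- The image of Koszul data under a ring homomorphism. -/
def map {R S : Type*} [Ring R] [Ring S] (K : KoszulData R) (f : R →+* S) : KoszulData S where
  ξ := f K.ξ
  ξ' := f K.ξ'
  σ := f K.σ
  τ := f K.τ
  η := f K.η
  η' := f K.η'
  μ := f K.μ
  ν := f K.ν
  ξ_ξ' := by rw [← map_mul, K.ξ_ξ', map_zero]
  ξ'_ξ := by rw [← map_mul, K.ξ'_ξ, map_zero]
  σ_ξ := by rw [← map_mul, ← map_mul, ← map_add, K.σ_ξ, map_one]
  τ_ξ' := by rw [← map_mul, ← map_mul, ← map_add, K.τ_ξ', map_one]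
  η_η' := by rw [← map_mul, K.η_η', map_zero]
  η'_η := by rw [← map_mul, K.η'_η, map_zero]
  μ_η := by rw [← map_mul, ← map_mul, ← map_add, K.μ_η, map_one]
  ν_η' := by rw [← map_mul, ← map_mul, ← map_add, K.ν_η', map_one]
  ξ_η := by rw [← map_mul, K.ξ_η, map_mul]
  ξ_η' := by rw [← map_mul, K.ξ_η', map_mul]
  ξ'_η := by rw [← map_mul, K.ξ'_η, map_mul]
  ξ_μ := by rw [← map_mul, K.ξ_μ, map_mul]
  ξ_ν := by rw [← map_mul, K.ξ_ν, map_mul]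

section Exactness

variable {U : Type*} [AddCommGroup U] [Module ℂ U] (K : KoszulData (Module.End ℂ U))

/-- Exactness at `U²` of the total complex with differentials `v ↦ (ξ v, η v)` and `(a, b) ↦ (ξ' a,
η a - ξ b, η' b)`. The element `σ a` solves the first equation; the error left in `b` is killed by
`ξ` and `η'`, and `μ`, which commutes with `ξ`, removes it without disturbing the first equation. -/
theorem exact_one {a b : U} (ha : K.ξ' a = 0) (hab : K.η a = K.ξ b) (hb : K.η' b = 0) :
    ∃ v, K.ξ v = a ∧ K.η v = b := by
  have e1 : K.ξ (K.σ a) = a := by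
    have h := LinearMap.congr_fun K.τ_ξ' a
    simpa [ha] using h
  have e2 : K.ξ (b - K.η (K.σ a)) = 0 := by
    have h := LinearMap.congr_fun K.ξ_η (K.σ a)
    simp only [Module.End.mul_apply] at h
    rw [map_sub, h, e1, hab, sub_self]
  have e3 : K.η' (b - K.η (K.σ a)) = 0 := by
    have h := LinearMap.congr_fun K.η'_η (K.σ a)
    simp only [Module.End.mul_apply, LinearMap.zero_apply] at h
    rw [map_sub, h, hb, sub_self]
  have e4 : K.η (K.μ (b - K.η (K.σ a))) = b - K.η (K.σ a) := by
    have h := LinearMap.congr_fun K.ν_η' (b - K.η (K.σ a))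
    simpa only [LinearMap.add_apply, Module.End.mul_apply, e3, map_zero, zero_add,
      Module.End.one_apply] using h
  refine ⟨K.σ a + K.μ (b - K.η (K.σ a)), ?_, ?_⟩
  · have h := LinearMap.congr_fun K.ξ_μ (b - K.η (K.σ a))
    simp only [Module.End.mul_apply] at h
    rw [map_add, e1, h, e2, map_zero, add_zero]
  · rw [map_add, e4, add_sub_cancel]

/-- Exactness at the next term `U³`, where the outgoing differential is `(u, v, w) ↦ (ξ u, η u - ξ'
v, η' v + ξ w, η w)`. The equations are solved from left to right, the remaining error being passed
on through `v'` and `w'`. -/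
theorem exact_two {u v w : U} (hu : K.ξ u = 0) (huv : K.η u = K.ξ' v)
    (hvw : K.η' v + K.ξ w = 0) (hw : K.η w = 0) :
    ∃ p r, K.ξ' p = u ∧ K.η p - K.ξ r = v ∧ K.η' r = w := by
  have e1 : K.ξ' (K.τ u) = u := by
    have h := LinearMap.congr_fun K.σ_ξ u
    simpa [hu] using h
  set v' := v - K.η (K.τ u) with hv'
  have e2 : K.ξ' v' = 0 := by
    have h := LinearMap.congr_fun K.ξ'_η (K.τ u)
    simp only [Module.End.mul_apply] at h
    rw [hv', map_sub, h, e1, huv, sub_self]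
  have e3 : K.ξ (K.σ v') = v' := by
    have h := LinearMap.congr_fun K.τ_ξ' v'
    simpa [e2] using h
  set w' := w + K.η' (K.σ v') with hw'
  have e4 : K.ξ w' = 0 := by
    have h := LinearMap.congr_fun K.ξ_η' (K.σ v')
    have h1 := LinearMap.congr_fun K.η'_η (K.τ u)
    simp only [Module.End.mul_apply, LinearMap.zero_apply] at h h1
    rw [hw', map_add, h, e3, hv', map_sub, h1, sub_zero, add_comm, hvw]
  have e5 : K.η w' = 0 := by
    have h1 := LinearMap.congr_fun K.η_η' (K.σ v')
    simp only [Module.End.mul_apply, LinearMap.zero_apply] at h1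
    rw [hw', map_add, h1, hw, add_zero]
  have e6 : K.η' (K.ν w') = w' := by
    have h := LinearMap.congr_fun K.μ_η w'
    simpa [e5] using h
  refine ⟨K.τ u, K.ν w' - K.σ v', e1, ?_, ?_⟩
  · have h := LinearMap.congr_fun K.ξ_ν w'
    simp only [Module.End.mul_apply] at h
    rw [map_sub, h, e4, map_zero, e3, hv']
    abel
  · rw [map_sub, e6, hw']
    abel

/-- The composite on the left is the projection to the bottom of both periodic complexes. -/
theorem eq_of_ker {w : U} (h1 : K.ξ w = 0) (h2 : K.η w = 0) :
    K.ξ' (K.τ (K.η' (K.ν w))) = w := by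
  have h := LinearMap.congr_fun K.μ_η w
  have h' := LinearMap.congr_fun K.σ_ξ w
  simp only [LinearMap.add_apply, Module.End.mul_apply, h1, h2, map_zero, zero_add,
    Module.End.one_apply] at h h'
  rw [h, h']

end Exactness

end KoszulData

/-! ### The cobar complex and the chase that kills its third cohomology. -/

namespace QuasiHopfData

variable {A : Type*} [Ring A] [Algebra ℂ A]

/-- The counit applied to the first tensor factor. -/
noncomputable def contractCounit (Q : QuasiHopfData A) (W : Type*) [AddCommGroup W] [Module ℂ W] :
    A ⊗[ℂ] W →ₗ[ℂ] W := (TensorProduct.lid ℂ W).toLinearMap ∘ₗ LinearMap.rTensor W Q.counit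

/-- The action of an endomorphism of `A` on the first tensor factor. -/
noncomputable def firstFactor (W : Type*) [AddCommGroup W] [Module ℂ W] :
    Module.End ℂ A →+* Module.End ℂ (A ⊗[ℂ] W) where
  toFun := LinearMap.rTensor W
  map_one' := LinearMap.rTensor_id W A
  map_mul' f g := LinearMap.rTensor_mul W f g
  map_zero' := LinearMap.rTensor_zero W
  map_add' f g := LinearMap.rTensor_add W f g

theorem firstFactor_tmul {W : Type*} [AddCommGroup W] [Module ℂ W] (T : Module.End ℂ A) (a : A)
    (w : W) : firstFactor W T (a ⊗ₜ[ℂ] w) = T a ⊗ₜ[ℂ] w := rfl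

variable (Q : QuasiHopfData A)

/-- The differential `A → A ⊗ A` of the cobar complex with coefficients in `A`. -/
noncomputable def cobar₀ : A →ₗ[ℂ] A ⊗[ℂ] A :=
  Q.comul - (TensorProduct.mk ℂ A A).flip 1

/-- The differential `A ⊗ A → A ⊗ A ⊗ A` of the cobar complex with coefficients in `A`. -/
noncomputable def cobar₁ : A ⊗[ℂ] A →ₗ[ℂ] A ⊗[ℂ] (A ⊗[ℂ] A) :=
  Q.comulLeft - Q.comulRight + tensorOne

/-- The differential `A ⊗ A ⊗ A → A ⊗ A ⊗ A ⊗ A` of the cobar complex with coefficients in `A`. -/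
noncomputable def cobar₂ : A ⊗[ℂ] (A ⊗[ℂ] A) →ₗ[ℂ] A ⊗[ℂ] (A ⊗[ℂ] (A ⊗[ℂ] A)) :=
  Q.comul₁ - Q.comul₂ + Q.comul₃ - tensorOne₃

/-- The differential in degree two of the cobar complex with trivial coefficients. -/
noncomputable def cobarTrivial₂ : A ⊗[ℂ] A →ₗ[ℂ] A ⊗[ℂ] (A ⊗[ℂ] A) :=
  TensorProduct.mk ℂ A (A ⊗[ℂ] A) 1 - Q.cobar₁

/-- The differential in degree three of the cobar complex with trivial coefficients. -/
noncomputable def cobarTrivial₃ : A ⊗[ℂ] (A ⊗[ℂ] A) →ₗ[ℂ] A ⊗[ℂ] (A ⊗[ℂ] (A ⊗[ℂ] A)) :=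
  TensorProduct.mk ℂ A (A ⊗[ℂ] (A ⊗[ℂ] A)) 1 - Q.cobar₂

variable {Q}

theorem contractCounit_assoc {W : Type*} [AddCommGroup W] [Module ℂ W] (t : A ⊗[ℂ] A) (w : W) :
    Q.contractCounit (A ⊗[ℂ] W) (TensorProduct.assoc ℂ A A W (t ⊗ₜ[ℂ] w)) =
      Q.counitLeft t ⊗ₜ[ℂ] w := by
  induction t using TensorProduct.induction_on with
  | zero => simp
  | add x y hx hy => simp only [map_add, hx, hy, TensorProduct.add_tmul]
  | tmul x y => simp [counitLeft, contractCounit, TensorProduct.smul_tmul']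

theorem contractCounit_tmul {W : Type*} [AddCommGroup W] [Module ℂ W] (a : A) (w : W) :
    Q.contractCounit W (a ⊗ₜ[ℂ] w) = Q.counit a • w := by
  simp [contractCounit]

/-- The coinvariants of the regular comodule are the scalars; apply the counit to the first factor
of `Δ(a) = a ⊗ 1`. -/
theorem eq_of_cobar₀_eq_zero (hc : ∀ a, Q.counitLeft (Q.comul a) = a) {a : A}
    (h : Q.cobar₀ a = 0) : a = Q.counit a • 1 := by
  have h1 : Q.comul a = a ⊗ₜ[ℂ] 1 := sub_eq_zero.1 h
  have h2 := hc a
  rw [h1] at h2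
  simpa [counitLeft] using h2.symm

/-- The regular comodule is cofree, so the complex with coefficients in `A` is acyclic, and the
counit in the coefficient factor is a contracting homotopy: a cocycle is the coboundary of its
contraction. -/
theorem contractCounit_cobar₁ (hc : ∀ a, Q.counitLeft (Q.comul a) = a) (w : A ⊗[ℂ] A) :
    Q.contractCounit (A ⊗[ℂ] A) (Q.cobar₁ w) = w - Q.cobar₀ (Q.contractCounit A w) := by
  induction w using TensorProduct.induction_on with
  | zero => simp
  | add x y hx hy => simp only [map_add, hx, hy]; abel
  | tmul x y =>
    have h1 : Q.comulLeft (x ⊗ₜ[ℂ] y) = TensorProduct.assoc ℂ A A A (Q.comul x ⊗ₜ[ℂ] y) := rfl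
    have h2 : Q.comulRight (x ⊗ₜ[ℂ] y) = x ⊗ₜ[ℂ] Q.comul y := rfl
    have h3 : tensorOne (x ⊗ₜ[ℂ] y) = x ⊗ₜ[ℂ] (y ⊗ₜ[ℂ] (1 : A)) := rfl
    simp only [cobar₁, cobar₀, LinearMap.add_apply, LinearMap.sub_apply, h1, h2, h3, map_add,
      map_sub, contractCounit_assoc, hc, contractCounit_tmul, LinearMap.flip_apply,
      TensorProduct.mk_apply, map_smul, smul_sub]
    abel

theorem contractCounit_cobar₂ (hc : ∀ a, Q.counitLeft (Q.comul a) = a)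
    (w : A ⊗[ℂ] (A ⊗[ℂ] A)) :
    Q.contractCounit (A ⊗[ℂ] (A ⊗[ℂ] A)) (Q.cobar₂ w) =
      w - Q.cobar₁ (Q.contractCounit (A ⊗[ℂ] A) w) := by
  induction w using TensorProduct.induction_on with
  | zero => simp
  | add x y hx hy => simp only [map_add, hx, hy]; abel
  | tmul x y =>
    have h1 : Q.comul₁ (x ⊗ₜ[ℂ] y) = TensorProduct.assoc ℂ A A _ (Q.comul x ⊗ₜ[ℂ] y) := rfl
    have h2 : Q.comul₂ (x ⊗ₜ[ℂ] y) = x ⊗ₜ[ℂ] Q.comulLeft y := rfl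
    have h3 : Q.comul₃ (x ⊗ₜ[ℂ] y) = x ⊗ₜ[ℂ] Q.comulRight y := rfl
    have h4 : tensorOne₃ (x ⊗ₜ[ℂ] y) = x ⊗ₜ[ℂ] tensorOne y := rfl
    simp only [cobar₁, cobar₂, LinearMap.add_apply, LinearMap.sub_apply, h1, h2, h3, h4, map_add,
      map_sub, contractCounit_assoc, hc, contractCounit_tmul, map_smul]
    simp only [smul_sub, smul_add]
    abel

theorem cobar₁_cobar₀ (h1 : Q.comul 1 = 1)
    (hc : ∀ a, Q.comulRight (Q.comul a) = Q.comulLeft (Q.comul a)) (a : A) :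
    Q.cobar₁ (Q.cobar₀ a) = 0 := by
  have e1 : Q.comulLeft (a ⊗ₜ[ℂ] 1) = tensorOne (Q.comul a) := by
    rw [← assoc_tmul_one]; rfl
  have e2 : Q.comulRight (a ⊗ₜ[ℂ] 1) = tensorOne (a ⊗ₜ[ℂ] 1) := by
    simp [comulRight, tensorOne, h1, Algebra.TensorProduct.one_def]
  simp only [cobar₁, cobar₀, LinearMap.add_apply, LinearMap.sub_apply, map_sub, hc,
    LinearMap.flip_apply, TensorProduct.mk_apply, e1, e2]
  abel

theorem comul₁_comulLeft (hc : ∀ a, Q.comulRight (Q.comul a) = Q.comulLeft (Q.comul a))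
    (t : A ⊗[ℂ] A) : Q.comul₂ (Q.comulLeft t) = Q.comul₁ (Q.comulLeft t) := by
  induction t using TensorProduct.induction_on with
  | zero => simp
  | add x y hx hy => simp only [map_add, hx, hy]
  | tmul x y => rw [comul₂_comulLeft_tmul, comul₁_comulLeft_tmul, hc]

theorem comul₂_comulRight (hc : ∀ a, Q.comulRight (Q.comul a) = Q.comulLeft (Q.comul a))
    (t : A ⊗[ℂ] A) : Q.comul₂ (Q.comulRight t) = Q.comul₃ (Q.comulRight t) := by
  induction t using TensorProduct.induction_on with
  | zero => simp
  | add x y hx hy => simp only [map_add, hx, hy]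
  | tmul x y => exact congrArg (fun s => x ⊗ₜ[ℂ] s) (hc y).symm

theorem cobar₂_cobar₁ (h1 : Q.comul 1 = 1)
    (hc : ∀ a, Q.comulRight (Q.comul a) = Q.comulLeft (Q.comul a)) (w : A ⊗[ℂ] A) :
    Q.cobar₂ (Q.cobar₁ w) = 0 := by
  simp only [cobar₁, cobar₂, LinearMap.add_apply, LinearMap.sub_apply, map_sub, map_add,
    comul₁_comulLeft hc, comul₂_comulRight hc, comul₃_comulLeft, comul₃_tensorOne Q h1,
    comul₂_tensorOne, comul₁_tensorOne]
  abel

/-- An endomorphism of `A` as a right comodule over itself. -/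
def IsComoduleMap (Q : QuasiHopfData A) (T : Module.End ℂ A) : Prop :=
  ∀ a, Q.comul (T a) = firstFactor A T (Q.comul a)

section Comodule

variable {T : Module.End ℂ A}

theorem assoc_firstFactor {W : Type*} [AddCommGroup W] [Module ℂ W] (t : A ⊗[ℂ] A) (w : W) :
    TensorProduct.assoc ℂ A A W (firstFactor A T t ⊗ₜ[ℂ] w) =
      firstFactor (A ⊗[ℂ] W) T (TensorProduct.assoc ℂ A A W (t ⊗ₜ[ℂ] w)) := by
  induction t using TensorProduct.induction_on with
  | zero => simp
  | add x y hx hy => simp only [map_add, hx, hy, TensorProduct.add_tmul]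
  | tmul x y => simp [firstFactor_tmul]

/-- A comodule map acts on the complex through the coefficients, hence is a chain map; this and the
two next lemmas give the degrees that are needed. -/
theorem IsComoduleMap.cobar₀ (hT : Q.IsComoduleMap T) (a : A) :
    Q.cobar₀ (T a) = firstFactor A T (Q.cobar₀ a) := by
  simp only [QuasiHopfData.cobar₀, LinearMap.sub_apply, map_sub, hT a, LinearMap.flip_apply,
    TensorProduct.mk_apply, firstFactor_tmul]

theorem IsComoduleMap.cobar₁ (hT : Q.IsComoduleMap T) (w : A ⊗[ℂ] A) :
    Q.cobar₁ (firstFactor A T w) = firstFactor (A ⊗[ℂ] A) T (Q.cobar₁ w) := by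
  induction w using TensorProduct.induction_on with
  | zero => simp
  | add x y hx hy => simp only [map_add, hx, hy]
  | tmul x y =>
    have h1 : ∀ x, Q.comulLeft (x ⊗ₜ[ℂ] y) = TensorProduct.assoc ℂ A A A (Q.comul x ⊗ₜ[ℂ] y) :=
      fun _ => rfl
    have h2 : ∀ x, Q.comulRight (x ⊗ₜ[ℂ] y) = x ⊗ₜ[ℂ] Q.comul y := fun _ => rfl
    have h3 : ∀ x, tensorOne (x ⊗ₜ[ℂ] y) = x ⊗ₜ[ℂ] (y ⊗ₜ[ℂ] (1 : A)) := fun _ => rfl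
    simp only [QuasiHopfData.cobar₁, LinearMap.add_apply, LinearMap.sub_apply, h1, h2, h3,
      firstFactor_tmul, map_add, map_sub, hT x, assoc_firstFactor]

theorem IsComoduleMap.cobar₂ (hT : Q.IsComoduleMap T) (w : A ⊗[ℂ] (A ⊗[ℂ] A)) :
    Q.cobar₂ (firstFactor (A ⊗[ℂ] A) T w) =
      firstFactor (A ⊗[ℂ] (A ⊗[ℂ] A)) T (Q.cobar₂ w) := by
  induction w using TensorProduct.induction_on with
  | zero => simp
  | add x y hx hy => simp only [map_add, hx, hy]
  | tmul x y =>
    have h1 : ∀ x, Q.comul₁ (x ⊗ₜ[ℂ] y) = TensorProduct.assoc ℂ A A _ (Q.comul x ⊗ₜ[ℂ] y) :=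
      fun _ => rfl
    have h2 : ∀ x, Q.comul₂ (x ⊗ₜ[ℂ] y) = x ⊗ₜ[ℂ] Q.comulLeft y := fun _ => rfl
    have h3 : ∀ x, Q.comul₃ (x ⊗ₜ[ℂ] y) = x ⊗ₜ[ℂ] Q.comulRight y := fun _ => rfl
    have h4 : ∀ x, tensorOne₃ (x ⊗ₜ[ℂ] y) = x ⊗ₜ[ℂ] tensorOne y := fun _ => rfl
    simp only [QuasiHopfData.cobar₂, LinearMap.add_apply, LinearMap.sub_apply, h1, h2, h3, h4,
      firstFactor_tmul, map_add, map_sub, hT x, assoc_firstFactor]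

end Comodule

/-- Koszul data consisting of comodule maps, homogeneous with respect to a grading of `A` by
`ℤ / N`. -/
structure KoszulComodule (Q : QuasiHopfData A) (K : KoszulData (Module.End ℂ A)) {N : ℕ}
    (π : ZMod N → Module.End ℂ A) (m : ZMod N) : Prop where
  ξ_comodule : Q.IsComoduleMap K.ξ
  ξ'_comodule : Q.IsComoduleMap K.ξ'
  η_comodule : Q.IsComoduleMap K.η
  η'_comodule : Q.IsComoduleMap K.η'
  π_comodule : ∀ j, Q.IsComoduleMap (π j)
  ξ_π : ∀ j, K.ξ * π j = π (j + 1) * K.ξ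
  ξ'_π : ∀ j, K.ξ' * π j = π (j - 1) * K.ξ'
  η_π : ∀ j, K.η * π j = π (j + 1) * K.η
  η'_π : ∀ j, K.η' * π j = π (j + m) * K.η'
  π_π : ∀ j, π j * π j = π j
  ξ_one : K.ξ 1 = 0
  η_one : K.η 1 = 0
  π_zero_one : π 0 1 = 1
  -- At the third stage of the chase the defects are coinvariants, hence scalars, of weights `1`,
  -- `1`, `m + 2`, `m + 2`. As `1` has no component in these weights, the defects vanish; this is
  -- the whole reason for the vanishing of cohomology.
  π_one_one : π 1 1 = 0
  π_two_one : π (m + 2) 1 = 0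
  -- The composite fixes the common kernel of `ξ` and `η`; its part of weight zero consists of
  -- scalars, so the data resolve the trivial comodule.
  π_eq : ∀ a, π 0 (K.ξ' (K.τ (K.η' (K.ν a)))) = Q.counit (π 0 a) • 1

/-- The third cohomology of the cobar complex with trivial coefficients vanishes. -/
theorem KoszulComodule.exists_cobarTrivial₂_eq {K : KoszulData (Module.End ℂ A)} {N : ℕ}
    {π : ZMod N → Module.End ℂ A} {m : ZMod N} (hK : Q.KoszulComodule K π m)
    (h1 : Q.comul 1 = 1) (he : Q.counit 1 = 1)
    (hc : ∀ a, Q.comulRight (Q.comul a) = Q.comulLeft (Q.comul a))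
    (hl : ∀ a, Q.counitLeft (Q.comul a) = a) {z : A ⊗[ℂ] (A ⊗[ℂ] A)}
    (hz : Q.cobarTrivial₃ z = 0) : ∃ f, Q.cobarTrivial₂ f = z := by
  have ff : ∀ {W : Type _} [AddCommGroup W] [Module ℂ W] {S T S' T' : Module.End ℂ A},
      S * T = S' * T' → ∀ w : A ⊗[ℂ] W,
      firstFactor W S (firstFactor W T w) = firstFactor W S' (firstFactor W T' w) := by
    intro W _ _ S T S' T' h w
    have h2 := congrArg (firstFactor W) h
    rw [map_mul, map_mul] at h2
    exact LinearMap.congr_fun h2 w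
  have ff0 : ∀ {W : Type _} [AddCommGroup W] [Module ℂ W] {S T : Module.End ℂ A},
      S * T = 0 → ∀ w : A ⊗[ℂ] W, firstFactor W S (firstFactor W T w) = 0 := by
    intro W _ _ S T h w
    have h2 := congrArg (firstFactor W) h
    rw [map_mul, map_zero] at h2
    exact LinearMap.congr_fun h2 w
  have ffπ : ∀ {W : Type _} [AddCommGroup W] [Module ℂ W] (j) (w : A ⊗[ℂ] W),
      firstFactor W (π j) (firstFactor W (π j) w) = firstFactor W (π j) w := by
    intro W _ _ j w
    have h2 := congrArg (firstFactor W) (hK.π_π j)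
    rw [map_mul] at h2
    exact LinearMap.congr_fun h2 w
  -- Contraction followed by projection: a cocycle of weight `j` has a primitive of the same weight.
  have inv₁ : ∀ j (a : A ⊗[ℂ] (A ⊗[ℂ] A)), Q.cobar₂ a = 0 →
      firstFactor _ (π j) a = a →
      Q.cobar₁ (firstFactor _ (π j) (Q.contractCounit _ a)) = a := by
    intro j a h2 h3
    have h4 := contractCounit_cobar₂ hl a
    rw [h2, map_zero, eq_comm, sub_eq_zero] at h4
    rw [(hK.π_comodule j).cobar₁, ← h4, h3]
  have inv₀ : ∀ j (a : A ⊗[ℂ] A), Q.cobar₁ a = 0 → firstFactor _ (π j) a = a →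
      Q.cobar₀ (π j (Q.contractCounit _ a)) = a := by
    intro j a h2 h3
    have h4 := contractCounit_cobar₁ hl a
    rw [h2, map_zero, eq_comm, sub_eq_zero] at h4
    rw [(hK.π_comodule j).cobar₀, ← h4, h3]
  -- A coinvariant is a scalar, and a scalar of weight `j` vanishes if `1` has no component of that
  -- weight.
  have inv : ∀ j (a : A), Q.cobar₀ a = 0 → π j a = a → π j 1 = 0 → a = 0 := by
    intro j a h2 h3 h4
    have h5 := eq_of_cobar₀_eq_zero hl h2
    rw [← h3, h5, map_smul, h4, smul_zero]
  -- The inclusion of the trivial comodule in `A` turns `z` into `1 ⊗ z`, and the cocycle condition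
  -- for `z` exhibits `z` itself as a primitive of it in the acyclic complex.
  have dz : Q.cobar₂ z = 1 ⊗ₜ[ℂ] z := (sub_eq_zero.1 hz).symm
  -- the first row
  obtain ⟨w0, dw0, pw0⟩ : ∃ w0, Q.cobar₂ w0 = 1 ⊗ₜ[ℂ] z ∧ firstFactor _ (π 0) w0 = w0 := by
    refine ⟨firstFactor _ (π 0) z, ?_, ffπ _ _⟩
    rw [(hK.π_comodule 0).cobar₂, dz, firstFactor_tmul, hK.π_zero_one]
  -- the second row
  have px : firstFactor _ (π 1) (firstFactor _ K.ξ w0) = firstFactor _ K.ξ w0 := by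
    conv_rhs => rw [← pw0]
    rw [ff (hK.ξ_π 0), zero_add]
  have py : firstFactor _ (π 1) (firstFactor _ K.η w0) = firstFactor _ K.η w0 := by
    conv_rhs => rw [← pw0]
    rw [ff (hK.η_π 0), zero_add]
  -- Since `ξ` and `η` annihilate `1`, the images of `w0` are cocycles and have primitives. In the
  -- same way the relations of the resolution provide the third row.
  obtain ⟨p, dp, pp⟩ : ∃ p, Q.cobar₁ p = firstFactor _ K.ξ w0 ∧ firstFactor _ (π 1) p = p := by
    refine ⟨_, inv₁ 1 _ ?_ px, ffπ _ _⟩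
    rw [hK.ξ_comodule.cobar₂, dw0, firstFactor_tmul, hK.ξ_one, TensorProduct.zero_tmul]
  obtain ⟨r, dr, pr⟩ : ∃ r, Q.cobar₁ r = firstFactor _ K.η w0 ∧ firstFactor _ (π 1) r = r := by
    refine ⟨_, inv₁ 1 _ ?_ py, ffπ _ _⟩
    rw [hK.η_comodule.cobar₂, dw0, firstFactor_tmul, hK.η_one, TensorProduct.zero_tmul]
  -- the third row
  obtain ⟨u, du, pu⟩ : ∃ u, Q.cobar₀ u = firstFactor _ K.ξ' p ∧ π 0 u = u := by
    refine ⟨_, inv₀ 0 _ ?_ ?_, LinearMap.congr_fun (hK.π_π 0) _⟩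
    · rw [hK.ξ'_comodule.cobar₁, dp, ff0 K.ξ'_ξ]
    · conv_rhs => rw [← pp]
      rw [ff (hK.ξ'_π 1), sub_self]
  obtain ⟨v, dv, pv⟩ : ∃ v, Q.cobar₀ v = firstFactor _ K.η p - firstFactor _ K.ξ r ∧
      π 2 v = v := by
    refine ⟨_, inv₀ 2 _ ?_ ?_, LinearMap.congr_fun (hK.π_π 2) _⟩
    · rw [map_sub, hK.η_comodule.cobar₁, hK.ξ_comodule.cobar₁, dp, dr, ff K.ξ_η, sub_self]
    · conv_rhs => rw [← pp, ← pr]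
      rw [ff (hK.η_π 1), ff (hK.ξ_π 1), map_sub, one_add_one_eq_two]
  obtain ⟨w, dw, pw⟩ : ∃ w, Q.cobar₀ w = firstFactor _ K.η' r ∧ π (1 + m) w = w := by
    refine ⟨_, inv₀ (1 + m) _ ?_ ?_, LinearMap.congr_fun (hK.π_π (1 + m)) _⟩
    · rw [hK.η'_comodule.cobar₁, dr, ff0 K.η'_η]
    · conv_rhs => rw [← pr]
      rw [ff (hK.η'_π 1)]
  have ax : ∀ {S T S' T' : Module.End ℂ A}, S * T = S' * T' → ∀ a, S (T a) = S' (T' a) :=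
    fun h a => LinearMap.congr_fun h a
  -- The equations `q1` to `q4` say that `(u, v, w)` is a cycle of the resolution. Each defect is
  -- annihilated by `cobar₀` and has weight `1` or `m + 2`.
  have q1 : K.ξ u = 0 := by
    refine inv 1 _ ?_ ?_ hK.π_one_one
    · rw [hK.ξ_comodule.cobar₀, du, ff0 K.ξ_ξ']
    · conv_rhs => rw [← pu]
      rw [ax (hK.ξ_π 0), zero_add]
  have q2 : K.η u = K.ξ' v := by
    refine sub_eq_zero.1 (inv 1 _ ?_ ?_ hK.π_one_one)
    · rw [map_sub, hK.η_comodule.cobar₀, hK.ξ'_comodule.cobar₀, du, dv, map_sub, ff0 K.ξ'_ξ,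
        ff K.ξ'_η, sub_zero, sub_self]
    · conv_rhs => rw [← pu, ← pv]
      rw [ax (hK.η_π 0), ax (hK.ξ'_π 2), zero_add, show (2 : ZMod N) - 1 = 1 by ring, map_sub]
  have q3 : K.η' v + K.ξ w = 0 := by
    refine inv (m + 2) _ ?_ ?_ hK.π_two_one
    · rw [map_add, hK.η'_comodule.cobar₀, hK.ξ_comodule.cobar₀, dw, dv, map_sub, ff0 K.η'_η,
        ff K.ξ_η', zero_sub, neg_add_cancel]
    · conv_rhs => rw [← pv, ← pw]
      rw [ax (hK.η'_π 2), ax (hK.ξ_π _), show (1 : ZMod N) + m + 1 = m + 2 by ring,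
        add_comm 2 m, map_add]
  have q4 : K.η w = 0 := by
    refine inv (m + 2) _ ?_ ?_ hK.π_two_one
    · rw [hK.η_comodule.cobar₀, dw, ff0 K.η_η']
    · conv_rhs => rw [← pw]
      rw [ax (hK.η_π _), show (1 : ZMod N) + m + 1 = m + 2 by ring]
  -- the way back
  obtain ⟨p', r', e1, e2, e3⟩ := K.exact_two q1 q2 q3 q4
  let K₁ := K.map (firstFactor A)
  let K₂ := K.map (firstFactor (A ⊗[ℂ] A))
  -- Subtracting the coboundaries of `p'` and `r'` makes the second row a cycle of the resolution,
  -- hence the image of some `s`, which in turn corrects `w0`.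
  obtain ⟨s, hs1, hs2⟩ := K₁.exact_one (a := p - Q.cobar₀ p') (b := r - Q.cobar₀ r')
    (by
      change firstFactor A K.ξ' _ = 0
      rw [map_sub, ← hK.ξ'_comodule.cobar₀, e1, du, sub_self])
    (by
      change firstFactor A K.η _ = firstFactor A K.ξ _
      rw [map_sub, map_sub, ← hK.η_comodule.cobar₀, ← hK.ξ_comodule.cobar₀]
      have h2 : Q.cobar₀ (K.η p') - Q.cobar₀ (K.ξ r') = firstFactor _ K.η p - firstFactor _ K.ξ r := by
        rw [← map_sub, e2, dv]
      rw [sub_eq_sub_iff_sub_eq_sub, h2])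
    (by
      change firstFactor A K.η' _ = 0
      rw [map_sub, ← hK.η'_comodule.cobar₀, e3, dw, sub_self])
  change firstFactor A K.ξ s = _ at hs1
  change firstFactor A K.η s = _ at hs2
  have k1 : K₂.ξ (w0 - Q.cobar₁ s) = 0 := by
    change firstFactor _ K.ξ _ = 0
    rw [map_sub, ← hK.ξ_comodule.cobar₁, hs1, map_sub, cobar₁_cobar₀ h1 hc, dp, sub_zero, sub_self]
  have k2 : K₂.η (w0 - Q.cobar₁ s) = 0 := by
    change firstFactor _ K.η _ = 0
    rw [map_sub, ← hK.η_comodule.cobar₁, hs2, map_sub, cobar₁_cobar₀ h1 hc, dr, sub_zero, sub_self]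
  -- The corrected `w0` lies in the common kernel of `ξ` and `η`, so that its part of weight zero
  -- has the form `1 ⊗ f`.
  have k3 := K₂.eq_of_ker k1 k2
  have k4 : ∀ t : A ⊗[ℂ] (A ⊗[ℂ] A), firstFactor _ (π 0) (K₂.ξ' (K₂.τ (K₂.η' (K₂.ν t)))) =
      1 ⊗ₜ[ℂ] Q.contractCounit _ (firstFactor _ (π 0) t) := by
    intro t
    induction t using TensorProduct.induction_on with
    | zero => simp
    | add x y hx hy => simp only [map_add, hx, hy, TensorProduct.tmul_add]
    | tmul x y =>
      change π 0 (K.ξ' (K.τ (K.η' (K.ν x)))) ⊗ₜ[ℂ] y = 1 ⊗ₜ[ℂ] Q.contractCounit _ (π 0 x ⊗ₜ[ℂ] y)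
      rw [hK.π_eq, contractCounit_tmul, TensorProduct.smul_tmul]
  have k5 : Q.cobar₂ (firstFactor _ (π 0) (w0 - Q.cobar₁ s)) = 1 ⊗ₜ[ℂ] z := by
    rw [(hK.π_comodule 0).cobar₂, map_sub, cobar₂_cobar₁ h1 hc, dw0, sub_zero, firstFactor_tmul,
      hK.π_zero_one]
  rw [← k3, k4] at k5
  set f := Q.contractCounit _ (firstFactor _ (π 0) (w0 - Q.cobar₁ s)) with hf
  refine ⟨f, ?_⟩
  -- On elements `1 ⊗ f` the differential with coefficients in `A` is the one with trivial
  -- coefficients.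
  have k6 : Q.cobar₂ (1 ⊗ₜ[ℂ] f) = 1 ⊗ₜ[ℂ] Q.cobarTrivial₂ f := by
    have h2 : Q.comul₂ (1 ⊗ₜ[ℂ] f) = 1 ⊗ₜ[ℂ] Q.comulLeft f := rfl
    have h3 : Q.comul₃ (1 ⊗ₜ[ℂ] f) = 1 ⊗ₜ[ℂ] Q.comulRight f := rfl
    have h4 : tensorOne₃ ((1 : A) ⊗ₜ[ℂ] f) = 1 ⊗ₜ[ℂ] tensorOne f := rfl
    simp only [cobar₂, cobarTrivial₂, cobar₁, LinearMap.add_apply, LinearMap.sub_apply,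
      comul₁_one_tmul Q h1, h2, h3, h4, TensorProduct.mk_apply, TensorProduct.tmul_sub,
      TensorProduct.tmul_add]
    abel
  rw [k6] at k5
  have k7 := congrArg (Q.contractCounit _) k5
  rwa [contractCounit_tmul, contractCounit_tmul, he, one_smul, one_smul] at k7

end QuasiHopfData

/-! ## Monomials in skew commuting variables -/

section PowVal

variable {N : ℕ} [NeZero N]

/-- Exponents of elements with `u ^ N = 1` are indexed by `ZMod N`; these lemmas show that `a ↦ u ^
a.val` turns sums into products. -/
theorem pow_val_natCast {B : Type*} [Monoid B] {u : B} (hu : u ^ N = 1) (k : ℕ) :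
    u ^ (k : ZMod N).val = u ^ k := by
  rw [ZMod.val_natCast]
  conv_rhs => rw [← Nat.mod_add_div k N, pow_add, pow_mul, hu, one_pow, mul_one]

theorem pow_val_add {B : Type*} [Monoid B] {u : B} (hu : u ^ N = 1) (a b : ZMod N) :
    u ^ (a + b).val = u ^ a.val * u ^ b.val := by
  rw [← pow_add, ← pow_val_natCast hu (a.val + b.val)]
  simp

theorem pow_val_one {B : Type*} [Monoid B] {u : B} (hu : u ^ N = 1) :
    u ^ (1 : ZMod N).val = u := by
  have h := pow_val_natCast hu 1
  simpa using h

theorem pow_val_zero {B : Type*} [Monoid B] (u : B) : u ^ (0 : ZMod N).val = 1 := by simp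

theorem pow_val_neg_mul {B : Type*} [Monoid B] {u : B} (hu : u ^ N = 1) (a : ZMod N) :
    u ^ (-a).val * u ^ a.val = 1 := by
  rw [← pow_val_add hu, neg_add_cancel, pow_val_zero]

theorem pow_pred_eq {B : Type*} [Monoid B] {u : B} (hu : u ^ N = 1) :
    u ^ (N - 1) = u ^ (-1 : ZMod N).val := by
  rw [← pow_val_natCast hu (N - 1), Nat.cast_sub NeZero.one_le]
  simp

end PowVal

/-- Elements `g`, `x`, `y` with `g ^ N = 1`, `g x = q x g`, `g y = q⁻¹ y g`. -/
structure SkewTriple {B : Type*} [Ring B] [Algebra ℂ B] (N : ℕ) (q : ℂ) (g x y : B) : Prop where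
  root : IsPrimitiveRoot q N
  g_pow : g ^ N = 1
  g_mul_x : g * x = q • (x * g)
  g_mul_y : g * y = q⁻¹ • (y * g)

section Monomials

variable {B : Type*} [Ring B] [Algebra ℂ B] {N : ℕ} [NeZero N] {q : ℂ} {g x y : B}

/-- The monomial `x ^ b g ^ a y ^ c`. -/
def skewMonomial (g x y : B) (b : ℕ) (a : ZMod N) (c : ℕ) : B := x ^ b * g ^ a.val * y ^ c

namespace SkewTriple

variable (h : SkewTriple N q g x y)

theorem ne_zero (h : SkewTriple N q g x y) : q ≠ 0 := h.root.ne_zero (NeZero.ne N)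

theorem pow_mul_x (h : SkewTriple N q g x y) (a b : ℕ) :
    g ^ a * x ^ b = q ^ (a * b) • (x ^ b * g ^ a) := by
  rw [skew_mul_pow (skew_pow_mul h.g_mul_x a) b, pow_mul]

theorem y_mul_g (h : SkewTriple N q g x y) : y * g = q • (g * y) := by
  rw [h.g_mul_y, smul_smul, mul_inv_cancel₀ h.ne_zero, one_smul]

theorem y_mul_pow (h : SkewTriple N q g x y) (a c : ℕ) :
    y ^ c * g ^ a = q ^ (c * a) • (g ^ a * y ^ c) := by
  rw [skew_mul_pow (skew_pow_mul h.y_mul_g c) a, pow_mul]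

/-- The product of two monomials in normal order. -/
theorem skewMonomial_mul (h : SkewTriple N q g x y) (b b' c c' : ℕ) (a a' : ZMod N)
    (hxy : y ^ c * x ^ b' = x ^ b' * y ^ c) :
    skewMonomial g x y b a c * skewMonomial g x y b' a' c' =
      q ^ (a.val * b' + c * a'.val) • skewMonomial g x y (b + b') (a + a') (c + c') := by
  simp only [skewMonomial]
  calc _ = x ^ b * g ^ a.val * (y ^ c * x ^ b') * g ^ a'.val * y ^ c' := by
        simp only [mul_assoc]
    _ = x ^ b * (g ^ a.val * x ^ b') * (y ^ c * g ^ a'.val) * y ^ c' := by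
        rw [hxy]; simp only [mul_assoc]
    _ = _ := by
        rw [h.pow_mul_x, h.y_mul_pow, pow_val_add h.g_pow, pow_add, pow_add x, pow_add y]
        simp only [mul_smul_comm, smul_mul_assoc, smul_smul, mul_assoc]
        congr 1
        exact mul_comm _ _

theorem skewMonomial_zero (g x y : B) : skewMonomial (N := N) g x y 0 0 0 = 1 := by
  simp [skewMonomial]

end SkewTriple

end Monomials

/-! ## Quantum factorials -/

/-- The quantum integer `1 + q + ⋯ + q ^ (n - 1)`. -/
def qInt (q : ℂ) (n : ℕ) : ℂ := ∑ i ∈ Finset.range n, q ^ i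

/-- The quantum factorial. -/
def qFactorial (q : ℂ) (n : ℕ) : ℂ := ∏ i ∈ Finset.range n, qInt q (i + 1)

theorem qInt_add (q : ℂ) (m n : ℕ) : qInt q (m + n) = qInt q m + q ^ m * qInt q n := by
  rw [qInt, Finset.sum_range_add, qInt, qInt, Finset.mul_sum]
  simp only [pow_add]

theorem qInt_ne_zero {q : ℂ} {N n : ℕ} (hq : IsPrimitiveRoot q N) (h0 : 0 < n) (hn : n < N) :
    qInt q n ≠ 0 := by
  intro h
  have h1 := mul_geom_sum q n
  rw [show ∑ i ∈ Finset.range n, q ^ i = qInt q n from rfl, h, mul_zero, eq_comm, sub_eq_zero] at h1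
  exact hq.pow_ne_one_of_pos_of_lt h0.ne' hn h1

theorem qFactorial_succ (q : ℂ) (n : ℕ) :
    qFactorial q (n + 1) = qFactorial q n * qInt q (n + 1) := Finset.prod_range_succ _ _

theorem qFactorial_ne_zero {q : ℂ} {N n : ℕ} (hq : IsPrimitiveRoot q N) (hn : n < N) :
    qFactorial q n ≠ 0 := by
  refine Finset.prod_ne_zero_iff.2 fun i hi => qInt_ne_zero hq (Nat.succ_pos i) ?_
  rw [Finset.mem_range] at hi
  omega

/-- The quantum form of `n! / (k! j!)`. It follows from the Pascal recursion and the splitting of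
`qInt q (k + 1 + (j + 1))` given by `qInt_add`. -/
theorem qBinom_mul_qFactorial (q : ℂ) (n : ℕ) : ∀ k j, k + j = n →
    qBinom q n k * (qFactorial q k * qFactorial q j) = qFactorial q n := by
  induction n with
  | zero =>
    intro k j h
    obtain ⟨rfl, rfl⟩ : k = 0 ∧ j = 0 := by omega
    simp [qBinom, qFactorial]
  | succ n ih =>
    intro k j h
    rcases k with - | k
    · obtain rfl : j = n + 1 := by omega
      simp [qBinom_zero_right, qFactorial]
    · rw [qBinom_succ]
      rcases j with - | j
      · obtain rfl : k = n := by omega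
        rw [qBinom_eq_zero q k (k + 1) (by omega), qBinom_self]
        simp [qFactorial]
      · have h1 := ih k (j + 1) (by omega)
        have h2 := ih (k + 1) j (by omega)
        have h3 : qInt q (n + 1) = qInt q (k + 1) + q ^ (k + 1) * qInt q (j + 1) := by
          rw [← qInt_add]; congr 1; omega
        rw [qFactorial_succ q n, h3, mul_add]
        nth_rewrite 1 [← h1]
        rw [← h2, qFactorial_succ q k, qFactorial_succ q j]
        ring

/-- Below `N` the quantum factorials are invertible. Dividing monomials by them removes the binomial
coefficients from the coproduct, which is the purpose of the divided monomials. -/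
theorem qBinom_div {q : ℂ} {N n k j : ℕ} (hq : IsPrimitiveRoot q N) (hn : n < N)
    (h : k + j = n) : (qFactorial q n)⁻¹ * qBinom q n k =
      (qFactorial q k)⁻¹ * (qFactorial q j)⁻¹ := by
  have h1 := qFactorial_ne_zero hq hn
  have h2 := qFactorial_ne_zero hq (show k < N by omega)
  have h3 := qFactorial_ne_zero hq (show j < N by omega)
  have h4 := qBinom_mul_qFactorial q n k j h
  field_simp
  rw [← h4]
  ring

/-! ## The algebras with generators `g`, `x`, `y` -/

/-- A common description of the Taft algebras (`M = 1`) and of the book algebra (`M = N = 4`):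
a bialgebra generated by `g`, `x`, `y` with `g ^ N = 1`, `x ^ N = y ^ M = 0`, `g x = q x g`,
`g y = q⁻¹ y g`, `x y = y x` and `Δ(g) = g ⊗ g`, `Δ(x) = x ⊗ g + 1 ⊗ x`,
`Δ(y) = y ⊗ 1 + g⁻¹ ⊗ y`, with a basis of monomials. -/
structure IsBookAlgebra {A : Type*} [Ring A] [Algebra ℂ A] (Q : QuasiHopfData A) (N M : ℕ)
    [NeZero N] (q : ℂ) (g x y : A) : Prop extends SkewTriple N q g x y where
  -- This makes `1` and `2` nonzero in `ZMod N`, the arithmetic behind the vanishing of the third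
  -- cohomology.
  three_le : 3 ≤ N
  M_eq : M = 1 ∨ M = N
  x_pow : x ^ N = 0
  y_pow : y ^ M = 0
  x_mul_y : x * y = y * x
  isQuasiBialgebra : Q.IsQuasiBialgebra
  assoc : Q.assoc = 1
  comul_g : Q.comul g = g ⊗ₜ g
  comul_x : Q.comul x = x ⊗ₜ g + 1 ⊗ₜ x
  comul_y : Q.comul y = y ⊗ₜ 1 + (g ^ (N - 1)) ⊗ₜ y
  counit_g : Q.counit g = 1
  counit_x : Q.counit x = 0
  counit_y : Q.counit y = 0
  adjoin_eq_top : Algebra.adjoin ℂ {g, x, y} = ⊤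
  linearIndependent : LinearIndependent ℂ
    (fun i : Fin N × ZMod N × Fin M => skewMonomial g x y i.1 i.2.1 i.2.2)
  -- These characters detect the part of degree zero, by Fourier inversion on the powers of `g`.
  exists_character : ∀ j : ℕ, ∃ χ : A →ₐ[ℂ] ℂ, χ g = q ^ j ∧ χ x = 0 ∧ χ y = 0

namespace IsBookAlgebra

variable {A : Type*} [Ring A] [Algebra ℂ A] {Q : QuasiHopfData A} {N M : ℕ} [NeZero N] {q : ℂ}
  {g x y : A}

theorem M_pos (h : IsBookAlgebra Q N M q g x y) : 0 < M := by
  rcases h.M_eq with rfl | rfl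
  · exact one_pos
  · exact NeZero.pos M

theorem M_le (h : IsBookAlgebra Q N M q g x y) : M ≤ N := by
  rcases h.M_eq with rfl | rfl
  · exact NeZero.one_le
  · exact le_rfl

theorem y_pow_mul_x_pow (h : IsBookAlgebra Q N M q g x y) (c b : ℕ) :
    y ^ c * x ^ b = x ^ b * y ^ c := by
  have h1 : Commute x y := h.x_mul_y
  exact ((h1.pow_pow b c).eq).symm

theorem mul_skewMonomial (h : IsBookAlgebra Q N M q g x y) (b b' c c' : ℕ) (a a' : ZMod N) :
    skewMonomial g x y b a c * skewMonomial g x y b' a' c' =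
      q ^ (a.val * b' + c * a'.val) • skewMonomial g x y (b + b') (a + a') (c + c') :=
  h.toSkewTriple.skewMonomial_mul _ _ _ _ _ _ (h.y_pow_mul_x_pow c b')

theorem skewMonomial_eq_zero (h : IsBookAlgebra Q N M q g x y) {b c : ℕ} (a : ZMod N)
    (hbc : N ≤ b ∨ M ≤ c) : skewMonomial g x y b a c = 0 := by
  rcases hbc with hb | hc
  · rw [skewMonomial, ← Nat.sub_add_cancel hb, pow_add, h.x_pow]; simp
  · rw [skewMonomial, ← Nat.sub_add_cancel hc, pow_add, h.y_pow]; simp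

theorem skewMonomial_gen (h : IsBookAlgebra Q N M q g x y) :
    skewMonomial g x y 0 (1 : ZMod N) 0 = g ∧ skewMonomial g x y 1 (0 : ZMod N) 0 = x ∧
      skewMonomial g x y 0 (0 : ZMod N) 1 = y := by
  simp [skewMonomial, pow_val_one h.g_pow]

/-- The span of the monomials contains the generators and is closed under products, since a product
of monomials is a multiple of a monomial, which vanishes when an exponent leaves the range. -/
theorem span_skewMonomial (h : IsBookAlgebra Q N M q g x y) :
    Submodule.span ℂ (Set.range fun i : Fin N × ZMod N × Fin M =>
      skewMonomial g x y i.1 i.2.1 i.2.2) = ⊤ := by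
  set S := Submodule.span ℂ (Set.range fun i : Fin N × ZMod N × Fin M =>
      skewMonomial g x y i.1 i.2.1 i.2.2) with hS
  have hm : ∀ (b c : ℕ) (a : ZMod N), skewMonomial g x y b a c ∈ S := by
    intro b c a
    by_cases hbc : N ≤ b ∨ M ≤ c
    · rw [h.skewMonomial_eq_zero a hbc]; exact zero_mem _
    · rw [not_or, not_le, not_le] at hbc
      exact Submodule.subset_span ⟨(⟨b, hbc.1⟩, a, ⟨c, hbc.2⟩), rfl⟩
  have hmul : ∀ s ∈ S, ∀ t ∈ S, s * t ∈ S := by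
    intro s hs t ht
    have h1 := Submodule.mul_mem_mul hs ht
    rw [hS, Submodule.span_mul_span] at h1
    refine Submodule.span_le.2 ?_ h1
    rintro _ ⟨_, ⟨i, rfl⟩, _, ⟨j, rfl⟩, rfl⟩
    simp only [h.mul_skewMonomial]
    exact Submodule.smul_mem _ _ (hm _ _ _)
  let S' : Subalgebra ℂ A := S.toSubalgebra
    (by rw [← SkewTriple.skewMonomial_zero (N := N) g x y]; exact hm _ _ _)
    (fun s t hs ht => hmul s hs t ht)
  have h1 : Algebra.adjoin ℂ {g, x, y} ≤ S' := by
    refine Algebra.adjoin_le ?_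
    obtain ⟨e1, e2, e3⟩ := h.skewMonomial_gen
    rintro t (rfl | rfl | rfl)
    · rw [← e1]; exact hm _ _ _
    · rw [← e2]; exact hm _ _ _
    · rw [← e3]; exact hm _ _ _
  rw [h.adjoin_eq_top] at h1
  exact eq_top_iff.2 fun t _ => h1 (Algebra.mem_top (x := t))

/-- The divided monomial `x ^ b g ^ a y ^ c / ([b]_q! [c]_{q⁻¹}!)`. -/
noncomputable def divMonomial (q : ℂ) (g x y : A) (b : ℕ) (a : ZMod N) (c : ℕ) : A :=
  ((qFactorial q b)⁻¹ * (qFactorial q⁻¹ c)⁻¹) • skewMonomial g x y b a c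

theorem divMonomial_eq_zero (h : IsBookAlgebra Q N M q g x y) {b c : ℕ} (a : ZMod N)
    (hbc : N ≤ b ∨ M ≤ c) : divMonomial q g x y b a c = 0 := by
  rw [divMonomial, h.skewMonomial_eq_zero a hbc, smul_zero]

theorem scalar_ne_zero (h : IsBookAlgebra Q N M q g x y) {b c : ℕ} (hb : b < N) (hc : c < M) :
    (qFactorial q b)⁻¹ * (qFactorial q⁻¹ c)⁻¹ ≠ 0 :=
  mul_ne_zero (inv_ne_zero (qFactorial_ne_zero h.root hb))
    (inv_ne_zero (qFactorial_ne_zero h.root.inv (hc.trans_le h.M_le)))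

theorem smul_divMonomial (h : IsBookAlgebra Q N M q g x y) (b c : ℕ) (a : ZMod N) :
    skewMonomial g x y b a c =
      ((qFactorial q b) * (qFactorial q⁻¹ c)) • divMonomial q g x y b a c := by
  by_cases hbc : N ≤ b ∨ M ≤ c
  · rw [h.skewMonomial_eq_zero a hbc, h.divMonomial_eq_zero a hbc, smul_zero]
  · rw [not_or, not_le, not_le] at hbc
    rw [divMonomial, smul_smul, ← mul_inv, mul_inv_cancel₀ (mul_ne_zero
      (qFactorial_ne_zero h.root hbc.1)
      (qFactorial_ne_zero h.root.inv (hbc.2.trans_le h.M_le))), one_smul]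

/-- The basis of divided monomials. -/
noncomputable def basis (h : IsBookAlgebra Q N M q g x y) :
    Module.Basis (Fin N × ZMod N × Fin M) ℂ A :=
  (Module.Basis.mk h.linearIndependent h.span_skewMonomial.ge).isUnitSMul
    (w := fun i => (qFactorial q i.1)⁻¹ * (qFactorial q⁻¹ i.2.2)⁻¹)
    (fun i => (h.scalar_ne_zero i.1.2 i.2.2.2).isUnit)

theorem basis_apply (h : IsBookAlgebra Q N M q g x y) (i : Fin N × ZMod N × Fin M) :
    h.basis i = divMonomial q g x y i.1 i.2.1 i.2.2 := by
  rw [basis, Module.Basis.isUnitSMul_apply, Module.Basis.mk_apply]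
  rfl

/-- The linear map with prescribed values on the divided monomials. -/
noncomputable def ofValues (h : IsBookAlgebra Q N M q g x y) {V : Type*} [AddCommGroup V]
    [Module ℂ V] (F : ℕ → ZMod N → ℕ → V) : A →ₗ[ℂ] V :=
  h.basis.constr ℂ fun i => F i.1 i.2.1 i.2.2

theorem ofValues_apply (h : IsBookAlgebra Q N M q g x y) {V : Type*} [AddCommGroup V]
    [Module ℂ V] (F : ℕ → ZMod N → ℕ → V) {b c : ℕ} (a : ZMod N) (hb : b < N) (hc : c < M) :
    h.ofValues F (divMonomial q g x y b a c) = F b a c := by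
  have h1 := h.basis_apply (⟨b, hb⟩, a, ⟨c, hc⟩)
  simp only at h1
  rw [← h1, ofValues, Module.Basis.constr_basis]

theorem hom_ext (h : IsBookAlgebra Q N M q g x y) {V : Type*} [AddCommGroup V]
    [Module ℂ V] {f f' : A →ₗ[ℂ] V}
    (hf : ∀ (b : ℕ) (a : ZMod N) (c : ℕ), b < N → c < M →
      f (divMonomial q g x y b a c) = f' (divMonomial q g x y b a c)) : f = f' := by
  refine h.basis.ext fun i => ?_
  rw [h.basis_apply]
  exact hf _ _ _ i.1.2 i.2.2.2

theorem divMonomial_zero (q : ℂ) (g x y : A) : divMonomial (N := N) q g x y 0 0 0 = 1 := by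
  simp [divMonomial, SkewTriple.skewMonomial_zero, qFactorial]

/-- The coproduct of a divided monomial. -/
theorem comul_divMonomial (h : IsBookAlgebra Q N M q g x y) {b c : ℕ} (a : ZMod N) (hb : b < N)
    (hc : c < M) : Q.comul (divMonomial q g x y b a c) =
      ∑ p ∈ Finset.HasAntidiagonal.antidiagonal b, ∑ r ∈ Finset.HasAntidiagonal.antidiagonal c,
        divMonomial q g x y p.1 (a - (r.2 : ZMod N)) r.1 ⊗ₜ[ℂ]
          divMonomial q g x y p.2 (a + (p.1 : ZMod N)) r.2 := by
  have hq0 := h.toSkewTriple.ne_zero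
  have e1 : Q.comul (x ^ b) = ∑ p ∈ Finset.HasAntidiagonal.antidiagonal b,
      qBinom q b p.2 • ((x ^ p.1) ⊗ₜ[ℂ] (x ^ p.2 * g ^ p.1)) := by
    have h1 : (x ⊗ₜ[ℂ] g) * ((1 : A) ⊗ₜ[ℂ] x) = q • (((1 : A) ⊗ₜ[ℂ] x) * (x ⊗ₜ[ℂ] g)) := by
      simp [h.g_mul_x]
    have h2 := skew_add_pow h1 b
    have h3 : Q.comul (x ^ b) = (1 ⊗ₜ[ℂ] x + x ⊗ₜ[ℂ] g) ^ b := by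
      rw [add_comm, ← h.comul_x]
      exact map_pow h.isQuasiBialgebra.comulHom x b
    rw [h3, h2, ← Finset.Nat.sum_antidiagonal_swap, Finset.Nat.sum_antidiagonal_eq_sum_range_succ_mk]
    refine Finset.sum_congr rfl fun k _ => ?_
    simp [Algebra.TensorProduct.tmul_pow]
  have e2 : Q.comul (y ^ c) = ∑ r ∈ Finset.HasAntidiagonal.antidiagonal c,
      qBinom q⁻¹ c r.2 • ((g ^ (-(r.2 : ZMod N)).val * y ^ r.1) ⊗ₜ[ℂ] (y ^ r.2)) := by
    -- The two summands of `Δ(y)` commute up to `q⁻¹`, as `q ^ (N - 1) = q⁻¹`; so the factorials for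
    -- `y` are those of `q⁻¹`.
    have h1 : (y ⊗ₜ[ℂ] 1) * ((g ^ (N - 1)) ⊗ₜ[ℂ] y) =
        q⁻¹ • (((g ^ (N - 1)) ⊗ₜ[ℂ] y) * (y ⊗ₜ[ℂ] (1 : A))) := by
      have h4 := h.toSkewTriple.y_mul_pow (N - 1) 1
      have h5 : q ^ (N - 1) = q⁻¹ := by
        refine eq_inv_of_mul_eq_one_right ?_
        rw [mul_pow_sub_one (NeZero.ne N), h.root.pow_eq_one]
      rw [pow_one, one_mul, h5] at h4
      simp [h4, TensorProduct.smul_tmul']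
    have h2 := skew_add_pow h1 c
    have h3 : Q.comul (y ^ c) = ((g ^ (N - 1)) ⊗ₜ[ℂ] y + y ⊗ₜ[ℂ] 1) ^ c := by
      rw [add_comm, ← h.comul_y]
      exact map_pow h.isQuasiBialgebra.comulHom y c
    rw [h3, h2, ← Finset.Nat.sum_antidiagonal_swap, Finset.Nat.sum_antidiagonal_eq_sum_range_succ_mk]
    refine Finset.sum_congr rfl fun k _ => ?_
    have h6 : ∀ k : ℕ, (g ^ (N - 1)) ^ k = g ^ (-(k : ZMod N)).val := by
      intro k
      induction k with
      | zero => simp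
      | succ k ih =>
        rw [pow_succ, ih, pow_pred_eq h.g_pow, ← pow_val_add h.g_pow]
        congr 2
        push_cast
        ring
    simp [Algebra.TensorProduct.tmul_pow, h6]
  have e3 : ∀ k : ℕ, Q.comul (g ^ k) = (g ^ k) ⊗ₜ[ℂ] (g ^ k) := by
    intro k
    have h3 : Q.comul (g ^ k) = (g ⊗ₜ[ℂ] g) ^ k := by
      rw [← h.comul_g]
      exact map_pow h.isQuasiBialgebra.comulHom g k
    rw [h3, Algebra.TensorProduct.tmul_pow]
  rw [divMonomial, skewMonomial, map_smul, h.isQuasiBialgebra.comul_mul,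
    h.isQuasiBialgebra.comul_mul, e1, e2, e3, Finset.sum_mul, Finset.sum_mul, Finset.smul_sum]
  refine Finset.sum_congr rfl fun p hp => ?_
  rw [Finset.mul_sum, Finset.smul_sum]
  refine Finset.sum_congr rfl fun r hr => ?_
  rw [Finset.HasAntidiagonal.mem_antidiagonal] at hp hr
  -- The factorial of the product is absorbed: each binomial, divided by it, becomes the product of
  -- the two normalisations on the right-hand side.
  have b1 := qBinom_div h.root hb (show p.2 + p.1 = b by omega)
  have b2 := qBinom_div h.root.inv (hc.trans_le h.M_le) (show r.2 + r.1 = c by omega)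
  have g1 : g ^ (a - (r.2 : ZMod N)).val = g ^ a.val * g ^ (-(r.2 : ZMod N)).val := by
    rw [← pow_val_add h.g_pow, sub_eq_add_neg]
  have g2 : g ^ (a + (p.1 : ZMod N)).val = g ^ p.1 * g ^ a.val := by
    rw [add_comm, pow_val_add h.g_pow, pow_val_natCast h.g_pow]
  simp only [divMonomial, skewMonomial, smul_mul_assoc, mul_smul_comm, smul_smul,
    Algebra.TensorProduct.tmul_mul_tmul, TensorProduct.smul_tmul_smul, g1, g2, mul_assoc]
  congr 1
  linear_combination (qFactorial q⁻¹ c)⁻¹ * qBinom q⁻¹ c r.2 * b1 +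
    (qFactorial q p.2)⁻¹ * (qFactorial q p.1)⁻¹ * b2

theorem counit_divMonomial (h : IsBookAlgebra Q N M q g x y) (b c : ℕ) (a : ZMod N) :
    Q.counit (divMonomial q g x y b a c) = if b = 0 ∧ c = 0 then 1 else 0 := by
  have e : ∀ (t : A) (k : ℕ), Q.counit (t ^ k) = Q.counit t ^ k :=
    fun t k => map_pow h.isQuasiBialgebra.counitHom t k
  rw [divMonomial, skewMonomial, map_smul, h.isQuasiBialgebra.counit_mul,
    h.isQuasiBialgebra.counit_mul, e, e, e, h.counit_g, h.counit_x, h.counit_y]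
  rcases Nat.eq_zero_or_pos b with rfl | hb
  · rcases Nat.eq_zero_or_pos c with rfl | hc
    · simp [qFactorial]
    · rw [if_neg (by omega), zero_pow hc.ne']; simp
  · rw [if_neg (by omega), zero_pow hb.ne']; simp

end IsBookAlgebra

/-! ### The periodic resolution for a book algebra. -/

namespace IsBookAlgebra

variable {A : Type*} [Ring A] [Algebra ℂ A] {Q : QuasiHopfData A} {N M : ℕ} [NeZero N] {q : ℂ}
  {g x y : A}

/-- The model of a minimal resolution of the trivial comodule. -/
noncomputable def koszulData (h : IsBookAlgebra Q N M q g x y) :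
    KoszulData (Module.End ℂ A) where
  -- On divided monomials `ξ` lowers the exponent of `x`, and `ξ'` sends the top power of `x` to the
  -- bottom one, as in the periodic resolution of a truncated polynomial algebra; `η`, `η'` do the
  -- same for `y`. The shifts of `a` in `ξ`, `ξ'` compensate for the term `a + p.1` of
  -- `comul_divMonomial`, so that these are comodule maps.
  ξ := h.ofValues fun b a c => if b = 0 then 0 else divMonomial q g x y (b - 1) (a + 1) c
  ξ' := h.ofValues fun b a c => if b + 1 = N then divMonomial q g x y 0 (a - 1) c else 0
  σ := h.ofValues fun b a c => divMonomial q g x y (b + 1) (a - 1) c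
  τ := h.ofValues fun b a c => if b = 0 then divMonomial q g x y (N - 1) (a + 1) c else 0
  η := h.ofValues fun b a c => if c = 0 then 0 else divMonomial q g x y b a (c - 1)
  η' := h.ofValues fun b a c => if c + 1 = M then divMonomial q g x y b a 0 else 0
  μ := h.ofValues fun b a c => divMonomial q g x y b a (c + 1)
  ν := h.ofValues fun b a c => if c = 0 then divMonomial q g x y b a (M - 1) else 0
  ξ_ξ' := h.hom_ext fun b a c hb hc => by
    have hN := h.three_le
    by_cases h1 : b + 1 = N <;> simp (disch := omega) [ofValues_apply, h1]
  ξ'_ξ := h.hom_ext fun b a c hb hc => by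
    have hN := h.three_le
    by_cases h1 : b = 0
    · simp (disch := omega) [ofValues_apply, h1]
    · simp (disch := omega) [ofValues_apply, h1, show b - 1 + 1 = b by omega, show b ≠ N by omega]
  σ_ξ := h.hom_ext fun b a c hb hc => by
    have hN := h.three_le
    by_cases h1 : b = 0
    · simp (disch := omega) [ofValues_apply, h1, show N - 1 + 1 = N by omega]
    · simp (disch := omega) [ofValues_apply, h1, show b - 1 + 1 = b by omega]
  τ_ξ' := h.hom_ext fun b a c hb hc => by
    have hN := h.three_le
    by_cases h1 : b + 1 = N
    · simp (disch := omega) [ofValues_apply, h1, h.divMonomial_eq_zero _ (Or.inl (le_refl N)),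
        show N - 1 = b by omega]
    · simp (disch := omega) [ofValues_apply, h1]
  η_η' := h.hom_ext fun b a c hb hc => by
    have hN := h.M_pos
    by_cases h1 : c + 1 = M <;> simp (disch := omega) [ofValues_apply, h1]
  η'_η := h.hom_ext fun b a c hb hc => by
    by_cases h1 : c = 0
    · simp (disch := omega) [ofValues_apply, h1]
    · simp (disch := omega) [ofValues_apply, h1, show c - 1 + 1 = c by omega, show c ≠ M by omega]
  μ_η := h.hom_ext fun b a c hb hc => by
    by_cases h1 : c = 0
    · simp (disch := omega) [ofValues_apply, h1, show M - 1 + 1 = M by omega]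
    · simp (disch := omega) [ofValues_apply, h1, show c - 1 + 1 = c by omega]
  ν_η' := h.hom_ext fun b a c hb hc => by
    by_cases h1 : c + 1 = M
    · simp (disch := omega) [ofValues_apply, h1, h.divMonomial_eq_zero _ (Or.inr (le_refl M)),
        show M - 1 = c by omega]
    · simp (disch := omega) [ofValues_apply, h1]
  ξ_η := h.hom_ext fun b a c hb hc => by
    by_cases h1 : b = 0 <;> by_cases h2 : c = 0 <;>
      simp (disch := omega) [ofValues_apply, h1, h2]
  ξ_η' := h.hom_ext fun b a c hb hc => by
    have hN := h.M_pos
    by_cases h1 : b = 0 <;> by_cases h2 : c + 1 = M <;>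
      simp (disch := omega) [ofValues_apply, h1, h2]
  ξ'_η := h.hom_ext fun b a c hb hc => by
    by_cases h1 : b + 1 = N <;> by_cases h2 : c = 0 <;>
      simp (disch := omega) [ofValues_apply, h1, h2]
  ξ_μ := h.hom_ext fun b a c hb hc => by
    by_cases h1 : b = 0 <;> by_cases h2 : c + 1 = M
    · simp (disch := omega) [ofValues_apply, h1, h2, h.divMonomial_eq_zero _ (Or.inr (le_refl M))]
    · simp (disch := omega) [ofValues_apply, h1]
    · simp (disch := omega) [ofValues_apply, h1, h2, h.divMonomial_eq_zero _ (Or.inr (le_refl M))]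
    · simp (disch := omega) [ofValues_apply, h1]
  ξ_ν := h.hom_ext fun b a c hb hc => by
    by_cases h1 : b = 0 <;> by_cases h2 : c = 0 <;>
      simp (disch := omega) [ofValues_apply, h1, h2]

/-- The projection to the span of the `x ^ b g ^ a y ^ c` with `a - c = j`. -/
noncomputable def weightProjection (h : IsBookAlgebra Q N M q g x y) (j : ZMod N) :
    Module.End ℂ A :=
  h.ofValues fun b a c => if a - (c : ZMod N) = j then divMonomial q g x y b a c else 0

theorem isComoduleMap_of (h : IsBookAlgebra Q N M q g x y) {T : Module.End ℂ A}
    (hT : ∀ (b : ℕ) (a : ZMod N) (c : ℕ), b < N → c < M → Q.comul (T (divMonomial q g x y b a c)) =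
      ∑ p ∈ Finset.HasAntidiagonal.antidiagonal b, ∑ r ∈ Finset.HasAntidiagonal.antidiagonal c,
        T (divMonomial q g x y p.1 (a - (r.2 : ZMod N)) r.1) ⊗ₜ[ℂ]
          divMonomial q g x y p.2 (a + (p.1 : ZMod N)) r.2) : Q.IsComoduleMap T := by
  have h1 : Q.comul ∘ₗ T = QuasiHopfData.firstFactor A T ∘ₗ Q.comul := by
    refine h.hom_ext fun b a c hb hc => ?_
    rw [LinearMap.comp_apply, LinearMap.comp_apply, hT b a c hb hc, h.comul_divMonomial a hb hc]
    simp only [map_sum, QuasiHopfData.firstFactor_tmul]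
  exact fun a => LinearMap.congr_fun h1 a

theorem one_ne_zero_zmod (h : IsBookAlgebra Q N M q g x y) : (1 : ZMod N) ≠ 0 := by
  have : Fact (1 < N) := ⟨by have := h.three_le; omega⟩
  exact one_ne_zero

theorem two_ne_zero_zmod (h : IsBookAlgebra Q N M q g x y) : (2 : ZMod N) ≠ 0 := by
  intro h1
  have h2 : ((2 : ℕ) : ZMod N) = 0 := by exact_mod_cast h1
  rw [ZMod.natCast_eq_zero_iff] at h2
  have := Nat.le_of_dvd two_pos h2
  have := h.three_le
  omega

theorem koszulComodule (h : IsBookAlgebra Q N M q g x y) :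
    Q.KoszulComodule h.koszulData h.weightProjection ((M : ZMod N) - 1) where
  ξ_comodule := h.isComoduleMap_of fun b a c hb hc => by
    rcases b with - | b
    · rw [koszulData]
      simp only [Finset.Nat.antidiagonal_zero, Finset.sum_singleton]
      rw [ofValues_apply _ _ _ hb hc, if_pos rfl, map_zero, eq_comm]
      refine Finset.sum_eq_zero fun r hr => ?_
      rw [Finset.HasAntidiagonal.mem_antidiagonal] at hr
      rw [ofValues_apply _ _ _ hb (by omega), if_pos rfl, TensorProduct.zero_tmul]
    · rw [Finset.Nat.sum_antidiagonal_succ, koszulData]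
      simp only
      rw [ofValues_apply _ _ _ hb hc, if_neg (Nat.succ_ne_zero b), Nat.add_sub_cancel,
        h.comul_divMonomial _ (by omega) hc, eq_comm, add_eq_right.2]
      · symm
        refine Finset.sum_congr rfl fun p hp => Finset.sum_congr rfl fun r hr => ?_
        rw [Finset.HasAntidiagonal.mem_antidiagonal] at hp hr
        rw [ofValues_apply _ _ _ (by omega) (by omega), if_neg (Nat.succ_ne_zero _),
          Nat.add_sub_cancel]
        congr 2 <;> push_cast <;> ring
      · refine Finset.sum_eq_zero fun r hr => ?_
        rw [Finset.HasAntidiagonal.mem_antidiagonal] at hr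
        rw [ofValues_apply _ _ _ (by omega) (by omega), if_pos rfl, TensorProduct.zero_tmul]
  ξ'_comodule := h.isComoduleMap_of fun b a c hb hc => by
    rw [koszulData]
    simp only
    rw [ofValues_apply _ _ _ hb hc]
    have hv : ∀ p ∈ Finset.HasAntidiagonal.antidiagonal b, p.1 + 1 ≠ N →
        ∑ r ∈ Finset.HasAntidiagonal.antidiagonal c,
        h.ofValues (fun b a c => if b + 1 = N then divMonomial q g x y 0 (a - 1) c else 0)
          (divMonomial q g x y p.1 (a - (r.2 : ZMod N)) r.1) ⊗ₜ[ℂ]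
            divMonomial q g x y p.2 (a + (p.1 : ZMod N)) r.2 = 0 := by
      intro p hp hp1
      rw [Finset.HasAntidiagonal.mem_antidiagonal] at hp
      refine Finset.sum_eq_zero fun r hr => ?_
      rw [Finset.HasAntidiagonal.mem_antidiagonal] at hr
      rw [ofValues_apply _ _ _ (by omega) (by omega), if_neg hp1, TensorProduct.zero_tmul]
    split_ifs with h1
    · rw [Finset.sum_eq_single_of_mem (b, 0)
        (Finset.HasAntidiagonal.mem_antidiagonal.2 (add_zero b)) (fun p hp hne => hv p hp
          (fun h2 => hne (by
            rw [Finset.HasAntidiagonal.mem_antidiagonal] at hp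
            exact Prod.ext (by simp only; omega) (by simp only; omega)))),
        h.comul_divMonomial _ (NeZero.pos N) hc]
      simp only [Finset.Nat.antidiagonal_zero, Finset.sum_singleton]
      refine Finset.sum_congr rfl fun r hr => ?_
      rw [Finset.HasAntidiagonal.mem_antidiagonal] at hr
      rw [ofValues_apply _ _ _ (by omega) (by omega), if_pos h1]
      -- Only the top exponent `b = N - 1` survives in the first factor; it shifts the power of `g`
      -- in the second factor by `-1`, which is the shift built into `ξ'`.
      have hb' : (b : ZMod N) = -1 := by
        rw [eq_neg_iff_add_eq_zero]
        exact_mod_cast (by rw [h1]; simp : ((b + 1 : ℕ) : ZMod N) = 0)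
      rw [hb']
      congr 2 <;> push_cast <;> ring
    · rw [map_zero, eq_comm]
      refine Finset.sum_eq_zero fun p hp => hv p hp ?_
      rw [Finset.HasAntidiagonal.mem_antidiagonal] at hp
      omega
  η_comodule := h.isComoduleMap_of fun b a c hb hc => by
    rw [koszulData]
    simp only
    rw [ofValues_apply _ _ _ hb hc]
    rcases c with - | c
    · simp only [Finset.Nat.antidiagonal_zero, Finset.sum_singleton, ↓reduceIte]
      rw [map_zero, eq_comm]
      refine Finset.sum_eq_zero fun r hr => ?_
      rw [Finset.HasAntidiagonal.mem_antidiagonal] at hr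
      rw [ofValues_apply _ _ _ (by omega) hc, if_pos rfl, TensorProduct.zero_tmul]
    · rw [if_neg (Nat.succ_ne_zero c), Nat.add_sub_cancel,
        h.comul_divMonomial _ hb (by omega)]
      refine Finset.sum_congr rfl fun p hp => ?_
      rw [Finset.HasAntidiagonal.mem_antidiagonal] at hp
      rw [Finset.Nat.sum_antidiagonal_succ]
      rw [ofValues_apply _ _ _ (by omega) (by omega), if_pos rfl, TensorProduct.zero_tmul, zero_add]
      refine Finset.sum_congr rfl fun r hr => ?_
      rw [Finset.HasAntidiagonal.mem_antidiagonal] at hr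
      rw [ofValues_apply _ _ _ (by omega) (by omega), if_neg (Nat.succ_ne_zero _),
          Nat.add_sub_cancel]
  η'_comodule := h.isComoduleMap_of fun b a c hb hc => by
    rw [koszulData]
    simp only
    rw [ofValues_apply _ _ _ hb hc]
    split_ifs with h1
    · rw [h.comul_divMonomial _ hb h.M_pos]
      refine Finset.sum_congr rfl fun p hp => ?_
      rw [Finset.HasAntidiagonal.mem_antidiagonal] at hp
      rw [Finset.sum_eq_single_of_mem (c, 0)
        (Finset.HasAntidiagonal.mem_antidiagonal.2 (add_zero c))]
      · simp only [Finset.Nat.antidiagonal_zero, Finset.sum_singleton]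
        rw [ofValues_apply _ _ _ (by omega) hc, if_pos h1]
      · intro r hr hne
        rw [Finset.HasAntidiagonal.mem_antidiagonal] at hr
        rw [ofValues_apply _ _ _ (by omega) (by omega), if_neg, TensorProduct.zero_tmul]
        exact fun h2 => hne (Prod.ext (by simp only; omega) (by simp only; omega))
    · rw [map_zero, eq_comm]
      refine Finset.sum_eq_zero fun p hp => Finset.sum_eq_zero fun r hr => ?_
      rw [Finset.HasAntidiagonal.mem_antidiagonal] at hp hr
      rw [ofValues_apply _ _ _ (by omega) (by omega), if_neg (by omega), TensorProduct.zero_tmul]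
  -- All left-hand factors of the coproduct have the same weight: `(a - r.2) - r.1 = a - c`.
  π_comodule j := h.isComoduleMap_of fun b a c hb hc => by
    rw [weightProjection, ofValues_apply _ _ _ hb hc]
    have hv : ∀ p ∈ Finset.HasAntidiagonal.antidiagonal b,
        ∀ r ∈ Finset.HasAntidiagonal.antidiagonal c,
        h.ofValues (fun b a c => if a - (c : ZMod N) = j then divMonomial q g x y b a c else 0)
          (divMonomial q g x y p.1 (a - (r.2 : ZMod N)) r.1) = if a - (c : ZMod N) = j then
            divMonomial q g x y p.1 (a - (r.2 : ZMod N)) r.1 else 0 := by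
      intro p hp r hr
      rw [Finset.HasAntidiagonal.mem_antidiagonal] at hp hr
      rw [ofValues_apply _ _ _ (by omega) (by omega), ← hr]
      congr 2
      push_cast
      ring
    rw [Finset.sum_congr rfl fun p hp => Finset.sum_congr rfl fun r hr => by rw [hv p hp r hr]]
    split_ifs with h1
    · exact h.comul_divMonomial _ hb hc
    · simp
  ξ_π j := h.hom_ext fun b a c hb hc => by
    have e : a + 1 - (c : ZMod N) = j + 1 ↔ a - (c : ZMod N) = j := by
      rw [add_sub_right_comm, add_left_inj]
    by_cases h1 : b = 0 <;> by_cases h2 : a - (c : ZMod N) = j <;>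
      simp (disch := omega) [weightProjection, koszulData, ofValues_apply, h1, h2, e]
  ξ'_π j := h.hom_ext fun b a c hb hc => by
    have e : a - 1 - (c : ZMod N) = j - 1 ↔ a - (c : ZMod N) = j := by
      rw [sub_right_comm, sub_left_inj]
    have := NeZero.pos N
    by_cases h1 : b + 1 = N <;> by_cases h2 : a - (c : ZMod N) = j <;>
      simp (disch := omega) [weightProjection, koszulData, ofValues_apply, h1, h2, e]
  η_π j := h.hom_ext fun b a c hb hc => by
    rcases c with - | c
    · by_cases h2 : a = j <;>
        simp (disch := omega) [weightProjection, koszulData, ofValues_apply, h2]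
    · have e : a - (c : ZMod N) = j + 1 ↔ a - ((c : ZMod N) + 1) = j := by
        constructor <;> intro h <;> linear_combination h
      by_cases h2 : a - ((c : ZMod N) + 1) = j <;>
        simp (disch := omega) [weightProjection, koszulData, ofValues_apply, h2, e]
  η'_π j := h.hom_ext fun b a c hb hc => by
    have hM := h.M_pos
    by_cases h1 : c + 1 = M
    · have e : a = j + (c : ZMod N) ↔ a - (c : ZMod N) = j := sub_eq_iff_eq_add.symm
      subst h1
      by_cases h2 : a - (c : ZMod N) = j <;>
        simp (disch := omega) [weightProjection, koszulData, ofValues_apply, h2, e]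
    · by_cases h2 : a - (c : ZMod N) = j <;>
        simp (disch := omega) [weightProjection, koszulData, ofValues_apply, h1, h2]
  π_π j := h.hom_ext fun b a c hb hc => by
    by_cases h2 : a - (c : ZMod N) = j <;>
      simp (disch := omega) [weightProjection, ofValues_apply, h2]
  ξ_one := by
    rw [← divMonomial_zero (N := N) q g x y, koszulData]
    simp only
    rw [ofValues_apply _ _ _ (NeZero.pos N) h.M_pos, if_pos rfl]
  η_one := by
    rw [← divMonomial_zero (N := N) q g x y, koszulData]
    simp only
    rw [ofValues_apply _ _ _ (NeZero.pos N) h.M_pos, if_pos rfl]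
  π_zero_one := by
    rw [← divMonomial_zero (N := N) q g x y, weightProjection,
      ofValues_apply _ _ _ (NeZero.pos N) h.M_pos, if_pos (by simp)]
  π_one_one := by
    rw [← divMonomial_zero (N := N) q g x y, weightProjection,
      ofValues_apply _ _ _ (NeZero.pos N) h.M_pos, if_neg]
    simpa using h.one_ne_zero_zmod.symm
  π_two_one := by
    rw [← divMonomial_zero (N := N) q g x y, weightProjection,
      ofValues_apply _ _ _ (NeZero.pos N) h.M_pos, if_neg]
    -- The weight `m + 2` is `M + 1` in `ZMod N`, that is, `2` if `M = 1` and `1` if `M = N`.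
    rcases h.M_eq with rfl | rfl
    · simpa using h.two_ne_zero_zmod.symm
    · have := h.one_ne_zero_zmod
      simp only [Nat.cast_zero, sub_zero, CharP.cast_eq_zero, zero_sub]
      intro h1
      apply this
      rw [h1]
      ring
  π_eq a := by
    -- The composite of the four operators keeps the monomials with `b = c = 0`, and weight zero
    -- then leaves only `a = 0`.
    have h1 : h.weightProjection 0 ∘ₗ h.koszulData.ξ' ∘ₗ h.koszulData.τ ∘ₗ h.koszulData.η' ∘ₗ
        h.koszulData.ν = LinearMap.toSpanSingleton ℂ A 1 ∘ₗ Q.counit ∘ₗ h.weightProjection 0 := by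
      refine h.hom_ext fun b a c hb hc => ?_
      have hM := h.M_pos
      have hN := NeZero.pos N
      have e : divMonomial (N := N) q g x y 0 0 0 = 1 := divMonomial_zero q g x y
      by_cases h1 : c = 0
      · by_cases h2 : b = 0
        · by_cases h3 : a = 0
          · simp (disch := omega) [weightProjection, koszulData, ofValues_apply, h1, h2, h3,
              show M - 1 + 1 = M by omega, show N - 1 + 1 = N by omega, h.counit_divMonomial]
            exact e
          · simp (disch := omega) [weightProjection, koszulData, ofValues_apply, h1, h2, h3,
              show M - 1 + 1 = M by omega, show N - 1 + 1 = N by omega]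
        · by_cases h3 : a = 0 <;>
          simp (disch := omega) [weightProjection, koszulData, ofValues_apply, h1, h2, h3,
            show M - 1 + 1 = M by omega, h.counit_divMonomial]
      · by_cases h3 : a = (c : ZMod N) <;>
        simp (disch := omega) [weightProjection, koszulData, ofValues_apply, h1, h3,
            h.counit_divMonomial]
        simp [sub_eq_zero, h3]
    exact LinearMap.congr_fun h1 a

end IsBookAlgebra

section FilteredEqArith

variable {V W : Type*} [AddCommGroup V] [Module ℂ V] [AddCommGroup W] [Module ℂ W]
  {P : ℕ → Submodule ℂ V} {R : ℕ → Submodule ℂ W}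

theorem FilteredEq.add {f g f' g' : V →ₗ[ℂ] W} (h : FilteredEq P R f g)
    (h' : FilteredEq P R f' g') : FilteredEq P R (f + f') (g + g') := fun k v hv => by
  rw [LinearMap.add_apply, LinearMap.add_apply, add_sub_add_comm]
  exact add_mem (h k v hv) (h' k v hv)

theorem FilteredEq.sub {f g f' g' : V →ₗ[ℂ] W} (h : FilteredEq P R f g)
    (h' : FilteredEq P R f' g') : FilteredEq P R (f - f') (g - g') := fun k v hv => by
  rw [LinearMap.sub_apply, LinearMap.sub_apply, sub_sub_sub_comm]
  exact sub_mem (h k v hv) (h' k v hv)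

theorem FilteredEq.of_eq {f g : V →ₗ[ℂ] W} (h : f = g) : FilteredEq P R f g :=
  h ▸ FilteredEq.refl f

end FilteredEqArith

/-! ### Transport of the cobar complex, and filtered quasi-bialgebras. -/

namespace QuasiHopfData

variable {A B : Type*} [Ring A] [Algebra ℂ A] [Ring B] [Algebra ℂ B]

section Transport

variable (Q₀ : QuasiHopfData A) (Q : QuasiHopfData B) (s : A →ₗ[ℂ] B)

theorem map_assoc_apply {U W : Type*} [AddCommGroup U] [Module ℂ U] [AddCommGroup W] [Module ℂ W]
    (r : U →ₗ[ℂ] W) (t : A ⊗[ℂ] A) (u : U) :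
    TensorProduct.map s (TensorProduct.map s r) (TensorProduct.assoc ℂ A A U (t ⊗ₜ[ℂ] u)) =
      TensorProduct.assoc ℂ B B W (TensorProduct.map s s t ⊗ₜ[ℂ] r u) := by
  induction t using TensorProduct.induction_on with
  | zero => simp
  | add x y hx hy => simp only [map_add, hx, hy, TensorProduct.add_tmul]
  | tmul x y => simp

theorem comulLeft_map : Q.comulLeft ∘ₗ TensorProduct.map s s =
    (TensorProduct.assoc ℂ B B B).toLinearMap ∘ₗ TensorProduct.map (Q.comul ∘ₗ s) s :=
  TensorProduct.ext' fun _ _ => rfl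

theorem map_comulLeft : TensorProduct.map s (TensorProduct.map s s) ∘ₗ Q₀.comulLeft =
    (TensorProduct.assoc ℂ B B B).toLinearMap ∘ₗ
      TensorProduct.map (TensorProduct.map s s ∘ₗ Q₀.comul) s :=
  TensorProduct.ext' fun _ _ => map_assoc_apply _ _ _ _

theorem comulRight_map : Q.comulRight ∘ₗ TensorProduct.map s s =
    TensorProduct.map s (Q.comul ∘ₗ s) :=
  TensorProduct.ext' fun _ _ => rfl

theorem map_comulRight : TensorProduct.map s (TensorProduct.map s s) ∘ₗ Q₀.comulRight =
    TensorProduct.map s (TensorProduct.map s s ∘ₗ Q₀.comul) :=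
  TensorProduct.ext' fun _ _ => rfl

theorem comul₁_map : Q.comul₁ ∘ₗ TensorProduct.map s (TensorProduct.map s s) =
    (TensorProduct.assoc ℂ B B (B ⊗[ℂ] B)).toLinearMap ∘ₗ
      TensorProduct.map (Q.comul ∘ₗ s) (TensorProduct.map s s) :=
  TensorProduct.ext' fun _ _ => rfl

theorem map_comul₁ :
    TensorProduct.map s (TensorProduct.map s (TensorProduct.map s s)) ∘ₗ Q₀.comul₁ =
    (TensorProduct.assoc ℂ B B (B ⊗[ℂ] B)).toLinearMap ∘ₗ
      TensorProduct.map (TensorProduct.map s s ∘ₗ Q₀.comul) (TensorProduct.map s s) :=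
  TensorProduct.ext' fun _ _ => map_assoc_apply _ _ _ _

theorem comul₂_map : Q.comul₂ ∘ₗ TensorProduct.map s (TensorProduct.map s s) =
    TensorProduct.map s (Q.comulLeft ∘ₗ TensorProduct.map s s) :=
  TensorProduct.ext' fun _ _ => rfl

theorem map_comul₂ :
    TensorProduct.map s (TensorProduct.map s (TensorProduct.map s s)) ∘ₗ Q₀.comul₂ =
    TensorProduct.map s (TensorProduct.map s (TensorProduct.map s s) ∘ₗ Q₀.comulLeft) :=
  TensorProduct.ext' fun _ _ => rfl

theorem comul₃_map : Q.comul₃ ∘ₗ TensorProduct.map s (TensorProduct.map s s) =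
    TensorProduct.map s (Q.comulRight ∘ₗ TensorProduct.map s s) :=
  TensorProduct.ext' fun _ _ => rfl

theorem map_comul₃ :
    TensorProduct.map s (TensorProduct.map s (TensorProduct.map s s)) ∘ₗ Q₀.comul₃ =
    TensorProduct.map s (TensorProduct.map s (TensorProduct.map s s) ∘ₗ Q₀.comulRight) :=
  TensorProduct.ext' fun _ _ => rfl

variable {s}

theorem tensorOne_map (h1 : s 1 = 1) : tensorOne ∘ₗ TensorProduct.map s s =
    TensorProduct.map s (TensorProduct.map s s) ∘ₗ tensorOne := by
  refine TensorProduct.ext' fun a b => ?_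
  change s a ⊗ₜ[ℂ] (s b ⊗ₜ[ℂ] (1 : B)) = s a ⊗ₜ[ℂ] (s b ⊗ₜ[ℂ] s 1)
  rw [h1]

theorem tensorOne₃_map (h1 : s 1 = 1) :
    tensorOne₃ ∘ₗ TensorProduct.map s (TensorProduct.map s s) =
      TensorProduct.map s (TensorProduct.map s (TensorProduct.map s s)) ∘ₗ tensorOne₃ := by
  refine TensorProduct.ext' fun a b => ?_
  exact congrArg (fun t => s a ⊗ₜ[ℂ] t) (LinearMap.congr_fun (tensorOne_map h1) b)

theorem one_tmul_map {U W : Type*} [AddCommGroup U] [Module ℂ U] [AddCommGroup W] [Module ℂ W]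
    (h1 : s 1 = 1) (r : U →ₗ[ℂ] W) : TensorProduct.mk ℂ B W 1 ∘ₗ r =
      TensorProduct.map s r ∘ₗ TensorProduct.mk ℂ A U 1 := by
  refine LinearMap.ext fun u => ?_
  change (1 : B) ⊗ₜ[ℂ] r u = s 1 ⊗ₜ[ℂ] r u
  rw [h1]

theorem cobarTrivial₂_eq : Q.cobarTrivial₂ =
    TensorProduct.mk ℂ B (B ⊗[ℂ] B) 1 - (Q.comulLeft - Q.comulRight + tensorOne) := rfl

theorem cobarTrivial₃_eq : Q.cobarTrivial₃ =
    TensorProduct.mk ℂ B (B ⊗[ℂ] (B ⊗[ℂ] B)) 1 -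
      (Q.comul₁ - Q.comul₂ + Q.comul₃ - tensorOne₃) := rfl

/-- The cobar differential commutes with unital coalgebra maps. -/
theorem cobarTrivial₂_map (h1 : s 1 = 1) (hs : Q.comul ∘ₗ s = TensorProduct.map s s ∘ₗ Q₀.comul) :
    Q.cobarTrivial₂ ∘ₗ TensorProduct.map s s =
      TensorProduct.map s (TensorProduct.map s s) ∘ₗ Q₀.cobarTrivial₂ := by
  simp only [cobarTrivial₂_eq, LinearMap.sub_comp, LinearMap.add_comp, LinearMap.comp_sub,
    LinearMap.comp_add, comulLeft_map, map_comulLeft, comulRight_map, map_comulRight,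
    tensorOne_map h1, one_tmul_map h1, hs]

theorem cobarTrivial₃_map (h1 : s 1 = 1) (hs : Q.comul ∘ₗ s = TensorProduct.map s s ∘ₗ Q₀.comul) :
    Q.cobarTrivial₃ ∘ₗ TensorProduct.map s (TensorProduct.map s s) =
      TensorProduct.map s (TensorProduct.map s (TensorProduct.map s s)) ∘ₗ Q₀.cobarTrivial₃ := by
  simp only [cobarTrivial₃_eq, LinearMap.sub_comp, LinearMap.add_comp, LinearMap.comp_sub,
    LinearMap.comp_add, comulLeft_map, map_comulLeft, comulRight_map, map_comulRight,
    comul₁_map, map_comul₁, comul₂_map, map_comul₂, comul₃_map, map_comul₃,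
    tensorOne₃_map h1, one_tmul_map h1, hs]

end Transport

/-- A quasi-bialgebra with a compatible finite multiplicative filtration. -/
structure IsFiltered (Q : QuasiHopfData B) (P : ℕ → Submodule ℂ B) : Prop where
  isQuasiBialgebra : Q.IsQuasiBialgebra
  antitone : Antitone P
  zero : P 0 = ⊤
  eq_bot : ∃ m, P m = ⊥
  mul : MulFiltration P
  comul : FilteredMap P (tensorFiltration P P) Q.comul

/-- A filtered coalgebra split by a grading operator `θ`. -/
structure IsGradedBy (Q : QuasiHopfData A) (O : ℕ → Submodule ℂ A) (θ : A →ₗ[ℂ] A) (C : ℕ) :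
    Prop where
  antitone : Antitone O
  zero : O 0 = ⊤
  spanned : SpannedByEigenvectors θ C O
  comul : FilteredMap O (tensorFiltration O O) Q.comul
  comul_comp : Q.comul ∘ₗ θ = TensorProduct.map θ θ ∘ₗ Q.comul
  counit_comp : Q.counit ∘ₗ θ = Q.counit
  map_one : θ 1 = 1

/-- A filtered linear isomorphism that respects the coproducts modulo terms of higher degree. -/
structure IsFilteredIso (Q₀ : QuasiHopfData A) (Q : QuasiHopfData B) (O : ℕ → Submodule ℂ A)
    (P : ℕ → Submodule ℂ B) (s : A ≃ₗ[ℂ] B) : Prop where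
  filtered : FilteredMap O P s.toLinearMap
  filtered_symm : FilteredMap P O s.symm.toLinearMap
  comul : FilteredEq O (tensorFiltration P P) (Q.comul ∘ₗ s.toLinearMap)
    (TensorProduct.map s.toLinearMap s.toLinearMap ∘ₗ Q₀.comul)
  map_one : s 1 = 1
  counit : Q.counit ∘ₗ s.toLinearMap = Q₀.counit

theorem _root_.MulFiltration.mul_right_mem {R : ℕ → Submodule ℂ B} (hR : MulFiltration R)
    (h0 : R 0 = ⊤) {k : ℕ} {t : B} (ht : t ∈ R k) (u : B) : t * u ∈ R k :=
  hR k 0 t ht u (h0 ▸ Submodule.mem_top)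

section IsFiltered

variable {Q : QuasiHopfData B} {P : ℕ → Submodule ℂ B} (hB : Q.IsFiltered P)

namespace IsFiltered

theorem mem_zero (hB : Q.IsFiltered P) (b : B) : b ∈ P 0 := hB.zero ▸ Submodule.mem_top

theorem antitone₂ (hB : Q.IsFiltered P) : Antitone (tensorFiltration P P) :=
  tensorFiltration_antitone hB.antitone hB.antitone

theorem antitone₃ (hB : Q.IsFiltered P) : Antitone (tensorFiltration P (tensorFiltration P P)) :=
  tensorFiltration_antitone hB.antitone hB.antitone₂

theorem antitone₄ (hB : Q.IsFiltered P) :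
    Antitone (tensorFiltration P (tensorFiltration P (tensorFiltration P P))) :=
  tensorFiltration_antitone hB.antitone hB.antitone₃

theorem zero₂ (hB : Q.IsFiltered P) : tensorFiltration P P 0 = ⊤ :=
  tensorFiltration_zero hB.zero hB.zero

theorem zero₃ (hB : Q.IsFiltered P) : tensorFiltration P (tensorFiltration P P) 0 = ⊤ :=
  tensorFiltration_zero hB.zero hB.zero₂

theorem mul₂ (hB : Q.IsFiltered P) : MulFiltration (tensorFiltration P P) := hB.mul.tensor hB.mul

theorem mul₃ (hB : Q.IsFiltered P) : MulFiltration (tensorFiltration P (tensorFiltration P P)) :=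
  hB.mul.tensor hB.mul₂

theorem mul₄ (hB : Q.IsFiltered P) :
    MulFiltration (A := B ⊗[ℂ] (B ⊗[ℂ] (B ⊗[ℂ] B)))
      (tensorFiltration P (tensorFiltration P (tensorFiltration P P))) :=
  hB.mul.tensor hB.mul₃

theorem one_tmul (hB : Q.IsFiltered P) {U : Type*} [AddCommGroup U] [Module ℂ U]
    {R : ℕ → Submodule ℂ U} : FilteredMap R (tensorFiltration P R) (TensorProduct.mk ℂ B U 1) :=
  fun k _ hv => tmul_mem_tensorFiltration (zero_add k) (hB.mem_zero 1) hv

theorem tmul_one (hB : Q.IsFiltered P) :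
    FilteredMap P (tensorFiltration P P) ((TensorProduct.mk ℂ B B).flip 1) :=
  fun k _ hv => tmul_mem_tensorFiltration (add_zero k) hv (hB.mem_zero 1)

theorem tensorOne (hB : Q.IsFiltered P) : FilteredMap (tensorFiltration P P)
    (tensorFiltration P (tensorFiltration P P)) tensorOne :=
  FilteredMap.id.tensorMap hB.tmul_one

theorem tensorOne₃ (hB : Q.IsFiltered P) :
    FilteredMap (tensorFiltration P (tensorFiltration P P))
    (tensorFiltration P (tensorFiltration P (tensorFiltration P P))) tensorOne₃ :=
  FilteredMap.id.tensorMap hB.tensorOne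

theorem comulLeft (hB : Q.IsFiltered P) : FilteredMap (tensorFiltration P P)
    (tensorFiltration P (tensorFiltration P P)) Q.comulLeft :=
  filteredMap_assoc.comp (hB.comul.tensorMap FilteredMap.id)

theorem comulRight (hB : Q.IsFiltered P) : FilteredMap (tensorFiltration P P)
    (tensorFiltration P (tensorFiltration P P)) Q.comulRight :=
  FilteredMap.id.tensorMap hB.comul

theorem comul₁ (hB : Q.IsFiltered P) : FilteredMap (tensorFiltration P (tensorFiltration P P))
    (tensorFiltration P (tensorFiltration P (tensorFiltration P P))) Q.comul₁ :=
  filteredMap_assoc.comp (hB.comul.tensorMap FilteredMap.id)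

theorem comul₂ (hB : Q.IsFiltered P) : FilteredMap (tensorFiltration P (tensorFiltration P P))
    (tensorFiltration P (tensorFiltration P (tensorFiltration P P))) Q.comul₂ :=
  FilteredMap.id.tensorMap hB.comulLeft

theorem comul₃ (hB : Q.IsFiltered P) : FilteredMap (tensorFiltration P (tensorFiltration P P))
    (tensorFiltration P (tensorFiltration P (tensorFiltration P P))) Q.comul₃ :=
  FilteredMap.id.tensorMap hB.comulRight

end IsFiltered

/-- The pentagon equation in first order. -/
theorem pentagon_first_order {R : Type*} [Ring R] {c₁ c₂ c₃ o t : R}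
    (h : (1 + c₃) * (1 + c₁) = (1 + o) * (1 + c₂) * (1 + t)) :
    o - (c₁ - c₂ + c₃ - t) = c₃ * c₁ - o * c₂ - o * t - c₂ * t - o * c₂ * t := by
  have h1 : (1 + c₃) * (1 + c₁) = 1 + c₁ + c₃ + c₃ * c₁ := by noncomm_ring
  have h2 : (1 + o) * (1 + c₂) * (1 + t) =
    1 + o + c₂ + t + o * c₂ + o * t + c₂ * t + o * c₂ * t := by noncomm_ring
  rw [h1, h2] at h
  have h3 : c₃ * c₁ = 1 + o + c₂ + t + o * c₂ + o * t + c₂ * t + o * c₂ * t - 1 - c₁ - c₃ := by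
    rw [← h]; abel
  rw [h3]
  abel

/-- The cocycle condition is the linear part of the pentagon. The remaining terms are products of at
least two elements of degree `d`, and `2 d ≥ d + 1`. -/
theorem IsFiltered.cobarTrivial₃_assoc_mem (hB : Q.IsFiltered P) {d : ℕ} (hd : 1 ≤ d)
    (h : Q.assoc - 1 ∈ tensorFiltration P (tensorFiltration P P) d) :
    Q.cobarTrivial₃ (Q.assoc - 1) ∈
      tensorFiltration P (tensorFiltration P (tensorFiltration P P)) (d + 1) := by
  have hQ := hB.isQuasiBialgebra
  set φ := Q.assoc - 1 with hφ
  have e : Q.assoc = 1 + φ := by rw [hφ, add_sub_cancel]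
  have e1 : Q.comul₁ Q.assoc = 1 + Q.comul₁ φ := by
    rw [e, map_add]; congr 1; exact map_one hQ.comul₁Hom
  have e2 : Q.comul₂ Q.assoc = 1 + Q.comul₂ φ := by
    rw [e, map_add]; congr 1; exact map_one hQ.comul₂Hom
  have e3 : Q.comul₃ Q.assoc = 1 + Q.comul₃ φ := by
    rw [e, map_add]; congr 1; exact map_one hQ.comul₃Hom
  have e4 : QuasiHopfData.tensorOne₃ Q.assoc = 1 + QuasiHopfData.tensorOne₃ φ := by
    rw [e, map_add, tensorOne₃_one]
  have e5 : (1 : B) ⊗ₜ[ℂ] Q.assoc = 1 + 1 ⊗ₜ[ℂ] φ := by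
    rw [e, TensorProduct.tmul_add]; rfl
  have hp := hQ.pentagon
  rw [e1, e2, e3, e4, e5] at hp
  have hp' := pentagon_first_order hp
  have hm : ∀ {k}, d + 1 ≤ k → ∀ {t}, t ∈ tensorFiltration P (tensorFiltration P
      (tensorFiltration P P)) k → t ∈ tensorFiltration P (tensorFiltration P
      (tensorFiltration P P)) (d + 1) := fun hk _ ht => hB.antitone₄ hk ht
  have m1 := hB.comul₁ _ _ h
  have m2 := hB.comul₂ _ _ h
  have m3 := hB.comul₃ _ _ h
  have m4 := hB.tensorOne₃ _ _ h
  have m5 := hB.one_tmul _ _ h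
  change (1 : B) ⊗ₜ[ℂ] φ - (Q.comul₁ φ - Q.comul₂ φ + Q.comul₃ φ - QuasiHopfData.tensorOne₃ φ) ∈ _
  rw [hp']
  have hdd : d + 1 ≤ d + d := by omega
  have m52 := hB.mul₄ _ _ _ m5 _ m2
  exact sub_mem (sub_mem (sub_mem (sub_mem (hm hdd (hB.mul₄ _ _ _ m3 _ m1)) (hm hdd m52))
    (hm hdd (hB.mul₄ _ _ _ m5 _ m4))) (hm hdd (hB.mul₄ _ _ _ m2 _ m4)))
    (hm (by omega) (hB.mul₄ _ _ _ m52 _ m4))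

/-- The twisted associator in first order. -/
theorem IsFiltered.twist_assoc_mem (hB : Q.IsFiltered P) {d : ℕ} (hd : 1 ≤ d)
    (h : Q.assoc - 1 ∈ tensorFiltration P (tensorFiltration P P) d) {F : (B ⊗[ℂ] B)ˣ}
    {f : B ⊗[ℂ] B} (hF : (F : B ⊗[ℂ] B) = 1 + f) (hf : f ∈ tensorFiltration P P d)
    (hf' : Q.assoc - 1 + Q.cobarTrivial₂ f ∈ tensorFiltration P (tensorFiltration P P) (d + 1)) :
    (Q.twist F).assoc - 1 ∈ tensorFiltration P (tensorFiltration P P) (d + 1) := by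
  have hQ := hB.isQuasiBialgebra
  set φ := Q.assoc - 1 with hφ
  have e : Q.assoc = 1 + φ := by rw [hφ, add_sub_cancel]
  have e1 : Q.comulLeft (F : B ⊗[ℂ] B) = 1 + Q.comulLeft f := by
    rw [hF, map_add]; congr 1; exact map_one hQ.comulLeftHom
  have e2 : Q.comulRight (F : B ⊗[ℂ] B) = 1 + Q.comulRight f := by
    rw [hF, map_add]; congr 1; exact map_one hQ.comulRightHom
  have e3 : QuasiHopfData.tensorOne (F : B ⊗[ℂ] B) = 1 + QuasiHopfData.tensorOne f := by
    rw [hF, map_add, tensorOne_one]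
  have e4 : (1 : B) ⊗ₜ[ℂ] (F : B ⊗[ℂ] B) = 1 + 1 ⊗ₜ[ℂ] f := by
    rw [hF, TensorProduct.tmul_add]; rfl
  have u1 : Q.comulLeft ((F⁻¹ : (B ⊗[ℂ] B)ˣ) : B ⊗[ℂ] B) * Q.comulLeft (F : B ⊗[ℂ] B) = 1 := by
    rw [← hQ.comulLeft_mul, Units.inv_mul]; exact map_one hQ.comulLeftHom
  have u2 : QuasiHopfData.tensorOne ((F⁻¹ : (B ⊗[ℂ] B)ˣ) : B ⊗[ℂ] B) *
      QuasiHopfData.tensorOne (F : B ⊗[ℂ] B) = 1 := by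
    rw [← tensorOne_mul, Units.inv_mul]; exact tensorOne_one
  have u1' : Q.comulLeft (F : B ⊗[ℂ] B) * Q.comulLeft ((F⁻¹ : (B ⊗[ℂ] B)ˣ) : B ⊗[ℂ] B) = 1 := by
    rw [← hQ.comulLeft_mul, Units.mul_inv]; exact map_one hQ.comulLeftHom
  have u2' : QuasiHopfData.tensorOne (F : B ⊗[ℂ] B) *
      QuasiHopfData.tensorOne ((F⁻¹ : (B ⊗[ℂ] B)ˣ) : B ⊗[ℂ] B) = 1 := by
    rw [← tensorOne_mul, Units.mul_inv]; exact tensorOne_one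
  -- The factors that contain the inverse twist are taken out on the right, so that only `F` itself
  -- has to be expanded.
  have key : ∀ {R : Type _} [Ring R] (o r p l t l' t' : R), l * l' = 1 → t * t' = 1 →
      o * r * p * l' * t' - 1 = (o * r * p - t * l) * (l' * t') := by
    intro R _ o r p l t l' t' h1 h2
    rw [sub_mul, mul_assoc t, ← mul_assoc l, h1, one_mul, h2]
    simp only [mul_assoc]
  have key2 : ∀ {R : Type _} [Ring R] (o r p l t : R),
      (1 + o) * (1 + r) * (1 + p) - (1 + t) * (1 + l) =
        (p + (o - (l - r + t))) + (o * r + o * p + r * p + o * r * p - t * l) := by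
    intro R _ o r p l t
    noncomm_ring
  change (1 ⊗ₜ[ℂ] (F : B ⊗[ℂ] B)) * Q.comulRight (F : B ⊗[ℂ] B) * Q.assoc *
    Q.comulLeft ((F⁻¹ : (B ⊗[ℂ] B)ˣ) : B ⊗[ℂ] B) *
      QuasiHopfData.tensorOne ((F⁻¹ : (B ⊗[ℂ] B)ˣ) : B ⊗[ℂ] B) - 1 ∈ _
  rw [key _ _ _ _ _ _ _ u1' u2', e1, e2, e3, e4, e, key2]
  refine hB.mul₃.mul_right_mem hB.zero₃ ?_ _
  have hm : ∀ {k}, d + 1 ≤ k → ∀ {t}, t ∈ tensorFiltration P (tensorFiltration P P) k →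
      t ∈ tensorFiltration P (tensorFiltration P P) (d + 1) := fun hk _ ht => hB.antitone₃ hk ht
  have m1 := hB.comulLeft _ _ hf
  have m2 := hB.comulRight _ _ hf
  have m4 := hB.tensorOne _ _ hf
  have m5 := hB.one_tmul _ _ hf
  have hdd : d + 1 ≤ d + d := by omega
  have m52 := hB.mul₃ _ _ _ m5 _ m2
  exact add_mem hf' (sub_mem (add_mem (add_mem (add_mem (hm hdd m52)
    (hm hdd (hB.mul₃ _ _ _ m5 _ h))) (hm hdd (hB.mul₃ _ _ _ m2 _ h)))
    (hm (by omega) (hB.mul₃ _ _ _ m52 _ h))) (hm hdd (hB.mul₃ _ _ _ m4 _ m1)))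

/-- The difference of the two coproducts is the commutator of `F - 1` with `Δ(a)`, times the inverse
of `F`, and `F - 1` raises the degree by one. Hence twisting does not change the leading terms. -/
theorem IsFiltered.twist_comul_sub_mem (hB : Q.IsFiltered P) {F : (B ⊗[ℂ] B)ˣ}
    (hF : (F : B ⊗[ℂ] B) - 1 ∈ tensorFiltration P P 1) :
    FilteredEq P (tensorFiltration P P) (Q.twist F).comul Q.comul := by
  intro k a ha
  have key : ∀ {R : Type _} [Ring R] (f d i : R), f * i = 1 →
      f * d * i - d = ((f - 1) * d - d * (f - 1)) * i := by
    intro R _ f d i h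
    have h1 : (f - 1) * d - d * (f - 1) = f * d - d * f := by noncomm_ring
    rw [h1, sub_mul, mul_assoc d, h, mul_one]
  rw [twist_comul, key _ _ _ (Units.mul_inv F)]
  refine hB.mul₂.mul_right_mem hB.zero₂ (sub_mem ?_ ?_) _
  · have := hB.mul₂ _ _ _ hF _ (hB.comul _ _ ha)
    rwa [add_comm] at this
  · exact hB.mul₂ _ _ _ (hB.comul _ _ ha) _ hF

theorem IsFiltered.twist (hB : Q.IsFiltered P) {F : (B ⊗[ℂ] B)ˣ} (hF : Q.IsTwist F)
    (hF1 : (F : B ⊗[ℂ] B) - 1 ∈ tensorFiltration P P 1) : (Q.twist F).IsFiltered P where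
  isQuasiBialgebra := hB.isQuasiBialgebra.twist hF
  antitone := hB.antitone
  zero := hB.zero
  eq_bot := hB.eq_bot
  mul := hB.mul
  comul := (hB.twist_comul_sub_mem hF1).filteredMap hB.antitone₂ hB.comul

theorem IsFilteredIso.twist {Q₀ : QuasiHopfData A} {O : ℕ → Submodule ℂ A} {s : A ≃ₗ[ℂ] B}
    (hs : IsFilteredIso Q₀ Q O P s) (hB : Q.IsFiltered P) {F : (B ⊗[ℂ] B)ˣ}
    (hF1 : (F : B ⊗[ℂ] B) - 1 ∈ tensorFiltration P P 1) : IsFilteredIso Q₀ (Q.twist F) O P s where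
  filtered := hs.filtered
  filtered_symm := hs.filtered_symm
  comul := ((hB.twist_comul_sub_mem hF1).comp_right hs.filtered).trans hs.comul
  map_one := hs.map_one
  counit := hs.counit

end IsFiltered

section IsFilteredIso

variable {Q₀ : QuasiHopfData A} {Q : QuasiHopfData B} {O : ℕ → Submodule ℂ A}
  {P : ℕ → Submodule ℂ B} {s : A ≃ₗ[ℂ] B}

/-- Whatever is built from the coproduct agrees with its counterpart on the graded side to leading
order; this and the lemmas below record it up to the cobar differentials. -/
theorem IsFilteredIso.comulLeft (hs : IsFilteredIso Q₀ Q O P s)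
    (hc : FilteredMap O (tensorFiltration O O) Q₀.comul) : FilteredEq (tensorFiltration O O)
    (tensorFiltration P (tensorFiltration P P)) (Q.comulLeft ∘ₗ TensorProduct.map s s)
    (TensorProduct.map s.toLinearMap (TensorProduct.map s s) ∘ₗ Q₀.comulLeft) := by
  rw [comulLeft_map, map_comulLeft]
  exact (hs.comul.tensorMap (FilteredEq.refl _) ((hs.filtered.tensorMap hs.filtered).comp hc)
    hs.filtered).comp_left filteredMap_assoc

theorem IsFilteredIso.comulRight (hs : IsFilteredIso Q₀ Q O P s) (hB : Q.IsFiltered P) :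
    FilteredEq (tensorFiltration O O)
    (tensorFiltration P (tensorFiltration P P)) (Q.comulRight ∘ₗ TensorProduct.map s s)
    (TensorProduct.map s.toLinearMap (TensorProduct.map s s) ∘ₗ Q₀.comulRight) := by
  rw [comulRight_map, map_comulRight]
  exact (FilteredEq.refl _).tensorMap hs.comul hs.filtered (hB.comul.comp hs.filtered)

theorem IsFilteredIso.cobarTrivial₂ (hs : IsFilteredIso Q₀ Q O P s) (hB : Q.IsFiltered P)
    (hc : FilteredMap O (tensorFiltration O O) Q₀.comul) : FilteredEq (tensorFiltration O O)
    (tensorFiltration P (tensorFiltration P P)) (Q.cobarTrivial₂ ∘ₗ TensorProduct.map s s)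
    (TensorProduct.map s.toLinearMap (TensorProduct.map s s) ∘ₗ Q₀.cobarTrivial₂) := by
  have h1 : s.toLinearMap 1 = 1 := hs.map_one
  simp only [cobarTrivial₂_eq, LinearMap.sub_comp, LinearMap.add_comp, LinearMap.comp_sub,
    LinearMap.comp_add]
  exact (FilteredEq.of_eq (one_tmul_map h1 _)).sub
    (((hs.comulLeft hc).sub (hs.comulRight hB)).add (FilteredEq.of_eq (tensorOne_map h1)))

theorem IsFilteredIso.cobarTrivial₃ (hs : IsFilteredIso Q₀ Q O P s) (hB : Q.IsFiltered P)
    (hc : FilteredMap O (tensorFiltration O O) Q₀.comul) :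
    FilteredEq (tensorFiltration O (tensorFiltration O O))
    (tensorFiltration P (tensorFiltration P (tensorFiltration P P)))
    (Q.cobarTrivial₃ ∘ₗ TensorProduct.map s.toLinearMap (TensorProduct.map s s))
    (TensorProduct.map s.toLinearMap (TensorProduct.map s.toLinearMap (TensorProduct.map s s)) ∘ₗ
      Q₀.cobarTrivial₃) := by
  have h1 : s.toLinearMap 1 = 1 := hs.map_one
  have hf := hs.filtered
  have hf₂ := hf.tensorMap hf
  have hf₃ := hf.tensorMap hf₂
  simp only [cobarTrivial₃_eq, LinearMap.sub_comp, LinearMap.add_comp, LinearMap.comp_sub,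
    LinearMap.comp_add]
  refine (FilteredEq.of_eq (one_tmul_map h1 _)).sub ((((?_ : FilteredEq _ _ _ _).sub
    (?_ : FilteredEq _ _ _ _)).add ?_).sub (FilteredEq.of_eq (tensorOne₃_map h1)))
  · rw [comul₁_map, map_comul₁]
    exact (hs.comul.tensorMap (FilteredEq.refl _) (hf₂.comp hc) hf₂).comp_left filteredMap_assoc
  · rw [comul₂_map, map_comul₂]
    exact (FilteredEq.refl _).tensorMap (hs.comulLeft hc) hf (hB.comulLeft.comp hf₂)
  · rw [comul₃_map, map_comul₃]
    exact (FilteredEq.refl _).tensorMap (hs.comulRight hB) hf (hB.comulRight.comp hf₂)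

end IsFilteredIso

end QuasiHopfData

/-! ### Removing the associator degree by degree. -/

namespace QuasiHopfData

variable {A B : Type*} [Ring A] [Algebra ℂ A] [Ring B] [Algebra ℂ B]

section Graded

variable {Q : QuasiHopfData A} {O : ℕ → Submodule ℂ A} {θ : A →ₗ[ℂ] A} {C : ℕ}

theorem counitLeft_map {Q' : QuasiHopfData B} {s : A →ₗ[ℂ] B} (hs : Q'.counit ∘ₗ s = Q.counit)
    (t : A ⊗[ℂ] A) : Q'.counitLeft (TensorProduct.map s s t) = s (Q.counitLeft t) := by
  induction t using TensorProduct.induction_on with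
  | zero => simp
  | add x y hx hy => simp only [map_add, hx, hy]
  | tmul x y =>
    have h := LinearMap.congr_fun hs x
    simp only [LinearMap.comp_apply] at h
    simp [counitLeft, h]

theorem counitRight_map {Q' : QuasiHopfData B} {s : A →ₗ[ℂ] B} (hs : Q'.counit ∘ₗ s = Q.counit)
    (t : A ⊗[ℂ] A) : Q'.counitRight (TensorProduct.map s s t) = s (Q.counitRight t) := by
  induction t using TensorProduct.induction_on with
  | zero => simp
  | add x y hx hy => simp only [map_add, hx, hy]
  | tmul x y =>
    have h := LinearMap.congr_fun hs y
    simp only [LinearMap.comp_apply] at h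
    simp [counitRight, h]

theorem lTensor_counitLeft_map {Q' : QuasiHopfData B} {s : A →ₗ[ℂ] B}
    (hs : Q'.counit ∘ₗ s = Q.counit) (t : A ⊗[ℂ] (A ⊗[ℂ] A)) :
    LinearMap.lTensor B Q'.counitLeft (TensorProduct.map s (TensorProduct.map s s) t) =
      TensorProduct.map s s (LinearMap.lTensor A Q.counitLeft t) := by
  induction t using TensorProduct.induction_on with
  | zero => simp
  | add x y hx hy => simp only [map_add, hx, hy]
  | tmul x y => simp [counitLeft_map hs]

/-- Applying the counit in the middle of the cobar differential. -/
theorem lTensor_counitLeft_cobarTrivial₂ (hQ : Q.IsQuasiBialgebra) (f : A ⊗[ℂ] A) :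
    LinearMap.lTensor A Q.counitLeft (Q.cobarTrivial₂ f) =
      1 ⊗ₜ[ℂ] Q.counitLeft f - Q.counitRight f ⊗ₜ[ℂ] 1 := by
  have h1 : ∀ t : A ⊗[ℂ] A, ∀ z : A, LinearMap.lTensor A Q.counitLeft
      (TensorProduct.assoc ℂ A A A (t ⊗ₜ[ℂ] z)) = Q.counitRight t ⊗ₜ[ℂ] z := by
    intro t z
    induction t using TensorProduct.induction_on with
    | zero => simp
    | add x y hx hy => simp only [map_add, hx, hy, TensorProduct.add_tmul]
    | tmul x y => simp [counitLeft, counitRight, TensorProduct.smul_tmul]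
  have h2 : LinearMap.lTensor A Q.counitLeft (Q.comulLeft f) = f := by
    induction f using TensorProduct.induction_on with
    | zero => simp
    | add x y hx hy => simp only [map_add, hx, hy]
    | tmul x y =>
      have := h1 (Q.comul x) y
      rw [hQ.counitRight_comul] at this
      exact this
  have h3 : LinearMap.lTensor A Q.counitLeft (Q.comulRight f) = f := by
    clear h2
    induction f using TensorProduct.induction_on with
    | zero => simp
    | add x y hx hy => simp only [map_add, hx, hy]
    | tmul x y =>
      change x ⊗ₜ[ℂ] Q.counitLeft (Q.comul y) = _
      rw [hQ.counitLeft_comul]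
  have h4 : LinearMap.lTensor A Q.counitLeft (tensorOne f) = Q.counitRight f ⊗ₜ[ℂ] 1 := by
    clear h2 h3
    induction f using TensorProduct.induction_on with
    | zero => simp
    | add x y hx hy => simp only [map_add, hx, hy, TensorProduct.add_tmul]
    | tmul x y =>
      change x ⊗ₜ[ℂ] Q.counitLeft (y ⊗ₜ[ℂ] 1) = _
      simp [counitLeft, counitRight, TensorProduct.smul_tmul']
  simp only [cobarTrivial₂_eq, LinearMap.sub_apply, LinearMap.add_apply, map_sub, map_add, h2, h3,
    h4, TensorProduct.mk_apply, LinearMap.lTensor_tmul]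
  abel

theorem counit_counitLeft_tmul_one (hQ : Q.IsQuasiBialgebra) (a : A) :
    Q.counitLeft (1 ⊗ₜ[ℂ] a) = a ∧ Q.counitRight (a ⊗ₜ[ℂ] 1) = a ∧
      Q.counitLeft (a ⊗ₜ[ℂ] 1) = Q.counit a • 1 ∧ Q.counitRight (1 ⊗ₜ[ℂ] a) = Q.counit a • 1 := by
  simp [counitLeft, counitRight, hQ.counit_one]

/-- Cocycles of positive degree are coboundaries of normalised cochains modulo higher degree. -/
theorem IsGradedBy.exists_cobarTrivial₂ (hA : Q.IsGradedBy O θ C) (hQ : Q.IsQuasiBialgebra)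
    (hH : ∀ z, Q.cobarTrivial₃ z = 0 → ∃ f, Q.cobarTrivial₂ f = z) {d : ℕ} (hd : 1 ≤ d)
    {ψ : A ⊗[ℂ] (A ⊗[ℂ] A)} (hψ : ψ ∈ tensorFiltration O (tensorFiltration O O) d)
    (hψ' : Q.cobarTrivial₃ ψ ∈
      tensorFiltration O (tensorFiltration O (tensorFiltration O O)) (d + 1))
    (hψ'' : LinearMap.lTensor A Q.counitLeft ψ = 0) :
    ∃ f ∈ tensorFiltration O O d, Q.counitLeft f = 0 ∧ Q.counitRight f = 0 ∧
      ψ - Q.cobarTrivial₂ f ∈ tensorFiltration O (tensorFiltration O O) (d + 1) := by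
  -- A common bound for `d` and for the degrees in up to four tensor factors.
  set D := C + (C + (C + C)) + d with hD
  have s₂ : SpannedByEigenvectors (TensorProduct.map θ θ) D (tensorFiltration O O) :=
    (hA.spanned.tensor hA.spanned).mono (by omega)
  have s₃ : SpannedByEigenvectors (TensorProduct.map θ (TensorProduct.map θ θ)) D
      (tensorFiltration O (tensorFiltration O O)) :=
    (hA.spanned.tensor (hA.spanned.tensor hA.spanned)).mono (by omega)
  have s₄ : SpannedByEigenvectors (TensorProduct.map θ (TensorProduct.map θ (TensorProduct.map θ θ)))
      D (tensorFiltration O (tensorFiltration O (tensorFiltration O O))) :=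
    (hA.spanned.tensor (hA.spanned.tensor (hA.spanned.tensor hA.spanned))).mono (by omega)
  have hdD : d ≤ D := by omega
  have a₂ := tensorFiltration_antitone hA.antitone hA.antitone
  have a₃ := tensorFiltration_antitone hA.antitone a₂
  have z₂ := tensorFiltration_zero hA.zero hA.zero
  have z₃ := tensorFiltration_zero hA.zero z₂
  have c₂ := cobarTrivial₂_map Q Q hA.map_one hA.comul_comp
  have c₃ := cobarTrivial₃_map Q Q hA.map_one hA.comul_comp
  set θ₂ := TensorProduct.map θ θ with hθ₂
  set θ₃ := TensorProduct.map θ θ₂ with hθ₃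
  set θ₄ := TensorProduct.map θ θ₃ with hθ₄
  set L := degreePolynomial D d with hL
  set ψ' := Polynomial.aeval θ₃ L ψ with hψ1
  -- The differential is homogeneous, so the component of degree `d` of an approximate cocycle is a
  -- cocycle.
  have e1 : Q.cobarTrivial₃ ψ' = 0 := by
    rw [hψ1, aeval_comm_apply (θ' := θ₄) (fun v => LinearMap.congr_fun c₃ v)]
    exact s₄.component_eq_zero hdD hψ'
  obtain ⟨f, hf⟩ := hH _ e1
  obtain ⟨m1, m2⟩ := s₂.component_mem z₂ hdD f
  have e2 : Q.cobarTrivial₂ (Polynomial.aeval θ₂ L f) = ψ' := by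
    rw [aeval_comm_apply (θ' := θ₃) (fun v => LinearMap.congr_fun c₂ v), hf]
    exact (aeval_degreePolynomial_eigenvector hdD hdD (s₃.component_mem z₃ hdD ψ).2).trans
      (if_pos rfl)
  set f' := Polynomial.aeval θ₂ L f with hf'
  have e3 : LinearMap.lTensor A Q.counitLeft ψ' = 0 := by
    rw [hψ1, aeval_comm_apply (θ' := θ₂) (fun v => lTensor_counitLeft_map hA.counit_comp v), hψ'',
      map_zero]
  rw [← e2, lTensor_counitLeft_cobarTrivial₂ hQ, sub_eq_zero] at e3
  -- The counit in the middle leg gives `1 ⊗ a = b ⊗ 1` for the two partial counits `a`, `b` of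
  -- `f'`; hence both are the same scalar.
  have e4 := congrArg Q.counitLeft e3
  rw [(counit_counitLeft_tmul_one hQ _).1, (counit_counitLeft_tmul_one hQ _).2.2.1] at e4
  -- This scalar is homogeneous of degree `d ≥ 1` as well as of degree zero, so `2 ^ d` times it
  -- equals itself and it vanishes.
  have e5 : Q.counitLeft f' = 0 := by
    have h1 : θ (Q.counitLeft f') = (2 : ℂ) ^ d • Q.counitLeft f' := by
      rw [← counitLeft_map hA.counit_comp, ← map_smul]
      exact congrArg _ m2
    rw [e4, map_smul, hA.map_one, smul_smul] at h1
    have h2 := congrArg Q.counit h1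
    rw [map_smul, map_smul, hQ.counit_one, smul_eq_mul, smul_eq_mul, mul_one, mul_one] at h2
    have h3 : ((2 : ℂ) ^ d - 1) * Q.counit (Q.counitRight f') = 0 := by
      rw [sub_mul, one_mul, ← h2, sub_self]
    rcases mul_eq_zero.1 h3 with h4 | h4
    · exfalso
      have h5 : (2 : ℂ) ^ d = (2 : ℂ) ^ 0 := by rw [pow_zero]; exact sub_eq_zero.1 h4
      have := two_pow_complex_injective h5
      omega
    · rw [e4, h4, zero_smul]
  refine ⟨f', m1, e5, ?_, ?_⟩
  · have h := congrArg Q.counitRight e3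
    rw [(counit_counitLeft_tmul_one hQ _).2.1, e5, TensorProduct.tmul_zero, map_zero] at h
    exact h.symm
  · rw [e2]
    exact s₃.sub_component_mem a₃ hdD hψ

end Graded

section Trivialise

variable {Q₀ : QuasiHopfData A} {Q : QuasiHopfData B} {O : ℕ → Submodule ℂ A}
  {P : ℕ → Submodule ℂ B} {s : A ≃ₗ[ℂ] B} {θ : A →ₗ[ℂ] A} {C : ℕ}

/-- The leading term of the associator is pulled back to the graded side, written there as the
coboundary of a normalised `f` of degree `d`, and cancelled by the twist `1 - s(f)`. -/
theorem IsFiltered.exists_twist_step (hB : Q.IsFiltered P) (hs : IsFilteredIso Q₀ Q O P s)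
    (hA : Q₀.IsGradedBy O θ C) (hQ₀ : Q₀.IsQuasiBialgebra)
    (hH : ∀ z, Q₀.cobarTrivial₃ z = 0 → ∃ f, Q₀.cobarTrivial₂ f = z) {d : ℕ} (hd : 1 ≤ d)
    (h : Q.assoc - 1 ∈ tensorFiltration P (tensorFiltration P P) d) :
    ∃ F : (B ⊗[ℂ] B)ˣ, Q.IsTwist F ∧ (F : B ⊗[ℂ] B) - 1 ∈ tensorFiltration P P 1 ∧
      (Q.twist F).assoc - 1 ∈ tensorFiltration P (tensorFiltration P P) (d + 1) := by
  have hQ := hB.isQuasiBialgebra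
  let s₂ := TensorProduct.congr s s
  let s₃ := TensorProduct.congr s s₂
  let s₄ := TensorProduct.congr s s₃
  have hf₂ : FilteredMap (tensorFiltration O O) (tensorFiltration P P) s₂.toLinearMap :=
    hs.filtered.tensorMap hs.filtered
  have hf₃ : FilteredMap (tensorFiltration O (tensorFiltration O O))
      (tensorFiltration P (tensorFiltration P P)) s₃.toLinearMap := hs.filtered.tensorMap hf₂
  have hg₂ : FilteredMap (tensorFiltration P P) (tensorFiltration O O) s₂.symm.toLinearMap :=
    hs.filtered_symm.tensorMap hs.filtered_symm
  have hg₃ : FilteredMap (tensorFiltration P (tensorFiltration P P))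
      (tensorFiltration O (tensorFiltration O O)) s₃.symm.toLinearMap :=
    hs.filtered_symm.tensorMap hg₂
  have hg₄ : FilteredMap (tensorFiltration P (tensorFiltration P (tensorFiltration P P)))
      (tensorFiltration O (tensorFiltration O (tensorFiltration O O))) s₄.symm.toLinearMap :=
    hs.filtered_symm.tensorMap hg₃
  set φ := Q.assoc - 1 with hφ
  set ψ := s₃.symm φ with hψ
  have hψφ : s₃ ψ = φ := by rw [hψ, LinearEquiv.apply_symm_apply]
  have mψ : ψ ∈ tensorFiltration O (tensorFiltration O O) d := hg₃ d φ h
  have m1 : Q₀.cobarTrivial₃ ψ ∈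
      tensorFiltration O (tensorFiltration O (tensorFiltration O O)) (d + 1) := by
    have h1 := hs.cobarTrivial₃ hB hA.comul d ψ mψ
    have h2 := hB.cobarTrivial₃_assoc_mem hd h
    have h3 : Q.cobarTrivial₃ (s₃ ψ) - s₄ (Q₀.cobarTrivial₃ ψ) ∈ _ := h1
    rw [hψφ] at h3
    have h4 := hg₄ _ _ (sub_mem h2 h3)
    rw [sub_sub_cancel] at h4
    simpa using h4
  have m2 : LinearMap.lTensor A Q₀.counitLeft ψ = 0 := by
    apply s₂.injective
    have h1 := lTensor_counitLeft_map hs.counit ψ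
    change LinearMap.lTensor B Q.counitLeft (s₃ ψ) = s₂ _ at h1
    rw [← h1, hψφ, hφ, map_sub, hQ.counit_assoc, map_zero, sub_eq_zero]
    change (1 : B ⊗[ℂ] B) = (1 : B) ⊗ₜ[ℂ] Q.counitLeft ((1 : B) ⊗ₜ[ℂ] 1)
    rw [(counit_counitLeft_tmul_one hQ _).1]
    rfl
  obtain ⟨f, mf, f1, f2, f3⟩ := hA.exists_cobarTrivial₂ hQ₀ hH hd mψ m1 m2
  have mf' : -(s₂ f) ∈ tensorFiltration P P d := neg_mem (hf₂ _ _ mf)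
  have mf1 : -(s₂ f) ∈ tensorFiltration P P 1 := hB.antitone₂ hd mf'
  -- The correction has positive degree, so it is nilpotent and `1` plus it is invertible.
  have hnil : IsNilpotent (-(s₂ f)) := by
    obtain ⟨m, hm⟩ := hB.eq_bot
    have hpow : ∀ n, (-(s₂ f)) ^ n ∈ tensorFiltration P P n := by
      intro n
      induction n with
      | zero => rw [hB.zero₂]; exact Submodule.mem_top
      | succ n ih => rw [pow_succ]; exact hB.mul₂ _ _ _ ih _ mf1
    refine ⟨m + m, ?_⟩
    have h1 := hpow (m + m)
    rwa [tensorFiltration_eq_bot hB.antitone hB.antitone hm hm, Submodule.mem_bot] at h1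
  obtain ⟨F, hF⟩ := hnil.isUnit_one_add
  refine ⟨F, ⟨?_, ?_⟩, ?_, ?_⟩
  · have h1 : Q.counitLeft (s₂ f) = s (Q₀.counitLeft f) := counitLeft_map hs.counit f
    rw [hF, map_add, map_neg, h1, f1, map_zero, neg_zero, add_zero]
    exact (counit_counitLeft_tmul_one hQ _).1
  · have h1 : Q.counitRight (s₂ f) = s (Q₀.counitRight f) := counitRight_map hs.counit f
    rw [hF, map_add, map_neg, h1, f2, map_zero, neg_zero, add_zero]
    exact (counit_counitLeft_tmul_one hQ _).2.1
  · rw [hF, add_sub_cancel_left]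
    exact mf1
  · refine hB.twist_assoc_mem hd h hF mf' ?_
    have h1 : Q.cobarTrivial₂ (s₂ f) - s₃ (Q₀.cobarTrivial₂ f) ∈ _ :=
      hs.cobarTrivial₂ hB hA.comul d f mf
    have h2 : s₃ (ψ - Q₀.cobarTrivial₂ f) ∈ _ := hf₃ _ _ f3
    have h3 := sub_mem h2 h1
    rw [map_sub, hψφ, sub_sub_sub_cancel_right] at h3
    rw [map_neg, ← sub_eq_add_neg]
    exact h3

/-- A filtered quasi-bialgebra whose associated graded coalgebra has vanishing third cohomology
can be twisted to one with trivial associator. -/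
theorem IsFiltered.exists_twist_assoc_eq_one (hB : Q.IsFiltered P) (hs : IsFilteredIso Q₀ Q O P s)
    (hA : Q₀.IsGradedBy O θ C) (hQ₀ : Q₀.IsQuasiBialgebra)
    (hH : ∀ z, Q₀.cobarTrivial₃ z = 0 → ∃ f, Q₀.cobarTrivial₂ f = z)
    (h : Q.assoc - 1 ∈ tensorFiltration P (tensorFiltration P P) 1) :
    ∃ F : (B ⊗[ℂ] B)ˣ, Q.IsTwist F ∧ (F : B ⊗[ℂ] B) - 1 ∈ tensorFiltration P P 1 ∧
      (Q.twist F).assoc = 1 := by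
  have key : ∀ d, ∃ F : (B ⊗[ℂ] B)ˣ, Q.IsTwist F ∧ (F : B ⊗[ℂ] B) - 1 ∈ tensorFiltration P P 1 ∧
      (Q.twist F).assoc - 1 ∈ tensorFiltration P (tensorFiltration P P) (d + 1) := by
    intro d
    induction d with
    | zero =>
      refine ⟨1, ⟨(counit_counitLeft_tmul_one hB.isQuasiBialgebra 1).1,
        (counit_counitLeft_tmul_one hB.isQuasiBialgebra 1).2.1⟩, ?_, ?_⟩
      · rw [Units.val_one, sub_self]; exact zero_mem _
      · have e : (Q.twist 1).assoc = Q.assoc := by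
          change (1 : B) ⊗ₜ[ℂ] ((1 : (B ⊗[ℂ] B)ˣ) : B ⊗[ℂ] B) * Q.comulRight _ * Q.assoc *
            Q.comulLeft _ * QuasiHopfData.tensorOne _ = _
          rw [inv_one, Units.val_one, hB.isQuasiBialgebra.comulRight_one,
            hB.isQuasiBialgebra.comulLeft_one, tensorOne_one, mul_one, mul_one, mul_one]
          exact one_mul Q.assoc
        rw [e]
        exact h
    | succ d ih =>
      obtain ⟨F, hF1, hF2, hF3⟩ := ih
      obtain ⟨G, hG1, hG2, hG3⟩ := (hB.twist hF1 hF2).exists_twist_step (hs.twist hB hF2) hA hQ₀ hH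
        (Nat.succ_pos d) hF3
      refine ⟨G * F, ?_, ?_, ?_⟩
      · have hl := hB.isQuasiBialgebra.counitLeftHom.map_mul (G : B ⊗[ℂ] B) F
        have hr := hB.isQuasiBialgebra.counitRightHom.map_mul (G : B ⊗[ℂ] B) F
        refine ⟨hl.trans ?_, hr.trans ?_⟩
        · change Q.counitLeft (G : B ⊗[ℂ] B) * Q.counitLeft (F : B ⊗[ℂ] B) = 1
          rw [hF1.1, mul_one]; exact hG1.1
        · change Q.counitRight (G : B ⊗[ℂ] B) * Q.counitRight (F : B ⊗[ℂ] B) = 1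
          rw [hF1.2, mul_one]; exact hG1.2
      · have e : ((G * F : (B ⊗[ℂ] B)ˣ) : B ⊗[ℂ] B) - 1 =
            ((G : B ⊗[ℂ] B) - 1) * F + ((F : B ⊗[ℂ] B) - 1) := by
          rw [Units.val_mul, sub_mul, one_mul, sub_add_sub_cancel]
        rw [e]
        exact add_mem (hB.mul₂.mul_right_mem hB.zero₂ hG2 _) hF2
      · rw [← hB.isQuasiBialgebra.twist_twist_assoc]
        exact hG3
  obtain ⟨m, hm⟩ := hB.eq_bot
  -- The filtration of the threefold tensor product vanishes in this degree.
  obtain ⟨F, hF1, hF2, hF3⟩ := key (m + (m + m))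
  refine ⟨F, hF1, hF2, ?_⟩
  have h1 := hB.antitone₃ (Nat.le_succ _) hF3
  rw [tensorFiltration_eq_bot hB.antitone hB.antitone₂ hm
    (tensorFiltration_eq_bot hB.antitone hB.antitone hm hm), Submodule.mem_bot, sub_eq_zero] at h1
  exact h1

end Trivialise

end QuasiHopfData

/-! ### Orthogonality of the characters of `ℤ / N`. -/

section Orthogonality

variable {N : ℕ} [NeZero N] {q : ℂ}

theorem root_pow_val_mul {B : Type*} [Monoid B] {u : B} (hu : u ^ N = 1) (j a : ZMod N) :
    u ^ (j * a).val = (u ^ j.val) ^ a.val := by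
  rw [← pow_mul, ← pow_val_natCast hu (j.val * a.val)]
  simp

theorem sum_root_pow (hq : IsPrimitiveRoot q N) (b : ZMod N) :
    ∑ j : ZMod N, q ^ (j * b).val = if b = 0 then (N : ℂ) else 0 := by
  classical
  have h := AddChar.sum_mulShift b (AddChar.zmodChar_primitive_of_primitive_root N hq)
  rw [ZMod.card] at h
  simp only [AddChar.zmodChar_apply] at h
  rw [h]
  split_ifs <;> simp

/-- Fourier inversion on `ZMod N`. -/
theorem eq_zero_of_sum_mul_root_pow (hq : IsPrimitiveRoot q N) {w : ZMod N → ℂ}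
    (h : ∀ j : ZMod N, ∑ a, w a * q ^ (j * a).val = 0) (b : ZMod N) : w b = 0 := by
  have h1 : ∑ j : ZMod N, q ^ (-(j * b)).val * ∑ a, w a * q ^ (j * a).val = N * w b := by
    simp only [Finset.mul_sum]
    rw [Finset.sum_comm]
    have h2 : ∀ a, ∑ j : ZMod N, q ^ (-(j * b)).val * (w a * q ^ (j * a).val) =
        w a * if a - b = 0 then (N : ℂ) else 0 := by
      intro a
      rw [← sum_root_pow hq, Finset.mul_sum]
      refine Finset.sum_congr rfl fun j _ => ?_
      rw [show j * (a - b) = -(j * b) + j * a by ring, pow_val_add hq.pow_eq_one]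
      ring
    simp only [h2, sub_eq_zero]
    simp [mul_comm]
  simp only [h, mul_zero, Finset.sum_const_zero] at h1
  have h3 : (N : ℂ) ≠ 0 := Nat.cast_ne_zero.2 (NeZero.ne N)
  exact (mul_eq_zero.1 h1.symm).resolve_left h3

end Orthogonality

/-- The span of the monomials of degree at least `k` in the variables `x` and `y`. -/
def monomialFiltration {A : Type*} [Ring A] [Algebra ℂ A] (N : ℕ) (g x y : A) (k : ℕ) :
    Submodule ℂ A :=
  Submodule.span ℂ {t | ∃ (b c : ℕ) (a : ZMod N), k ≤ b + c ∧ t = skewMonomial g x y b a c}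

/-! ### The monomial filtration of a book algebra and its grading. -/

namespace IsBookAlgebra

variable {A : Type*} [Ring A] [Algebra ℂ A] {Q : QuasiHopfData A} {N M : ℕ} [NeZero N] {q : ℂ}
  {g x y : A}

theorem skewMonomial_mem {b c k : ℕ} (a : ZMod N) (h : k ≤ b + c) :
    skewMonomial g x y b a c ∈ monomialFiltration N g x y k :=
  Submodule.subset_span ⟨b, c, a, h, rfl⟩

theorem divMonomial_mem {b c k : ℕ} (a : ZMod N) (h : k ≤ b + c) :
    divMonomial q g x y b a c ∈ monomialFiltration N g x y k :=
  Submodule.smul_mem _ _ (skewMonomial_mem a h)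

theorem monomialFiltration_antitone : Antitone (monomialFiltration N g x y) := by
  intro i j hij
  refine Submodule.span_mono ?_
  rintro _ ⟨b, c, a, h, rfl⟩
  exact ⟨b, c, a, hij.trans h, rfl⟩

theorem monomialFiltration_zero (h : IsBookAlgebra Q N M q g x y) :
    monomialFiltration N g x y 0 = ⊤ := by
  rw [eq_top_iff, ← h.span_skewMonomial]
  refine Submodule.span_le.2 ?_
  rintro _ ⟨i, rfl⟩
  exact skewMonomial_mem _ (Nat.zero_le _)

/-- To verify a property of the elements of a step of the filtration it suffices to consider the
nonzero divided monomials. -/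
theorem monomialFiltration_le (h : IsBookAlgebra Q N M q g x y) {k : ℕ} {S : Submodule ℂ A}
    (hS : ∀ (b c : ℕ) (a : ZMod N), b < N → c < M → k ≤ b + c → divMonomial q g x y b a c ∈ S) :
    monomialFiltration N g x y k ≤ S := by
  refine Submodule.span_le.2 ?_
  rintro _ ⟨b, c, a, hk, rfl⟩
  by_cases hbc : N ≤ b ∨ M ≤ c
  · rw [h.skewMonomial_eq_zero a hbc]; exact zero_mem _
  · rw [not_or, not_le, not_le] at hbc
    rw [h.smul_divMonomial]
    exact Submodule.smul_mem _ _ (hS b c a hbc.1 hbc.2 hk)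

theorem monomialFiltration_eq_bot (h : IsBookAlgebra Q N M q g x y) :
    monomialFiltration N g x y (N + M) = ⊥ := by
  rw [eq_bot_iff]
  refine h.monomialFiltration_le fun b c a hb hc hk => ?_
  omega

theorem mulFiltration (h : IsBookAlgebra Q N M q g x y) :
    MulFiltration (monomialFiltration N g x y) := by
  intro i j s hs t ht
  have h1 := Submodule.mul_mem_mul hs ht
  rw [monomialFiltration, monomialFiltration, Submodule.span_mul_span] at h1
  refine Submodule.span_le.2 ?_ h1
  rintro _ ⟨_, ⟨b, c, a, hk, rfl⟩, _, ⟨b', c', a', hk', rfl⟩, rfl⟩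
  simp only [h.mul_skewMonomial]
  exact Submodule.smul_mem _ _ (skewMonomial_mem _ (by omega))

/-- The operator that is `2 ^ d` in degree `d`. -/
noncomputable def gradingOperator (h : IsBookAlgebra Q N M q g x y) : A →ₗ[ℂ] A :=
  h.ofValues fun b a c => (2 : ℂ) ^ (b + c) • divMonomial q g x y b a c

theorem gradingOperator_apply (h : IsBookAlgebra Q N M q g x y) (b c : ℕ) (a : ZMod N) :
    h.gradingOperator (divMonomial q g x y b a c) =
      (2 : ℂ) ^ (b + c) • divMonomial q g x y b a c := by
  by_cases hbc : N ≤ b ∨ M ≤ c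
  · rw [h.divMonomial_eq_zero a hbc, map_zero, smul_zero]
  · rw [not_or, not_le, not_le] at hbc
    exact h.ofValues_apply _ a hbc.1 hbc.2

/-- Every term of `comul_divMonomial` has total exponent `b + c` in `x` and `y`, so the coproduct is
homogeneous. -/
theorem isGradedBy (h : IsBookAlgebra Q N M q g x y) :
    Q.IsGradedBy (monomialFiltration N g x y) h.gradingOperator (N + M) where
  antitone := monomialFiltration_antitone
  zero := h.monomialFiltration_zero
  spanned k := h.monomialFiltration_le fun b c a hb hc hk =>
    Submodule.subset_span ⟨b + c, hk, by omega, divMonomial_mem a le_rfl,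
      h.gradingOperator_apply b c a⟩
  comul k := by
    change _ ≤ (tensorFiltration _ _ k).comap Q.comul
    refine h.monomialFiltration_le fun b c a hb hc hk => ?_
    rw [Submodule.mem_comap, h.comul_divMonomial a hb hc]
    refine Submodule.sum_mem _ fun p hp => Submodule.sum_mem _ fun r hr => ?_
    rw [Finset.HasAntidiagonal.mem_antidiagonal] at hp hr
    exact tensorFiltration_antitone monomialFiltration_antitone monomialFiltration_antitone hk
      (tmul_mem_tensorFiltration (i := p.1 + r.1) (j := p.2 + r.2) (by omega)
        (divMonomial_mem _ le_rfl) (divMonomial_mem _ le_rfl))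
  comul_comp := h.hom_ext fun b a c hb hc => by
    simp only [LinearMap.comp_apply, h.gradingOperator_apply, map_smul, h.comul_divMonomial a hb hc,
      map_sum, Finset.smul_sum, TensorProduct.map_tmul]
    refine Finset.sum_congr rfl fun p hp => Finset.sum_congr rfl fun r hr => ?_
    rw [Finset.HasAntidiagonal.mem_antidiagonal] at hp hr
    rw [TensorProduct.smul_tmul_smul, ← pow_add]
    congr 2
    omega
  counit_comp := h.hom_ext fun b a c hb hc => by
    rw [LinearMap.comp_apply, h.gradingOperator_apply, map_smul, h.counit_divMonomial]
    split_ifs with h1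
    · simp [h1]
    · simp
  map_one := by
    rw [← divMonomial_zero (N := N) q g x y, h.gradingOperator_apply]
    simp

theorem exists_cobarTrivial₂ (h : IsBookAlgebra Q N M q g x y) (z : A ⊗[ℂ] (A ⊗[ℂ] A))
    (hz : Q.cobarTrivial₃ z = 0) : ∃ f, Q.cobarTrivial₂ f = z := by
  have hQ := h.isQuasiBialgebra
  refine h.koszulComodule.exists_cobarTrivial₂_eq hQ.comul_one hQ.counit_one (fun a => ?_)
    hQ.counitLeft_comul hz
  have h1 := hQ.quasi_coassoc a
  rwa [h.assoc, mul_one, one_mul] at h1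

/-- An element on which all characters `g ↦ q ^ j` vanish has positive degree. -/
theorem mem_of_characters (h : IsBookAlgebra Q N M q g x y) {t : A}
    (ht : ∀ (j : ℕ) (χ : A →ₐ[ℂ] ℂ), χ g = q ^ j → χ x = 0 → χ y = 0 → χ t = 0) :
    t ∈ monomialFiltration N g x y 1 := by
  -- the component of degree zero
  obtain ⟨u, k, hk, hu, rfl⟩ : ∃ u k : A, k ∈ monomialFiltration N g x y 1 ∧
      u ∈ Submodule.span ℂ (Set.range fun a : ZMod N => g ^ a.val) ∧ u + k = t := by
    have h1 : monomialFiltration N g x y 0 ≤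
        Submodule.span ℂ (Set.range fun a : ZMod N => g ^ a.val) ⊔ monomialFiltration N g x y 1 := by
      refine Submodule.span_le.2 ?_
      rintro _ ⟨b, c, a, -, rfl⟩
      by_cases hbc : 1 ≤ b + c
      · exact Submodule.mem_sup_right (skewMonomial_mem a hbc)
      · obtain ⟨rfl, rfl⟩ : b = 0 ∧ c = 0 := by omega
        exact Submodule.mem_sup_left (Submodule.subset_span ⟨a, by simp [skewMonomial]⟩)
    rw [h.monomialFiltration_zero] at h1
    obtain ⟨u, hu, k, hk, e⟩ := Submodule.mem_sup.1 (h1 (Submodule.mem_top (x := t)))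
    exact ⟨u, k, hk, hu, e⟩
  have hχk : ∀ χ : A →ₐ[ℂ] ℂ, χ x = 0 → χ y = 0 →
      ∀ k ∈ monomialFiltration N g x y 1, χ k = 0 := by
    intro χ hx hy k hk
    have : monomialFiltration N g x y 1 ≤ LinearMap.ker χ.toLinearMap := by
      refine Submodule.span_le.2 ?_
      rintro _ ⟨b, c, a, hbc, rfl⟩
      change χ _ = 0
      rw [skewMonomial, map_mul, map_mul, map_pow, map_pow, map_pow, hx, hy]
      rcases Nat.eq_zero_or_pos b with rfl | hb
      · rw [zero_pow (by omega : c ≠ 0), mul_zero]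
      · rw [zero_pow hb.ne', zero_mul, zero_mul]
    exact this hk
  refine add_mem ?_ hk
  obtain ⟨w, hw⟩ := (Submodule.mem_span_range_iff_exists_fun ℂ).1 hu
  -- The part of degree zero is `∑ w a • g ^ a`, and the values of the characters on it are the
  -- Fourier transform of `w`.
  suffices hw0 : w = 0 by
    rw [← hw, hw0]; simp
  refine funext fun a => eq_zero_of_sum_mul_root_pow h.root (fun j => ?_) a
  obtain ⟨χ, h1, h2, h3⟩ := h.exists_character j.val
  have h4 := ht j.val χ h1 h2 h3
  rw [map_add, hχk χ h2 h3 k hk, add_zero, ← hw, map_sum] at h4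
  rw [← h4]
  refine Finset.sum_congr rfl fun a _ => ?_
  rw [map_smul, map_pow, h1, smul_eq_mul, root_pow_val_mul h.root.pow_eq_one]

end IsBookAlgebra

/-! ## Elements that agree modulo higher filtration degree -/

/-- `a` and `b` lie in `P k` and agree modulo `P (k + 1)`. -/
structure SameSymbol {B : Type*} [Ring B] [Algebra ℂ B] (P : ℕ → Submodule ℂ B) (k : ℕ)
    (a b : B) : Prop where
  mem : b ∈ P k
  sub_mem : a - b ∈ P (k + 1)

namespace SameSymbol

variable {B : Type*} [Ring B] [Algebra ℂ B] {P : ℕ → Submodule ℂ B} {k l : ℕ} {a b c d : B}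

theorem refl (h : a ∈ P k) : SameSymbol P k a a := ⟨h, by rw [sub_self]; exact zero_mem _⟩

theorem mem_left (hP : Antitone P) (h : SameSymbol P k a b) : a ∈ P k := by
  have := add_mem (hP (Nat.le_succ k) h.sub_mem) h.mem
  rwa [sub_add_cancel] at this

theorem symm (hP : Antitone P) (h : SameSymbol P k a b) : SameSymbol P k b a :=
  ⟨h.mem_left hP, by rw [← neg_sub]; exact neg_mem h.sub_mem⟩

theorem trans (h : SameSymbol P k a b) (h' : SameSymbol P k b c) : SameSymbol P k a c :=
  ⟨h'.mem, by rw [← sub_add_sub_cancel]; exact add_mem h.sub_mem h'.sub_mem⟩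

theorem mul (hP : Antitone P) (hm : MulFiltration P) (h : SameSymbol P k a b)
    (h' : SameSymbol P l c d) : SameSymbol P (k + l) (a * c) (b * d) := by
  refine ⟨hm _ _ _ h.mem _ h'.mem, ?_⟩
  have e : a * c - b * d = (a - b) * c + b * (c - d) := by noncomm_ring
  rw [e]
  refine add_mem ?_ ?_
  · have := hm _ _ _ h.sub_mem _ (h'.mem_left hP)
    rwa [add_right_comm] at this
  · exact hm _ _ _ h.mem _ h'.sub_mem

end SameSymbol

/-! ### The degree filtration of `gr H` and splittings of the radical filtration. -/

namespace RadGr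

variable {H : Type*} [Ring H] [Algebra ℂ H]

/-- The filtration of `gr H` by degree. -/
noncomputable def filtration (H : Type*) [Ring H] [Algebra ℂ H] (k : ℕ) : Submodule ℂ (Gr H) :=
  Submodule.span ℂ {t | ∃ (l : ℕ) (a : radPow H l), k ≤ l ∧ t = symbol l a}

theorem symbol_mem {k l : ℕ} (a : radPow H l) (h : k ≤ l) : symbol l a ∈ filtration H k :=
  Submodule.subset_span ⟨l, a, h, rfl⟩

theorem filtration_antitone : Antitone (filtration H) := by
  intro i j hij
  refine Submodule.span_mono ?_
  rintro _ ⟨l, a, h, rfl⟩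
  exact ⟨l, a, hij.trans h, rfl⟩

theorem filtration_le {k : ℕ} {S : Submodule ℂ (Gr H)}
    (hS : ∀ l (a : radPow H l), k ≤ l → symbol l a ∈ S) : filtration H k ≤ S := by
  refine Submodule.span_le.2 ?_
  rintro _ ⟨l, a, h, rfl⟩
  exact hS l a h

theorem filtration_zero : filtration H 0 = ⊤ := by
  rw [eq_top_iff]
  rintro u -
  induction u using DirectSum.induction_on with
  | zero => exact zero_mem _
  | of l p =>
    obtain ⟨a, rfl⟩ := toPiece_surjective l p
    exact symbol_mem a (Nat.zero_le l)
  | add u v hu hv => exact add_mem hu hv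

theorem mulFiltration : MulFiltration (filtration H) := by
  intro i j s hs t ht
  have h1 := Submodule.mul_mem_mul hs ht
  rw [filtration, filtration, Submodule.span_mul_span] at h1
  refine Submodule.span_le.2 ?_ h1
  rintro _ ⟨_, ⟨k, a, hk, rfl⟩, _, ⟨l, b, hl, rfl⟩, rfl⟩
  simp only [symbol_mul_symbol]
  exact symbol_mem _ (by omega)

theorem radPow_mulFiltration : MulFiltration (radPow H) :=
  fun _ _ _ ha _ hb => mul_mem_radPow ha hb

theorem radPow_zero : radPow H 0 = ⊤ := eq_top_iff.2 fun a _ => mem_radPow_zero a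

theorem radPow_antitone : Antitone (radPow H) := fun _ _ h => radPow_anti h

theorem symbol_eq_zero {k : ℕ} {a : radPow H k} (h : (a : H) ∈ radPow H (k + 1)) :
    symbol k a = 0 := by
  rw [symbol, LinearMap.comp_apply, toPiece_eq_zero.2 h, map_zero]

theorem filtration_eq_bot {m : ℕ} (hm : radPow H m = ⊥) : filtration H m = ⊥ := by
  rw [eq_bot_iff]
  refine filtration_le fun l a hl => ?_
  have h1 : (a : H) ∈ radPow H m := radPow_anti hl a.2
  rw [hm, Submodule.mem_bot] at h1
  rw [Submodule.mem_bot]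
  exact symbol_eq_zero (by rw [h1]; exact zero_mem _)

theorem exists_eq_symbol_add {k : ℕ} {u : Gr H} (hu : u ∈ filtration H k) :
    ∃ (a : radPow H k) (v : Gr H), v ∈ filtration H (k + 1) ∧ u = symbol k a + v := by
  induction hu using Submodule.span_induction with
  | zero => exact ⟨0, 0, zero_mem _, by rw [map_zero, add_zero]⟩
  | add u v _ _ hu hv =>
    obtain ⟨a, u', hu', rfl⟩ := hu
    obtain ⟨b, v', hv', rfl⟩ := hv
    exact ⟨a + b, u' + v', add_mem hu' hv', by rw [map_add]; abel⟩
  | smul c u _ hu =>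
    obtain ⟨a, u', hu', rfl⟩ := hu
    exact ⟨c • a, c • u', Submodule.smul_mem _ _ hu', by rw [map_smul, smul_add]⟩
  | mem u hu =>
    obtain ⟨l, a, hl, rfl⟩ := hu
    rcases eq_or_lt_of_le hl with rfl | hl
    · exact ⟨a, 0, zero_mem _, by rw [add_zero]⟩
    · exact ⟨0, _, symbol_mem a hl, by rw [map_zero, zero_add]⟩

theorem one_eq_symbol : (1 : Gr H) = symbolZero 1 := rfl

/-- A linear section of the quotient map `J ^ k → J ^ k / J ^ (k + 1)`. -/
noncomputable def pieceSection (k : ℕ) : Piece H k →ₗ[ℂ] H :=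
  (radPow H k).subtype ∘ₗ
    ((toPiece (A := H) k).exists_rightInverse_of_surjective
      (LinearMap.range_eq_top.2 (toPiece_surjective k))).choose

theorem pieceSection_toPiece (k : ℕ) (a : radPow H k) :
    SameSymbol (radPow H) k (pieceSection k (toPiece k a)) a := by
  refine ⟨a.2, ?_⟩
  have h := LinearMap.congr_fun ((toPiece (A := H) k).exists_rightInverse_of_surjective
      (LinearMap.range_eq_top.2 (toPiece_surjective k))).choose_spec (toPiece k a)
  rw [LinearMap.comp_apply, LinearMap.id_apply, ← sub_eq_zero, ← map_sub, toPiece_eq_zero] at h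
  exact h

/-- A linear map `gr H → H` that splits the radical filtration. -/
noncomputable def splitting (H : Type*) [Ring H] [Algebra ℂ H] : Gr H →ₗ[ℂ] H :=
  DirectSum.toModule ℂ ℕ H fun k => pieceSection k

theorem splitting_symbol (k : ℕ) (a : radPow H k) :
    SameSymbol (radPow H) k (splitting H (symbol k a)) a := by
  have h : splitting H (symbol k a) = pieceSection k (toPiece k a) :=
    DirectSum.toModule_lof ℂ k _
  rw [h]
  exact pieceSection_toPiece k a

theorem filteredMap_splitting : FilteredMap (filtration H) (radPow H) (splitting H) := by
  intro k
  change _ ≤ (radPow H k).comap (splitting H)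
  refine filtration_le fun l a hl => ?_
  exact radPow_anti hl ((splitting_symbol l a).mem_left radPow_antitone)

/-- A splitting also reflects the filtrations: if the image lies one step deeper, the leading symbol
vanishes. -/
theorem mem_filtration_of_splitting_mem {k : ℕ} {u : Gr H} (hu : splitting H u ∈ radPow H k) :
    u ∈ filtration H k := by
  induction k with
  | zero => rw [filtration_zero]; exact Submodule.mem_top
  | succ k ih =>
    obtain ⟨a, v, hv, rfl⟩ := exists_eq_symbol_add (ih (radPow_anti (Nat.le_succ k) hu))
    have h1 := filteredMap_splitting _ _ hv
    rw [map_add] at hu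
    have h2 := sub_mem (sub_mem hu h1) (splitting_symbol k a).sub_mem
    rw [add_sub_cancel_right, sub_sub_cancel] at h2
    rw [symbol_eq_zero h2, zero_add]
    exact hv

/-- A splitting of the radical filtration is a filtered isomorphism. -/
theorem exists_splittingEquiv {m : ℕ} (hm : radPow H m = ⊥) :
    ∃ e : Gr H ≃ₗ[ℂ] H, e.toLinearMap = splitting H ∧
      FilteredMap (radPow H) (filtration H) e.symm.toLinearMap := by
  have hinj : Function.Injective (splitting H) := by
    rw [← LinearMap.ker_eq_bot, LinearMap.ker_eq_bot']
    intro u hu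
    have h1 : u ∈ filtration H m :=
      mem_filtration_of_splitting_mem (by rw [hu]; exact zero_mem _)
    rwa [filtration_eq_bot hm, Submodule.mem_bot] at h1
  have hsurj : ∀ j k, j + k = m → ∀ h ∈ radPow H k, ∃ u, splitting H u = h := by
    intro j
    induction j with
    | zero =>
      intro k hk h hh
      rw [show k = m by omega, hm, Submodule.mem_bot] at hh
      exact ⟨0, by rw [map_zero, hh]⟩
    | succ j ih =>
      intro k hk h hh
      obtain ⟨v, hv⟩ := ih (k + 1) (by omega) _ (splitting_symbol k ⟨h, hh⟩).sub_mem
      exact ⟨symbol k ⟨h, hh⟩ - v, by rw [map_sub, hv, sub_sub_cancel]⟩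
  let e := LinearEquiv.ofBijective (splitting H)
    ⟨hinj, fun h => hsurj m 0 rfl h (mem_radPow_zero h)⟩
  refine ⟨e, rfl, fun k h hh => mem_filtration_of_splitting_mem ?_⟩
  have h2 : splitting H (e.symm h) = h := e.apply_symm_apply h
  change splitting H (e.symm h) ∈ _
  rw [h2]
  exact hh

/-- The splitting is multiplicative modulo terms of higher degree. -/
theorem splitting_mul {i j : ℕ} {u v : Gr H} (hu : u ∈ filtration H i) (hv : v ∈ filtration H j) :
    splitting H (u * v) - splitting H u * splitting H v ∈ radPow H (i + j + 1) := by
  let D : Gr H →ₗ[ℂ] Gr H →ₗ[ℂ] H := (LinearMap.mul ℂ (Gr H)).compr₂ (splitting H) -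
    (LinearMap.mul ℂ H).compl₁₂ (splitting H) (splitting H)
  have hD : ∀ u v, D u v = splitting H (u * v) - splitting H u * splitting H v := fun _ _ => rfl
  rw [← hD]
  have h1 : filtration H j ≤ (radPow H (i + j + 1)).comap (D u) := by
    refine filtration_le fun l b hl => ?_
    have h2 : filtration H i ≤ (radPow H (i + j + 1)).comap (D.flip (symbol l b)) := by
      refine filtration_le fun k a hk => ?_
      rw [Submodule.mem_comap, LinearMap.flip_apply, hD, symbol_mul_symbol]
      have h3 := (splitting_symbol (k + l) ⟨(a : H) * b, mul_mem_radPow a.2 b.2⟩).trans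
        (((splitting_symbol k a).mul radPow_antitone radPow_mulFiltration
          (splitting_symbol l b)).symm radPow_antitone)
      exact radPow_anti (by omega) h3.sub_mem
    exact h2 hu
  exact h1 hv

end RadGr

namespace RadGr

section Basic

variable {H : Type*} [Ring H] [Algebra ℂ H]

theorem exists_radPow_eq_bot [FiniteDimensional ℂ H] : ∃ m, radPow H m = ⊥ := by
  have : IsArtinianRing H := IsArtinianRing.of_finite ℂ H
  obtain ⟨m, hm⟩ : IsNilpotent (Ring.jacobson H) := IsSemiprimaryRing.isNilpotent
  refine ⟨m, ?_⟩
  rw [radPow, hm]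
  rfl

theorem mem_radPow_one {a : H} : a ∈ radPow H 1 ↔ a ∈ Ring.jacobson H := by
  change a ∈ Ring.jacobson H ^ 1 ↔ _
  rw [Submodule.pow_one]

/-- The radical quotient of a basic algebra is reduced. -/
theorem mem_radPow_one_of_pow_mem (hH : IsBasicAlgebra H) {a : H} {n : ℕ}
    (h : a ^ n ∈ radPow H 1) : a ∈ radPow H 1 := by
  obtain ⟨m, ⟨e⟩⟩ := hH
  rw [mem_radPow_one, ← Ideal.Quotient.eq_zero_iff_mem] at h ⊢
  rw [map_pow] at h
  have h1 : (e (Ideal.Quotient.mk _ a)) ^ n = 0 := by rw [← map_pow, h, map_zero]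
  have h2 : e (Ideal.Quotient.mk _ a) = 0 := by
    funext i
    have h3 := congrFun h1 i
    rw [Pi.pow_apply] at h3
    exact eq_zero_of_pow_eq_zero h3
  rwa [EmbeddingLike.map_eq_zero_iff] at h2

/-- For a basic algebra the part `H / J` of degree zero is reduced, so a nilpotent element has no
component there. The isomorphism from `gr H` to the book algebra is not assumed to be graded;
nilpotence is what locates degrees. -/
theorem mem_filtration_one_of_isNilpotent (hH : IsBasicAlgebra H) {u : Gr H}
    (hu : IsNilpotent u) : u ∈ filtration H 1 := by
  obtain ⟨n, hn⟩ := hu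
  have h0 : ∀ u : Gr H, u ∈ filtration H 0 := fun u => by
    rw [filtration_zero]; exact Submodule.mem_top
  obtain ⟨a, v, hv, rfl⟩ := exists_eq_symbol_add (h0 u)
  have key : ∀ n, SameSymbol (radPow H) 0 (splitting H ((symbol 0 a + v) ^ n)) ((a : H) ^ n) := by
    intro n
    have h1 : SameSymbol (radPow H) 0 (splitting H (symbol 0 a + v)) a := by
      refine ⟨mem_radPow_zero _, ?_⟩
      rw [map_add, add_sub_right_comm]
      exact add_mem (splitting_symbol 0 a).sub_mem (filteredMap_splitting _ _ hv)
    induction n with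
    | zero =>
      rw [pow_zero, pow_zero, one_eq_symbol]
      exact splitting_symbol 0 ⟨1, mem_radPow_zero 1⟩
    | succ n ih =>
      rw [pow_succ, pow_succ]
      refine SameSymbol.trans (b := splitting H ((symbol 0 a + v) ^ n) *
        splitting H (symbol 0 a + v)) ⟨mem_radPow_zero _, ?_⟩
        (ih.mul radPow_antitone radPow_mulFiltration h1)
      exact splitting_mul (i := 0) (j := 0) (h0 _) (h0 _)
  have h2 := (key n).sub_mem
  rw [hn, map_zero, zero_sub, neg_mem_iff] at h2
  rw [symbol_eq_zero (mem_radPow_one_of_pow_mem hH h2), zero_add]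
  exact hv

end Basic

section Structure

variable {H : Type*} [Ring H] [Algebra ℂ H] {Q : QuasiHopfData H}

open QuasiHopfData

theorem isFiltered [FiniteDimensional ℂ H] (hQ : Q.IsQuasiHopf) (hJ : Q.RadicalIsQuasiHopfIdeal) :
    Q.IsFiltered (radPow H) where
  isQuasiBialgebra := hQ.isQuasiBialgebra
  antitone := radPow_antitone
  zero := radPow_zero
  eq_bot := exists_radPow_eq_bot
  mul := radPow_mulFiltration
  comul := comul_mem_tensorFil hQ hJ

/-- On the tensor square, too, the splitting inverts the symbol map modulo higher degree; this is
what relates the coproduct of `gr H` to that of `H`. -/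
theorem splitting_tensorSymbol {k : ℕ} {t : H ⊗[ℂ] H}
    (ht : t ∈ tensorFiltration (radPow H) (radPow H) k) :
    TensorProduct.map (splitting H) (splitting H) (tensorSymbol k t) - t ∈
      tensorFiltration (radPow H) (radPow H) (k + 1) := by
  have h : tensorFiltration (radPow H) (radPow H) k ≤
      (tensorFiltration (radPow H) (radPow H) (k + 1)).comap
        (TensorProduct.map (splitting H) (splitting H) ∘ₗ tensorSymbol k - LinearMap.id) := by
    refine tensorFiltration_le ?_
    rintro i j b c rfl hb hc
    have h1 := tensorSymbol_tmul i j ⟨b, hb⟩ ⟨c, hc⟩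
    simp only at h1
    rw [Submodule.mem_comap, LinearMap.sub_apply, LinearMap.comp_apply, h1,
      TensorProduct.map_tmul, LinearMap.id_apply]
    have hb' := splitting_symbol i ⟨b, hb⟩
    have hc' := splitting_symbol j ⟨c, hc⟩
    have e : ∀ b' c' : H, b' ⊗ₜ[ℂ] c' - b ⊗ₜ[ℂ] c = (b' - b) ⊗ₜ[ℂ] c' + b ⊗ₜ[ℂ] (c' - c) := by
      intro b' c'
      rw [TensorProduct.sub_tmul, TensorProduct.tmul_sub, sub_add_sub_cancel]
    rw [e]
    exact add_mem
      (tmul_mem_tensorFiltration (by omega) hb'.sub_mem (hc'.mem_left radPow_antitone))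
      (tmul_mem_tensorFiltration (by omega) hb hc'.sub_mem)
  exact h ht

theorem splitting_comul (hQ : Q.IsQuasiHopf) (hJ : Q.RadicalIsQuasiHopfIdeal) :
    FilteredEq (filtration H) (tensorFiltration (radPow H) (radPow H)) (Q.comul ∘ₗ splitting H)
      (TensorProduct.map (splitting H) (splitting H) ∘ₗ (gr hQ hJ).comul) := by
  intro k
  change _ ≤ (tensorFiltration (radPow H) (radPow H) (k + 1)).comap
    (Q.comul ∘ₗ splitting H -
      TensorProduct.map (splitting H) (splitting H) ∘ₗ (gr hQ hJ).comul)
  refine filtration_le fun l a hl => ?_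
  have h1 : (gr hQ hJ).comul (symbol l a) = tensorSymbol l (Q.comul a) :=
    DirectSum.toModule_lof ℂ l _
  have h2 := comul_mem_tensorFil hQ hJ _ _ (splitting_symbol l a).sub_mem
  have h3 := splitting_tensorSymbol (comul_mem_tensorFil hQ hJ l a a.2)
  rw [Submodule.mem_comap, LinearMap.sub_apply, LinearMap.comp_apply, LinearMap.comp_apply, h1]
  have h4 := sub_mem h2 h3
  rw [map_sub, sub_sub_sub_cancel_right] at h4
  exact (tensorFiltration_antitone radPow_antitone radPow_antitone :
    Antitone (tensorFiltration (radPow H) (radPow H))) (Nat.succ_le_succ hl) h4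

/-- An exact equality, since the counit vanishes on the radical and so does not see the higher
terms. -/
theorem counit_splitting (hQ : Q.IsQuasiHopf) (hJ : Q.RadicalIsQuasiHopfIdeal) :
    Q.counit ∘ₗ splitting H = (gr hQ hJ).counit := by
  have h0 : ∀ a ∈ radPow H 1, Q.counit a = 0 := fun a ha =>
    hJ.counit_eq_zero a (mem_radPow_one.1 ha)
  have h1 : ∀ l (a : radPow H l), Q.counit (splitting H (symbol l a)) = Q.counit a := by
    intro l a
    rw [← sub_eq_zero, ← map_sub]
    exact h0 _ (radPow_anti (by omega) (splitting_symbol l a).sub_mem)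
  have h3 : ∀ a : radPow H 0, (a : H) ∈ radPow H (0 + 1) →
      (Q.counit ∘ₗ (radPow H 0).subtype) a = 0 := fun a ha => h0 _ ha
  have h2 : filtration H 0 ≤ LinearMap.ker (Q.counit ∘ₗ splitting H - (gr hQ hJ).counit) := by
    refine filtration_le fun l a _ => ?_
    rw [LinearMap.mem_ker, LinearMap.sub_apply, LinearMap.comp_apply, h1]
    change Q.counit a - lift 0 (Q.counit ∘ₗ (radPow H 0).subtype) h3 (DirectSum.component ℂ ℕ (Piece H) 0
      (DirectSum.lof ℂ ℕ (Piece H) l (toPiece l a))) = 0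
    rcases Nat.eq_zero_or_pos l with rfl | hl
    · rw [DirectSum.component.lof_self]
      exact sub_self _
    · rw [DirectSum.component.of, dif_neg hl.ne', map_zero, sub_zero]
      exact h0 _ (radPow_anti hl a.2)
  rw [filtration_zero] at h2
  refine sub_eq_zero.1 (LinearMap.ext fun u => ?_)
  exact h2 (Submodule.mem_top (x := u))

theorem assoc_sub_one_mem (hQ : Q.IsQuasiHopf) (hJ : Q.RadicalIsQuasiHopfIdeal)
    (h : (gr hQ hJ).assoc = 1) : Q.assoc - 1 ∈
      tensorFiltration (radPow H) (tensorFiltration (radPow H) (radPow H)) 1 := by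
  -- With this trivial filtration on the source, agreement to leading order means an error in
  -- filtration degree one on all of `H`. It is applied to the associator and to `1`, which have the
  -- same symbol in degree zero.
  let T : ℕ → Submodule ℂ H := fun k => if k = 0 then ⊤ else ⊥
  have hT : ∀ f : H →ₗ[ℂ] H, FilteredMap T (radPow H) f := by
    intro f k v hv
    rcases Nat.eq_zero_or_pos k with rfl | hk
    · exact mem_radPow_zero _
    · simp only [T, if_neg hk.ne', Submodule.mem_bot] at hv
      rw [hv, map_zero]
      exact zero_mem _
  have h1 : FilteredEq T (radPow H) (splitting H ∘ₗ symbolZero) LinearMap.id := by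
    intro k v hv
    rcases Nat.eq_zero_or_pos k with rfl | hk
    · exact (splitting_symbol 0 ⟨v, mem_radPow_zero v⟩).sub_mem
    · simp only [T, if_neg hk.ne', Submodule.mem_bot] at hv
      rw [hv, map_zero, map_zero, sub_zero]
      exact zero_mem _
  have h2 := h1.tensorMap h1 (hT _) (hT _)
  have h3 := h1.tensorMap h2 (hT _) ((hT _).tensorMap (hT _))
  have hT0 : T 0 = ⊤ := if_pos rfl
  have h4 : ∀ t : H ⊗[ℂ] (H ⊗[ℂ] H), t ∈ tensorFiltration T (tensorFiltration T T) 0 := by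
    intro t
    rw [tensorFiltration_zero hT0 (tensorFiltration_zero hT0 hT0)]
    exact Submodule.mem_top
  have h5 := h3 0 _ (h4 Q.assoc)
  have h6 := h3 0 _ (h4 1)
  have e : ∀ t : H ⊗[ℂ] (H ⊗[ℂ] H), TensorProduct.map (splitting H ∘ₗ symbolZero)
      (TensorProduct.map (splitting H ∘ₗ symbolZero) (splitting H ∘ₗ symbolZero)) t =
      TensorProduct.map (splitting H) (TensorProduct.map (splitting H) (splitting H))
        (TensorProduct.map symbolZero (TensorProduct.map symbolZero symbolZero) t) := by
    intro t
    rw [← LinearMap.comp_apply, ← TensorProduct.map_comp, ← TensorProduct.map_comp]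
  have e1 : TensorProduct.map (symbolZero (A := H)) (TensorProduct.map symbolZero symbolZero) 1 =
      TensorProduct.map symbolZero (TensorProduct.map symbolZero symbolZero) Q.assoc := by
    change _ = (gr hQ hJ).assoc
    rw [h]
    rfl
  rw [e, TensorProduct.map_id, TensorProduct.map_id, LinearMap.id_apply] at h5 h6
  rw [e1] at h6
  have h7 := sub_mem h6 h5
  rwa [sub_sub_sub_cancel_left] at h7

end Structure

end RadGr

/-! ### Correcting elements modulo nilpotents so that relations hold exactly. -/

section Corrections

variable {B : Type*} [Ring B] [Algebra ℂ B]

theorem MulFiltration.isNilpotent {P : ℕ → Submodule ℂ B} (hP : MulFiltration P)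
    (h0 : P 0 = ⊤) {m : ℕ} (hm : P m = ⊥) {a : B} (ha : a ∈ P 1) : IsNilpotent a := by
  have h : ∀ n, a ^ n ∈ P n := by
    intro n
    induction n with
    | zero => rw [h0]; exact Submodule.mem_top
    | succ n ih => rw [pow_succ]; exact hP _ _ _ ih _ ha
  refine ⟨m, ?_⟩
  have h1 := h m
  rwa [hm, Submodule.mem_bot] at h1

/-- An element whose `N`-th power is unipotent can be corrected to one with `N`-th power one. -/
theorem exists_pow_eq_one {N : ℕ} (hN : N ≠ 0) {c : B} (hc : IsNilpotent (c ^ N - 1)) :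
    ∃ r : B, r ^ N = 1 ∧ IsNilpotent (c - r) := by
  let S := Algebra.adjoin ℂ {c}
  have : IsMulCommutative S := Algebra.isMulCommutative_adjoin ℂ (by
    rintro _ rfl _ rfl; rfl)
  let c' : S := ⟨c, Algebra.subset_adjoin rfl⟩
  have h1 : IsNilpotent (Polynomial.aeval c' (Polynomial.X ^ N - 1 : Polynomial ℂ)) := by
    obtain ⟨n, hn⟩ := hc
    refine ⟨n, Subtype.ext ?_⟩
    simpa [c'] using hn
  -- Newton's method for `X ^ N - 1` in the commutative algebra generated by `c`: the value at `c`
  -- is nilpotent, and the derivative `N c ^ (N - 1)` is a unit because `c ^ N` is unipotent.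
  have h2 : IsUnit (Polynomial.aeval c' (Polynomial.derivative (Polynomial.X ^ N - 1 : Polynomial ℂ))) := by
    have h3 : IsUnit (c' ^ N) := by
      have h4 := h1.isUnit_one_add
      simpa using h4
    have h5 : IsUnit (c' ^ (N - 1)) := by
      rw [← pow_sub_one_mul hN] at h3
      exact isUnit_of_mul_isUnit_left h3
    have h6 : IsUnit ((N : ℂ) • c' ^ (N - 1)) := by
      obtain ⟨w, hw⟩ := h5
      rw [← hw]
      exact (Units.mk0 (N : ℂ) (Nat.cast_ne_zero.2 hN) • w).isUnit
    have e : Polynomial.aeval c' (Polynomial.derivative (Polynomial.X ^ N - 1 : Polynomial ℂ)) =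
        (N : ℂ) • c' ^ (N - 1) := by
      simp [Algebra.smul_def, Polynomial.derivative_X_pow]
    rw [e]
    exact h6
  obtain ⟨r, ⟨hr1, hr2⟩, -⟩ := Polynomial.existsUnique_nilpotent_sub_and_aeval_eq_zero h1 h2
  refine ⟨r, ?_, ?_⟩
  · have h3 := congrArg (Subtype.val) hr2
    simpa [sub_eq_zero] using h3
  · obtain ⟨n, hn⟩ := hr1
    exact ⟨n, by simpa [c'] using congrArg Subtype.val hn⟩

/-- An element that skew commutes with `u` modulo an ideal can be corrected by averaging. -/
theorem exists_skew_commute {N : ℕ} (hN : N ≠ 0) {S : Submodule ℂ B}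
    (hl : ∀ t ∈ S, ∀ b, b * t ∈ S) (hr : ∀ t ∈ S, ∀ b, t * b ∈ S) {u z : B} {r : ℂ}
    (hu : u ^ N = 1) (hrN : r ^ N = 1) (hz : u * z - r • (z * u) ∈ S) :
    ∃ z', z' - z ∈ S ∧ u * z' = r • (z' * u) := by
  have hr0 : r ≠ 0 := by
    rintro rfl
    rw [zero_pow hN] at hrN
    exact zero_ne_one hrN
  set v := u ^ (N - 1) with hv
  have huv : u * v = 1 := by rw [hv, mul_pow_sub_one hN, hu]
  have hvu : v * u = 1 := by rw [hv, pow_sub_one_mul hN, hu]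
  have hvN : v ^ N = 1 := by rw [hv, ← pow_mul, mul_comm, pow_mul, hu, one_pow]
  -- The conjugates `r⁻ʲ uʲ z u⁻ʲ` are all congruent to `z` modulo `S` and periodic in `j` with
  -- period `N`, so their mean is a correction of `z` that satisfies the relation exactly.
  let t : ℕ → B := fun j => (r⁻¹) ^ j • (u ^ j * z * v ^ j)
  have ht : ∀ j, t (j + 1) = r⁻¹ • (u * t j * v) := by
    intro j
    simp only [t, mul_smul_comm, smul_mul_assoc, smul_smul]
    rw [pow_succ' r⁻¹, pow_succ' u, pow_succ v]
    simp only [mul_assoc]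
  have htz : ∀ j, t j - z ∈ S := by
    intro j
    induction j with
    | zero => simp [t]
    | succ j ih =>
      have e : t (j + 1) - z = r⁻¹ • (u * (t j - z) * v) + r⁻¹ • ((u * z - r • (z * u)) * v) := by
        rw [ht, mul_sub, sub_mul, sub_mul, smul_sub, smul_sub, smul_mul_assoc, smul_smul,
          inv_mul_cancel₀ hr0, one_smul, mul_assoc z, huv, mul_one, sub_add_sub_cancel]
      rw [e]
      exact add_mem (Submodule.smul_mem _ _ (hr _ (hl _ ih _) _))
        (Submodule.smul_mem _ _ (hr _ hz _))
  have hN0 : (N : ℂ) ≠ 0 := Nat.cast_ne_zero.2 hN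
  refine ⟨(N : ℂ)⁻¹ • ∑ j ∈ Finset.range N, t j, ?_, ?_⟩
  · have e : (N : ℂ)⁻¹ • ∑ j ∈ Finset.range N, t j - z =
        (N : ℂ)⁻¹ • ∑ j ∈ Finset.range N, (t j - z) := by
      rw [Finset.sum_sub_distrib, smul_sub, Finset.sum_const, Finset.card_range,
        ← Nat.cast_smul_eq_nsmul ℂ, smul_smul, inv_mul_cancel₀ hN0, one_smul]
    rw [e]
    exact Submodule.smul_mem _ _ (Submodule.sum_mem _ fun j _ => htz j)
  · have e : ∑ j ∈ Finset.range N, t (j + 1) = ∑ j ∈ Finset.range N, t j := by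
      have h1 := Finset.sum_range_succ t N
      rw [Finset.sum_range_succ'] at h1
      have h2 : t N = t 0 := by simp [t, hu, hvN, hrN]
      rw [h2] at h1
      exact add_right_cancel h1
    rw [mul_smul_comm, smul_mul_assoc, smul_comm r]
    congr 1
    nth_rewrite 2 [← e]
    simp only [ht]
    rw [← Finset.smul_sum, smul_mul_assoc, smul_smul, mul_inv_cancel₀ hr0, one_smul,
      Finset.mul_sum, Finset.sum_mul]
    refine Finset.sum_congr rfl fun j _ => ?_
    rw [mul_assoc, hvu, mul_one]

end Corrections

/-! ### Generators of `H` that satisfy the skew commutation relations. -/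

namespace IsBookAlgebra

open QuasiHopfData RadGr

variable {A : Type*} [Ring A] [Algebra ℂ A] {Q₀ : QuasiHopfData A} {N M : ℕ} [NeZero N] {q : ℂ}
  {g x y : A} {H : Type*} [Ring H] [Algebra ℂ H] {Q : QuasiHopfData H}

theorem mem_of_isNilpotent (h : IsBookAlgebra Q₀ N M q g x y) {t : A} (ht : IsNilpotent t) :
    t ∈ monomialFiltration N g x y 1 :=
  h.mem_of_characters fun _ χ _ _ _ => (ht.map χ).eq_zero

theorem g_mem (h : IsBookAlgebra Q₀ N M q g x y) : g ∈ monomialFiltration N g x y 0 := by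
  rw [h.monomialFiltration_zero]; exact Submodule.mem_top

theorem x_mem : x ∈ monomialFiltration N g x y 1 :=
  Submodule.subset_span ⟨1, 0, 0, by omega, by simp [skewMonomial]⟩

theorem y_mem : y ∈ monomialFiltration N g x y 1 :=
  Submodule.subset_span ⟨0, 1, 0, by omega, by simp [skewMonomial]⟩

/-- An isomorphism from `gr H` is filtered. -/
theorem filteredMap_of_gr [FiniteDimensional ℂ H] (h : IsBookAlgebra Q₀ N M q g x y)
    (φ : Gr H ≃ₐ[ℂ] A) :
    FilteredMap (RadGr.filtration H) (monomialFiltration N g x y) φ.toLinearMap := by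
  obtain ⟨m, hm⟩ := exists_radPow_eq_bot (H := H)
  -- Symbols of positive degree are nilpotent, so their images have positive degree. Products then
  -- give all higher degrees, the powers of the radical being generated by products.
  have h1 : ∀ r (hr : r ∈ radPow H 1), φ (symbol 1 ⟨r, hr⟩) ∈ monomialFiltration N g x y 1 := by
    intro r hr
    refine h.mem_of_isNilpotent (IsNilpotent.map ?_ φ)
    exact RadGr.mulFiltration.isNilpotent RadGr.filtration_zero (RadGr.filtration_eq_bot hm)
      (RadGr.symbol_mem _ le_rfl)
  have key : ∀ k, ∀ a ∈ radPow H k, ∃ ha : a ∈ radPow H k,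
      φ (symbol k ⟨a, ha⟩) ∈ monomialFiltration N g x y k := by
    intro k
    induction k with
    | zero =>
      intro a ha
      exact ⟨ha, by rw [h.monomialFiltration_zero]; exact Submodule.mem_top⟩
    | succ k ih =>
      intro a ha
      change a ∈ Ring.jacobson H ^ (k + 1) at ha
      rw [Ideal.IsTwoSided.pow_succ] at ha
      refine Submodule.smul_induction_on ha (fun r hr s hs => ?_) (fun u v hu hv => ?_)
      · rw [smul_eq_mul]
        have hr' := mem_radPow_one.2 hr
        obtain ⟨hs', h2⟩ := ih s hs
        have h3 := symbol_mul_symbol k 1 ⟨s, hs'⟩ ⟨r, hr'⟩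
        have h4 := symbol_mul_symbol 1 k ⟨r, hr'⟩ ⟨s, hs'⟩
        have h5 : r * s ∈ radPow H (k + 1) := by
          rw [add_comm]; exact mul_mem_radPow hr' hs'
        refine ⟨h5, ?_⟩
        have h6 : symbol (k + 1) ⟨r * s, h5⟩ = symbol 1 ⟨r, hr'⟩ * symbol k ⟨s, hs'⟩ := by
          rw [h4]
          have e : ∀ i (hi : r * s ∈ radPow H i), i = k + 1 →
              symbol (k + 1) ⟨r * s, h5⟩ = symbol i ⟨r * s, hi⟩ := by
            rintro i hi rfl; rfl
          exact e _ _ (add_comm 1 k)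
        rw [h6, map_mul, add_comm]
        exact h.mulFiltration _ _ _ (h1 r hr') _ h2
      · obtain ⟨hu1, hu2⟩ := hu
        obtain ⟨hv1, hv2⟩ := hv
        refine ⟨add_mem hu1 hv1, ?_⟩
        have e : (⟨u + v, add_mem hu1 hv1⟩ : radPow H (k + 1)) = ⟨u, hu1⟩ + ⟨v, hv1⟩ := rfl
        rw [e, map_add, map_add]
        exact add_mem hu2 hv2
  intro k
  change _ ≤ (monomialFiltration N g x y k).comap φ.toLinearMap
  refine RadGr.filtration_le fun l a hl => ?_
  obtain ⟨_, h2⟩ := key l a a.2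
  exact monomialFiltration_antitone hl h2

/-- The preimages of `x` and `y` are nilpotent, hence of positive degree; the power of `g` may sit
in any degree, as it contributes zero to the bound. -/
theorem filteredMap_to_gr (h : IsBookAlgebra Q₀ N M q g x y) (hH : IsBasicAlgebra H)
    (φ : Gr H ≃ₐ[ℂ] A) :
    FilteredMap (monomialFiltration N g x y) (RadGr.filtration H) φ.symm.toLinearMap := by
  have hx : φ.symm x ∈ RadGr.filtration H 1 :=
    mem_filtration_one_of_isNilpotent hH (IsNilpotent.map ⟨N, h.x_pow⟩ φ.symm)
  have hy : φ.symm y ∈ RadGr.filtration H 1 :=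
    mem_filtration_one_of_isNilpotent hH (IsNilpotent.map ⟨M, h.y_pow⟩ φ.symm)
  have hp : ∀ u ∈ RadGr.filtration H 1, ∀ n, u ^ n ∈ RadGr.filtration H n := by
    intro u hu n
    induction n with
    | zero => rw [RadGr.filtration_zero]; exact Submodule.mem_top
    | succ n ih => rw [pow_succ]; exact RadGr.mulFiltration _ _ _ ih _ hu
  intro k
  change _ ≤ (RadGr.filtration H k).comap φ.symm.toLinearMap
  refine Submodule.span_le.2 ?_
  rintro _ ⟨b, c, a, hk, rfl⟩
  change φ.symm _ ∈ RadGr.filtration H k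
  rw [skewMonomial, map_mul, map_mul, map_pow, map_pow, map_pow]
  refine RadGr.filtration_antitone (show k ≤ b + 0 + c by omega) ?_
  exact RadGr.mulFiltration _ _ _ (RadGr.mulFiltration _ _ _ (hp _ hx b) _
    (by rw [RadGr.filtration_zero]; exact Submodule.mem_top)) _ (hp _ hy c)

/-- A quasi-Hopf algebra whose associated graded algebra is a book algebra has generators that
satisfy the skew commutation relations exactly. -/
theorem exists_filteredIso [FiniteDimensional ℂ H] (h : IsBookAlgebra Q₀ N M q g x y)
    (hQ : Q.IsQuasiHopf) (hH : IsBasicAlgebra H) (hJ : Q.RadicalIsQuasiHopfIdeal)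
    (hiso : (gr hQ hJ).Isomorphic Q₀) :
    ∃ (g' x' y' : H) (s : A ≃ₗ[ℂ] H), SkewTriple N q g' x' y' ∧
      IsFilteredIso Q₀ Q (monomialFiltration N g x y) (radPow H) s ∧
      (∀ (b c : ℕ) (a : ZMod N), b < N → c < M →
        s (skewMonomial g x y b a c) = skewMonomial g' x' y' b a c) ∧
      Q.assoc - 1 ∈ tensorFiltration (radPow H) (tensorFiltration (radPow H) (radPow H)) 1 := by
  obtain ⟨φ, hφ1, hφ2, hφ3, -⟩ := hiso
  have hF := RadGr.isFiltered hQ hJ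
  obtain ⟨m, hm⟩ := hF.eq_bot
  obtain ⟨e, he, he'⟩ := exists_splittingEquiv hm
  have hfe : FilteredMap (RadGr.filtration H) (radPow H) e.toLinearMap :=
    he ▸ filteredMap_splitting
  have hφf := h.filteredMap_of_gr φ
  have hφg := h.filteredMap_to_gr hH φ
  -- A first splitting, correct to leading order. It is replaced below by one that sends monomials
  -- to monomials in the corrected generators.
  let s₀ : A ≃ₗ[ℂ] H := φ.symm.toLinearEquiv.trans e
  have hs : ∀ t, s₀ t = splitting H (φ.symm t) := fun t => LinearMap.congr_fun he (φ.symm t)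
  have hs₀ : FilteredMap (monomialFiltration N g x y) (radPow H) s₀.toLinearMap := hfe.comp hφg
  have hs₀' : FilteredMap (radPow H) (monomialFiltration N g x y) s₀.symm.toLinearMap :=
    hφf.comp he'
  have hanti := radPow_antitone (H := H)
  have hmul : ∀ {i j u v}, u ∈ monomialFiltration N g x y i → v ∈ monomialFiltration N g x y j →
      ∀ {a b}, SameSymbol (radPow H) i (s₀ u) a → SameSymbol (radPow H) j (s₀ v) b →
      SameSymbol (radPow H) (i + j) (s₀ (u * v)) (a * b) := by
    intro i j u v hu hv a b ha hb
    refine SameSymbol.trans (b := s₀ u * s₀ v) ⟨mul_mem_radPow (hs₀ _ _ hu) (hs₀ _ _ hv), ?_⟩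
      (ha.mul hanti radPow_mulFiltration hb)
    rw [hs, hs, hs, map_mul]
    exact splitting_mul (hφg _ _ hu) (hφg _ _ hv)
  have hone : SameSymbol (radPow H) 0 (s₀ 1) 1 := by
    rw [hs, map_one, one_eq_symbol]
    exact splitting_symbol 0 ⟨1, mem_radPow_zero 1⟩
  have hpow : ∀ {i u a}, u ∈ monomialFiltration N g x y i → SameSymbol (radPow H) i (s₀ u) a →
      ∀ n, u ^ n ∈ monomialFiltration N g x y (n * i) ∧
        SameSymbol (radPow H) (n * i) (s₀ (u ^ n)) (a ^ n) := by
    intro i u a hu ha n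
    induction n with
    | zero =>
      rw [zero_mul, pow_zero, pow_zero]
      exact ⟨by rw [h.monomialFiltration_zero]; exact Submodule.mem_top, hone⟩
    | succ n ih =>
      rw [pow_succ, pow_succ, Nat.succ_mul]
      exact ⟨h.mulFiltration _ _ _ ih.1 _ hu, hmul ih.1 hu ih.2 ha⟩
  have hg0 := h.g_mem
  have hx1 : x ∈ monomialFiltration N g x y 1 := x_mem
  have hy1 : y ∈ monomialFiltration N g x y 1 := y_mem
  -- correction of the image of `g`
  obtain ⟨g', hg'N, hg'⟩ : ∃ g' : H, g' ^ N = 1 ∧ SameSymbol (radPow H) 0 (s₀ g) g' := by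
    have h1 := (hpow hg0 (SameSymbol.refl (hs₀ _ _ hg0)) N).2
    rw [h.g_pow, mul_zero] at h1
    have h2 := (hone.symm hanti).trans h1
    have h3 : IsNilpotent ((s₀ g) ^ N - 1) := by
      refine radPow_mulFiltration.isNilpotent radPow_zero hm ?_
      rw [← neg_sub]
      exact neg_mem h2.sub_mem
    obtain ⟨r, hr, n, hn⟩ := exists_pow_eq_one (NeZero.ne N) h3
    refine ⟨r, hr, mem_radPow_zero r, mem_radPow_one_of_pow_mem hH (n := n) ?_⟩
    rw [hn]
    exact zero_mem _
  -- correction of the images of `x` and `y`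
  have hcor : ∀ (z : A) (r : ℂ), r ^ N = 1 → z ∈ monomialFiltration N g x y 1 →
      g * z = r • (z * g) →
      ∃ z' : H, SameSymbol (radPow H) 1 (s₀ z) z' ∧ g' * z' = r • (z' * g') := by
    intro z r hr hz hgz
    have h1 := SameSymbol.refl (hs₀ _ _ hz)
    have h2 := hmul hg0 hz hg' h1
    have h3 := hmul hz hg0 h1 hg'
    -- Both products have the leading terms prescribed by `g z = r z g`, so the relation holds
    -- modulo the square of the radical, where the averaging can start.
    have h4 : g' * s₀ z - r • (s₀ z * g') ∈ radPow H 2 := by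
      have h5 := sub_mem (Submodule.smul_mem _ r h3.sub_mem) h2.sub_mem
      rw [hgz, map_smul, smul_sub, sub_sub_sub_cancel_left] at h5
      exact h5
    obtain ⟨z', hz', hgz'⟩ := exists_skew_commute (NeZero.ne N) (S := radPow H 2)
      (fun t ht b => by
        have := mul_mem_radPow (mem_radPow_zero b) ht
        rwa [zero_add] at this)
      (fun t ht b => mul_mem_radPow ht (mem_radPow_zero b)) hg'N hr h4
    exact ⟨z', SameSymbol.symm hanti ⟨h1.mem, hz'⟩, hgz'⟩
  obtain ⟨x', hx', hgx⟩ := hcor x q h.root.pow_eq_one hx1 h.g_mul_x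
  obtain ⟨y', hy', hgy⟩ := hcor y q⁻¹ (by rw [inv_pow, h.root.pow_eq_one, inv_one]) hy1 h.g_mul_y
  have hmono : ∀ (b c : ℕ) (a : ZMod N), SameSymbol (radPow H) (b + c)
      (s₀ (skewMonomial g x y b a c)) (skewMonomial g' x' y' b a c) := by
    intro b c a
    have h1 := hpow hx1 hx' b
    have h2 := hpow hg0 hg' a.val
    have h3 := hpow hy1 hy' c
    rw [mul_one] at h1 h3
    rw [mul_zero] at h2
    have h4 := hmul h1.1 h2.1 h1.2 h2.2
    have h5 := h.mulFiltration _ _ _ h1.1 _ h2.1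
    rw [add_zero] at h4 h5
    exact hmul h5 h3.1 h4 h3.2
  -- the map that preserves monomials
  let f : A →ₗ[ℂ] H := (Module.Basis.mk h.linearIndependent h.span_skewMonomial.ge).constr ℂ
    fun i => skewMonomial g' x' y' i.1 i.2.1 i.2.2
  have hf : ∀ (b c : ℕ) (a : ZMod N), b < N → c < M →
      f (skewMonomial g x y b a c) = skewMonomial g' x' y' b a c := by
    intro b c a hb hc
    have h1 := (Module.Basis.mk h.linearIndependent h.span_skewMonomial.ge).constr_basis ℂ
      (fun i => skewMonomial g' x' y' i.1 i.2.1 i.2.2) (⟨b, hb⟩, a, ⟨c, hc⟩)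
    rwa [Module.Basis.mk_apply] at h1
  have hfs : FilteredEq (monomialFiltration N g x y) (radPow H) f s₀.toLinearMap := by
    intro k
    change _ ≤ (radPow H (k + 1)).comap (f - s₀.toLinearMap)
    refine h.monomialFiltration_le fun b c a hb hc hk => ?_
    refine Submodule.smul_mem _ _ ?_
    rw [Submodule.mem_comap, LinearMap.sub_apply, hf b c a hb hc]
    exact hanti (Nat.succ_le_succ hk) ((hmono b c a).symm hanti).sub_mem
  -- The monomial map agrees with `s₀` to leading order, and therefore is itself a filtered
  -- isomorphism.
  obtain ⟨s, hsf, hs1, hs2⟩ := hfs.exists_equiv hs₀ hs₀' hanti radPow_zero hm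
  have hss : FilteredEq (monomialFiltration N g x y) (radPow H) s.toLinearMap s₀.toLinearMap := by
    rw [hsf]; exact hfs
  have hsm : ∀ (b c : ℕ) (a : ZMod N), b < N → c < M →
      s (skewMonomial g x y b a c) = skewMonomial g' x' y' b a c := fun b c a hb hc => by
    rw [← hf b c a hb hc, ← hsf]; rfl
  have hc₀ : FilteredEq (monomialFiltration N g x y) (tensorFiltration (radPow H) (radPow H))
      (Q.comul ∘ₗ s₀.toLinearMap)
      (TensorProduct.map s₀.toLinearMap s₀.toLinearMap ∘ₗ Q₀.comul) := by
    have h1 := (splitting_comul hQ hJ).comp_right hφg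
    have h2 : s₀.toLinearMap = splitting H ∘ₗ φ.symm.toLinearMap := LinearMap.ext hs
    have h3 : TensorProduct.map s₀.toLinearMap s₀.toLinearMap ∘ₗ Q₀.comul =
        (TensorProduct.map (splitting H) (splitting H) ∘ₗ (gr hQ hJ).comul) ∘ₗ
          φ.symm.toLinearMap := by
      refine LinearMap.ext fun t => ?_
      obtain ⟨u, rfl⟩ := φ.surjective t
      simp only [LinearMap.comp_apply, hφ1]
      have h4 : φ.symm.toLinearMap (φ u) = u := φ.symm_apply_apply u
      have h5 : (splitting H ∘ₗ φ.symm.toLinearMap) ∘ₗ φ.toLinearMap = splitting H :=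
        LinearMap.ext fun u => congrArg (splitting H) (φ.symm_apply_apply u)
      rw [h4, h2, ← LinearMap.comp_apply, ← TensorProduct.map_comp, h5]
    rw [h3, h2, ← LinearMap.comp_assoc]
    exact h1
  refine ⟨g', x', y', s, ⟨h.root, hg'N, hgx, hgy⟩, ⟨hs1, hs2, ?_, ?_, ?_⟩, hsm, ?_⟩
  · have h1 := hss.comp_left hF.comul
    have h2 : FilteredEq _ _ _ _ := hss.tensorMap hss hs₀ hs1
    exact (h1.trans hc₀).trans (h2.comp_right h.isGradedBy.comul).symm
  · have h1 := hsm 0 0 0 (NeZero.pos N) h.M_pos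
    rwa [SkewTriple.skewMonomial_zero, SkewTriple.skewMonomial_zero] at h1
  · refine LinearMap.ext fun t => ?_
    -- The maps `s` and `s₀` differ by elements of the radical, on which the counit is zero.
    have h1 := hss 0 t (by rw [h.monomialFiltration_zero]; exact Submodule.mem_top)
    have h2 := hJ.counit_eq_zero _ (mem_radPow_one.1 h1)
    rw [map_sub, sub_eq_zero] at h2
    have h3 := LinearMap.congr_fun (counit_splitting hQ hJ) (φ.symm t)
    have h4 := hφ2 (φ.symm t)
    rw [φ.apply_symm_apply] at h4
    rw [h4, ← h3]
    refine h2.trans ?_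
    exact congrArg Q.counit (hs t)
  · refine assoc_sub_one_mem hQ hJ ?_
    let φ₂ := TensorProduct.congr φ.toLinearEquiv φ.toLinearEquiv
    let φ₃ := TensorProduct.congr φ.toLinearEquiv φ₂
    apply φ₃.injective
    rw [h.assoc] at hφ3
    have h1 : φ₃ (gr hQ hJ).assoc = 1 := hφ3.symm
    rw [h1]
    change (1 : A ⊗[ℂ] (A ⊗[ℂ] A)) = φ 1 ⊗ₜ[ℂ] (φ 1 ⊗ₜ[ℂ] φ 1)
    rw [map_one]
    rfl

end IsBookAlgebra

/-! ## Bialgebras presented by operators on the dual side -/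

namespace QuasiHopfData

variable {H : Type*} [Ring H] [Algebra ℂ H] (Q : QuasiHopfData H)

/-- An endomorphism of `H` as a left comodule over itself. -/
def IsLeftComoduleMap (T : Module.End ℂ H) : Prop :=
  ∀ h, Q.comul (T h) = LinearMap.lTensor H T (Q.comul h)

/-- `a ⊗ b ↦ f(b) a`. -/
noncomputable def contractRight (f : H →ₗ[ℂ] ℂ) : H ⊗[ℂ] H →ₗ[ℂ] H :=
  (TensorProduct.rid ℂ H).toLinearMap ∘ₗ LinearMap.lTensor H f

theorem contractRight_tmul (f : H →ₗ[ℂ] ℂ) (a b : H) : contractRight f (a ⊗ₜ b) = f b • a := by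
  simp [contractRight]

/-- The action `h ↦ ∑ f(h₂) h₁` of a functional. -/
noncomputable def dualAction (f : H →ₗ[ℂ] ℂ) : Module.End ℂ H := contractRight f ∘ₗ Q.comul

/-- `a ⊗ b ↦ f(a) f'(b)`. -/
noncomputable def pairing (f f' : H →ₗ[ℂ] ℂ) : H ⊗[ℂ] H →ₗ[ℂ] ℂ :=
  LinearMap.mul' ℂ ℂ ∘ₗ TensorProduct.map f f'

theorem pairing_tmul (f f' : H →ₗ[ℂ] ℂ) (a b : H) : pairing f f' (a ⊗ₜ b) = f a * f' b := rfl

variable {Q}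

namespace IsLeftComoduleMap

theorem one : Q.IsLeftComoduleMap 1 := fun h => by
  change Q.comul h = LinearMap.lTensor H LinearMap.id (Q.comul h)
  rw [LinearMap.lTensor_id, LinearMap.id_apply]

theorem mul {S T : Module.End ℂ H} (hS : Q.IsLeftComoduleMap S) (hT : Q.IsLeftComoduleMap T) :
    Q.IsLeftComoduleMap (S * T) := fun h => by
  rw [Module.End.mul_apply, hS, hT, LinearMap.lTensor_mul, Module.End.mul_apply]

theorem pow {T : Module.End ℂ H} (hT : Q.IsLeftComoduleMap T) (n : ℕ) :
    Q.IsLeftComoduleMap (T ^ n) := by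
  induction n with
  | zero => rw [pow_zero]; exact one
  | succ n ih => rw [pow_succ]; exact ih.mul hT

theorem add {S T : Module.End ℂ H} (hS : Q.IsLeftComoduleMap S) (hT : Q.IsLeftComoduleMap T) :
    Q.IsLeftComoduleMap (S + T) := fun h => by
  rw [LinearMap.add_apply, map_add, hS, hT, LinearMap.lTensor_add, LinearMap.add_apply]

theorem smul {T : Module.End ℂ H} (hT : Q.IsLeftComoduleMap T) (c : ℂ) :
    Q.IsLeftComoduleMap (c • T) := fun h => by
  rw [LinearMap.smul_apply, map_smul, hT, LinearMap.lTensor_smul, LinearMap.smul_apply]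

theorem sub {S T : Module.End ℂ H} (hS : Q.IsLeftComoduleMap S) (hT : Q.IsLeftComoduleMap T) :
    Q.IsLeftComoduleMap (S - T) := fun h => by
  rw [LinearMap.sub_apply, map_sub, hS, hT, LinearMap.lTensor_sub, LinearMap.sub_apply]

theorem zero : Q.IsLeftComoduleMap 0 := fun h => by
  rw [LinearMap.zero_apply, map_zero, LinearMap.lTensor_zero, LinearMap.zero_apply]

theorem sum {ι : Type*} (s : Finset ι) {T : ι → Module.End ℂ H}
    (hT : ∀ i, Q.IsLeftComoduleMap (T i)) : Q.IsLeftComoduleMap (∑ i ∈ s, T i) := by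
  classical
  induction s using Finset.induction_on with
  | empty => rw [Finset.sum_empty]; exact zero
  | insert i s hi ih => rw [Finset.sum_insert hi]; exact (hT i).add ih

/-- `H` is cofree as a comodule over itself, so an endomorphism is recovered from its composite with
the counit. Identities between such operators may hence be tested after applying the counit. -/
theorem eq_dualAction (hQ : Q.IsQuasiBialgebra) {T : Module.End ℂ H}
    (hT : Q.IsLeftComoduleMap T) : T = Q.dualAction (Q.counit ∘ₗ T) := by
  refine LinearMap.ext fun h => ?_
  rw [← hQ.counitRight_comul (T h), hT]
  simp only [counitRight, dualAction, contractRight, LinearMap.comp_apply,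
    LinearMap.lTensor_comp]

theorem ext (hQ : Q.IsQuasiBialgebra) {S T : Module.End ℂ H} (hS : Q.IsLeftComoduleMap S)
    (hT : Q.IsLeftComoduleMap T) (h : ∀ a, Q.counit (S a) = Q.counit (T a)) : S = T := by
  rw [hS.eq_dualAction hQ, hT.eq_dualAction hQ]
  congr 1
  exact LinearMap.ext h

/-- Composition of operators corresponds to convolution of functionals, so left comodule
endomorphisms are a model of the dual algebra. -/
theorem counit_mul_apply (hQ : Q.IsQuasiBialgebra) (S : Module.End ℂ H) {T : Module.End ℂ H}
    (hT : Q.IsLeftComoduleMap T) (h : H) : Q.counit ((S * T) h) =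
      pairing (Q.counit ∘ₗ S) (Q.counit ∘ₗ T) (Q.comul h) := by
  rw [Module.End.mul_apply]
  conv_lhs => rw [hT.eq_dualAction hQ]
  rw [dualAction, LinearMap.comp_apply]
  induction Q.comul h using TensorProduct.induction_on with
  | zero => simp
  | add x y hx hy => simp only [map_add, hx, hy]
  | tmul x y => rw [contractRight_tmul, map_smul, map_smul, pairing_tmul, smul_eq_mul, mul_comm]; rfl

end IsLeftComoduleMap

/-- This is coassociativity, which is why the associator has to be trivialised before passing to the
dual side. -/
theorem isLeftComoduleMap_dualAction
    (hc : ∀ a, Q.comulRight (Q.comul a) = Q.comulLeft (Q.comul a)) (f : H →ₗ[ℂ] ℂ) :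
    Q.IsLeftComoduleMap (Q.dualAction f) := by
  intro h
  have h1 : ∀ t : H ⊗[ℂ] H, Q.comul (contractRight f t) =
      LinearMap.lTensor H (contractRight f) (Q.comulLeft t) := by
    intro t
    induction t using TensorProduct.induction_on with
    | zero => simp
    | add x y hx hy => simp only [map_add, hx, hy]
    | tmul x y =>
      rw [contractRight_tmul, map_smul]
      change _ = LinearMap.lTensor H (contractRight f) (TensorProduct.assoc ℂ H H H (Q.comul x ⊗ₜ y))
      induction Q.comul x using TensorProduct.induction_on with
      | zero => simp
      | add x y hx hy => simp only [map_add, hx, hy, TensorProduct.add_tmul, smul_add]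
      | tmul u v => simp [contractRight_tmul]
  rw [dualAction, LinearMap.comp_apply, h1, ← hc, LinearMap.lTensor_comp, LinearMap.comp_apply]
  rfl

theorem dualAction_counit (hQ : Q.IsQuasiBialgebra) : Q.dualAction Q.counit = 1 :=
  LinearMap.ext hQ.counitRight_comul

/-- A product rule for functionals yields a product rule for their actions. -/
theorem dualAction_mul (hQ : Q.IsQuasiBialgebra) {f f₁ f₂ f₃ f₄ : H →ₗ[ℂ] ℂ}
    (hf : ∀ a b, f (a * b) = f₁ a * f₂ b + f₃ a * f₄ b) (a b : H) :
    Q.dualAction f (a * b) = Q.dualAction f₁ a * Q.dualAction f₂ b +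
      Q.dualAction f₃ a * Q.dualAction f₄ b := by
  simp only [dualAction, LinearMap.comp_apply, hQ.comul_mul]
  induction Q.comul a using TensorProduct.induction_on with
  | zero => simp
  | add x y hx hy => simp only [map_add, add_mul, hx, hy]; abel
  | tmul x y =>
    induction Q.comul b using TensorProduct.induction_on with
    | zero => simp
    | add x y hx hy => simp only [map_add, mul_add, hx, hy]; abel
    | tmul u v =>
      simp only [Algebra.TensorProduct.tmul_mul_tmul, contractRight_tmul, hf, smul_mul_smul_comm,
        add_smul]

end QuasiHopfData

/-- The projection to the eigenspace of `C` for the eigenvalue `q ^ a`, if `C ^ N = 1`. -/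
noncomputable def fourierProjection {R : Type*} [Ring R] [Algebra ℂ R] {N : ℕ} [NeZero N] (q : ℂ)
    (C : R) (a : ZMod N) : R := (N : ℂ)⁻¹ • ∑ j : ZMod N, q ^ (-(j * a)).val • C ^ j.val

/-! ### Spectral projections of an element of order `N`. -/

section Fourier

variable {R : Type*} [Ring R] [Algebra ℂ R] {N : ℕ} [NeZero N] {q : ℂ} {C X : R}

theorem pow_mul_fourierProjection (hq : IsPrimitiveRoot q N) (hC : C ^ N = 1) (i a : ZMod N) :
    C ^ i.val * fourierProjection q C a = q ^ (i * a).val • fourierProjection q C a := by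
  rw [fourierProjection, mul_smul_comm, smul_comm]
  congr 1
  rw [Finset.mul_sum, Finset.smul_sum]
  rw [← Equiv.sum_comp (Equiv.addLeft i) fun j => q ^ (i * a).val • q ^ (-(j * a)).val • C ^ j.val]
  refine Finset.sum_congr rfl fun j _ => ?_
  rw [mul_smul_comm, ← pow_val_add hC, smul_smul, ← pow_val_add hq.pow_eq_one]
  congr 3
  simp only [Equiv.coe_addLeft]
  ring

theorem fourierProjection_mul (hq : IsPrimitiveRoot q N) (hC : C ^ N = 1) (a b : ZMod N) :
    fourierProjection q C a * fourierProjection q C b =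
      if a = b then fourierProjection q C b else 0 := by
  conv_lhs => rw [fourierProjection]
  rw [smul_mul_assoc, Finset.sum_mul]
  have h1 : ∀ j : ZMod N, (q ^ (-(j * a)).val • C ^ j.val) * fourierProjection q C b =
      q ^ (j * (b - a)).val • fourierProjection q C b := by
    intro j
    rw [smul_mul_assoc, pow_mul_fourierProjection hq hC, smul_smul, ← pow_val_add hq.pow_eq_one]
    congr 3
    ring
  simp only [h1]
  rw [← Finset.sum_smul, sum_root_pow hq, smul_smul]
  simp only [sub_eq_zero, eq_comm (a := b)]
  split_ifs
  · rw [inv_mul_cancel₀ (Nat.cast_ne_zero.2 (NeZero.ne N)), one_smul]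
  · rw [mul_zero, zero_smul]

/-- The spectral decomposition of the powers of `C`; for `i = 0` it says that the projections sum to
`1`. -/
theorem sum_fourierProjection (hq : IsPrimitiveRoot q N) (i : ZMod N) :
    ∑ a : ZMod N, q ^ (i * a).val • fourierProjection q C a = C ^ i.val := by
  simp only [fourierProjection, Finset.smul_sum, smul_smul]
  rw [Finset.sum_comm]
  have h1 : ∀ j : ZMod N, ∑ a : ZMod N,
      (q ^ (i * a).val * ((N : ℂ)⁻¹ * q ^ (-(j * a)).val)) • C ^ j.val =
      (if i - j = 0 then 1 else 0 : ℂ) • C ^ j.val := by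
    intro j
    rw [← Finset.sum_smul]
    congr 1
    have h2 : ∀ a : ZMod N, q ^ (i * a).val * ((N : ℂ)⁻¹ * q ^ (-(j * a)).val) =
        (N : ℂ)⁻¹ * q ^ (a * (i - j)).val := by
      intro a
      rw [show a * (i - j) = i * a + -(j * a) by ring, pow_val_add hq.pow_eq_one]
      ring
    simp only [h2]
    rw [← Finset.mul_sum, sum_root_pow hq]
    split_ifs
    · rw [inv_mul_cancel₀ (Nat.cast_ne_zero.2 (NeZero.ne N))]
    · rw [mul_zero]
  simp only [h1, sub_eq_zero, ite_smul, one_smul, zero_smul]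
  simp

/-- `X` lowers the exponent of the eigenvalue of `C` by one. -/
theorem fourierProjection_mul_of_skew (hq : IsPrimitiveRoot q N) (hX : C * X = q⁻¹ • (X * C))
    (a : ZMod N) : fourierProjection q C a * X = X * fourierProjection q C (a + 1) := by
  rw [fourierProjection, fourierProjection, smul_mul_assoc, mul_smul_comm, Finset.sum_mul,
    Finset.mul_sum]
  congr 1
  refine Finset.sum_congr rfl fun j _ => ?_
  rw [smul_mul_assoc, mul_smul_comm, skew_pow_mul hX, smul_smul]
  congr 1
  rw [show -(j * (a + 1)) = -(j * a) + -j by ring, pow_val_add hq.pow_eq_one]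
  congr 1
  have h1 := pow_val_neg_mul hq.pow_eq_one j
  rw [inv_pow]
  exact (eq_inv_of_mul_eq_one_left h1).symm

theorem fourierProjection_mul_pow (hq : IsPrimitiveRoot q N) (hX : C * X = q⁻¹ • (X * C))
    (a : ZMod N) (n : ℕ) :
    fourierProjection q C a * X ^ n = X ^ n * fourierProjection q C (a + (n : ZMod N)) := by
  induction n with
  | zero => simp
  | succ n ih =>
    rw [pow_succ, ← mul_assoc, ih, mul_assoc, fourierProjection_mul_of_skew hq hX, ← mul_assoc]
    congr 2
    push_cast
    ring

end Fourier

/-- `X ^ b Y ^ c p_{a + b}`. -/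
noncomputable def dualMonomial {R : Type*} [Ring R] [Algebra ℂ R] {N : ℕ} [NeZero N] (q : ℂ)
    (C X Y : R) (b : ℕ) (a : ZMod N) (c : ℕ) : R :=
  X ^ b * Y ^ c * fourierProjection q C (a + (b : ZMod N))

/-! ### Bialgebras determined by dual generators. -/

namespace QuasiHopfData

/-- Operators on a bialgebra that correspond to generators of the dual of a book algebra. -/
structure DualGenerators {H : Type*} [Ring H] [Algebra ℂ H] (Q : QuasiHopfData H) (N M : ℕ)
    [NeZero N] (q : ℂ) (C X Y : Module.End ℂ H) : Prop where
  root : IsPrimitiveRoot q N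
  C_comodule : Q.IsLeftComoduleMap C
  X_comodule : Q.IsLeftComoduleMap X
  Y_comodule : Q.IsLeftComoduleMap Y
  C_mul : ∀ a b, C (a * b) = C a * C b
  X_mul : ∀ a b, X (a * b) = X a * b + C a * X b
  Y_mul : ∀ a b, Y (a * b) = a * Y b + Y a * C b
  C_pow : C ^ N = 1
  C_X : C * X = q⁻¹ • (X * C)
  C_Y : C * Y = q⁻¹ • (Y * C)
  X_pow : X ^ N = 0
  Y_pow : Y ^ M = 0
  X_Y : X * Y = Y * X
  -- The functionals of the dual monomials form a basis of the dual space.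
  bijective : Function.Bijective fun (h : H) (i : Fin N × ZMod N × Fin M) =>
    Q.counit (dualMonomial q C X Y i.1 i.2.1 i.2.2 h)

namespace DualGenerators

variable {H : Type*} [Ring H] [Algebra ℂ H] {Q : QuasiHopfData H} {N M : ℕ} [NeZero N] {q : ℂ}
  {C X Y : Module.End ℂ H}

theorem dualMonomial_eq_zero (D : Q.DualGenerators N M q C X Y) {b c : ℕ} (a : ZMod N)
    (h : N ≤ b ∨ M ≤ c) : dualMonomial q C X Y b a c = 0 := by
  rcases h with h | h
  · rw [dualMonomial, ← Nat.sub_add_cancel h, pow_add, D.X_pow]; simp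
  · rw [dualMonomial, ← Nat.sub_add_cancel h, pow_add, D.Y_pow]; simp

/-- The projections are moved to the right past powers of `X` and `Y`, shifting their index. The
structure constants involve nothing of `H` itself, so the dual algebras of any two such bialgebras
coincide. -/
theorem dualMonomial_mul (D : Q.DualGenerators N M q C X Y) (b b' c c' : ℕ) (a a' : ZMod N) :
    dualMonomial q C X Y b a c * dualMonomial q C X Y b' a' c' =
      if a + (c' : ZMod N) + (b : ZMod N) = a' then
        dualMonomial q C X Y (b + b') (a + (c' : ZMod N)) (c + c') else 0 := by
  have h1 : Commute Y X := D.X_Y.symm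
  have h2 : Y ^ c * X ^ b' = X ^ b' * Y ^ c := (h1.pow_pow c b').eq
  simp only [dualMonomial]
  calc _ = X ^ b * Y ^ c * (fourierProjection q C (a + (b : ZMod N)) * X ^ b') * Y ^ c' *
        fourierProjection q C (a' + (b' : ZMod N)) := by simp only [mul_assoc]
    _ = X ^ b * (Y ^ c * X ^ b') * Y ^ c' *
        (fourierProjection q C (a + (b : ZMod N) + (b' : ZMod N) + (c' : ZMod N)) *
          fourierProjection q C (a' + (b' : ZMod N))) := by
        rw [fourierProjection_mul_pow D.root D.C_X, mul_assoc _ (X ^ b' * _) (Y ^ c'),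
          mul_assoc (X ^ b') _ (Y ^ c'), fourierProjection_mul_pow D.root D.C_Y]
        simp only [mul_assoc]
    _ = _ := by
        rw [fourierProjection_mul D.root D.C_pow, h2]
        have e : a + (b : ZMod N) + (b' : ZMod N) + (c' : ZMod N) = a' + (b' : ZMod N) ↔
            a + (c' : ZMod N) + (b : ZMod N) = a' := by
          constructor <;> intro h <;> linear_combination h
        simp only [e]
        split_ifs with h3
        · rw [← h3, pow_add, pow_add]
          simp only [mul_assoc]
          congr 5
          push_cast
          ring
        · rw [mul_zero]

theorem comodule (D : Q.DualGenerators N M q C X Y) (b c : ℕ) (a : ZMod N) :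
    Q.IsLeftComoduleMap (dualMonomial q C X Y b a c) :=
  ((D.X_comodule.pow b).mul (D.Y_comodule.pow c)).mul
    ((IsLeftComoduleMap.sum _ fun _ => (D.C_comodule.pow _).smul _).smul _)

/-- The generators are expanded in dual monomials by means of the partition of unity; this and the
next three lemmas show that the comparison map matches their functionals. -/
theorem X_eq_sum (D : Q.DualGenerators N M q C X Y) :
    X = ∑ a : ZMod N, dualMonomial q C X Y 1 a 0 := by
  have h := sum_fourierProjection (C := C) D.root 0
  simp only [zero_mul, ZMod.val_zero, pow_zero, one_smul] at h
  have h2 : ∑ a : ZMod N, fourierProjection q C (a + 1) = 1 := by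
    rw [← h]
    exact Fintype.sum_equiv (Equiv.addRight 1) _ _ fun a => rfl
  simp only [dualMonomial, pow_one, pow_zero, mul_one, Nat.cast_one]
  rw [← Finset.mul_sum, h2, mul_one]

theorem Y_eq_sum (D : Q.DualGenerators N M q C X Y) :
    Y = ∑ a : ZMod N, dualMonomial q C X Y 0 a 1 := by
  have h := sum_fourierProjection (C := C) D.root 0
  simp only [zero_mul, ZMod.val_zero, pow_zero, one_smul] at h
  simp only [dualMonomial, pow_one, pow_zero, one_mul, Nat.cast_zero, add_zero]
  rw [← Finset.mul_sum, h, mul_one]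

theorem C_eq_sum (D : Q.DualGenerators N M q C X Y) :
    C = ∑ a : ZMod N, q ^ a.val • dualMonomial q C X Y 0 a 0 := by
  have h := sum_fourierProjection (C := C) D.root 1
  rw [pow_val_one D.C_pow] at h
  simp only [dualMonomial, pow_zero, one_mul, Nat.cast_zero, add_zero]
  simpa only [one_mul] using h.symm

theorem one_eq_sum (D : Q.DualGenerators N M q C X Y) :
    1 = ∑ a : ZMod N, dualMonomial q C X Y 0 a 0 := by
  have h := sum_fourierProjection (C := C) D.root 0
  simp only [zero_mul, ZMod.val_zero, pow_zero, one_smul] at h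
  simp only [dualMonomial, pow_zero, one_mul, Nat.cast_zero, add_zero]
  exact h.symm

/-- The linear equivalence given by the dual monomials. -/
noncomputable def coords (D : Q.DualGenerators N M q C X Y) :
    H ≃ₗ[ℂ] (Fin N × ZMod N × Fin M → ℂ) :=
  LinearEquiv.ofBijective
    (LinearMap.pi fun i : Fin N × ZMod N × Fin M =>
      Q.counit ∘ₗ dualMonomial q C X Y i.1 i.2.1 i.2.2) D.bijective

theorem coords_apply (D : Q.DualGenerators N M q C X Y) (h : H) (i : Fin N × ZMod N × Fin M) :
    D.coords h i = Q.counit (dualMonomial q C X Y i.1 i.2.1 i.2.2 h) := rfl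

theorem ext (D : Q.DualGenerators N M q C X Y) {h h' : H}
    (hh : ∀ (b c : ℕ) (a : ZMod N), Q.counit (dualMonomial q C X Y b a c h) =
      Q.counit (dualMonomial q C X Y b a c h')) : h = h' :=
  D.bijective.1 (funext fun _ => hh _ _ _)

theorem tensor_ext (D : Q.DualGenerators N M q C X Y) {t t' : H ⊗[ℂ] H}
    (hh : ∀ (b c b' c' : ℕ) (a a' : ZMod N),
      pairing (Q.counit ∘ₗ dualMonomial q C X Y b a c)
        (Q.counit ∘ₗ dualMonomial q C X Y b' a' c') t =
      pairing (Q.counit ∘ₗ dualMonomial q C X Y b a c)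
        (Q.counit ∘ₗ dualMonomial q C X Y b' a' c') t') : t = t' := by
  let β := (Module.Basis.ofEquivFun D.coords).tensorProduct (Module.Basis.ofEquivFun D.coords)
  have hβ : ∀ t i j, β.repr t (i, j) =
      pairing (Q.counit ∘ₗ dualMonomial q C X Y i.1 i.2.1 i.2.2)
        (Q.counit ∘ₗ dualMonomial q C X Y j.1 j.2.1 j.2.2) t := by
    intro t i j
    induction t using TensorProduct.induction_on with
    | zero => simp
    | tmul x y =>
      rw [pairing_tmul]
      simp [β, Module.Basis.tensorProduct_repr_tmul_apply, coords_apply, mul_comm]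
    | add x y hx hy => rw [map_add, Finsupp.add_apply, hx, hy, map_add]
  apply β.repr.injective
  ext ⟨i, j⟩
  rw [hβ, hβ]
  exact hh _ _ _ _ _ _

section Comparison

variable {A : Type*} [Ring A] [Algebra ℂ A] {Q' : QuasiHopfData A} {C' X' Y' : Module.End ℂ A}

/-- The comparison map between two bialgebras with dual generators. -/
noncomputable def comparison (D : Q.DualGenerators N M q C X Y)
    (D' : Q'.DualGenerators N M q C' X' Y') : H ≃ₗ[ℂ] A := D.coords.trans D'.coords.symm

theorem counit_dualMonomial_comparison (D : Q.DualGenerators N M q C X Y)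
    (D' : Q'.DualGenerators N M q C' X' Y') (b c : ℕ) (a : ZMod N) (h : H) :
    Q'.counit (dualMonomial q C' X' Y' b a c (D.comparison D' h)) =
      Q.counit (dualMonomial q C X Y b a c h) := by
  by_cases hbc : N ≤ b ∨ M ≤ c
  · rw [D.dualMonomial_eq_zero a hbc, D'.dualMonomial_eq_zero a hbc]
    simp
  · rw [not_or, not_le, not_le] at hbc
    have h1 := D'.coords_apply (D.comparison D' h) (⟨b, hbc.1⟩, a, ⟨c, hbc.2⟩)
    rw [comparison, LinearEquiv.trans_apply, LinearEquiv.apply_symm_apply] at h1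
    exact h1.symm

theorem counit_comparison (D : Q.DualGenerators N M q C X Y)
    (D' : Q'.DualGenerators N M q C' X' Y') (h : H) :
    Q'.counit (D.comparison D' h) = Q.counit h := by
  have e : Q.counit h = Q.counit ((∑ a : ZMod N, dualMonomial q C X Y 0 a 0) h) := by
    rw [← D.one_eq_sum]; rfl
  have e' : Q'.counit (D.comparison D' h) =
      Q'.counit ((∑ a : ZMod N, dualMonomial q C' X' Y' 0 a 0) (D.comparison D' h)) := by
    rw [← D'.one_eq_sum]; rfl
  rw [e, e', LinearMap.sum_apply, LinearMap.sum_apply, map_sum, map_sum]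
  exact Finset.sum_congr rfl fun a _ => counit_dualMonomial_comparison D D' _ _ _ h

theorem pairing_map (D : Q.DualGenerators N M q C X Y)
    (D' : Q'.DualGenerators N M q C' X' Y') (b c b' c' : ℕ) (a a' : ZMod N) (t : H ⊗[ℂ] H) :
    pairing (Q'.counit ∘ₗ dualMonomial q C' X' Y' b a c)
      (Q'.counit ∘ₗ dualMonomial q C' X' Y' b' a' c')
      (TensorProduct.map (D.comparison D').toLinearMap (D.comparison D').toLinearMap t) =
    pairing (Q.counit ∘ₗ dualMonomial q C X Y b a c)
      (Q.counit ∘ₗ dualMonomial q C X Y b' a' c') t := by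
  induction t using TensorProduct.induction_on with
  | zero => simp
  | add x y hx hy => simp only [map_add, hx, hy]
  | tmul x y =>
    rw [TensorProduct.map_tmul, pairing_tmul, pairing_tmul]
    congr 1 <;> exact counit_dualMonomial_comparison D D' _ _ _ _

/-- Pairing the coproduct with two functionals is evaluation of their product, and products of dual
monomials obey the same rule on both sides. -/
theorem comul_comparison (D : Q.DualGenerators N M q C X Y)
    (D' : Q'.DualGenerators N M q C' X' Y') (hQ : Q.IsQuasiBialgebra) (hQ' : Q'.IsQuasiBialgebra)
    (h : H) : Q'.comul (D.comparison D' h) =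
      TensorProduct.map (D.comparison D').toLinearMap (D.comparison D').toLinearMap
        (Q.comul h) := by
  refine D'.tensor_ext fun b c b' c' a a' => ?_
  rw [pairing_map, ← (D'.comodule _ _ _).counit_mul_apply hQ', ← (D.comodule _ _ _).counit_mul_apply hQ,
    D.dualMonomial_mul, D'.dualMonomial_mul]
  split_ifs
  · exact counit_dualMonomial_comparison D D' _ _ _ h
  · simp

/-- Operators `T` on `H` and `T'` on `A` whose functionals agree on products. -/
def ProductCompatible (D : Q.DualGenerators N M q C X Y)
    (D' : Q'.DualGenerators N M q C' X' Y') (T : Module.End ℂ H) (T' : Module.End ℂ A) : Prop :=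
  ∀ a b, Q'.counit (T' (D.comparison D' a * D.comparison D' b)) = Q.counit (T (a * b))

/-- A convolution product evaluated at `a * b` depends only on the values of its factors at products
of components of the coproducts. So compatibility with multiplication need only be verified for `C`,
`X`, `Y`. -/
theorem ProductCompatible.mul {D : Q.DualGenerators N M q C X Y}
    {D' : Q'.DualGenerators N M q C' X' Y'} (hQ : Q.IsQuasiBialgebra) (hQ' : Q'.IsQuasiBialgebra)
    {S T : Module.End ℂ H} {S' T' : Module.End ℂ A} (hT : Q.IsLeftComoduleMap T)
    (hT' : Q'.IsLeftComoduleMap T') (h1 : ProductCompatible D D' S S')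
    (h2 : ProductCompatible D D' T T') : ProductCompatible D D' (S * T) (S' * T') := by
  intro a b
  rw [hT.counit_mul_apply hQ, hT'.counit_mul_apply hQ', hQ.comul_mul, hQ'.comul_mul,
    comul_comparison D D' hQ hQ', comul_comparison D D' hQ hQ']
  induction Q.comul a using TensorProduct.induction_on with
  | zero => simp
  | add x y hx hy => simp only [map_add, add_mul, hx, hy]
  | tmul x y =>
    induction Q.comul b using TensorProduct.induction_on with
    | zero => simp
    | add x y hx hy => simp only [map_add, mul_add, hx, hy]
    | tmul u v =>
      simp only [TensorProduct.map_tmul, Algebra.TensorProduct.tmul_mul_tmul, pairing_tmul]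
      congr 1
      · exact h1 _ _
      · exact h2 _ _

theorem ProductCompatible.one {D : Q.DualGenerators N M q C X Y}
    {D' : Q'.DualGenerators N M q C' X' Y'} (hQ : Q.IsQuasiBialgebra)
    (hQ' : Q'.IsQuasiBialgebra) : ProductCompatible D D' 1 1 := by
  intro a b
  change Q'.counit (_ * _) = Q.counit (_ * _)
  rw [hQ.counit_mul, hQ'.counit_mul, counit_comparison, counit_comparison]

theorem ProductCompatible.pow {D : Q.DualGenerators N M q C X Y}
    {D' : Q'.DualGenerators N M q C' X' Y'} (hQ : Q.IsQuasiBialgebra) (hQ' : Q'.IsQuasiBialgebra)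
    {T : Module.End ℂ H} {T' : Module.End ℂ A} (hT : Q.IsLeftComoduleMap T)
    (hT' : Q'.IsLeftComoduleMap T') (h : ProductCompatible D D' T T') (n : ℕ) :
    ProductCompatible D D' (T ^ n) (T' ^ n) := by
  induction n with
  | zero => rw [pow_zero, pow_zero]; exact one hQ hQ'
  | succ n ih => rw [pow_succ, pow_succ]; exact ih.mul hQ hQ' hT hT' h

/-- The product rules express the functionals of `C`, `X`, `Y` at `a * b` through their values at
`a` and `b`, by the same formulas on both sides; the dual monomials then separate points. -/
theorem mul_comparison (D : Q.DualGenerators N M q C X Y)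
    (D' : Q'.DualGenerators N M q C' X' Y') (hQ : Q.IsQuasiBialgebra) (hQ' : Q'.IsQuasiBialgebra)
    (a b : H) : D.comparison D' (a * b) = D.comparison D' a * D.comparison D' b := by
  have hX : ∀ h, Q'.counit (X' (D.comparison D' h)) = Q.counit (X h) := by
    intro h
    rw [LinearMap.congr_fun D'.X_eq_sum, LinearMap.congr_fun D.X_eq_sum, LinearMap.sum_apply,
      LinearMap.sum_apply, map_sum, map_sum]
    exact Finset.sum_congr rfl fun a _ => counit_dualMonomial_comparison D D' _ _ _ h
  have hY : ∀ h, Q'.counit (Y' (D.comparison D' h)) = Q.counit (Y h) := by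
    intro h
    rw [LinearMap.congr_fun D'.Y_eq_sum, LinearMap.congr_fun D.Y_eq_sum, LinearMap.sum_apply,
      LinearMap.sum_apply, map_sum, map_sum]
    exact Finset.sum_congr rfl fun a _ => counit_dualMonomial_comparison D D' _ _ _ h
  have hC : ∀ h, Q'.counit (C' (D.comparison D' h)) = Q.counit (C h) := by
    intro h
    rw [LinearMap.congr_fun D'.C_eq_sum, LinearMap.congr_fun D.C_eq_sum, LinearMap.sum_apply,
      LinearMap.sum_apply, map_sum, map_sum]
    refine Finset.sum_congr rfl fun a _ => ?_
    rw [LinearMap.smul_apply, LinearMap.smul_apply, map_smul, map_smul,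
      counit_dualMonomial_comparison]
  have pC : ProductCompatible D D' C C' := fun a b => by
    rw [D.C_mul, D'.C_mul, hQ.counit_mul, hQ'.counit_mul, hC, hC]
  have pX : ProductCompatible D D' X X' := fun a b => by
    rw [D.X_mul, D'.X_mul, map_add, map_add, hQ.counit_mul, hQ'.counit_mul, hQ.counit_mul,
      hQ'.counit_mul, hC, hX, hX, counit_comparison]
  have pY : ProductCompatible D D' Y Y' := fun a b => by
    rw [D.Y_mul, D'.Y_mul, map_add, map_add, hQ.counit_mul, hQ'.counit_mul, hQ.counit_mul,
      hQ'.counit_mul, hC, hY, hY, counit_comparison]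
  have pP : ∀ a : ZMod N, ProductCompatible D D' (fourierProjection q C a)
      (fourierProjection q C' a) := by
    intro a u v
    simp only [fourierProjection, LinearMap.smul_apply, LinearMap.sum_apply, map_smul, map_sum]
    congr 1
    refine Finset.sum_congr rfl fun j _ => ?_
    rw [pC.pow hQ hQ' D.C_comodule D'.C_comodule]
  refine D'.ext fun r s m => ?_
  rw [counit_dualMonomial_comparison]
  have cP := (IsLeftComoduleMap.sum Finset.univ fun j : ZMod N =>
    (D.C_comodule.pow j.val).smul (q ^ (-(j * (m + (r : ZMod N)))).val)).smul ((N : ℂ)⁻¹)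
  have cP' := (IsLeftComoduleMap.sum Finset.univ fun j : ZMod N =>
    (D'.C_comodule.pow j.val).smul (q ^ (-(j * (m + (r : ZMod N)))).val)).smul ((N : ℂ)⁻¹)
  exact ((((pX.pow hQ hQ' D.X_comodule D'.X_comodule r).mul hQ hQ' (D.Y_comodule.pow s)
    (D'.Y_comodule.pow s) (pY.pow hQ hQ' D.Y_comodule D'.Y_comodule s)).mul hQ hQ' cP cP'
    (pP _)) a b).symm

/-- Two bialgebras with dual generators are isomorphic. -/
theorem exists_algEquiv (D : Q.DualGenerators N M q C X Y)
    (D' : Q'.DualGenerators N M q C' X' Y') (hQ : Q.IsQuasiBialgebra)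
    (hQ' : Q'.IsQuasiBialgebra) : ∃ Ψ : H ≃ₐ[ℂ] A,
      (∀ h, Q'.comul (Ψ h) = TensorProduct.map Ψ.toLinearMap Ψ.toLinearMap (Q.comul h)) ∧
      ∀ h, Q'.counit (Ψ h) = Q.counit h := by
  -- The image of `1` is a left identity for the image of the map, which is everything.
  have h1 : D.comparison D' 1 = 1 := by
    obtain ⟨u, hu⟩ := (D.comparison D').surjective 1
    have h2 := mul_comparison D D' hQ hQ' 1 u
    rw [one_mul, hu, mul_one] at h2
    exact h2.symm
  exact ⟨AlgEquiv.ofLinearEquiv (D.comparison D') h1 (mul_comparison D D' hQ hQ'),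
    comul_comparison D D' hQ hQ', counit_comparison D D'⟩

end Comparison

end DualGenerators

end QuasiHopfData

/-- If `u v = q v u` with `q` a primitive `N`-th root of unity, then
`(v + u) ^ N = v ^ N + u ^ N`. -/
theorem skew_add_pow_eq_add {B : Type*} [Ring B] [Algebra ℂ B] {q : ℂ} {N : ℕ} (hN : N ≠ 0)
    (hq : IsPrimitiveRoot q N) {u v : B} (h : u * v = q • (v * u)) :
    (v + u) ^ N = v ^ N + u ^ N := by
  obtain ⟨M, rfl⟩ := Nat.exists_eq_succ_of_ne_zero hN
  rw [skew_add_pow h, Finset.sum_range_succ, Finset.sum_range_succ', Finset.sum_eq_zero]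
  · simp [qBinom_zero_right, qBinom_self, add_comm]
  intro k hk
  rw [Finset.mem_range] at hk
  have h1 := qBinom_mul q M k
  rw [hq.pow_eq_one, sub_self, zero_mul] at h1
  have h2 : (1 : ℂ) - q ^ (k + 1) ≠ 0 := fun h3 =>
    hq.pow_ne_one_of_pos_of_lt (Nat.succ_ne_zero k) (by omega) (sub_eq_zero.1 h3).symm
  rw [(mul_eq_zero.1 h1).resolve_left h2, zero_smul]

/-! ## Operators of a given degree on filtered spaces -/

section HasSymbol

variable {V W : Type*} [AddCommGroup V] [Module ℂ V] [AddCommGroup W] [Module ℂ W]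
  {O : ℕ → Submodule ℂ V} {P : ℕ → Submodule ℂ W} {s : V ≃ₗ[ℂ] W}

/-- The operator `T` lowers the filtration by `d`, and agrees with `T₀` modulo terms of higher
degree. -/
def HasSymbol (O : ℕ → Submodule ℂ V) (P : ℕ → Submodule ℂ W) (s : V ≃ₗ[ℂ] W) (d : ℕ)
    (T : Module.End ℂ W) (T₀ : Module.End ℂ V) : Prop :=
  (∀ k, ∀ v ∈ P (k + d), T v ∈ P k) ∧ ∀ k, ∀ u ∈ O (k + d), T (s u) - s (T₀ u) ∈ P (k + 1)

namespace HasSymbol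

variable {d e : ℕ} {S T : Module.End ℂ W} {S₀ T₀ : Module.End ℂ V}

theorem mul (hP : Antitone P) (hs : FilteredMap O P s.toLinearMap)
    (hs' : FilteredMap P O s.symm.toLinearMap) (hS : HasSymbol O P s e S S₀)
    (hT : HasSymbol O P s d T T₀) : HasSymbol O P s (e + d) (S * T) (S₀ * T₀) := by
  refine ⟨fun k v hv => hS.1 k _ (hT.1 _ _ (by rwa [add_assoc])), fun k u hu => ?_⟩
  rw [← add_assoc] at hu
  have h1 := hT.2 _ u hu
  have h2 : T₀ u ∈ O (k + e) := by
    have h3 := sub_mem (hT.1 _ _ (hs _ u hu)) (hP (Nat.le_succ _) h1)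
    have h4 := hs' _ _ h3
    rw [LinearEquiv.coe_coe, LinearEquiv.coe_coe, sub_sub_cancel, LinearEquiv.symm_apply_apply]
      at h4
    exact h4
  have h3 := add_mem (hS.1 (k + 1) (T (s u) - s (T₀ u)) (by rwa [add_right_comm])) (hS.2 _ _ h2)
  rw [map_sub, sub_add_sub_cancel] at h3
  exact h3

theorem one : HasSymbol O P s 0 1 1 :=
  ⟨fun _ _ hv => hv, fun k u _ => by
    rw [Module.End.one_apply, Module.End.one_apply, sub_self]; exact zero_mem _⟩

theorem add (hS : HasSymbol O P s d S S₀) (hT : HasSymbol O P s d T T₀) :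
    HasSymbol O P s d (S + T) (S₀ + T₀) :=
  ⟨fun k v hv => add_mem (hS.1 k v hv) (hT.1 k v hv), fun k u hu => by
    rw [LinearMap.add_apply, LinearMap.add_apply, map_add, add_sub_add_comm]
    exact add_mem (hS.2 k u hu) (hT.2 k u hu)⟩

theorem smul (hT : HasSymbol O P s d T T₀) (c : ℂ) : HasSymbol O P s d (c • T) (c • T₀) :=
  ⟨fun k v hv => Submodule.smul_mem _ _ (hT.1 k v hv), fun k u hu => by
    rw [LinearMap.smul_apply, LinearMap.smul_apply, map_smul, ← smul_sub]
    exact Submodule.smul_mem _ _ (hT.2 k u hu)⟩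

theorem sub (hS : HasSymbol O P s d S S₀) (hT : HasSymbol O P s d T T₀) :
    HasSymbol O P s d (S - T) (S₀ - T₀) := by
  rw [sub_eq_add_neg, sub_eq_add_neg, ← neg_one_smul ℂ T, ← neg_one_smul ℂ T₀]
  exact hS.add (hT.smul _)

theorem zero : HasSymbol O P s d 0 0 :=
  ⟨fun _ _ _ => zero_mem _, fun _ _ _ => by simp⟩

theorem sum {ι : Type*} (t : Finset ι) {T : ι → Module.End ℂ W} {T₀ : ι → Module.End ℂ V}
    (h : ∀ i, HasSymbol O P s d (T i) (T₀ i)) :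
    HasSymbol O P s d (∑ i ∈ t, T i) (∑ i ∈ t, T₀ i) := by
  classical
  induction t using Finset.induction_on with
  | empty => rw [Finset.sum_empty, Finset.sum_empty]; exact zero
  | insert i t hi ih => rw [Finset.sum_insert hi, Finset.sum_insert hi]; exact (h i).add ih

theorem pow (hP : Antitone P) (hs : FilteredMap O P s.toLinearMap)
    (hs' : FilteredMap P O s.symm.toLinearMap) (hT : HasSymbol O P s d T T₀) (n : ℕ) :
    HasSymbol O P s (n * d) (T ^ n) (T₀ ^ n) := by
  induction n with
  | zero => rw [pow_zero, pow_zero, Nat.zero_mul]; exact one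
  | succ n ih => rw [pow_succ, pow_succ, Nat.succ_mul]; exact ih.mul hP hs hs' hT

/-- An operator counted one degree too high has zero symbol. Thus a multiple of `C - 1`, of degree
zero, can be added to an operator of degree one without changing its symbol. -/
theorem degree_succ (hP : Antitone P) (hs : FilteredMap O P s.toLinearMap)
    (hT : HasSymbol O P s d T T₀) : HasSymbol O P s (d + 1) T 0 := by
  refine ⟨fun k v hv => hP (Nat.le_succ k) (hT.1 (k + 1) v ?_), fun k u hu => ?_⟩
  · rwa [add_right_comm]
  · rw [LinearMap.zero_apply, map_zero, sub_zero]
    refine hT.1 (k + 1) _ ?_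
    rw [add_right_comm]
    exact hs _ _ hu

end HasSymbol

end HasSymbol

/-! ### Actions of functionals on filtered bialgebras, and skew derivations. -/

namespace QuasiHopfData

variable {A B : Type*} [Ring A] [Algebra ℂ A] [Ring B] [Algebra ℂ B] {Q₀ : QuasiHopfData A}
  {Q : QuasiHopfData B}

/-- Only terms whose second factor has degree at most `d` survive, so at least `k` of the total
degree `k + d` remains in the first factor. -/
theorem contractRight_mem {P : ℕ → Submodule ℂ B} (hP : Antitone P) {d : ℕ} {f : B →ₗ[ℂ] ℂ}
    (hf : ∀ v ∈ P (d + 1), f v = 0) (k : ℕ) {t : B ⊗[ℂ] B}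
    (ht : t ∈ tensorFiltration P P (k + d)) : contractRight f t ∈ P k := by
  have h1 : tensorFiltration P P (k + d) ≤ (P k).comap (contractRight f) := by
    refine tensorFiltration_le fun i j a b hij ha hb => ?_
    rw [Submodule.mem_comap, contractRight_tmul]
    by_cases hj : d + 1 ≤ j
    · rw [hf b (hP hj hb), zero_smul]; exact zero_mem _
    · exact Submodule.smul_mem _ _ (hP (by omega) ha)
  exact h1 ht

/-- The action of a functional that is transported along a filtered isomorphism. -/
theorem IsFilteredIso.hasSymbol_dualAction {O : ℕ → Submodule ℂ A} {P : ℕ → Submodule ℂ B}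
    {s : A ≃ₗ[ℂ] B} (hs : IsFilteredIso Q₀ Q O P s) (hP : Q.IsFiltered P) {d : ℕ}
    {f : A →ₗ[ℂ] ℂ} (hf : ∀ u ∈ O (d + 1), f u = 0) :
    HasSymbol O P s d (Q.dualAction (f ∘ₗ s.symm.toLinearMap)) (Q₀.dualAction f) := by
  have hf' : ∀ v ∈ P (d + 1), (f ∘ₗ s.symm.toLinearMap) v = 0 :=
    fun v hv => hf _ (hs.filtered_symm _ v hv)
  refine ⟨fun k v hv => contractRight_mem hP.antitone hf' k (hP.comul _ v hv), fun k u hu => ?_⟩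
  have h1 : ∀ t : A ⊗[ℂ] A, contractRight (f ∘ₗ s.symm.toLinearMap)
      (TensorProduct.map s.toLinearMap s.toLinearMap t) = s (contractRight f t) := by
    intro t
    induction t using TensorProduct.induction_on with
    | zero => simp
    | add x y hx hy => simp only [map_add, hx, hy]
    | tmul x y => simp [contractRight_tmul]
  have h2 := hs.comul _ u hu
  rw [add_right_comm] at h2
  have h3 := contractRight_mem hP.antitone hf' (k + 1) h2
  rw [map_sub, LinearMap.comp_apply, LinearMap.comp_apply, h1] at h3
  exact h3

section Derivations

variable {H : Type*} [Ring H] [Algebra ℂ H]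

/-- A functional with `f(ab) = f(a) β(b) + α(a) f(b)`. -/
structure IsSkewDerivation (α β f : H →ₗ[ℂ] ℂ) : Prop where
  left_mul : ∀ a b, α (a * b) = α a * α b
  left_one : α 1 = 1
  right_mul : ∀ a b, β (a * b) = β a * β b
  right_one : β 1 = 1
  map_mul : ∀ a b, f (a * b) = f a * β b + α a * f b

namespace IsSkewDerivation

variable {α β f f' : H →ₗ[ℂ] ℂ}

theorem map_one (h : IsSkewDerivation α β f) : f 1 = 0 := by
  have h1 := h.map_mul 1 1
  rw [mul_one, h.left_one, h.right_one] at h1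
  linear_combination -h1

theorem sub (h : IsSkewDerivation α β f) (h' : IsSkewDerivation α β f') :
    IsSkewDerivation α β (f - f') :=
  { h with
    map_mul := fun a b => by
      simp only [LinearMap.sub_apply, h.map_mul, h'.map_mul]
      ring }

theorem smul (h : IsSkewDerivation α β f) (c : ℂ) : IsSkewDerivation α β (c • f) :=
  { h with
    map_mul := fun a b => by
      simp only [LinearMap.smul_apply, h.map_mul, smul_eq_mul]
      ring }

/-- The inner skew derivation; on the dual side it is the functional of a difference of powers of
`C`. -/
theorem sub_self (h : IsSkewDerivation α β f) : IsSkewDerivation α β (α - β) :=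
  { h with
    map_mul := fun a b => by
      simp only [LinearMap.sub_apply, h.left_mul, h.right_mul]
      ring }

/-- A skew derivation that vanishes on generators is zero. -/
theorem eq_zero (h : IsSkewDerivation α β f) {S : Set H} (hS : Algebra.adjoin ℂ S = ⊤)
    (hf : ∀ a ∈ S, f a = 0) : f = 0 := by
  refine LinearMap.ext fun a => ?_
  have ha : a ∈ Algebra.adjoin ℂ S := hS ▸ Algebra.mem_top
  induction ha using Algebra.adjoin_induction with
  | mem a ha => exact hf a ha
  | algebraMap c => rw [Algebra.algebraMap_eq_smul_one, map_smul, h.map_one]; simp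
  | add a b _ _ ha hb => rw [_root_.map_add, ha, hb]; simp
  | mul a b _ _ ha hb => rw [h.map_mul, ha, hb]; simp

theorem map_pow_left (h : IsSkewDerivation α α f) (a : H) (n : ℕ) :
    f (a ^ (n + 1)) = (n + 1) * α a ^ n * f a := by
  have hp : ∀ n, α (a ^ n) = α a ^ n := by
    intro n
    induction n with
    | zero => simp [h.left_one]
    | succ n ih => rw [pow_succ, h.left_mul, ih, pow_succ]
  induction n with
  | zero => simp
  | succ n ih =>
    rw [pow_succ, h.map_mul, ih, hp]
    push_cast
    ring

/-- A derivation into a character is zero on an algebra with semisimple diagonal generators. -/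
theorem eq_zero_of_skewTriple {N : ℕ} {q : ℂ} {g x y : H} (hN : 2 ≤ N)
    (ht : SkewTriple N q g x y) (hS : Algebra.adjoin ℂ {g, x, y} = ⊤)
    (h : IsSkewDerivation α α f) : f = 0 := by
  have hq : q ≠ 1 := ht.root.ne_one (by omega)
  have hq0 : q ≠ 0 := ht.root.ne_zero (by omega)
  obtain ⟨n, rfl⟩ : ∃ n, N = n + 1 := ⟨N - 1, by omega⟩
  have hg : α g ≠ 0 := by
    intro h0
    have h1 := h.left_mul (g ^ n) g
    rw [← pow_succ, ht.g_pow, h.left_one, h0, mul_zero] at h1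
    exact one_ne_zero h1
  -- Differentiate `g ^ N = 1`.
  have hfg : f g = 0 := by
    have h1 := h.map_pow_left g n
    rw [ht.g_pow, h.map_one] at h1
    have h2 : ((n : ℂ) + 1) * α g ^ n ≠ 0 :=
      mul_ne_zero (by exact_mod_cast n.succ_ne_zero) (pow_ne_zero _ hg)
    exact (mul_eq_zero.1 h1.symm).resolve_left h2
  -- Applying `f` to `g z = p z g`, with `f g = 0`, gives `(1 - p) α(g) f(z) = 0`.
  have key : ∀ (p : ℂ) (z : H), p ≠ 1 → g * z = p • (z * g) → f z = 0 := by
    intro p z hp hz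
    have h2 := congrArg f hz
    rw [h.map_mul, map_smul, h.map_mul, hfg, smul_eq_mul] at h2
    have h3 : (1 - p) * α g * f z = 0 := by linear_combination h2
    exact (mul_eq_zero.1 h3).resolve_left (mul_ne_zero (sub_ne_zero.2 hp.symm) hg)
  refine h.eq_zero hS ?_
  rintro a (rfl | rfl | rfl)
  · exact hfg
  · exact key q _ hq ht.g_mul_x
  · exact key q⁻¹ _ (by rwa [ne_eq, inv_eq_one]) ht.g_mul_y

end IsSkewDerivation

end Derivations

end QuasiHopfData

/-! ## The dual generators of a book algebra -/

namespace IsBookAlgebra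

open QuasiHopfData

variable {A : Type*} [Ring A] [Algebra ℂ A] {Q : QuasiHopfData A} {N M : ℕ} [NeZero N] {q : ℂ}
  {g x y : A}

/-- The functional that is `w a` on the divided monomials of bidegree `(i, j)`. -/
noncomputable def bidegreeFunctional (h : IsBookAlgebra Q N M q g x y) (i j : ℕ)
    (w : ZMod N → ℂ) : A →ₗ[ℂ] ℂ :=
  h.ofValues fun b a c => if b = i ∧ c = j then w a else 0

theorem bidegreeFunctional_apply (h : IsBookAlgebra Q N M q g x y) (i j : ℕ) (w : ZMod N → ℂ)
    {b c : ℕ} (a : ZMod N) (hb : b < N) (hc : c < M) :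
    h.bidegreeFunctional i j w (divMonomial q g x y b a c) = if b = i ∧ c = j then w a else 0 :=
  h.ofValues_apply _ a hb hc

theorem bidegreeFunctional_eq_zero (h : IsBookAlgebra Q N M q g x y) {i j k : ℕ} (w : ZMod N → ℂ)
    (hk : i + j < k) {u : A} (hu : u ∈ monomialFiltration N g x y k) :
    h.bidegreeFunctional i j w u = 0 := by
  refine h.monomialFiltration_le (S := LinearMap.ker (h.bidegreeFunctional i j w))
    (fun b c a hb hc hbc => ?_) hu
  rw [LinearMap.mem_ker, h.bidegreeFunctional_apply i j w a hb hc, if_neg (by omega)]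

/-- The action of a bidegree functional on a divided monomial. -/
theorem dualAction_bidegreeFunctional (h : IsBookAlgebra Q N M q g x y) (i j : ℕ)
    (w : ZMod N → ℂ) {b c : ℕ} (a : ZMod N) (hb : b < N) (hc : c < M) :
    Q.dualAction (h.bidegreeFunctional i j w) (divMonomial q g x y b a c) =
      if i ≤ b ∧ j ≤ c then
        w (a + ((b - i : ℕ) : ZMod N)) • divMonomial q g x y (b - i) (a - (j : ZMod N)) (c - j)
      else 0 := by
  rw [dualAction, LinearMap.comp_apply, h.comul_divMonomial a hb hc]
  simp only [map_sum, contractRight_tmul]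
  have h1 : ∀ p ∈ Finset.HasAntidiagonal.antidiagonal b,
      ∀ r ∈ Finset.HasAntidiagonal.antidiagonal c,
      h.bidegreeFunctional i j w (divMonomial q g x y p.2 (a + (p.1 : ZMod N)) r.2) •
        divMonomial q g x y p.1 (a - (r.2 : ZMod N)) r.1 =
      if p = (b - i, i) then if r = (c - j, j) then w (a + ((b - i : ℕ) : ZMod N)) •
        divMonomial q g x y (b - i) (a - (j : ZMod N)) (c - j) else 0 else 0 := by
    rintro ⟨p1, p2⟩ hp ⟨r1, r2⟩ hr
    rw [Finset.HasAntidiagonal.mem_antidiagonal] at hp hr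
    simp only at hp hr ⊢
    rw [h.bidegreeFunctional_apply i j w _ (by omega) (by omega)]
    simp only [Prod.mk.injEq]
    by_cases hi : p2 = i
    · by_cases hj : r2 = j
      · subst hi hj
        obtain rfl : p1 = b - p2 := by omega
        obtain rfl : r1 = c - r2 := by omega
        simp
      · simp [hj]
    · simp [hi]
  rw [Finset.sum_congr rfl fun p hp => Finset.sum_congr rfl (h1 p hp)]
  by_cases hi : i ≤ b
  · have m1 : (b - i, i) ∈ Finset.HasAntidiagonal.antidiagonal b := by
      rw [Finset.HasAntidiagonal.mem_antidiagonal]; exact Nat.sub_add_cancel hi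
    simp only [Finset.sum_ite_irrel, Finset.sum_const_zero]
    rw [Finset.sum_ite_eq' , if_pos m1, Finset.sum_ite_eq']
    have m2 : (c - j, j) ∈ Finset.HasAntidiagonal.antidiagonal c ↔ i ≤ b ∧ j ≤ c := by
      rw [Finset.HasAntidiagonal.mem_antidiagonal]
      simp only
      omega
    simp only [m2]
  · rw [if_neg (fun h2 => hi h2.1)]
    refine Finset.sum_eq_zero fun p hp => Finset.sum_eq_zero fun r _ => ?_
    rw [if_neg]
    rintro rfl
    rw [Finset.HasAntidiagonal.mem_antidiagonal] at hp
    simp only at hp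
    omega

/-- The functional `χ`. -/
noncomputable def chi (h : IsBookAlgebra Q N M q g x y) : A →ₗ[ℂ] ℂ :=
  h.bidegreeFunctional 0 0 fun a => q ^ a.val

/-- The functional `ξ`. -/
noncomputable def xi (h : IsBookAlgebra Q N M q g x y) : A →ₗ[ℂ] ℂ :=
  h.bidegreeFunctional 1 0 fun _ => 1

/-- The functional `η`. -/
noncomputable def eta (h : IsBookAlgebra Q N M q g x y) : A →ₗ[ℂ] ℂ :=
  h.bidegreeFunctional 0 1 fun _ => 1

theorem dualAction_chi (h : IsBookAlgebra Q N M q g x y) (b c : ℕ) (a : ZMod N) :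
    Q.dualAction h.chi (divMonomial q g x y b a c) =
      q ^ (a + (b : ZMod N)).val • divMonomial q g x y b a c := by
  by_cases hbc : N ≤ b ∨ M ≤ c
  · rw [h.divMonomial_eq_zero a hbc, map_zero, smul_zero]
  · rw [not_or, not_le, not_le] at hbc
    rw [chi, h.dualAction_bidegreeFunctional _ _ _ a hbc.1 hbc.2, if_pos ⟨Nat.zero_le _, Nat.zero_le _⟩]
    simp

theorem dualAction_xi (h : IsBookAlgebra Q N M q g x y) {b c : ℕ} (a : ZMod N) (hb : b < N)
    (hc : c < M) : Q.dualAction h.xi (divMonomial q g x y b a c) =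
      if 1 ≤ b then divMonomial q g x y (b - 1) a c else 0 := by
  rw [xi, h.dualAction_bidegreeFunctional _ _ _ a hb hc]
  simp

theorem dualAction_eta (h : IsBookAlgebra Q N M q g x y) {b c : ℕ} (a : ZMod N) (hb : b < N)
    (hc : c < M) : Q.dualAction h.eta (divMonomial q g x y b a c) =
      if 1 ≤ c then divMonomial q g x y b (a - 1) (c - 1) else 0 := by
  rw [eta, h.dualAction_bidegreeFunctional _ _ _ a hb hc]
  simp

theorem dualAction_chi_pow (h : IsBookAlgebra Q N M q g x y) (n b c : ℕ) (a : ZMod N) :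
    (Q.dualAction h.chi ^ n) (divMonomial q g x y b a c) =
      (q ^ (a + (b : ZMod N)).val) ^ n • divMonomial q g x y b a c := by
  induction n with
  | zero => simp
  | succ n ih =>
    rw [pow_succ', Module.End.mul_apply, ih, map_smul, dualAction_chi, smul_smul, ← pow_succ]

theorem dualAction_xi_pow (h : IsBookAlgebra Q N M q g x y) (n : ℕ) {b c : ℕ} (a : ZMod N)
    (hb : b < N) (hc : c < M) : (Q.dualAction h.xi ^ n) (divMonomial q g x y b a c) =
      if n ≤ b then divMonomial q g x y (b - n) a c else 0 := by
  induction n with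
  | zero => simp
  | succ n ih =>
    rw [pow_succ', Module.End.mul_apply, ih]
    by_cases hn : n ≤ b
    · rw [if_pos hn, h.dualAction_xi a (by omega) hc, Nat.sub_sub]
      congr 1
      rw [eq_iff_iff]
      omega
    · rw [if_neg hn, if_neg (by omega), map_zero]

theorem dualAction_eta_pow (h : IsBookAlgebra Q N M q g x y) (n : ℕ) {b c : ℕ} (a : ZMod N)
    (hb : b < N) (hc : c < M) : (Q.dualAction h.eta ^ n) (divMonomial q g x y b a c) =
      if n ≤ c then divMonomial q g x y b (a - (n : ZMod N)) (c - n) else 0 := by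
  induction n with
  | zero => simp
  | succ n ih =>
    rw [pow_succ', Module.End.mul_apply, ih]
    by_cases hn : n ≤ c
    · rw [if_pos hn, h.dualAction_eta _ hb (by omega), Nat.sub_sub, sub_sub, Nat.cast_succ]
      congr 1
      rw [eq_iff_iff]
      omega
    · rw [if_neg hn, if_neg (by omega), map_zero]

theorem dualAction_chi_pow_eq_one (h : IsBookAlgebra Q N M q g x y) :
    Q.dualAction h.chi ^ N = 1 := by
  refine h.hom_ext fun b a c _ _ => ?_
  rw [dualAction_chi_pow, ← pow_mul, mul_comm, pow_mul, h.root.pow_eq_one, one_pow, one_smul,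
    Module.End.one_apply]

theorem pow_val_sub_one {q : ℂ} (hq : IsPrimitiveRoot q N) (a : ZMod N) :
    q ^ (a - 1).val = q⁻¹ * q ^ a.val := by
  have h1 := pow_val_add hq.pow_eq_one (a - 1) 1
  rw [sub_add_cancel, pow_val_one hq.pow_eq_one] at h1
  rw [h1, mul_comm, mul_assoc, mul_inv_cancel₀ (hq.ne_zero (NeZero.ne N)), mul_one]

theorem dualAction_chi_mul_xi (h : IsBookAlgebra Q N M q g x y) :
    Q.dualAction h.chi * Q.dualAction h.xi = q⁻¹ • (Q.dualAction h.xi * Q.dualAction h.chi) := by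
  refine h.hom_ext fun b a c hb hc => ?_
  rw [Module.End.mul_apply, LinearMap.smul_apply, Module.End.mul_apply, dualAction_chi, map_smul,
    h.dualAction_xi a hb hc]
  split_ifs with h1
  · rw [dualAction_chi, smul_smul, Nat.cast_sub h1, Nat.cast_one, ← add_sub_assoc,
      pow_val_sub_one h.root]
  · simp

theorem dualAction_chi_mul_eta (h : IsBookAlgebra Q N M q g x y) :
    Q.dualAction h.chi * Q.dualAction h.eta = q⁻¹ • (Q.dualAction h.eta * Q.dualAction h.chi) := by
  refine h.hom_ext fun b a c hb hc => ?_
  rw [Module.End.mul_apply, LinearMap.smul_apply, Module.End.mul_apply, dualAction_chi, map_smul,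
    h.dualAction_eta a hb hc]
  split_ifs with h1
  · rw [dualAction_chi, smul_smul, sub_add_eq_add_sub, pow_val_sub_one h.root]
  · simp

/-- The functionals of the dual monomials form the dual basis. -/
theorem counit_dualMonomial (h : IsBookAlgebra Q N M q g x y) (b' c' : ℕ) (a' : ZMod N) {b c : ℕ}
    (a : ZMod N) (hb : b < N) (hc : c < M) :
    Q.counit (dualMonomial q (Q.dualAction h.chi) (Q.dualAction h.xi) (Q.dualAction h.eta) b' a' c'
      (divMonomial q g x y b a c)) = if b = b' ∧ a = a' ∧ c = c' then 1 else 0 := by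
  -- The divided monomial with exponents `b`, `a`, `c` is an eigenvector of the action of `χ` with
  -- eigenvalue `q ^ (a + b)`, so the projection either keeps or kills it.
  have hp : fourierProjection q (Q.dualAction h.chi) (a' + (b' : ZMod N))
      (divMonomial q g x y b a c) =
      if a + (b : ZMod N) - (a' + (b' : ZMod N)) = 0 then divMonomial q g x y b a c else 0 := by
    rw [fourierProjection, LinearMap.smul_apply, LinearMap.sum_apply]
    have h1 : ∀ j : ZMod N, (q ^ (-(j * (a' + (b' : ZMod N)))).val •
        Q.dualAction h.chi ^ j.val) (divMonomial q g x y b a c) =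
        q ^ (j * (a + (b : ZMod N) - (a' + (b' : ZMod N)))).val • divMonomial q g x y b a c := by
      intro j
      rw [LinearMap.smul_apply, dualAction_chi_pow, smul_smul, ← pow_mul, mul_comm _ j.val, pow_mul,
        ← root_pow_val_mul h.root.pow_eq_one, ← pow_val_add h.root.pow_eq_one]
      congr 3
      ring
    simp only [h1]
    rw [← Finset.sum_smul, sum_root_pow h.root, smul_smul]
    split_ifs
    · rw [inv_mul_cancel₀ (Nat.cast_ne_zero.2 (NeZero.ne N)), one_smul]
    · rw [mul_zero, zero_smul]
  rw [dualMonomial, Module.End.mul_apply, Module.End.mul_apply, hp]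
  by_cases h1 : a + (b : ZMod N) - (a' + (b' : ZMod N)) = 0
  · rw [if_pos h1, h.dualAction_eta_pow c' a hb hc]
    by_cases h2 : c' ≤ c
    · rw [if_pos h2, h.dualAction_xi_pow b' _ hb (by omega)]
      by_cases h3 : b' ≤ b
      · rw [if_pos h3, h.counit_divMonomial]
        congr 1
        rw [eq_iff_iff]
        constructor
        · rintro ⟨e1, e2⟩
          obtain rfl : b = b' := by omega
          exact ⟨rfl, by linear_combination h1, by omega⟩
        · rintro ⟨rfl, -, rfl⟩
          simp
      · rw [if_neg h3, map_zero, if_neg (by rintro ⟨rfl, -, -⟩; exact h3 le_rfl)]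
    · rw [if_neg h2, map_zero, map_zero, if_neg (by rintro ⟨-, -, rfl⟩; exact h2 le_rfl)]
  · rw [if_neg h1, map_zero, map_zero, map_zero, if_neg]
    rintro ⟨rfl, rfl, -⟩
    exact h1 (by ring)

/-! ### Product rules -/

/-- In exponents at most one all quantum factorials are `1`, so the normalisation of the divided
monomials does not show. -/
theorem bidegreeFunctional_skewMonomial (h : IsBookAlgebra Q N M q g x y) (i j : ℕ)
    (hi : i ≤ 1) (hj : j ≤ 1) (w : ZMod N → ℂ) (b c : ℕ) (a : ZMod N) :
    h.bidegreeFunctional i j w (skewMonomial g x y b a c) =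
      if b = i ∧ c = j ∧ c < M then w a else 0 := by
  have hN := h.three_le
  by_cases hbc : N ≤ b ∨ M ≤ c
  · rw [h.skewMonomial_eq_zero a hbc, map_zero, if_neg (by omega)]
  · rw [not_or, not_le, not_le] at hbc
    rw [h.smul_divMonomial, map_smul, h.bidegreeFunctional_apply _ _ _ _ hbc.1 hbc.2]
    by_cases h1 : b = i ∧ c = j
    · rw [if_pos h1, if_pos ⟨h1.1, h1.2, hbc.2⟩]
      have e : ∀ (p : ℂ) (n : ℕ), n ≤ 1 → qFactorial p n = 1 := by
        intro p n hn
        interval_cases n <;> simp [qFactorial, qInt]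
      rw [e _ _ (by omega), e _ _ (by omega)]
      simp
    · rw [if_neg h1, if_neg (fun h2 => h1 ⟨h2.1, h2.2.1⟩), smul_zero]

theorem counit_skewMonomial (h : IsBookAlgebra Q N M q g x y) (b c : ℕ) (a : ZMod N) :
    Q.counit (skewMonomial g x y b a c) = if b = 0 ∧ c = 0 then 1 else 0 := by
  rw [h.smul_divMonomial, map_smul, h.counit_divMonomial]
  split_ifs with h1
  · simp [h1.1, h1.2, qFactorial]
  · simp

theorem bilin_ext (h : IsBookAlgebra Q N M q g x y) {f f' : A →ₗ[ℂ] A →ₗ[ℂ] ℂ}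
    (hf : ∀ (b c b' c' : ℕ) (a a' : ZMod N), c < M → c' < M →
      f (skewMonomial g x y b a c) (skewMonomial g x y b' a' c') =
      f' (skewMonomial g x y b a c) (skewMonomial g x y b' a' c')) : f = f' := by
  refine h.hom_ext fun b a c _ hc => h.hom_ext fun b' a' c' _ hc' => ?_
  simp only [divMonomial, map_smul, LinearMap.smul_apply, hf _ _ _ _ _ _ hc hc']

theorem chi_mul (h : IsBookAlgebra Q N M q g x y) (u v : A) :
    h.chi (u * v) = h.chi u * h.chi v := by
  have hM := h.M_pos
  refine LinearMap.congr_fun₂ (h.bilin_ext (f := (LinearMap.mul ℂ A).compr₂ h.chi)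
    (f' := (LinearMap.mul ℂ ℂ).compl₁₂ h.chi h.chi) fun b c b' c' a a' hc hc' => ?_) u v
  simp only [LinearMap.compr₂_apply, LinearMap.mul_apply', LinearMap.compl₁₂_apply]
  rw [h.mul_skewMonomial, map_smul, chi]
  simp only [h.bidegreeFunctional_skewMonomial 0 0 (Nat.zero_le _) (Nat.zero_le _)]
  by_cases h1 : b = 0 ∧ c = 0
  · by_cases h2 : b' = 0 ∧ c' = 0
    · obtain ⟨rfl, rfl⟩ := h1
      obtain ⟨rfl, rfl⟩ := h2
      simp [hM, pow_val_add h.root.pow_eq_one]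
    · rw [if_neg (by omega), if_neg (fun h3 : b' = 0 ∧ c' = 0 ∧ c' < M => h2 ⟨h3.1, h3.2.1⟩)]
      simp
  · rw [if_neg (by omega), if_neg (fun h3 : b = 0 ∧ c = 0 ∧ c < M => h1 ⟨h3.1, h3.2.1⟩)]
    simp

/-- Only monomials with a single `x` and no `y` contribute, and the power of `q` created by moving
`g ^ a` past this `x` is the value of `χ` at `g ^ a`. The rule for `eta` arises in the same way,
with `y` moved past the second power of `g`. -/
theorem xi_mul (h : IsBookAlgebra Q N M q g x y) (u v : A) :
    h.xi (u * v) = h.xi u * Q.counit v + h.chi u * h.xi v := by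
  have hM := h.M_pos
  refine LinearMap.congr_fun₂ (h.bilin_ext (f := (LinearMap.mul ℂ A).compr₂ h.xi)
    (f' := (LinearMap.mul ℂ ℂ).compl₁₂ h.xi Q.counit + (LinearMap.mul ℂ ℂ).compl₁₂ h.chi h.xi)
    fun b c b' c' a a' hc hc' => ?_) u v
  simp only [LinearMap.compr₂_apply, LinearMap.mul_apply', LinearMap.compl₁₂_apply,
    LinearMap.add_apply]
  rw [h.mul_skewMonomial, map_smul, chi, xi]
  simp only [h.bidegreeFunctional_skewMonomial 0 0 (Nat.zero_le _) (Nat.zero_le _),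
    h.bidegreeFunctional_skewMonomial 1 0 le_rfl (Nat.zero_le _), h.counit_skewMonomial, hc, hc',
    and_true]
  rcases b with _ | _ | b <;> rcases b' with _ | _ | b' <;> rcases c with _ | c <;>
    rcases c' with _ | c' <;> simp [hM] <;> intros <;> omega

theorem eta_mul (h : IsBookAlgebra Q N M q g x y) (u v : A) :
    h.eta (u * v) = Q.counit u * h.eta v + h.eta u * h.chi v := by
  have hM := h.M_eq
  have hN := h.three_le
  refine LinearMap.congr_fun₂ (h.bilin_ext (f := (LinearMap.mul ℂ A).compr₂ h.eta)
    (f' := (LinearMap.mul ℂ ℂ).compl₁₂ Q.counit h.eta + (LinearMap.mul ℂ ℂ).compl₁₂ h.eta h.chi)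
    fun b c b' c' a a' hc hc' => ?_) u v
  simp only [LinearMap.compr₂_apply, LinearMap.mul_apply', LinearMap.compl₁₂_apply,
    LinearMap.add_apply]
  rw [h.mul_skewMonomial, map_smul, chi, eta]
  simp only [h.bidegreeFunctional_skewMonomial 0 0 (Nat.zero_le _) (Nat.zero_le _),
    h.bidegreeFunctional_skewMonomial 0 1 (Nat.zero_le _) le_rfl, h.counit_skewMonomial, hc, hc',
    and_true]
  rcases b with _ | b <;> rcases b' with _ | b' <;> rcases c with _ | _ | c <;>
    rcases c' with _ | _ | c' <;> simp [hc, hc'] <;> intros <;> omega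

end IsBookAlgebra

/-! ## Dual generators of a deformation of a book algebra -/

namespace QuasiHopfData

section SkewPowers

variable {H : Type*} [Ring H] [Algebra ℂ H] {N : ℕ} {q : ℂ} {C X Y : Module.End ℂ H}

/-- A product rule for `T` says that multiplication intertwines `T` with an operator `U` on the
tensor square, and the same then holds for powers. -/
theorem pow_comp_mul {T : Module.End ℂ H} {U : Module.End ℂ (H ⊗[ℂ] H)}
    (h : T ∘ₗ LinearMap.mul' ℂ H = LinearMap.mul' ℂ H ∘ₗ U) (n : ℕ) (t : H ⊗[ℂ] H) :
    (T ^ n) (LinearMap.mul' ℂ H t) = LinearMap.mul' ℂ H ((U ^ n) t) := by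
  induction n generalizing t with
  | zero => rfl
  | succ n ih =>
    rw [pow_succ, pow_succ, Module.End.mul_apply, Module.End.mul_apply, ← ih]
    exact congrArg _ (LinearMap.congr_fun h t)

/-- On the tensor square `X` acts as a sum of two operators that commute up to `q`; at a primitive
`N`-th root of unity the `N`-th power of such a sum is the sum of the `N`-th powers. -/
theorem pow_mul_of_skew_left (hN : N ≠ 0) (hq : IsPrimitiveRoot q N)
    (hX : ∀ a b, X (a * b) = X a * b + C a * X b) (hCX : C * X = q⁻¹ • (X * C)) (a b : H) :
    (X ^ N) (a * b) = (X ^ N) a * b + (C ^ N) a * (X ^ N) b := by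
  have h1 : X ∘ₗ LinearMap.mul' ℂ H =
      LinearMap.mul' ℂ H ∘ₗ (TensorProduct.map C X + TensorProduct.map X 1) :=
    TensorProduct.ext' fun a b => by simp [hX, add_comm]
  have h2 : TensorProduct.map X 1 * TensorProduct.map C X =
      q • (TensorProduct.map C X * TensorProduct.map X (1 : Module.End ℂ H)) := by
    rw [← TensorProduct.map_mul, ← TensorProduct.map_mul, hCX, TensorProduct.map_smul_left,
      smul_smul, mul_inv_cancel₀ (hq.ne_zero hN), one_smul, one_mul, mul_one]
  have h3 := pow_comp_mul h1 N (a ⊗ₜ b)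
  rw [skew_add_pow_eq_add hN hq h2, TensorProduct.map_pow, TensorProduct.map_pow] at h3
  simpa [add_comm] using h3

theorem pow_mul_of_skew_right (hN : N ≠ 0) (hq : IsPrimitiveRoot q N)
    (hY : ∀ a b, Y (a * b) = a * Y b + Y a * C b) (hCY : C * Y = q⁻¹ • (Y * C)) (a b : H) :
    (Y ^ N) (a * b) = a * (Y ^ N) b + (Y ^ N) a * (C ^ N) b := by
  have h1 : Y ∘ₗ LinearMap.mul' ℂ H =
      LinearMap.mul' ℂ H ∘ₗ (TensorProduct.map Y C + TensorProduct.map 1 Y) :=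
    TensorProduct.ext' fun a b => by simp [hY, add_comm]
  have h2 : TensorProduct.map 1 Y * TensorProduct.map Y C =
      q • (TensorProduct.map Y C * TensorProduct.map (1 : Module.End ℂ H) Y) := by
    rw [← TensorProduct.map_mul, ← TensorProduct.map_mul, hCY, TensorProduct.map_smul_right,
      smul_smul, mul_inv_cancel₀ (hq.ne_zero hN), one_smul, one_mul, mul_one]
  have h3 := pow_comp_mul h1 N (a ⊗ₜ b)
  rw [skew_add_pow_eq_add hN hq h2, TensorProduct.map_pow, TensorProduct.map_pow] at h3
  simpa [add_comm] using h3

end SkewPowers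

/-- A filtered bialgebra structure that agrees to leading order with a book algebra, together with
lifts of the generators that satisfy the skew commutation relations. -/
structure IsBookDeformation {A H : Type*} [Ring A] [Algebra ℂ A] [Ring H] [Algebra ℂ H]
    (Q₀ : QuasiHopfData A) (Q : QuasiHopfData H) (N M : ℕ) [NeZero N] (q : ℂ) (g x y : A)
    (P : ℕ → Submodule ℂ H) (g' x' y' : H) (s : A ≃ₗ[ℂ] H) : Prop where
  book : IsBookAlgebra Q₀ N M q g x y
  filtered : Q.IsFiltered P
  assoc : Q.assoc = 1
  iso : IsFilteredIso Q₀ Q (monomialFiltration N g x y) P s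
  triple : SkewTriple N q g' x' y'
  map_skewMonomial : ∀ (b c : ℕ) (a : ZMod N), b < N → c < M →
    s (skewMonomial g x y b a c) = skewMonomial g' x' y' b a c
  -- For `M = 1` no monomial in range contains `y`, so the isomorphism says nothing about `y'`.
  y_mem : y' ∈ P 1

namespace IsBookDeformation

variable {A H : Type*} [Ring A] [Algebra ℂ A] [Ring H] [Algebra ℂ H] {Q₀ : QuasiHopfData A}
  {Q : QuasiHopfData H} {N M : ℕ} [NeZero N] {q : ℂ} {g x y : A} {P : ℕ → Submodule ℂ H}
  {g' x' y' : H} {s : A ≃ₗ[ℂ] H}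

theorem coassoc (D : IsBookDeformation Q₀ Q N M q g x y P g' x' y' s) (a : H) :
    Q.comulRight (Q.comul a) = Q.comulLeft (Q.comul a) := by
  have h := D.filtered.isQuasiBialgebra.quasi_coassoc a
  rwa [D.assoc, mul_one, one_mul] at h

theorem map_g (D : IsBookDeformation Q₀ Q N M q g x y P g' x' y' s) : s g = g' := by
  have h := D.map_skewMonomial 0 0 1 (NeZero.pos N) D.book.M_pos
  simpa [skewMonomial, pow_val_one D.book.g_pow, pow_val_one D.triple.g_pow] using h

theorem map_x (D : IsBookDeformation Q₀ Q N M q g x y P g' x' y' s) : s x = x' := by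
  have h := D.map_skewMonomial 1 0 0 (by have := D.book.three_le; omega) D.book.M_pos
  simpa [skewMonomial] using h

theorem x_mem (D : IsBookDeformation Q₀ Q N M q g x y P g' x' y' s) : x' ∈ P 1 := by
  rw [← D.map_x]
  exact D.iso.filtered 1 _ IsBookAlgebra.x_mem

theorem adjoin_eq_top (D : IsBookDeformation Q₀ Q N M q g x y P g' x' y' s) :
    Algebra.adjoin ℂ {g', x', y'} = ⊤ := by
  set S := Algebra.adjoin ℂ {g', x', y'} with hS
  have h1 : (⊤ : Submodule ℂ A) ≤ (Subalgebra.toSubmodule S).comap s.toLinearMap := by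
    rw [← D.book.span_skewMonomial]
    refine Submodule.span_le.2 ?_
    rintro _ ⟨i, rfl⟩
    change s (skewMonomial g x y _ _ _) ∈ S
    rw [D.map_skewMonomial _ _ _ i.1.2 i.2.2.2]
    exact mul_mem (mul_mem (pow_mem (Algebra.subset_adjoin (by simp)) _)
      (pow_mem (Algebra.subset_adjoin (by simp)) _)) (pow_mem (Algebra.subset_adjoin (by simp)) _)
  refine eq_top_iff.2 fun a _ => ?_
  have h2 := h1 (Submodule.mem_top (x := s.symm a))
  rw [Submodule.mem_comap, LinearEquiv.coe_coe, LinearEquiv.apply_symm_apply] at h2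
  exact h2

theorem counit_map (D : IsBookDeformation Q₀ Q N M q g x y P g' x' y' s) (u : A) :
    Q.counit (s u) = Q₀.counit u := LinearMap.congr_fun D.iso.counit u

theorem counit_eq_zero (D : IsBookDeformation Q₀ Q N M q g x y P g' x' y' s) {v : H}
    (hv : v ∈ P 1) : Q.counit v = 0 := by
  rw [← s.apply_symm_apply v, D.counit_map]
  refine D.book.monomialFiltration_le (S := LinearMap.ker Q₀.counit) (fun b c a _ _ hbc => ?_)
    (D.iso.filtered_symm 1 v hv)
  rw [LinearMap.mem_ker, D.book.counit_divMonomial, if_neg (by omega)]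

/-- The splitting is multiplicative modulo terms of degree two. -/
theorem map_mul_sub_mem (D : IsBookDeformation Q₀ Q N M q g x y P g' x' y' s) (u v : A) :
    s (u * v) - s u * s v ∈ P 2 := by
  have h1 : ∀ (b c b' c' : ℕ) (a a' : ZMod N), b < N → c < M → b' < N → c' < M →
      s (skewMonomial g x y b a c * skewMonomial g x y b' a' c') -
        s (skewMonomial g x y b a c) * s (skewMonomial g x y b' a' c') ∈ P 2 := by
    intro b c b' c' a a' hb hc hb' hc'
    have hN := D.book.three_le
    have hM := D.book.M_eq
    -- In total degree at least two both terms already lie in `P 2`.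
    by_cases hd : 2 ≤ b + c + (b' + c')
    · have m1 := IsBookAlgebra.skewMonomial_mem (g := g) (x := x) (y := y) (b := b) (c := c) a le_rfl
      have m2 := IsBookAlgebra.skewMonomial_mem (g := g) (x := x) (y := y) (b := b') (c := c') a'
        le_rfl
      exact sub_mem (D.filtered.antitone hd (D.iso.filtered _ _ (D.book.mulFiltration _ _ _ m1 _ m2)))
        (D.filtered.antitone hd (D.filtered.mul _ _ _ (D.iso.filtered _ _ m1) _
          (D.iso.filtered _ _ m2)))
    -- In total degree at most one, `x'` and `y'` do not both occur, so normal ordering uses only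
    -- the relations with `g'`; no commutation of `x'` and `y'` is known at this point.
    · have h2 : y' ^ c * x' ^ b' = x' ^ b' * y' ^ c := by
        rcases Nat.eq_zero_or_pos c with rfl | h3
        · simp
        · obtain rfl : b' = 0 := by omega
          simp
      rw [D.book.mul_skewMonomial, map_smul, D.map_skewMonomial _ _ _ (by omega) (by omega),
        D.map_skewMonomial _ _ _ hb hc, D.map_skewMonomial _ _ _ hb' hc',
        D.triple.skewMonomial_mul _ _ _ _ _ _ h2, sub_self]
      exact zero_mem _
  let L : A →ₗ[ℂ] A →ₗ[ℂ] H := (LinearMap.mul ℂ A).compr₂ s.toLinearMap -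
    (LinearMap.mul ℂ H).compl₁₂ s.toLinearMap s.toLinearMap
  have h2 : ∀ j : Fin N × ZMod N × Fin M, ∀ u,
      L u (skewMonomial g x y j.1 j.2.1 j.2.2) ∈ P 2 := by
    intro j u
    have h3 : (⊤ : Submodule ℂ A) ≤
        (P 2).comap (L.flip (skewMonomial g x y j.1 j.2.1 j.2.2)) := by
      rw [← D.book.span_skewMonomial]
      refine Submodule.span_le.2 ?_
      rintro _ ⟨i, rfl⟩
      exact h1 _ _ _ _ _ _ i.1.2 i.2.2.2 j.1.2 j.2.2.2
    exact h3 (Submodule.mem_top (x := u))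
  have h3 : (⊤ : Submodule ℂ A) ≤ (P 2).comap (L u) := by
    rw [← D.book.span_skewMonomial]
    refine Submodule.span_le.2 ?_
    rintro _ ⟨j, rfl⟩
    exact h2 j u
  exact h3 (Submodule.mem_top (x := v))

/-- A product rule on the book algebra is inherited by the deformation. -/
theorem functional_mul (D : IsBookDeformation Q₀ Q N M q g x y P g' x' y' s)
    {f f₁ f₂ f₃ f₄ : A →ₗ[ℂ] ℂ} (hf : ∀ u ∈ monomialFiltration N g x y 2, f u = 0)
    (hm : ∀ u v, f (u * v) = f₁ u * f₂ v + f₃ u * f₄ v) (a b : H) :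
    (f ∘ₗ s.symm.toLinearMap) (a * b) =
      (f₁ ∘ₗ s.symm.toLinearMap) a * (f₂ ∘ₗ s.symm.toLinearMap) b +
      (f₃ ∘ₗ s.symm.toLinearMap) a * (f₄ ∘ₗ s.symm.toLinearMap) b := by
  -- The failure of `s` to be multiplicative has degree two, where `f` vanishes.
  have h1 := hf _ (D.iso.filtered_symm 2 _ (D.map_mul_sub_mem (s.symm a) (s.symm b)))
  rw [LinearEquiv.coe_coe, map_sub, LinearEquiv.symm_apply_apply, map_sub, sub_eq_zero,
    LinearEquiv.apply_symm_apply, LinearEquiv.apply_symm_apply] at h1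
  simp only [LinearMap.comp_apply, LinearEquiv.coe_coe]
  rw [← h1, hm]

theorem counit_comp_symm (D : IsBookDeformation Q₀ Q N M q g x y P g' x' y' s) :
    Q₀.counit ∘ₗ s.symm.toLinearMap = Q.counit := by
  refine LinearMap.ext fun a => ?_
  rw [LinearMap.comp_apply, LinearEquiv.coe_coe, ← D.counit_map, LinearEquiv.apply_symm_apply]

/-- The operator lifting the action of a functional on the book algebra. -/
noncomputable def lift (_ : IsBookDeformation Q₀ Q N M q g x y P g' x' y' s) (f : A →ₗ[ℂ] ℂ) :
    Module.End ℂ H := Q.dualAction (f ∘ₗ s.symm.toLinearMap)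

theorem lift_comodule (D : IsBookDeformation Q₀ Q N M q g x y P g' x' y' s) (f : A →ₗ[ℂ] ℂ) :
    Q.IsLeftComoduleMap (D.lift f) := isLeftComoduleMap_dualAction D.coassoc _

theorem lift_counit (D : IsBookDeformation Q₀ Q N M q g x y P g' x' y' s) :
    D.lift Q₀.counit = 1 := by
  rw [lift, D.counit_comp_symm, dualAction_counit D.filtered.isQuasiBialgebra]

theorem lift_mul (D : IsBookDeformation Q₀ Q N M q g x y P g' x' y' s)
    {f f₁ f₂ f₃ f₄ : A →ₗ[ℂ] ℂ} (hf : ∀ u ∈ monomialFiltration N g x y 2, f u = 0)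
    (hm : ∀ u v, f (u * v) = f₁ u * f₂ v + f₃ u * f₄ v) (a b : H) :
    D.lift f (a * b) = D.lift f₁ a * D.lift f₂ b + D.lift f₃ a * D.lift f₄ b :=
  dualAction_mul D.filtered.isQuasiBialgebra (D.functional_mul hf hm) a b

/-- The functionals `chi`, `xi`, `eta` vanish in degree two, so their product rules pass to the
deformation without error terms, and with them those of the lifted operators. -/
theorem lift_chi_mul (D : IsBookDeformation Q₀ Q N M q g x y P g' x' y' s) (a b : H) :
    D.lift D.book.chi (a * b) = D.lift D.book.chi a * D.lift D.book.chi b := by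
  have h := D.lift_mul (f := D.book.chi) (f₁ := D.book.chi) (f₂ := D.book.chi) (f₃ := 0) (f₄ := 0)
    (fun u hu => D.book.bidegreeFunctional_eq_zero _ (by norm_num) hu)
    (fun u v => by rw [D.book.chi_mul]; simp) a b
  rw [h]
  simp [lift, dualAction, contractRight]

theorem lift_xi_mul (D : IsBookDeformation Q₀ Q N M q g x y P g' x' y' s) (a b : H) :
    D.lift D.book.xi (a * b) = D.lift D.book.xi a * b + D.lift D.book.chi a * D.lift D.book.xi b := by
  rw [D.lift_mul (f := D.book.xi)
      (fun u hu => D.book.bidegreeFunctional_eq_zero _ (by norm_num) hu) D.book.xi_mul,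
    D.lift_counit, Module.End.one_apply]

theorem lift_eta_mul (D : IsBookDeformation Q₀ Q N M q g x y P g' x' y' s) (a b : H) :
    D.lift D.book.eta (a * b) =
      a * D.lift D.book.eta b + D.lift D.book.eta a * D.lift D.book.chi b := by
  rw [D.lift_mul (f := D.book.eta)
      (fun u hu => D.book.bidegreeFunctional_eq_zero _ (by norm_num) hu) D.book.eta_mul,
    D.lift_counit, Module.End.one_apply]

theorem hasSymbol_chi (D : IsBookDeformation Q₀ Q N M q g x y P g' x' y' s) :
    HasSymbol (monomialFiltration N g x y) P s 0 (D.lift D.book.chi) (Q₀.dualAction D.book.chi) :=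
  D.iso.hasSymbol_dualAction D.filtered
    fun _ hu => D.book.bidegreeFunctional_eq_zero _ (by norm_num) hu

theorem hasSymbol_xi (D : IsBookDeformation Q₀ Q N M q g x y P g' x' y' s) :
    HasSymbol (monomialFiltration N g x y) P s 1 (D.lift D.book.xi) (Q₀.dualAction D.book.xi) :=
  D.iso.hasSymbol_dualAction D.filtered
    fun _ hu => D.book.bidegreeFunctional_eq_zero _ (by norm_num) hu

theorem hasSymbol_eta (D : IsBookDeformation Q₀ Q N M q g x y P g' x' y' s) :
    HasSymbol (monomialFiltration N g x y) P s 1 (D.lift D.book.eta) (Q₀.dualAction D.book.eta) :=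
  D.iso.hasSymbol_dualAction D.filtered
    fun _ hu => D.book.bidegreeFunctional_eq_zero _ (by norm_num) hu

/-- The leading term of an operator determines the leading term of its functional. -/
theorem counit_apply (D : IsBookDeformation Q₀ Q N M q g x y P g' x' y' s) {d : ℕ}
    {T : Module.End ℂ H} {T₀ : Module.End ℂ A}
    (hT : HasSymbol (monomialFiltration N g x y) P s d T T₀) {u : A}
    (hu : u ∈ monomialFiltration N g x y d) : Q.counit (T (s u)) = Q₀.counit (T₀ u) := by
  have h := D.counit_eq_zero (hT.2 0 u (by rwa [zero_add]))
  rwa [map_sub, sub_eq_zero, D.counit_map] at h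

theorem hasSymbol_chi_pow (D : IsBookDeformation Q₀ Q N M q g x y P g' x' y' s) (n : ℕ) :
    HasSymbol (monomialFiltration N g x y) P s 0 (D.lift D.book.chi ^ n)
      (Q₀.dualAction D.book.chi ^ n) :=
  D.hasSymbol_chi.pow D.filtered.antitone D.iso.filtered D.iso.filtered_symm n

/-- For operators of degree zero the functional is determined by the symbol, and the symbol of the
power is `1`. -/
theorem lift_chi_pow (D : IsBookDeformation Q₀ Q N M q g x y P g' x' y' s) :
    D.lift D.book.chi ^ N = 1 := by
  refine IsLeftComoduleMap.ext D.filtered.isQuasiBialgebra ((D.lift_comodule _).pow N)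
    IsLeftComoduleMap.one fun a => ?_
  have h := D.counit_apply (D.hasSymbol_chi_pow N) (u := s.symm a)
    (by rw [D.book.monomialFiltration_zero]; exact Submodule.mem_top)
  rw [D.book.dualAction_chi_pow_eq_one, LinearEquiv.apply_symm_apply] at h
  rw [h, Module.End.one_apply, Module.End.one_apply, ← D.counit_map, LinearEquiv.apply_symm_apply]

theorem lift_chi_pow_mul (D : IsBookDeformation Q₀ Q N M q g x y P g' x' y' s) (n : ℕ) (a b : H) :
    (D.lift D.book.chi ^ n) (a * b) = (D.lift D.book.chi ^ n) a * (D.lift D.book.chi ^ n) b := by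
  induction n with
  | zero => rfl
  | succ n ih => rw [pow_succ', Module.End.mul_apply, ih, D.lift_chi_mul]; rfl

/-- The character `ε ∘ C ^ n`. -/
noncomputable def character (D : IsBookDeformation Q₀ Q N M q g x y P g' x' y' s) (n : ℕ) :
    H →ₗ[ℂ] ℂ := Q.counit ∘ₗ (D.lift D.book.chi ^ n)

theorem character_mul (D : IsBookDeformation Q₀ Q N M q g x y P g' x' y' s) (n : ℕ) (a b : H) :
    D.character n (a * b) = D.character n a * D.character n b := by
  simp only [character, LinearMap.comp_apply, D.lift_chi_pow_mul,
    D.filtered.isQuasiBialgebra.counit_mul]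

theorem character_map (D : IsBookDeformation Q₀ Q N M q g x y P g' x' y' s) (n : ℕ) (a : ZMod N) :
    D.character n (s (IsBookAlgebra.divMonomial q g x y 0 a 0)) = (q ^ a.val) ^ n := by
  rw [character, LinearMap.comp_apply, D.counit_apply (D.hasSymbol_chi_pow n)
    (by rw [D.book.monomialFiltration_zero]; exact Submodule.mem_top),
    D.book.dualAction_chi_pow, map_smul, D.book.counit_divMonomial]
  simp

theorem character_g (D : IsBookDeformation Q₀ Q N M q g x y P g' x' y' s) (n : ℕ) :
    D.character n g' = q ^ n := by
  have h := D.character_map n 1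
  have e : IsBookAlgebra.divMonomial q g x y 0 (1 : ZMod N) 0 = g := by
    simp [IsBookAlgebra.divMonomial, skewMonomial, pow_val_one D.book.g_pow, qFactorial]
  rwa [e, D.map_g, pow_val_one D.book.root.pow_eq_one] at h

theorem character_one (D : IsBookDeformation Q₀ Q N M q g x y P g' x' y' s) (n : ℕ) :
    D.character n 1 = 1 := by
  have h := D.character_map n 0
  rwa [IsBookAlgebra.divMonomial_zero, D.iso.map_one, ZMod.val_zero, pow_zero, one_pow] at h

theorem character_eq_zero (D : IsBookDeformation Q₀ Q N M q g x y P g' x' y' s) (n : ℕ) {v : H}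
    (hv : v ∈ P 1) : D.character n v = 0 :=
  D.counit_eq_zero ((D.hasSymbol_chi_pow n).1 1 v hv)

/-- A skew derivation that vanishes in positive degrees is inner. -/
theorem exists_eq_smul (D : IsBookDeformation Q₀ Q N M q g x y P g' x' y' s) {m n : ℕ}
    (hmn : q ^ m ≠ q ^ n) {f : H →ₗ[ℂ] ℂ}
    (hf : IsSkewDerivation (D.character m) (D.character n) f) (h0 : ∀ v ∈ P 1, f v = 0) :
    ∃ k : ℂ, f = k • (D.character m - D.character n) := by
  -- Chosen so that the difference vanishes at `g'`, where the two characters take the values `q ^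
  -- m` and `q ^ n`. At `x'` and `y'` everything vanishes by degree.
  refine ⟨f g' / (q ^ m - q ^ n), ?_⟩
  rw [← sub_eq_zero]
  refine (hf.sub (hf.sub_self.smul _)).eq_zero D.adjoin_eq_top ?_
  rintro a (rfl | rfl | rfl)
  · rw [LinearMap.sub_apply, LinearMap.smul_apply, LinearMap.sub_apply, D.character_g,
      D.character_g, smul_eq_mul, div_mul_cancel₀ _ (sub_ne_zero.2 hmn), sub_self]
  · simp [h0 _ D.x_mem, D.character_eq_zero _ D.x_mem]
  · simp [h0 _ D.y_mem, D.character_eq_zero _ D.y_mem]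

theorem q_ne_one (D : IsBookDeformation Q₀ Q N M q g x y P g' x' y' s) : q ≠ 1 :=
  D.book.root.ne_one (by have := D.book.three_le; omega)

/-- Correction of an operator by a multiple of `C - 1`, so that it `q`-commutes with `C`. -/
theorem exists_skew (D : IsBookDeformation Q₀ Q N M q g x y P g' x' y' s) {T : Module.End ℂ H}
    (hT : Q.IsLeftComoduleMap T) {k : ℂ}
    (hk : ∀ a, Q.counit ((D.lift D.book.chi * T - q⁻¹ • (T * D.lift D.book.chi)) a) =
      k * (D.character 2 a - D.character 1 a)) :
    ∃ k' : ℂ, D.lift D.book.chi * (T + k' • (D.lift D.book.chi - 1)) =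
      q⁻¹ • ((T + k' • (D.lift D.book.chi - 1)) * D.lift D.book.chi) := by
  have hC := D.lift_comodule D.book.chi
  have h1 : D.lift D.book.chi * T - q⁻¹ • (T * D.lift D.book.chi) =
      k • (D.lift D.book.chi ^ 2 - D.lift D.book.chi) := by
    refine IsLeftComoduleMap.ext D.filtered.isQuasiBialgebra
      ((hC.mul hT).sub ((hT.mul hC).smul _)) (((hC.pow 2).sub hC).smul k) fun a => ?_
    rw [hk]
    simp [character]
  set C := D.lift D.book.chi
  have hq : (1 - q⁻¹) ≠ 0 := sub_ne_zero.2 fun h => D.q_ne_one (by rw [eq_comm, inv_eq_one] at h; exact h)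
  -- The element `C - 1` fails to `q`-commute with `C` by `(1 - q⁻¹) (C ^ 2 - C)`, which must cancel
  -- `k (C ^ 2 - C)`.
  refine ⟨-k / (1 - q⁻¹), ?_⟩
  have h2 : C * T = q⁻¹ • (T * C) + k • (C ^ 2 - C) := by rw [← h1]; abel
  have h3 : k = -(-k / (1 - q⁻¹)) * (1 - q⁻¹) := by
    rw [neg_div, neg_neg, div_mul_cancel₀ _ hq]
  rw [mul_add, add_mul, h2, mul_smul_comm, smul_mul_assoc, mul_sub, sub_mul, mul_one, one_mul,
    ← pow_two]
  generalize -k / (1 - q⁻¹) = k' at h3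
  subst h3
  module

end IsBookDeformation
end QuasiHopfData

theorem HasSymbol.fourierProjection {V W : Type*} [AddCommGroup V] [Module ℂ V] [AddCommGroup W]
    [Module ℂ W] {O : ℕ → Submodule ℂ V} {P : ℕ → Submodule ℂ W} {s : V ≃ₗ[ℂ] W} (hP : Antitone P)
    (hs : FilteredMap O P s.toLinearMap) (hs' : FilteredMap P O s.symm.toLinearMap)
    {C : Module.End ℂ W} {C₀ : Module.End ℂ V} (hC : HasSymbol O P s 0 C C₀) {N : ℕ} [NeZero N]
    (q : ℂ) (a : ZMod N) :
    HasSymbol O P s 0 (fourierProjection q C a) (fourierProjection q C₀ a) := by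
  refine HasSymbol.smul ?_ _
  exact HasSymbol.sum (T := fun j : ZMod N => q ^ (-(j * a)).val • C ^ j.val)
    (T₀ := fun j : ZMod N => q ^ (-(j * a)).val • C₀ ^ j.val) _
    fun j => (hC.pow hP hs hs' j.val).smul _

/-! ### Exact relations between the lifted operators. -/

namespace QuasiHopfData
namespace IsBookDeformation

variable {A H : Type*} [Ring A] [Algebra ℂ A] [Ring H] [Algebra ℂ H] {Q₀ : QuasiHopfData A}
  {Q : QuasiHopfData H} {N M : ℕ} [NeZero N] {q : ℂ} {g x y : A} {P : ℕ → Submodule ℂ H}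
  {g' x' y' : H} {s : A ≃ₗ[ℂ] H}

theorem two_le (D : IsBookDeformation Q₀ Q N M q g x y P g' x' y' s) : 2 ≤ N := by
  have := D.book.three_le
  omega

/-- The functional of `T` is a derivation from a character to itself, hence zero, and a comodule map
is determined by its functional. -/
theorem eq_zero_of_derivation (D : IsBookDeformation Q₀ Q N M q g x y P g' x' y' s)
    {T : Module.End ℂ H} (hT : Q.IsLeftComoduleMap T) (n : ℕ)
    (h : ∀ a b, T (a * b) = (D.lift D.book.chi ^ n) a * T b + T a * (D.lift D.book.chi ^ n) b) :
    T = 0 := by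
  refine hT.ext D.filtered.isQuasiBialgebra IsLeftComoduleMap.zero fun a => ?_
  have h1 : IsSkewDerivation (D.character n) (D.character n) (Q.counit ∘ₗ T) :=
    ⟨D.character_mul n, D.character_one n, D.character_mul n, D.character_one n, fun a b => by
      simp only [LinearMap.comp_apply, character, h, map_add, D.filtered.isQuasiBialgebra.counit_mul]
      ring⟩
  have h2 := LinearMap.congr_fun (h1.eq_zero_of_skewTriple D.two_le D.triple D.adjoin_eq_top) a
  rw [LinearMap.zero_apply, map_zero]
  exact h2

/-- The commutator has degree one and zero symbol, so its functional vanishes in positive degree. In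
degree zero it may survive, and this is what a multiple of `C - 1` corrects. -/
theorem hasSymbol_commutator (D : IsBookDeformation Q₀ Q N M q g x y P g' x' y' s)
    {T : Module.End ℂ H} {T₀ : Module.End ℂ A}
    (hT : HasSymbol (monomialFiltration N g x y) P s 1 T T₀)
    (h0 : Q₀.dualAction D.book.chi * T₀ = q⁻¹ • (T₀ * Q₀.dualAction D.book.chi)) {v : H}
    (hv : v ∈ P 1) :
    Q.counit ((D.lift D.book.chi * T - q⁻¹ • (T * D.lift D.book.chi)) v) = 0 := by
  have hP := D.filtered.antitone
  have h1 := (D.hasSymbol_chi.mul hP D.iso.filtered D.iso.filtered_symm hT).sub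
    ((hT.mul hP D.iso.filtered D.iso.filtered_symm D.hasSymbol_chi).smul q⁻¹)
  have h2 := D.counit_apply h1 (D.iso.filtered_symm 1 v hv)
  rw [h0, sub_self, LinearMap.zero_apply, map_zero, LinearEquiv.coe_coe,
    LinearEquiv.apply_symm_apply] at h2
  exact h2

theorem hasSymbol_add_smul (D : IsBookDeformation Q₀ Q N M q g x y P g' x' y' s)
    {T : Module.End ℂ H} {T₀ : Module.End ℂ A}
    (hT : HasSymbol (monomialFiltration N g x y) P s 1 T T₀) (k : ℂ) :
    HasSymbol (monomialFiltration N g x y) P s 1 (T + k • (D.lift D.book.chi - 1)) T₀ := by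
  have h := hT.add (((D.hasSymbol_chi.sub HasSymbol.one).degree_succ D.filtered.antitone
    D.iso.filtered).smul k)
  rwa [smul_zero, add_zero] at h

theorem pow_one_ne (D : IsBookDeformation Q₀ Q N M q g x y P g' x' y' s) : q ^ 2 ≠ q ^ 1 := by
  intro h
  have h1 : q * (q - 1) = 0 := by linear_combination h
  rcases mul_eq_zero.1 h1 with h2 | h2
  · exact D.triple.ne_zero h2
  · exact D.q_ne_one (sub_eq_zero.1 h2)

/-- The functional of `C X - q⁻¹ X C` is a skew derivation between two distinct characters that
vanishes in positive degree, hence inner; since `C - 1` obeys the product rule of `X`, adding a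
multiple of it yields exact `q`-commutation. Then `X ^ N` is an ordinary derivation, because `C ^ N
= 1`, and is zero. -/
theorem exists_X (D : IsBookDeformation Q₀ Q N M q g x y P g' x' y' s) :
    ∃ X : Module.End ℂ H, Q.IsLeftComoduleMap X ∧
      (∀ a b, X (a * b) = X a * b + D.lift D.book.chi a * X b) ∧
      D.lift D.book.chi * X = q⁻¹ • (X * D.lift D.book.chi) ∧ X ^ N = 0 ∧
      HasSymbol (monomialFiltration N g x y) P s 1 X (Q₀.dualAction D.book.xi) := by
  have hC := D.lift_comodule D.book.chi
  have hX := D.lift_comodule D.book.xi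
  have hCm := D.lift_chi_mul
  have hXm := D.lift_xi_mul
  have hd : IsSkewDerivation (D.character 2) (D.character 1)
      (Q.counit ∘ₗ (D.lift D.book.chi * D.lift D.book.xi -
        q⁻¹ • (D.lift D.book.xi * D.lift D.book.chi))) :=
    ⟨D.character_mul _, D.character_one _, D.character_mul _, D.character_one _, fun a b => by
      simp only [LinearMap.comp_apply, LinearMap.sub_apply, LinearMap.smul_apply,
        Module.End.mul_apply, hCm, hXm, map_add, map_sub, map_smul, character, pow_one, pow_two,
        D.filtered.isQuasiBialgebra.counit_mul, smul_eq_mul]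
      ring⟩
  obtain ⟨k, hk⟩ := D.exists_eq_smul D.pow_one_ne hd
    fun v hv => D.hasSymbol_commutator D.hasSymbol_xi D.book.dualAction_chi_mul_xi hv
  obtain ⟨k', hk'⟩ := D.exists_skew hX fun a => LinearMap.congr_fun hk a
  have hXm' : ∀ a b, (D.lift D.book.xi + k' • (D.lift D.book.chi - 1)) (a * b) =
      (D.lift D.book.xi + k' • (D.lift D.book.chi - 1)) a * b +
      D.lift D.book.chi a * (D.lift D.book.xi + k' • (D.lift D.book.chi - 1)) b := by
    intro a b
    simp only [LinearMap.add_apply, LinearMap.smul_apply, LinearMap.sub_apply, Module.End.one_apply,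
      hCm, hXm, add_mul, mul_add, smul_mul_assoc, mul_smul_comm, sub_mul, mul_sub, smul_sub]
    abel
  have hX' := hX.add ((hC.sub IsLeftComoduleMap.one).smul k')
  refine ⟨_, hX', hXm', hk', ?_, D.hasSymbol_add_smul D.hasSymbol_xi k'⟩
  refine D.eq_zero_of_derivation (hX'.pow N) 0 fun a b => ?_
  rw [pow_mul_of_skew_left (NeZero.ne N) D.book.root hXm' hk', D.lift_chi_pow, pow_zero, add_comm]
  rfl

theorem exists_Y (D : IsBookDeformation Q₀ Q N M q g x y P g' x' y' s) :
    ∃ Y : Module.End ℂ H, Q.IsLeftComoduleMap Y ∧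
      (∀ a b, Y (a * b) = a * Y b + Y a * D.lift D.book.chi b) ∧
      D.lift D.book.chi * Y = q⁻¹ • (Y * D.lift D.book.chi) ∧ Y ^ M = 0 ∧
      HasSymbol (monomialFiltration N g x y) P s 1 Y (Q₀.dualAction D.book.eta) := by
  -- For `M = 1` the functional `eta` is zero, and `Y = 0` will do.
  rcases D.book.M_eq with hM | hM
  · have h0 : Q₀.dualAction D.book.eta = 0 := by
      refine D.book.hom_ext fun b a c hb hc => ?_
      rw [D.book.dualAction_eta a hb hc, if_neg (by omega), LinearMap.zero_apply]
    rw [h0]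
    exact ⟨0, IsLeftComoduleMap.zero, by simp, by simp, zero_pow D.book.M_pos.ne', HasSymbol.zero⟩
  have hC := D.lift_comodule D.book.chi
  have hY := D.lift_comodule D.book.eta
  have hCm := D.lift_chi_mul
  have hYm := D.lift_eta_mul
  have hd : IsSkewDerivation (D.character 1) (D.character 2)
      (Q.counit ∘ₗ (D.lift D.book.chi * D.lift D.book.eta -
        q⁻¹ • (D.lift D.book.eta * D.lift D.book.chi))) :=
    ⟨D.character_mul _, D.character_one _, D.character_mul _, D.character_one _, fun a b => by
      simp only [LinearMap.comp_apply, LinearMap.sub_apply, LinearMap.smul_apply,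
        Module.End.mul_apply, hCm, hYm, map_add, map_sub, map_smul, character, pow_one, pow_two,
        D.filtered.isQuasiBialgebra.counit_mul, smul_eq_mul]
      ring⟩
  obtain ⟨k, hk⟩ := D.exists_eq_smul D.pow_one_ne.symm hd
    fun v hv => D.hasSymbol_commutator D.hasSymbol_eta D.book.dualAction_chi_mul_eta hv
  -- The sign appears because the two characters are exchanged in comparison with the case of `X`.
  obtain ⟨k', hk'⟩ := D.exists_skew (k := -k) hY fun a => by
    have h1 := LinearMap.congr_fun hk a
    rw [LinearMap.smul_apply, LinearMap.sub_apply, smul_eq_mul] at h1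
    rw [LinearMap.comp_apply] at h1
    rw [h1]
    ring
  have hYm' : ∀ a b, (D.lift D.book.eta + k' • (D.lift D.book.chi - 1)) (a * b) =
      a * (D.lift D.book.eta + k' • (D.lift D.book.chi - 1)) b +
      (D.lift D.book.eta + k' • (D.lift D.book.chi - 1)) a * D.lift D.book.chi b := by
    intro a b
    simp only [LinearMap.add_apply, LinearMap.smul_apply, LinearMap.sub_apply, Module.End.one_apply,
      hCm, hYm, add_mul, mul_add, smul_mul_assoc, mul_smul_comm, sub_mul, mul_sub, smul_sub]
    abel
  have hY' := hY.add ((hC.sub IsLeftComoduleMap.one).smul k')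
  refine ⟨_, hY', hYm', hk', ?_, D.hasSymbol_add_smul D.hasSymbol_eta k'⟩
  refine (congrArg (fun n => (D.lift D.book.eta + k' • (D.lift D.book.chi - 1)) ^ n) hM).trans ?_
  refine D.eq_zero_of_derivation (hY'.pow N) 0 fun a b => ?_
  rw [pow_mul_of_skew_right (NeZero.ne N) D.book.root hYm' hk', D.lift_chi_pow, pow_zero]
  rfl

theorem hasSymbol_dualMonomial (D : IsBookDeformation Q₀ Q N M q g x y P g' x' y' s)
    {X Y : Module.End ℂ H}
    (hX : HasSymbol (monomialFiltration N g x y) P s 1 X (Q₀.dualAction D.book.xi))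
    (hY : HasSymbol (monomialFiltration N g x y) P s 1 Y (Q₀.dualAction D.book.eta))
    (b c : ℕ) (a : ZMod N) : HasSymbol (monomialFiltration N g x y) P s (b + c)
      (dualMonomial q (D.lift D.book.chi) X Y b a c)
      (dualMonomial q (Q₀.dualAction D.book.chi) (Q₀.dualAction D.book.xi)
        (Q₀.dualAction D.book.eta) b a c) := by
  have hP := D.filtered.antitone
  have hs := D.iso.filtered
  have hs' := D.iso.filtered_symm
  have h1 : HasSymbol (monomialFiltration N g x y) P s 0
      (fourierProjection q (D.lift D.book.chi) (a + (b : ZMod N)))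
      (fourierProjection q (Q₀.dualAction D.book.chi) (a + (b : ZMod N))) :=
    HasSymbol.fourierProjection hP hs hs' D.hasSymbol_chi _ _
  have h2 := (hX.pow hP hs hs' b).mul hP hs hs' (hY.pow hP hs hs' c)
  rw [mul_one, mul_one] at h2
  have h3 := h2.mul hP hs hs' h1
  rwa [add_zero] at h3

/-- The functions on the index set of the monomials that are supported in degrees `≥ k`. -/
def indexFiltration (N M k : ℕ) : Submodule ℂ (Fin N × ZMod N × Fin M → ℂ) where
  carrier := {f | ∀ i, (i.1 : ℕ) + i.2.2 < k → f i = 0}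
  add_mem' hf hf' i hi := by rw [Pi.add_apply, hf i hi, hf' i hi, add_zero]
  zero_mem' _ _ := rfl
  smul_mem' c f hf i hi := by rw [Pi.smul_apply, hf i hi, smul_zero]

/-- To leading order these functionals are the dual basis of the divided monomials, and a map with
bijective leading part is bijective. -/
theorem bijective_dualMonomial (D : IsBookDeformation Q₀ Q N M q g x y P g' x' y' s)
    {X Y : Module.End ℂ H}
    (hX : HasSymbol (monomialFiltration N g x y) P s 1 X (Q₀.dualAction D.book.xi))
    (hY : HasSymbol (monomialFiltration N g x y) P s 1 Y (Q₀.dualAction D.book.eta)) :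
    Function.Bijective fun (h : H) (i : Fin N × ZMod N × Fin M) =>
      Q.counit (dualMonomial q (D.lift D.book.chi) X Y i.1 i.2.1 i.2.2 h) := by
  let κ : H →ₗ[ℂ] (Fin N × ZMod N × Fin M → ℂ) := LinearMap.pi fun i =>
    Q.counit ∘ₗ dualMonomial q (D.lift D.book.chi) X Y i.1 i.2.1 i.2.2
  let κ₀ := D.book.basis.equivFun
  have hκ₀ : ∀ u i, κ₀ u i = Q₀.counit (dualMonomial q (Q₀.dualAction D.book.chi)
      (Q₀.dualAction D.book.xi) (Q₀.dualAction D.book.eta) i.1 i.2.1 i.2.2 u) := by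
    intro u i
    refine LinearMap.congr_fun (D.book.hom_ext (f := (LinearMap.proj i) ∘ₗ κ₀.toLinearMap)
      (f' := Q₀.counit ∘ₗ dualMonomial q (Q₀.dualAction D.book.chi)
      (Q₀.dualAction D.book.xi) (Q₀.dualAction D.book.eta) i.1 i.2.1 i.2.2)
      fun b a c hb hc => ?_) u
    rw [LinearMap.comp_apply, LinearMap.comp_apply, D.book.counit_dualMonomial _ _ _ a hb hc]
    have e := D.book.basis_apply (⟨b, hb⟩, a, ⟨c, hc⟩)
    simp only at e
    rw [← e]
    simp only [κ₀, LinearEquiv.coe_coe, LinearMap.proj_apply, Module.Basis.equivFun_apply,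
      Module.Basis.repr_self, Finsupp.single_apply, Prod.ext_iff, Fin.ext_iff]
  have h1 : FilteredEq (monomialFiltration N g x y) (indexFiltration N M)
      (κ ∘ₗ s.toLinearMap) κ₀.toLinearMap := by
    intro k u hu i hi
    rw [Pi.sub_apply, LinearEquiv.coe_coe, hκ₀, sub_eq_zero]
    exact D.counit_apply (D.hasSymbol_dualMonomial hX hY _ _ _)
      (IsBookAlgebra.monomialFiltration_antitone (by omega) hu)
  have h2 : FilteredMap (monomialFiltration N g x y) (indexFiltration N M) κ₀.toLinearMap := by
    intro k
    refine D.book.monomialFiltration_le (S := (indexFiltration N M k).comap κ₀.toLinearMap)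
      fun b c a hb hc hbc i hi => ?_
    rw [LinearEquiv.coe_coe, hκ₀, D.book.counit_dualMonomial _ _ _ a hb hc, if_neg]
    rintro ⟨e1, -, e2⟩
    omega
  have h3 : FilteredMap (indexFiltration N M) (monomialFiltration N g x y)
      κ₀.symm.toLinearMap := by
    intro k f hf
    rw [LinearEquiv.coe_coe, Module.Basis.equivFun_symm_apply]
    refine Submodule.sum_mem _ fun i _ => ?_
    by_cases hi : (i.1 : ℕ) + i.2.2 < k
    · rw [hf i hi, zero_smul]; exact zero_mem _
    · rw [D.book.basis_apply]
      exact Submodule.smul_mem _ _ (IsBookAlgebra.divMonomial_mem _ (by omega))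
  obtain ⟨e, he, -⟩ := h1.exists_equiv h2 h3
    (fun k l hkl f hf i hi => hf i (by omega)) (eq_top_iff.2 fun f _ i hi => by omega) (m := N + M)
    (eq_bot_iff.2 fun f hf => funext fun i => hf i (by omega))
  have h4 : ⇑κ = e ∘ s.symm := by
    funext a
    have h5 := LinearMap.congr_fun he (s.symm a)
    rw [LinearMap.comp_apply, LinearEquiv.coe_coe, LinearEquiv.coe_coe,
      LinearEquiv.apply_symm_apply] at h5
    exact h5.symm
  change Function.Bijective ⇑κ
  rw [h4]
  exact e.bijective.comp s.symm.bijective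

/-- A deformation of a book algebra with trivial associator has dual generators. -/
theorem exists_dualGenerators (D : IsBookDeformation Q₀ Q N M q g x y P g' x' y' s) :
    ∃ C X Y : Module.End ℂ H, Q.DualGenerators N M q C X Y := by
  obtain ⟨X, hX, hXm, hCX, hXN, hXs⟩ := D.exists_X
  obtain ⟨Y, hY, hYm, hCY, hYM, hYs⟩ := D.exists_Y
  have hC := D.lift_comodule D.book.chi
  refine ⟨D.lift D.book.chi, X, Y, D.book.root, hC, hX, hY, D.lift_chi_mul, hXm, hYm,
    D.lift_chi_pow, hCX, hCY, hXN, hYM, ?_, D.bijective_dualMonomial hXs hYs⟩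
  rw [← sub_eq_zero]
  -- In the commutator of `X` and `Y` applied to a product, the mixed terms `C Y a * X C b` and `Y C
  -- a * C X b` cancel because both operators commute with `C` up to the same factor `q⁻¹`; what
  -- remains is a derivation along `C`.
  refine D.eq_zero_of_derivation ((hX.mul hY).sub (hY.mul hX)) 1 fun a b => ?_
  have e1 : ∀ a, D.lift D.book.chi (X a) = q⁻¹ • X (D.lift D.book.chi a) :=
    fun a => LinearMap.congr_fun hCX a
  have e2 : ∀ a, D.lift D.book.chi (Y a) = q⁻¹ • Y (D.lift D.book.chi a) :=
    fun a => LinearMap.congr_fun hCY a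
  simp only [LinearMap.sub_apply, Module.End.mul_apply, hXm, hYm, map_add, pow_one, e1, e2,
    mul_sub, sub_mul, smul_mul_assoc, mul_smul_comm]
  abel

end IsBookDeformation
end QuasiHopfData

/-! ## Antipodes and twists -/

namespace QuasiHopfData

section AntipodeTwist

variable {H : Type*} [Ring H] [Algebra ℂ H] {Q : QuasiHopfData H}

theorem antipodeLeft_tmul (c a b : H) : Q.antipodeLeft c (a ⊗ₜ[ℂ] b) = Q.antipode a * c * b := rfl

theorem antipodeRight_tmul (c a b : H) : Q.antipodeRight c (a ⊗ₜ[ℂ] b) = a * c * Q.antipode b := rfl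

/-- The tensor square acts on `H` from the right by `c ↦ ∑ S(t₁) c t₂`. The twisted `α` is a value
of this action, so twists cancel by associativity; `antipodeRight_mul` is the left action that
governs `β`. -/
theorem antipodeLeft_mul (hS : ∀ a b, Q.antipode (a * b) = Q.antipode b * Q.antipode a) (c : H)
    (t w : H ⊗[ℂ] H) :
    Q.antipodeLeft c (t * w) = Q.antipodeLeft (Q.antipodeLeft c t) w := by
  induction w using TensorProduct.induction_on with
  | zero => simp
  | add w w' h h' => simp only [mul_add, map_add, h, h']
  | tmul u v =>
    rw [antipodeLeft_tmul]
    induction t using TensorProduct.induction_on with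
    | zero => simp
    | add t t' h h' => simp only [add_mul, mul_add, map_add, h, h']
    | tmul a b =>
      simp only [Algebra.TensorProduct.tmul_mul_tmul, antipodeLeft_tmul, hS, mul_assoc]

theorem antipodeRight_mul (hS : ∀ a b, Q.antipode (a * b) = Q.antipode b * Q.antipode a) (c : H)
    (w t : H ⊗[ℂ] H) :
    Q.antipodeRight c (w * t) = Q.antipodeRight (Q.antipodeRight c t) w := by
  induction w using TensorProduct.induction_on with
  | zero => simp
  | add w w' h h' => simp only [add_mul, map_add, h, h']
  | tmul u v =>
    rw [antipodeRight_tmul]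
    induction t using TensorProduct.induction_on with
    | zero => simp
    | add t t' h h' => simp only [add_mul, mul_add, map_add, h, h']
    | tmul a b =>
      simp only [Algebra.TensorProduct.tmul_mul_tmul, antipodeRight_tmul, hS, mul_assoc]

theorem antipodeLeft_smul (r : ℂ) (c : H) (t : H ⊗[ℂ] H) :
    Q.antipodeLeft (r • c) t = r • Q.antipodeLeft c t := by
  induction t using TensorProduct.induction_on with
  | zero => simp
  | add t t' h h' => simp only [map_add, smul_add, h, h']
  | tmul a b => simp [antipodeLeft_tmul]

theorem antipodeRight_smul (r : ℂ) (c : H) (t : H ⊗[ℂ] H) :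
    Q.antipodeRight (r • c) t = r • Q.antipodeRight c t := by
  induction t using TensorProduct.induction_on with
  | zero => simp
  | add t t' h h' => simp only [map_add, smul_add, h, h']
  | tmul a b => simp [antipodeRight_tmul]

theorem antipodeLeft_one (hS : Q.antipode 1 = 1) (c : H) : Q.antipodeLeft c 1 = c := by
  rw [Algebra.TensorProduct.one_def, antipodeLeft_tmul, hS, one_mul, mul_one]

theorem antipodeRight_one (hS : Q.antipode 1 = 1) (c : H) : Q.antipodeRight c 1 = c := by
  rw [Algebra.TensorProduct.one_def, antipodeRight_tmul, hS, one_mul, mul_one]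

/-- `x ⊗ y ⊗ z ↦ x b S(y) c z`. -/
noncomputable def zigzagWith (Q : QuasiHopfData H) (b c : H) : H ⊗[ℂ] (H ⊗[ℂ] H) →ₗ[ℂ] H :=
  LinearMap.mul' ℂ H ∘ₗ TensorProduct.map (LinearMap.mulRight ℂ b) (Q.antipodeLeft c)

theorem zigzagWith_tmul (b c x : H) (w : H ⊗[ℂ] H) :
    Q.zigzagWith b c (x ⊗ₜ w) = x * b * Q.antipodeLeft c w := rfl

/-- This lemma and the next three strip the outer factors from the twisted associator: those from
`F` and its inverse alone are absorbed into `α` and `β`, those containing a coproduct collapse by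
the antipode axioms to a partial counit. -/
theorem zigzagWith_one_tmul_mul
    (hS : ∀ a b, Q.antipode (a * b) = Q.antipode b * Q.antipode a) (b c : H)
    (t : H ⊗[ℂ] H) (T : H ⊗[ℂ] (H ⊗[ℂ] H)) :
    Q.zigzagWith b c ((1 ⊗ₜ t) * T) = Q.zigzagWith b (Q.antipodeLeft c t) T := by
  induction T using TensorProduct.induction_on with
  | zero => simp
  | add w w' h h' => simp only [mul_add, map_add, h, h']
  | tmul x w =>
    rw [Algebra.TensorProduct.tmul_mul_tmul, one_mul, zigzagWith_tmul, zigzagWith_tmul,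
      antipodeLeft_mul hS]

theorem zigzagWith_comulRight_mul (hQ : Q.IsQuasiHopf) (b : H) (t : H ⊗[ℂ] H)
    (T : H ⊗[ℂ] (H ⊗[ℂ] H)) : Q.zigzagWith b Q.alpha (Q.comulRight t * T) =
      Q.counitRight t * Q.zigzagWith b Q.alpha T := by
  induction t using TensorProduct.induction_on with
  | zero => simp
  | add w w' h h' => simp only [add_mul, map_add, h, h']
  | tmul f u =>
    induction T using TensorProduct.induction_on with
    | zero => simp
    | add w w' h h' => simp only [mul_add, map_add, h, h']
    | tmul x w =>
      change Q.zigzagWith b Q.alpha ((f ⊗ₜ Q.comul u) * (x ⊗ₜ w)) = _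
      rw [Algebra.TensorProduct.tmul_mul_tmul, zigzagWith_tmul, zigzagWith_tmul,
        antipodeLeft_mul hQ.antipode_mul, hQ.antipode_left, antipodeLeft_smul]
      simp [counitRight, mul_assoc]

theorem zigzagWith_mul_tensorOne
    (hS : ∀ a b, Q.antipode (a * b) = Q.antipode b * Q.antipode a) (b c : H)
    (t : H ⊗[ℂ] H) (T : H ⊗[ℂ] (H ⊗[ℂ] H)) :
    Q.zigzagWith b c (T * tensorOne t) = Q.zigzagWith (Q.antipodeRight b t) c T := by
  induction T using TensorProduct.induction_on with
  | zero => simp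
  | add w w' h h' => simp only [add_mul, map_add, h, h']
  | tmul x w =>
    rw [zigzagWith_tmul]
    induction w using TensorProduct.induction_on with
    | zero => simp
    | add w w' h h' => simp only [TensorProduct.tmul_add, add_mul, mul_add, map_add, h, h']
    | tmul y z =>
      induction t using TensorProduct.induction_on with
      | zero => simp
      | add w w' h h' => simp only [mul_add, add_mul, map_add, h, h']
      | tmul u v =>
        rw [tensorOne_tmul, Algebra.TensorProduct.tmul_mul_tmul,
          Algebra.TensorProduct.tmul_mul_tmul, zigzagWith_tmul, antipodeLeft_tmul,
          antipodeLeft_tmul, antipodeRight_tmul, hS]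
        simp only [mul_assoc, mul_one]

theorem zigzagWith_mul_comulLeft (hQ : Q.IsQuasiHopf) (c : H) (t : H ⊗[ℂ] H)
    (T : H ⊗[ℂ] (H ⊗[ℂ] H)) : Q.zigzagWith Q.beta c (T * Q.comulLeft t) =
      Q.zigzagWith Q.beta c T * Q.counitLeft t := by
  induction t using TensorProduct.induction_on with
  | zero => simp
  | add w w' h h' => simp only [mul_add, map_add, h, h']
  | tmul u v =>
    have h1 : Q.comulLeft (u ⊗ₜ v) = (1 ⊗ₜ (1 ⊗ₜ v)) * tensorOne (Q.comul u) := by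
      change TensorProduct.assoc ℂ H H H (Q.comul u ⊗ₜ v) = _
      induction Q.comul u using TensorProduct.induction_on with
      | zero => simp
      | add w w' h h' => simp only [TensorProduct.add_tmul, map_add, mul_add, h, h']
      | tmul a b => simp [tensorOne_tmul]
    rw [h1, ← mul_assoc, zigzagWith_mul_tensorOne hQ.antipode_mul, hQ.antipode_right]
    induction T using TensorProduct.induction_on with
    | zero => simp
    | add w w' h h' => simp only [add_mul, map_add, h, h']
    | tmul x w =>
      rw [Algebra.TensorProduct.tmul_mul_tmul, zigzagWith_tmul, zigzagWith_tmul]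
      induction w using TensorProduct.induction_on with
      | zero => simp
      | add w w' h h' => simp only [add_mul, mul_add, map_add, h, h']
      | tmul y z =>
        simp [antipodeLeft_tmul, counitLeft, mul_assoc]

theorem zigzag_twist_assoc (hQ : Q.IsQuasiHopf) {F : (H ⊗[ℂ] H)ˣ} (hF : Q.IsTwist F) :
    (Q.twist F).zigzag (Q.twist F).assoc = 1 := by
  have hF' := hQ.isQuasiBialgebra.isTwist_inv hF
  have hS := hQ.antipode_mul
  change Q.zigzagWith (Q.antipodeRight Q.beta F)
    (Q.antipodeLeft Q.alpha ((F⁻¹ : (H ⊗[ℂ] H)ˣ) : H ⊗[ℂ] H))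
    ((1 ⊗ₜ[ℂ] (F : H ⊗[ℂ] H)) * Q.comulRight (F : H ⊗[ℂ] H) * Q.assoc *
    Q.comulLeft ((F⁻¹ : (H ⊗[ℂ] H)ˣ) : H ⊗[ℂ] H) * tensorOne ((F⁻¹ : (H ⊗[ℂ] H)ˣ) : H ⊗[ℂ] H)) = 1
  rw [zigzagWith_mul_tensorOne hS, ← antipodeRight_mul hS, Units.inv_mul,
    antipodeRight_one hQ.antipode_one, zigzagWith_mul_comulLeft hQ, hF'.1, mul_one, mul_assoc,
    zigzagWith_one_tmul_mul hS, ← antipodeLeft_mul hS, Units.inv_mul,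
    antipodeLeft_one hQ.antipode_one, zigzagWith_comulRight_mul hQ, hF.2, one_mul]
  exact hQ.zigzag_assoc

theorem antipode_left_twist (hQ : Q.IsQuasiHopf) (F : (H ⊗[ℂ] H)ˣ) (a : H) :
    (Q.twist F).antipodeLeft (Q.twist F).alpha ((Q.twist F).comul a) =
      Q.counit a • (Q.twist F).alpha := by
  have hS := hQ.antipode_mul
  change Q.antipodeLeft (Q.antipodeLeft Q.alpha ((F⁻¹ : (H ⊗[ℂ] H)ˣ) : H ⊗[ℂ] H)) _ =
    Q.counit a • Q.antipodeLeft Q.alpha ((F⁻¹ : (H ⊗[ℂ] H)ˣ) : H ⊗[ℂ] H)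
  rw [twist_comul, ← antipodeLeft_mul hS, ← mul_assoc, ← mul_assoc, Units.inv_mul, one_mul,
    antipodeLeft_mul hS, hQ.antipode_left, antipodeLeft_smul]

theorem twist_inv_twist_assoc (hQ : Q.IsQuasiBialgebra) (F : (H ⊗[ℂ] H)ˣ) :
    ((Q.twist F).twist F⁻¹).assoc = Q.assoc := by
  rw [hQ.twist_twist_assoc, inv_mul_cancel]
  change (1 ⊗ₜ[ℂ] (1 : H ⊗[ℂ] H)) * Q.comulRight (1 : H ⊗[ℂ] H) * Q.assoc *
    Q.comulLeft (((1 : (H ⊗[ℂ] H)ˣ)⁻¹ : (H ⊗[ℂ] H)ˣ) : H ⊗[ℂ] H) *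
      tensorOne (((1 : (H ⊗[ℂ] H)ˣ)⁻¹ : (H ⊗[ℂ] H)ˣ) : H ⊗[ℂ] H) = _
  rw [inv_one, Units.val_one, hQ.comulLeft_one, hQ.comulRight_one, tensorOne_one,
    ← Algebra.TensorProduct.one_def, one_mul, one_mul, mul_one, mul_one]

end AntipodeTwist

/-- A left and a right convolution inverse of the identity agree. -/
theorem convolution_inverse_unique {A : Type*} [Ring A] [Algebra ℂ A] {Q : QuasiHopfData A}
    (hQ : Q.IsQuasiBialgebra)
    (hc : ∀ a, Q.comulRight (Q.comul a) = Q.comulLeft (Q.comul a)) {T S : A →ₗ[ℂ] A}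
    (hT : ∀ a, LinearMap.mul' ℂ A (TensorProduct.map T LinearMap.id (Q.comul a)) = Q.counit a • 1)
    (hS : ∀ a, LinearMap.mul' ℂ A (TensorProduct.map LinearMap.id S (Q.comul a)) = Q.counit a • 1)
    (a : A) : T a = S a := by
  -- The convolution product of `T`, the identity and `S`, to be evaluated with both bracketings.
  let Θ : A ⊗[ℂ] (A ⊗[ℂ] A) →ₗ[ℂ] A := LinearMap.mul' ℂ A ∘ₗ
    TensorProduct.map T (LinearMap.mul' ℂ A ∘ₗ TensorProduct.map LinearMap.id S)
  have h1 : ∀ t, Θ (Q.comulRight t) = T (Q.counitRight t) := by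
    intro t
    induction t using TensorProduct.induction_on with
    | zero => simp
    | add w w' h h' => simp only [map_add, h, h']
    | tmul x y =>
      change T x * LinearMap.mul' ℂ A (TensorProduct.map LinearMap.id S (Q.comul y)) = _
      rw [hS]
      simp [counitRight]
  have h2 : ∀ t, Θ (Q.comulLeft t) = S (Q.counitLeft t) := by
    intro t
    induction t using TensorProduct.induction_on with
    | zero => simp
    | add w w' h h' => simp only [map_add, h, h']
    | tmul x y =>
      have h3 : ∀ w : A ⊗[ℂ] A, Θ (TensorProduct.assoc ℂ A A A (w ⊗ₜ y)) =
          LinearMap.mul' ℂ A (TensorProduct.map T LinearMap.id w) * S y := by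
        intro w
        induction w using TensorProduct.induction_on with
        | zero => simp
        | add w w' h h' => simp only [TensorProduct.add_tmul, map_add, add_mul, h, h']
        | tmul u v => simp [Θ, mul_assoc]
      change Θ (TensorProduct.assoc ℂ A A A (Q.comul x ⊗ₜ y)) = _
      rw [h3, hT]
      simp [counitLeft]
  rw [← hQ.counitRight_comul a, ← h1, hc, h2, hQ.counitLeft_comul, hQ.counitRight_comul]

/-- If a twist of a quasi-Hopf algebra is isomorphic to a Hopf algebra as a bialgebra, then the
quasi-Hopf algebra is isomorphic to a twist of the Hopf algebra. -/
theorem isomorphic_twist {H A : Type*} [Ring H] [Algebra ℂ H] [FiniteDimensional ℂ H] [Ring A]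
    [Algebra ℂ A] {Q : QuasiHopfData H} {Q₀ : QuasiHopfData A} (hQ : Q.IsQuasiHopf)
    (hQ₀ : Q₀.IsQuasiBialgebra) (h₀ : Q₀.assoc = 1) (hα : Q₀.alpha = 1) (hβ : Q₀.beta = 1)
    (hS : ∀ a, Q₀.antipodeRight 1 (Q₀.comul a) = Q₀.counit a • 1)
    {F : (H ⊗[ℂ] H)ˣ} (hF : Q.IsTwist F) (hF1 : (Q.twist F).assoc = 1) (Ψ : H ≃ₐ[ℂ] A)
    (hΨ : ∀ h, Q₀.comul (Ψ h) =
      TensorProduct.map Ψ.toLinearMap Ψ.toLinearMap ((Q.twist F).comul h))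
    (hΨ' : ∀ h, Q₀.counit (Ψ h) = (Q.twist F).counit h) :
    Q.Isomorphic (Q₀.twist (Units.map
      (Algebra.TensorProduct.map Ψ.toAlgHom Ψ.toAlgHom : H ⊗[ℂ] H →* A ⊗[ℂ] A) F⁻¹)) := by
  have hQ1 := hQ.isQuasiBialgebra.twist hF
  set Q1 := Q.twist F with hQ1d
  set Ψ2 : H ⊗[ℂ] H →ₐ[ℂ] A ⊗[ℂ] A := Algebra.TensorProduct.map Ψ.toAlgHom Ψ.toAlgHom
  set F' : (A ⊗[ℂ] A)ˣ := Units.map (Ψ2 : H ⊗[ℂ] H →* A ⊗[ℂ] A) F⁻¹ with hF'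
  have e1 : (F' : A ⊗[ℂ] A) = Ψ2 ((F⁻¹ : (H ⊗[ℂ] H)ˣ) : H ⊗[ℂ] H) := rfl
  have e2 : ((F'⁻¹ : (A ⊗[ℂ] A)ˣ) : A ⊗[ℂ] A) = Ψ2 (F : H ⊗[ℂ] H) := by
    rw [hF', ← map_inv, inv_inv]; rfl
  have hΨ2 : ∀ t, Ψ2 t = TensorProduct.map Ψ.toLinearMap Ψ.toLinearMap t := fun _ => rfl
  -- With trivial associator the zigzag axiom of the twist becomes `β α = 1`; finite dimension then
  -- gives `α β = 1`.
  have hba : Q1.beta * Q1.alpha = 1 := by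
    have h1 := zigzag_twist_assoc hQ hF
    rw [← hQ1d, hF1] at h1
    have h2 : Q1.zigzag (1 ⊗ₜ (1 ⊗ₜ 1)) = 1 * Q1.beta * (Q.antipode 1 * Q1.alpha * 1) := rfl
    rw [Algebra.TensorProduct.one_def, Algebra.TensorProduct.one_def, h2, hQ.antipode_one, one_mul,
      one_mul, mul_one] at h1
    exact h1
  have : IsArtinianRing H := IsArtinianRing.of_finite ℂ H
  have hab : Q1.alpha * Q1.beta = 1 := mul_eq_one_symm hba
  have pba : Ψ Q1.beta * Ψ Q1.alpha = 1 := by rw [← map_mul, hba, map_one]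
  have pab : Ψ Q1.alpha * Ψ Q1.beta = 1 := by rw [← map_mul, hab, map_one]
  -- By the antipode axiom for `α`, conjugating the antipode of `H` with `β` and `α` gives a left
  -- convolution inverse of the identity of `A`, which must be the antipode of `A`.
  have hanti : ∀ a, Ψ Q1.beta * Ψ (Q.antipode a) * Ψ Q1.alpha = Q₀.antipode (Ψ a) := by
    let T : A →ₗ[ℂ] A := LinearMap.mulLeft ℂ (Ψ Q1.beta) ∘ₗ LinearMap.mulRight ℂ (Ψ Q1.alpha) ∘ₗ
      Ψ.toLinearMap ∘ₗ Q.antipode ∘ₗ Ψ.symm.toLinearMap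
    have hT : ∀ a, T (Ψ a) = Ψ (Q1.beta * (Q.antipode a * Q1.alpha)) := by
      intro a
      simp [T]
    have hT' : ∀ t : H ⊗[ℂ] H, LinearMap.mul' ℂ A (TensorProduct.map T LinearMap.id
        (TensorProduct.map Ψ.toLinearMap Ψ.toLinearMap t)) =
        Ψ (Q1.beta * Q1.antipodeLeft Q1.alpha t) := by
      intro t
      induction t using TensorProduct.induction_on with
      | zero => simp
      | add w w' h h' => simp only [map_add, mul_add, h, h']
      | tmul x y =>
        rw [antipodeLeft_tmul]
        change T (Ψ x) * Ψ y = _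
        rw [hT, ← map_mul]
        simp only [mul_assoc]
        rfl
    intro a
    have h1 := convolution_inverse_unique hQ₀ (fun a => by
        have h := hQ₀.quasi_coassoc a
        rwa [h₀, mul_one, one_mul] at h) (T := T) (S := Q₀.antipode)
      (fun a => by
        obtain ⟨a, rfl⟩ := Ψ.surjective a
        rw [hΨ, hT', antipode_left_twist hQ, mul_smul_comm, hba, map_smul, map_one, hΨ']
        rfl)
      (fun a => by
        have h := hS a
        rw [antipodeRight, LinearMap.mulRight_one] at h
        exact h) (Ψ a)
    rw [hT, map_mul, map_mul, ← mul_assoc] at h1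
    exact h1
  have hL : ∀ t, Ψ Q1.alpha * Q₀.antipodeLeft 1 (Ψ2 t) = Ψ (Q.antipodeLeft Q1.alpha t) := by
    intro t
    induction t using TensorProduct.induction_on with
    | zero => simp
    | add w w' h h' => simp only [map_add, mul_add, h, h']
    | tmul x y =>
      change Ψ Q1.alpha * (Q₀.antipode (Ψ x) * 1 * Ψ y) = Ψ (Q.antipode x * Q1.alpha * y)
      rw [← hanti, mul_one, map_mul, map_mul]
      simp only [← mul_assoc]
      rw [pab, one_mul]
  have hR : ∀ t, Q₀.antipodeRight 1 (Ψ2 t) * Ψ Q1.beta = Ψ (Q.antipodeRight Q1.beta t) := by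
    intro t
    induction t using TensorProduct.induction_on with
    | zero => simp
    | add w w' h h' => simp only [map_add, add_mul, h, h']
    | tmul x y =>
      change Ψ x * 1 * Q₀.antipode (Ψ y) * Ψ Q1.beta = Ψ (x * Q1.beta * Q.antipode y)
      rw [← hanti, mul_one, map_mul, map_mul]
      simp only [mul_assoc]
      rw [pab, mul_one]
  -- The unit relating the triples is the image of the twisted `α`, with inverse the image of the
  -- twisted `β`.
  refine ⟨Ψ, fun a => ?_, hΨ', ?_, ⟨Ψ Q1.alpha, Ψ Q1.beta, pab, pba⟩, fun a => ?_, ?_, ?_⟩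
  · rw [twist_comul, hΨ, ← hΨ2, ← hΨ2, e1, e2, ← map_mul, ← map_mul, hQ1d, twist_comul]
    congr 1
    rw [← mul_assoc, ← mul_assoc, Units.inv_mul, one_mul, mul_assoc, Units.inv_mul, mul_one]
  · let Ψ3 : H ⊗[ℂ] (H ⊗[ℂ] H) →ₐ[ℂ] A ⊗[ℂ] (A ⊗[ℂ] A) :=
      Algebra.TensorProduct.map Ψ.toAlgHom Ψ2
    have hΔ : Q₀.comul ∘ₗ Ψ.toLinearMap =
        TensorProduct.map Ψ.toLinearMap Ψ.toLinearMap ∘ₗ Q1.comul := LinearMap.ext hΨ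
    have c1 : ∀ t, Ψ3 (Q1.comulRight t) = Q₀.comulRight (Ψ2 t) := by
      intro t
      refine (LinearMap.congr_fun (map_comulRight Q1 Ψ.toLinearMap) t).trans ?_
      rw [← hΔ]
      exact (LinearMap.congr_fun (comulRight_map Q₀ Ψ.toLinearMap) t).symm
    have c2 : ∀ t, Ψ3 (Q1.comulLeft t) = Q₀.comulLeft (Ψ2 t) := by
      intro t
      refine (LinearMap.congr_fun (map_comulLeft Q1 Ψ.toLinearMap) t).trans ?_
      rw [← hΔ]
      exact (LinearMap.congr_fun (comulLeft_map Q₀ Ψ.toLinearMap) t).symm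
    have c3 : ∀ t, Ψ3 (tensorOne t) = tensorOne (Ψ2 t) := fun t =>
      (LinearMap.congr_fun (tensorOne_map (s := Ψ.toLinearMap) (map_one Ψ)) t).symm
    have c4 : ∀ t, Ψ3 (1 ⊗ₜ t) = 1 ⊗ₜ Ψ2 t := fun t => by
      rw [Algebra.TensorProduct.map_tmul, map_one]
    change (1 ⊗ₜ[ℂ] (F' : A ⊗[ℂ] A)) * Q₀.comulRight (F' : A ⊗[ℂ] A) * Q₀.assoc *
      Q₀.comulLeft ((F'⁻¹ : (A ⊗[ℂ] A)ˣ) : A ⊗[ℂ] A) *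
        tensorOne ((F'⁻¹ : (A ⊗[ℂ] A)ˣ) : A ⊗[ℂ] A) = Ψ3 Q.assoc
    rw [← twist_inv_twist_assoc hQ.isQuasiBialgebra F]
    change _ = Ψ3 ((1 ⊗ₜ[ℂ] ((F⁻¹ : (H ⊗[ℂ] H)ˣ) : H ⊗[ℂ] H)) *
      Q1.comulRight ((F⁻¹ : (H ⊗[ℂ] H)ˣ) : H ⊗[ℂ] H) * Q1.assoc *
      Q1.comulLeft (((F⁻¹)⁻¹ : (H ⊗[ℂ] H)ˣ) : H ⊗[ℂ] H) *
        tensorOne (((F⁻¹)⁻¹ : (H ⊗[ℂ] H)ˣ) : H ⊗[ℂ] H))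
    rw [inv_inv, map_mul, map_mul, map_mul, map_mul, c1, c2, c3, c4, hF1, map_one, h₀, e1, e2]
  · change _ = Ψ Q1.alpha * Q₀.antipode (Ψ a) * Ψ Q1.beta
    rw [← hanti]
    simp only [← mul_assoc]
    rw [pab, one_mul, mul_assoc, pab, mul_one]
  · change _ = Ψ Q1.alpha * Q₀.antipodeLeft Q₀.alpha ((F'⁻¹ : (A ⊗[ℂ] A)ˣ) : A ⊗[ℂ] A)
    rw [hα, e2, hL]
    congr 1
    change _ = Q.antipodeLeft (Q.antipodeLeft Q.alpha ((F⁻¹ : (H ⊗[ℂ] H)ˣ) : H ⊗[ℂ] H)) F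
    rw [← antipodeLeft_mul hQ.antipode_mul, Units.inv_mul, antipodeLeft_one hQ.antipode_one]
  · change _ = Q₀.antipodeRight Q₀.beta (F' : A ⊗[ℂ] A) * Ψ Q1.beta
    rw [hβ, e1, hR]
    congr 1
    change _ = Q.antipodeRight (Q.antipodeRight Q.beta F) ((F⁻¹ : (H ⊗[ℂ] H)ˣ) : H ⊗[ℂ] H)
    rw [← antipodeRight_mul hQ.antipode_mul, Units.inv_mul, antipodeRight_one hQ.antipode_one]

end QuasiHopfData

/-! ### The theorem for all book algebras. -/

namespace IsBookAlgebra

open QuasiHopfData RadGr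

/-- A basic quasi-Hopf algebra whose associated graded algebra is a book algebra is a twist of it. -/
theorem exists_twist {A : Type*} [Ring A] [Algebra ℂ A] {Q₀ : QuasiHopfData A} {N M : ℕ}
    [NeZero N] {q : ℂ} {g x y : A} {H : Type*} [Ring H] [Algebra ℂ H] [FiniteDimensional ℂ H]
    {Q : QuasiHopfData H} (h : IsBookAlgebra Q₀ N M q g x y) (hα : Q₀.alpha = 1)
    (hβ : Q₀.beta = 1) (hS : ∀ a, Q₀.antipodeRight 1 (Q₀.comul a) = Q₀.counit a • 1)
    (hy : y ∈ monomialFiltration N g x y 1)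
    (hQ : Q.IsQuasiHopf) (hH : IsBasicAlgebra H) (hJ : Q.RadicalIsQuasiHopfIdeal)
    (hiso : (gr hQ hJ).Isomorphic Q₀) :
    ∃ F : (A ⊗[ℂ] A)ˣ, Q₀.IsTwist F ∧ (F : A ⊗[ℂ] A) - 1 ∈
      tensorFiltration (monomialFiltration N g x y) (monomialFiltration N g x y) 1 ∧
      Q.Isomorphic (Q₀.twist F) := by
  have hQ₀ := h.isQuasiBialgebra
  have hB := RadGr.isFiltered hQ hJ
  obtain ⟨g', x', y', s, ht, hs, hsm, h1⟩ := h.exists_filteredIso hQ hH hJ hiso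
  -- If `M = 1`, the element `y'` enters no monomial and may be replaced by zero, which certainly
  -- has positive degree.
  obtain ⟨y'', ht', hsm', hy'⟩ : ∃ y'' : H, SkewTriple N q g' x' y'' ∧
      (∀ (b c : ℕ) (a : ZMod N), b < N → c < M →
        s (skewMonomial g x y b a c) = skewMonomial g' x' y'' b a c) ∧ y'' ∈ radPow H 1 := by
    rcases h.M_eq with hM | hM
    · refine ⟨0, ⟨ht.root, ht.g_pow, ht.g_mul_x, by simp⟩, fun b c a hb hc => ?_, zero_mem _⟩
      obtain rfl : c = 0 := by omega
      rw [hsm b 0 a hb hc]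
      simp [skewMonomial]
    · refine ⟨y', ht, hsm, ?_⟩
      have hN := h.three_le
      have e := hsm 0 1 0 (by omega) (by omega)
      have e' : s y = y' := by simpa [skewMonomial] using e
      rw [← e']
      exact hs.filtered 1 _ hy
  obtain ⟨F, hF, hF1, hF2⟩ := hB.exists_twist_assoc_eq_one hs h.isGradedBy hQ₀
    h.exists_cobarTrivial₂ h1
  have D : IsBookDeformation Q₀ (Q.twist F) N M q g x y (radPow H) g' x' y'' s :=
    ⟨h, hB.twist hF hF1, hF2, hs.twist hB hF1, ht', hsm', hy'⟩
  -- The book algebra is a deformation of itself, so its dual generators come from the same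
  -- construction.
  have D₀ : IsBookDeformation Q₀ Q₀ N M q g x y (monomialFiltration N g x y) g x y
      (LinearEquiv.refl ℂ A) :=
    ⟨h, ⟨hQ₀, monomialFiltration_antitone, h.monomialFiltration_zero,
      ⟨_, h.monomialFiltration_eq_bot⟩, h.mulFiltration, h.isGradedBy.comul⟩, h.assoc,
      ⟨fun _ _ hu => hu, fun _ _ hu => hu, fun k u _ => by simp, rfl, rfl⟩, h.toSkewTriple,
      fun _ _ _ _ _ => rfl, hy⟩
  obtain ⟨C, X, Y, hD⟩ := D.exists_dualGenerators
  obtain ⟨C₀, X₀, Y₀, hD₀⟩ := D₀.exists_dualGenerators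
  obtain ⟨Ψ, hΨ, hΨ'⟩ := hD.exists_algEquiv hD₀ D.filtered.isQuasiBialgebra hQ₀
  have hF' := hQ.isQuasiBialgebra.isTwist_inv hF
  refine ⟨_, ⟨?_, ?_⟩, ?_, isomorphic_twist hQ hQ₀ h.assoc hα hβ hS hF hF2 Ψ hΨ hΨ'⟩
  · have e : Q₀.counit ∘ₗ Ψ.toLinearMap = Q.counit := LinearMap.ext hΨ'
    refine (counitLeft_map e ((F⁻¹ : (H ⊗[ℂ] H)ˣ) : H ⊗[ℂ] H)).trans ?_
    rw [hF'.1]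
    exact map_one Ψ
  · have e : Q₀.counit ∘ₗ Ψ.toLinearMap = Q.counit := LinearMap.ext hΨ'
    refine (counitRight_map e ((F⁻¹ : (H ⊗[ℂ] H)ˣ) : H ⊗[ℂ] H)).trans ?_
    rw [hF'.2]
    exact map_one Ψ
  -- `Ψ` comes from a comparison of duals, but being an algebra map it sends the radical to
  -- nilpotent elements, and these have positive degree.
  · have hJ1 : ∀ v ∈ radPow H 1, Ψ v ∈ monomialFiltration N g x y 1 := by
      intro v hv
      obtain ⟨m, hm⟩ := hB.eq_bot
      exact h.mem_of_isNilpotent ((hB.mul.isNilpotent hB.zero hm hv).map Ψ)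
    have h2 : tensorFiltration (radPow H) (radPow H) 1 ≤
        (tensorFiltration (monomialFiltration N g x y) (monomialFiltration N g x y) 1).comap
          (TensorProduct.map Ψ.toLinearMap Ψ.toLinearMap) := by
      refine tensorFiltration_le fun i j a b hij ha hb => ?_
      have h0 : ∀ a : A, a ∈ monomialFiltration N g x y 0 := fun a => by
        rw [h.monomialFiltration_zero]; exact Submodule.mem_top
      rcases Nat.eq_zero_or_pos i with rfl | hi
      · obtain rfl : j = 1 := by omega
        exact tmul_mem_tensorFiltration hij (h0 _) (hJ1 b hb)
      · obtain rfl : i = 1 := by omega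
        obtain rfl : j = 0 := by omega
        exact tmul_mem_tensorFiltration hij (hJ1 a ha) (h0 _)
    have h3 : ((F⁻¹ : (H ⊗[ℂ] H)ˣ) : H ⊗[ℂ] H) - 1 ∈ tensorFiltration (radPow H) (radPow H) 1 := by
      have e : ((F⁻¹ : (H ⊗[ℂ] H)ˣ) : H ⊗[ℂ] H) - 1 =
          -(((F : H ⊗[ℂ] H) - 1) * ((F⁻¹ : (H ⊗[ℂ] H)ˣ) : H ⊗[ℂ] H)) := by
        rw [sub_mul, Units.mul_inv, one_mul, neg_sub]
      rw [e]
      exact neg_mem (hB.mul₂.mul_right_mem hB.zero₂ hF1 _)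
    have h4 := h2 h3
    rw [Submodule.mem_comap, map_sub] at h4
    have e : TensorProduct.map Ψ.toLinearMap Ψ.toLinearMap (1 : H ⊗[ℂ] H) = 1 :=
      map_one (Algebra.TensorProduct.map Ψ.toAlgHom Ψ.toAlgHom)
    rw [e] at h4
    exact h4

end IsBookAlgebra

/-! ## A construction of book algebras -/

section Representation

variable (N M : ℕ) [NeZero N] (q : ℂ)

/-- Functions on the index set of the monomials. -/
abbrev MonomialFunctions : Type := ℕ → ZMod N → ℕ → ℂ

/-- The operator dual to right multiplication by `g`. -/
def mulG : Module.End ℂ (MonomialFunctions N) where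
  toFun f b a c := q ^ c * f b (a + 1) c
  map_add' f f' := by funext b a c; exact mul_add _ _ _
  map_smul' r f := by funext b a c; exact mul_left_comm _ _ _

/-- The operator dual to right multiplication by `x`. -/
def mulX : Module.End ℂ (MonomialFunctions N) where
  toFun f b a c := if b + 1 < N then q ^ a.val * f (b + 1) a c else 0
  map_add' f f' := by funext b a c; simp only [Pi.add_apply]; split_ifs <;> ring
  map_smul' r f := by
    funext b a c; simp only [Pi.smul_apply, smul_eq_mul, RingHom.id_apply]; split_ifs <;> ring

/-- The operator dual to right multiplication by `y`. -/
def mulY : Module.End ℂ (MonomialFunctions N) where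
  toFun f b a c := if c + 1 < M then f b a (c + 1) else 0
  map_add' f f' := by funext b a c; simp only [Pi.add_apply]; split_ifs <;> ring
  map_smul' r f := by
    funext b a c; simp only [Pi.smul_apply, smul_eq_mul, RingHom.id_apply]; split_ifs <;> ring

variable {N M q}

theorem mulG_apply (f : MonomialFunctions N) (b : ℕ) (a : ZMod N) (c : ℕ) :
    mulG N q f b a c = q ^ c * f b (a + 1) c := rfl

theorem mulX_apply (f : MonomialFunctions N) (b : ℕ) (a : ZMod N) (c : ℕ) :
    mulX N q f b a c = if b + 1 < N then q ^ a.val * f (b + 1) a c else 0 := rfl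

theorem mulY_apply (f : MonomialFunctions N) (b : ℕ) (a : ZMod N) (c : ℕ) :
    mulY N M f b a c = if c + 1 < M then f b a (c + 1) else 0 := rfl

theorem mulG_pow_apply (n : ℕ) (f : MonomialFunctions N) (b : ℕ) (a : ZMod N) (c : ℕ) :
    (mulG N q ^ n) f b a c = (q ^ c) ^ n * f b (a + (n : ZMod N)) c := by
  induction n generalizing a with
  | zero => simp
  | succ n ih =>
    rw [pow_succ', Module.End.mul_apply, mulG_apply, ih, pow_succ', ← mul_assoc, Nat.cast_succ,
      add_assoc, add_comm (1 : ZMod N)]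

theorem mulX_pow_apply (n : ℕ) (f : MonomialFunctions N) {b : ℕ} (a : ZMod N) (c : ℕ)
    (hb : b < N) : (mulX N q ^ n) f b a c =
      if b + n < N then (q ^ a.val) ^ n * f (b + n) a c else 0 := by
  induction n generalizing b with
  | zero => simp [hb]
  | succ n ih =>
    rw [pow_succ', Module.End.mul_apply, mulX_apply]
    by_cases h : b + 1 < N
    · rw [if_pos h, ih h, pow_succ', add_assoc, add_comm 1 n]
      split_ifs <;> ring
    · rw [if_neg h, if_neg (by omega)]

theorem mulY_pow_apply (n : ℕ) (f : MonomialFunctions N) (b : ℕ) (a : ZMod N) {c : ℕ}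
    (hc : c < M) : (mulY N M ^ n) f b a c = if c + n < M then f b a (c + n) else 0 := by
  induction n generalizing c with
  | zero => simp [hc]
  | succ n ih =>
    rw [pow_succ', Module.End.mul_apply, mulY_apply]
    by_cases h : c + 1 < M
    · rw [if_pos h, ih h, add_assoc, add_comm 1 n]
    · rw [if_neg h, if_neg (by omega)]

theorem mulG_pow (hq : IsPrimitiveRoot q N) : mulG N q ^ N = 1 := by
  refine LinearMap.ext fun f => ?_
  funext b a c
  rw [mulG_pow_apply, ← pow_mul, mul_comm c N, pow_mul, hq.pow_eq_one]
  simp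

theorem mulX_pow : mulX N q ^ N = 0 := by
  refine LinearMap.ext fun f => ?_
  funext b a c
  by_cases hb : b < N
  · rw [mulX_pow_apply _ _ _ _ hb, if_neg (by omega)]; rfl
  · rw [← mul_pow_sub_one (NeZero.ne N), Module.End.mul_apply, mulX_apply, if_neg (by omega)]
    rfl

theorem mulY_pow (hM : M ≠ 0) : mulY N M ^ M = 0 := by
  refine LinearMap.ext fun f => ?_
  funext b a c
  by_cases hc : c < M
  · rw [mulY_pow_apply _ _ _ _ hc, if_neg (by omega)]; rfl
  · obtain ⟨n, rfl⟩ := Nat.exists_eq_succ_of_ne_zero hM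
    rw [pow_succ', Module.End.mul_apply, mulY_apply, if_neg (by omega)]
    rfl

theorem mulG_mul_mulX (hq : IsPrimitiveRoot q N) :
    mulG N q * mulX N q = q • (mulX N q * mulG N q) := by
  refine LinearMap.ext fun f => ?_
  funext b a c
  simp only [Module.End.mul_apply, LinearMap.smul_apply, Pi.smul_apply, mulG_apply, mulX_apply,
    smul_eq_mul]
  split_ifs
  · rw [pow_val_add hq.pow_eq_one, pow_val_one hq.pow_eq_one]
    ring
  · simp

theorem mulG_mul_mulY (hq : IsPrimitiveRoot q N) :
    mulG N q * mulY N M = q⁻¹ • (mulY N M * mulG N q) := by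
  refine LinearMap.ext fun f => ?_
  funext b a c
  simp only [Module.End.mul_apply, LinearMap.smul_apply, Pi.smul_apply, mulG_apply, mulY_apply,
    smul_eq_mul]
  split_ifs
  · rw [pow_succ', mul_assoc, inv_mul_cancel_left₀ (hq.ne_zero (NeZero.ne N))]
  · simp

theorem mulX_mul_mulY : mulX N q * mulY N M = mulY N M * mulX N q := by
  refine LinearMap.ext fun f => ?_
  funext b a c
  simp only [Module.End.mul_apply, mulX_apply, mulY_apply]
  split_ifs <;> simp

/-- Evaluation at the origin after applying a monomial reads off one coordinate of the function, so
the monomials act linearly independently. -/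
theorem skewMonomial_mul_apply (f : MonomialFunctions N) {b c : ℕ} (a : ZMod N) (hb : b < N)
    (hc : c < M) : skewMonomial (mulG N q) (mulX N q) (mulY N M) b a c f 0 0 0 = f b a c := by
  rw [skewMonomial, Module.End.mul_apply, Module.End.mul_apply,
    mulX_pow_apply _ _ _ _ (NeZero.pos N), zero_add, if_pos hb, mulG_pow_apply,
    mulY_pow_apply _ _ _ _ (Nat.zero_lt_of_lt hc), zero_add, if_pos hc]
  simp

end Representation

/-! ### Bialgebra and antipode axioms verified on generators. -/

namespace QuasiHopfData

variable {A : Type*} [Ring A] [Algebra ℂ A] {Q : QuasiHopfData A}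

/-- A bialgebra structure is determined by its values on generators. -/
theorem isQuasiBialgebra_of_algHom {S : Set A} (hS : Algebra.adjoin ℂ S = ⊤)
    (Δ : A →ₐ[ℂ] A ⊗[ℂ] A) (ε : A →ₐ[ℂ] ℂ) (hΔ : Q.comul = Δ.toLinearMap)
    (hε : Q.counit = ε.toLinearMap) (h1 : Q.assoc = 1)
    (hc : ∀ a ∈ S, Q.comulRight (Q.comul a) = Q.comulLeft (Q.comul a))
    (hl : ∀ a ∈ S, Q.counitLeft (Q.comul a) = a) (hr : ∀ a ∈ S, Q.counitRight (Q.comul a) = a) :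
    Q.IsQuasiBialgebra := by
  have eΔ : ∀ a, Q.comul a = Δ a := fun a => LinearMap.congr_fun hΔ a
  have eε : ∀ a, Q.counit a = ε a := fun a => LinearMap.congr_fun hε a
  let R : A ⊗[ℂ] A →ₐ[ℂ] A ⊗[ℂ] (A ⊗[ℂ] A) := Algebra.TensorProduct.map (AlgHom.id ℂ A) Δ
  let L : A ⊗[ℂ] A →ₐ[ℂ] A ⊗[ℂ] (A ⊗[ℂ] A) :=
    (Algebra.TensorProduct.assoc ℂ ℂ ℂ A A A).toAlgHom.comp
      (Algebra.TensorProduct.map Δ (AlgHom.id ℂ A))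
  let cl : A ⊗[ℂ] A →ₐ[ℂ] A :=
    (Algebra.TensorProduct.lid ℂ A).toAlgHom.comp (Algebra.TensorProduct.map ε (AlgHom.id ℂ A))
  let cr : A ⊗[ℂ] A →ₐ[ℂ] A :=
    (Algebra.TensorProduct.rid ℂ ℂ A).toAlgHom.comp (Algebra.TensorProduct.map (AlgHom.id ℂ A) ε)
  have eR : ∀ t, Q.comulRight t = R t := fun t => by rw [comulRight, hΔ]; rfl
  have eL : ∀ t, Q.comulLeft t = L t := fun t => by rw [comulLeft, hΔ]; rfl
  have ecl : ∀ t, Q.counitLeft t = cl t := fun t => by rw [counitLeft, hε]; rfl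
  have ecr : ∀ t, Q.counitRight t = cr t := fun t => by rw [counitRight, hε]; rfl
  have hc' : ∀ a, Q.comulRight (Q.comul a) = Q.comulLeft (Q.comul a) := by
    intro a
    have h : R.comp Δ = L.comp Δ := AlgHom.ext_of_adjoin_eq_top hS fun a ha => by
      have := hc a ha
      rwa [eR, eL, eΔ] at this
    rw [eR, eL, eΔ]
    exact AlgHom.congr_fun h a
  have hl' : ∀ a, Q.counitLeft (Q.comul a) = a := by
    intro a
    have h : cl.comp Δ = AlgHom.id ℂ A := AlgHom.ext_of_adjoin_eq_top hS fun a ha => by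
      have := hl a ha
      rwa [ecl, eΔ] at this
    rw [ecl, eΔ]
    exact AlgHom.congr_fun h a
  have hr' : ∀ a, Q.counitRight (Q.comul a) = a := by
    intro a
    have h : cr.comp Δ = AlgHom.id ℂ A := AlgHom.ext_of_adjoin_eq_top hS fun a ha => by
      have := hr a ha
      rwa [ecr, eΔ] at this
    rw [ecr, eΔ]
    exact AlgHom.congr_fun h a
  have d1 : Q.comul 1 = 1 := by rw [eΔ, map_one]
  have d2 : Q.comulLeft 1 = 1 := by rw [eL, map_one]
  have d3 : Q.comulRight 1 = 1 := by rw [eR, map_one]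
  refine ⟨d1, fun a b => by simp only [eΔ, map_mul], by rw [eε, map_one],
    fun a b => by simp only [eε, map_mul], by rw [h1]; exact isUnit_one,
    fun a => by rw [h1, mul_one, one_mul, hc'], ?_, hl', hr', ?_⟩
  · rw [h1, tensorOne₃_one]
    have e1 : Q.comul₁ 1 = 1 := by
      rw [Algebra.TensorProduct.one_def]
      change TensorProduct.assoc ℂ A A (A ⊗[ℂ] A) (Q.comul 1 ⊗ₜ 1) = _
      rw [d1]
      rfl
    have e2 : Q.comul₂ 1 = 1 := by
      rw [Algebra.TensorProduct.one_def]
      change 1 ⊗ₜ Q.comulLeft 1 = _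
      rw [d2]
      rfl
    have e3 : Q.comul₃ 1 = 1 := by
      rw [Algebra.TensorProduct.one_def]
      change 1 ⊗ₜ Q.comulRight 1 = _
      rw [d3]
      rfl
    rw [e1, e2, e3, ← Algebra.TensorProduct.one_def, one_mul, one_mul]
  · rw [h1, Algebra.TensorProduct.one_def, LinearMap.lTensor_tmul, ecl, map_one]
    rfl

/-- The axiom of a right antipode holds if it holds on generators. -/
theorem antipodeRight_comul_of_generators (hQ : Q.IsQuasiBialgebra) {S : Set A}
    (hS : Algebra.adjoin ℂ S = ⊤) (h1 : Q.antipode 1 = 1)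
    (hm : ∀ a b, Q.antipode (a * b) = Q.antipode b * Q.antipode a)
    (h : ∀ a ∈ S, Q.antipodeRight 1 (Q.comul a) = Q.counit a • 1) (a : A) :
    Q.antipodeRight 1 (Q.comul a) = Q.counit a • 1 := by
  have ha : a ∈ Algebra.adjoin ℂ S := hS ▸ Algebra.mem_top
  induction ha using Algebra.adjoin_induction with
  | mem a ha => exact h a ha
  | algebraMap c =>
    rw [Algebra.algebraMap_eq_smul_one, map_smul, map_smul, map_smul, hQ.comul_one,
      antipodeRight_one h1, hQ.counit_one]
    simp
  | add a b _ _ ha hb => rw [map_add, map_add, map_add, ha, hb, add_smul]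
  | mul a b _ _ ha hb =>
    rw [hQ.comul_mul, antipodeRight_mul hm, hb, antipodeRight_smul, ha, hQ.counit_mul, smul_smul,
      mul_comm]

end QuasiHopfData

namespace IsBookAlgebra

open QuasiHopfData

variable {A : Type*} [Ring A] [Algebra ℂ A] {Q : QuasiHopfData A} {N M : ℕ} [NeZero N] {q : ℂ}
  {g x y : A}

theorem linearIndependent_of_representation (ρ : A →ₐ[ℂ] Module.End ℂ (MonomialFunctions N))
    (hg : ρ g = mulG N q) (hx : ρ x = mulX N q) (hy : ρ y = mulY N M) :
    LinearIndependent ℂ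
      (fun i : Fin N × ZMod N × Fin M => skewMonomial g x y i.1 i.2.1 i.2.2) := by
  rw [Fintype.linearIndependent_iff]
  intro l hl j
  let f : MonomialFunctions N := fun b a c => if b = j.1 ∧ a = j.2.1 ∧ c = j.2.2 then 1 else 0
  have h1 : ∀ i : Fin N × ZMod N × Fin M,
      ρ (skewMonomial g x y i.1 i.2.1 i.2.2) f 0 0 0 = if i = j then 1 else 0 := by
    intro i
    have e : ρ (skewMonomial g x y i.1 i.2.1 i.2.2) =
        skewMonomial (mulG N q) (mulX N q) (mulY N M) i.1 i.2.1 i.2.2 := by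
      simp only [skewMonomial, map_mul, map_pow, hg, hx, hy]
    rw [e, skewMonomial_mul_apply f _ i.1.2 i.2.2.2]
    simp only [f, Prod.ext_iff, Fin.ext_iff]
  have h2 := congrArg (fun t => ρ t f 0 0 0) hl
  simp only [map_sum, map_smul, LinearMap.sum_apply, LinearMap.smul_apply, Finset.sum_apply,
    Pi.smul_apply, h1, smul_eq_mul, mul_ite, mul_one, mul_zero, Finset.sum_ite_eq',
    Finset.mem_univ, if_true, map_zero, LinearMap.zero_apply, Pi.zero_apply] at h2
  exact h2

/-- A bialgebra with generators `g`, `x`, `y` that satisfy the relations of a book algebra, and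
enough representations, is a book algebra. -/
theorem of_generators (ht : SkewTriple N q g x y) (hN : 3 ≤ N) (hM : M = 1 ∨ M = N)
    (hx : x ^ N = 0) (hy : y ^ M = 0) (hxy : x * y = y * x)
    (hS : Algebra.adjoin ℂ {g, x, y} = ⊤) (h1 : Q.assoc = 1)
    (Δ : A →ₐ[ℂ] A ⊗[ℂ] A) (ε : A →ₐ[ℂ] ℂ) (hΔ : Q.comul = Δ.toLinearMap)
    (hε : Q.counit = ε.toLinearMap) (hΔg : Q.comul g = g ⊗ₜ g)
    (hΔx : Q.comul x = x ⊗ₜ g + 1 ⊗ₜ x) (hΔy : Q.comul y = y ⊗ₜ 1 + (g ^ (N - 1)) ⊗ₜ y)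
    (hεg : Q.counit g = 1) (hεx : Q.counit x = 0) (hεy : Q.counit y = 0)
    (ρ : A →ₐ[ℂ] Module.End ℂ (MonomialFunctions N))
    (hρg : ρ g = mulG N q) (hρx : ρ x = mulX N q) (hρy : ρ y = mulY N M)
    (hχ : ∀ j : ℕ, ∃ χ : A →ₐ[ℂ] ℂ, χ g = q ^ j ∧ χ x = 0 ∧ χ y = 0) :
    IsBookAlgebra Q N M q g x y := by
  have hΔ1 : Q.comul 1 = 1 ⊗ₜ 1 := by rw [hΔ]; exact map_one Δ
  have hε1 : Q.counit 1 = 1 := by rw [hε]; exact map_one ε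
  have hΔp : Q.comul (g ^ (N - 1)) = (g ^ (N - 1)) ⊗ₜ[ℂ] (g ^ (N - 1)) := by
    have e : Q.comul (g ^ (N - 1)) = Q.comul g ^ (N - 1) := by rw [hΔ]; exact map_pow Δ _ _
    rw [e, hΔg, Algebra.TensorProduct.tmul_pow]
  have hεp : Q.counit (g ^ (N - 1)) = 1 := by
    have e : Q.counit (g ^ (N - 1)) = Q.counit g ^ (N - 1) := by rw [hε]; exact map_pow ε _ _
    rw [e, hεg, one_pow]
  have cR : ∀ a b : A, Q.comulRight (a ⊗ₜ b) = a ⊗ₜ Q.comul b := fun _ _ => rfl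
  have cL : ∀ a b : A, Q.comulLeft (a ⊗ₜ b) = TensorProduct.assoc ℂ A A A (Q.comul a ⊗ₜ b) :=
    fun _ _ => rfl
  have hQ : Q.IsQuasiBialgebra := by
    refine isQuasiBialgebra_of_algHom hS Δ ε hΔ hε h1 ?_ ?_ ?_
    · rintro a (rfl | rfl | rfl)
      · rw [hΔg, cR, cL, hΔg, TensorProduct.assoc_tmul]
      · rw [hΔx, map_add, map_add, cR, cR, cL, cL, hΔx, hΔg, hΔ1]
        simp only [TensorProduct.tmul_add, TensorProduct.add_tmul, map_add,
          TensorProduct.assoc_tmul, add_assoc]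
      · rw [hΔy, map_add, map_add, cR, cR, cL, cL, hΔy, hΔp, hΔ1]
        simp only [TensorProduct.tmul_add, TensorProduct.add_tmul, map_add,
          TensorProduct.assoc_tmul, add_assoc]
    · rintro a (rfl | rfl | rfl)
      · simp [hΔg, counitLeft, hεg]
      · simp [hΔx, counitLeft, hεx, hε1]
      · simp [hΔy, counitLeft, hεy, hεp]
    · rintro a (rfl | rfl | rfl)
      · simp [hΔg, counitRight, hεg]
      · simp [hΔx, counitRight, hεx, hεg]
      · simp [hΔy, counitRight, hεy, hε1]
  exact ⟨ht, hN, hM, hx, hy, hxy, hQ, h1, hΔg, hΔx, hΔy, hεg, hεx, hεy, hS,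
    linearIndependent_of_representation ρ hρg hρx hρy, hχ⟩

/-- Elements of positive filtration degree are sums of homogeneous elements of positive degree. -/
theorem tensorFiltration_le_higherDegree {𝒜 : ℕ → Submodule ℂ A}
    (h𝒜 : ∀ (b c : ℕ) (a : ZMod N), skewMonomial g x y b a c ∈ 𝒜 (b + c)) :
    tensorFiltration (monomialFiltration N g x y) (monomialFiltration N g x y) 1 ≤
      higherDegree 𝒜 := by
  refine tensorFiltration_le fun i j u v hij hu hv => ?_
  have h1 : monomialFiltration N g x y j ≤
      (higherDegree 𝒜).comap (TensorProduct.mk ℂ A A u) := by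
    refine Submodule.span_le.2 ?_
    rintro _ ⟨b, c, a, hk, rfl⟩
    have h2 : monomialFiltration N g x y i ≤
        (higherDegree 𝒜).comap ((TensorProduct.mk ℂ A A).flip (skewMonomial g x y b a c)) := by
      refine Submodule.span_le.2 ?_
      rintro _ ⟨b', c', a', hk', rfl⟩
      exact Submodule.subset_span ⟨b' + c', b + c, _, _, by omega, h𝒜 _ _ _, h𝒜 _ _ _, rfl⟩
    exact h2 hu
  exact h1 hv

end IsBookAlgebra

theorem SkewTriple.skewMonomial_eq {B : Type*} [Ring B] [Algebra ℂ B] {N : ℕ} [NeZero N] {q : ℂ}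
    {g x y : B} (h : SkewTriple N q g x y) (b : ℕ) (a : ZMod N) (c : ℕ) :
    skewMonomial g x y b a c = (q ^ (a.val * b))⁻¹ • (g ^ a.val * x ^ b * y ^ c) := by
  rw [skewMonomial, h.pow_mul_x, smul_mul_assoc, smul_smul,
    inv_mul_cancel₀ (pow_ne_zero _ h.ne_zero), one_smul]

/-! ### The Taft algebras. -/

namespace Taft

variable {N : ℕ} {q : ℂ}

theorem adjoin_eq_top : Algebra.adjoin ℂ {g, x, (0 : Taft N q)} = ⊤ := by
  have h : (Algebra.adjoin ℂ (Set.range (FreeAlgebra.ι ℂ (X := TaftGen)))).map (proj N q) = ⊤ := by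
    rw [FreeAlgebra.adjoin_range_ι, Algebra.map_top, AlgHom.range_eq_top]
    exact RingQuot.mkAlgHom_surjective ℂ _
  rw [AlgHom.map_adjoin] at h
  refine top_unique (h ▸ Algebra.adjoin_mono ?_)
  rintro _ ⟨_, ⟨t, rfl⟩, rfl⟩
  cases t
  · exact Or.inl rfl
  · exact Or.inr (Or.inl rfl)

theorem skewTriple (hq : IsPrimitiveRoot q N) : SkewTriple N q (g : Taft N q) x 0 :=
  ⟨hq, g_pow, g_mul_x, by simp⟩

/-- With `y = 0` and `M = 1` all conditions on `y` are trivial, and `mulY N 1` is the zero operator.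
-/
theorem isBookAlgebra [NeZero N] (hN : N ≠ 0) (h3 : 3 ≤ N) (hq : IsPrimitiveRoot q N) :
    IsBookAlgebra (quasiHopf hN hq) N 1 q g x 0 :=
  IsBookAlgebra.of_generators (skewTriple hq) h3 (Or.inl rfl) x_pow (pow_one 0) (by simp)
    adjoin_eq_top rfl (comul hN hq) (counit hN) rfl rfl (lift_g _ _ _ _ _) (lift_x _ _ _ _ _)
    (by rw [map_zero, TensorProduct.zero_tmul, TensorProduct.tmul_zero, add_zero])
    (lift_g _ _ _ _ _) (lift_x _ _ _ _ _) (map_zero _)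
    (lift (mulG N q) (mulX N q) (mulG_pow hq) mulX_pow (mulG_mul_mulX hq))
    (lift_g _ _ _ _ _) (lift_x _ _ _ _ _)
    (by rw [map_zero, ← mulY_pow (N := N) one_ne_zero, pow_one])
    (fun j => ⟨lift (q ^ j) 0 (by rw [← pow_mul, mul_comm, pow_mul, hq.pow_eq_one, one_pow])
      (zero_pow hN) (by simp), lift_g _ _ _ _ _, lift_x _ _ _ _ _, map_zero _⟩)

theorem antipodeRight_comul [NeZero N] (hN : N ≠ 0) (h3 : 3 ≤ N) (hq : IsPrimitiveRoot q N)
    (a : Taft N q) :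
    (quasiHopf hN hq).antipodeRight 1 ((quasiHopf hN hq).comul a) =
      (quasiHopf hN hq).counit a • 1 := by
  have h := isBookAlgebra hN h3 hq
  have hg : (quasiHopf hN hq).antipode g = g ^ (N - 1) :=
    congrArg MulOpposite.unop (lift_g _ _ _ _ _)
  have hx : (quasiHopf hN hq).antipode x = -(x * g ^ (N - 1)) :=
    congrArg MulOpposite.unop (lift_x _ _ _ _ _)
  have h1 : (quasiHopf hN hq).antipode 1 = 1 :=
    congrArg MulOpposite.unop (map_one (antipode hN hq))
  refine QuasiHopfData.antipodeRight_comul_of_generators h.isQuasiBialgebra adjoin_eq_top h1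
    (fun a b => congrArg MulOpposite.unop (map_mul (antipode hN hq) a b)) ?_ a
  rintro a (rfl | rfl | rfl)
  · rw [h.comul_g, QuasiHopfData.antipodeRight_tmul, hg, h.counit_g, mul_one, one_smul,
      mul_pow_sub_one hN, g_pow]
  · rw [h.comul_x, map_add, QuasiHopfData.antipodeRight_tmul, QuasiHopfData.antipodeRight_tmul,
      hg, hx, h.counit_x, mul_one, one_mul, zero_smul, one_mul, add_neg_cancel]
  · simp

theorem skewMonomial_mem_grade [NeZero N] (hq : IsPrimitiveRoot q N) (b c : ℕ) (a : ZMod N) :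
    skewMonomial (g : Taft N q) x 0 b a c ∈ grade N q (b + c) := by
  rw [(skewTriple hq).skewMonomial_eq]
  refine Submodule.smul_mem _ _ ?_
  obtain rfl | hc := eq_or_ne c 0
  · rw [pow_zero, mul_one]
    exact Submodule.subset_span ⟨_, rfl⟩
  · rw [zero_pow hc, mul_zero]
    exact Submodule.zero_mem _

end Taft

/-! ### The book algebra of dimension `64`. -/

namespace Book

section Lift

variable {B : Type*} [Ring B] [Algebra ℂ B] (a b c : B) (ha : a ^ 4 = 1) (hb : b ^ 4 = 0)
  (hc : c ^ 4 = 0) (hab : a * b = Complex.I • (b * a)) (hac : a * c = (-Complex.I) • (c * a))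
  (hbc : b * c = c * b)

theorem lift_g : lift a b c ha hb hc hab hac hbc g = a :=
  (RingQuot.liftAlgHom_mkAlgHom_apply ℂ _ _ _).trans (by simp)

theorem lift_x : lift a b c ha hb hc hab hac hbc x = b :=
  (RingQuot.liftAlgHom_mkAlgHom_apply ℂ _ _ _).trans (by simp)

theorem lift_y : lift a b c ha hb hc hab hac hbc y = c :=
  (RingQuot.liftAlgHom_mkAlgHom_apply ℂ _ _ _).trans (by simp)

end Lift

theorem adjoin_eq_top : Algebra.adjoin ℂ {g, x, y} = ⊤ := by
  have h : (Algebra.adjoin ℂ (Set.range (FreeAlgebra.ι ℂ (X := BookGen)))).map proj = ⊤ := by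
    rw [FreeAlgebra.adjoin_range_ι, Algebra.map_top, AlgHom.range_eq_top]
    exact RingQuot.mkAlgHom_surjective ℂ _
  rw [AlgHom.map_adjoin] at h
  refine top_unique (h ▸ Algebra.adjoin_mono ?_)
  rintro _ ⟨_, ⟨t, rfl⟩, rfl⟩
  cases t
  · exact Or.inl rfl
  · exact Or.inr (Or.inl rfl)
  · exact Or.inr (Or.inr rfl)

theorem skewTriple : SkewTriple 4 Complex.I g x y :=
  ⟨isPrimitiveRoot_I, g_pow, g_mul_x, by rw [Complex.inv_I, g_mul_y]⟩

theorem isBookAlgebra : IsBookAlgebra quasiHopf 4 4 Complex.I g x y :=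
  IsBookAlgebra.of_generators skewTriple (by norm_num) (Or.inr rfl) x_pow y_pow x_mul_y
    adjoin_eq_top rfl comul counit rfl rfl (lift_g _ _ _ _ _ _ _ _ _) (lift_x _ _ _ _ _ _ _ _ _)
    (lift_y _ _ _ _ _ _ _ _ _) (lift_g _ _ _ _ _ _ _ _ _) (lift_x _ _ _ _ _ _ _ _ _)
    (lift_y _ _ _ _ _ _ _ _ _)
    (lift (mulG 4 Complex.I) (mulX 4 Complex.I) (mulY 4 4) (mulG_pow isPrimitiveRoot_I) mulX_pow
      (mulY_pow four_ne_zero) (mulG_mul_mulX isPrimitiveRoot_I)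
      (by rw [mulG_mul_mulY isPrimitiveRoot_I, Complex.inv_I]) mulX_mul_mulY)
    (lift_g _ _ _ _ _ _ _ _ _) (lift_x _ _ _ _ _ _ _ _ _) (lift_y _ _ _ _ _ _ _ _ _)
    (fun j => ⟨lift (Complex.I ^ j) 0 0
      (by rw [← pow_mul, mul_comm, pow_mul, Complex.I_pow_four, one_pow])
      (zero_pow four_ne_zero) (zero_pow four_ne_zero) (by simp) (by simp) rfl,
      lift_g _ _ _ _ _ _ _ _ _, lift_x _ _ _ _ _ _ _ _ _, lift_y _ _ _ _ _ _ _ _ _⟩)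

theorem antipodeRight_comul (a : Book) :
    quasiHopf.antipodeRight 1 (quasiHopf.comul a) = quasiHopf.counit a • 1 := by
  have h := isBookAlgebra
  have hg : quasiHopf.antipode g = g ^ 3 :=
    congrArg MulOpposite.unop (lift_g _ _ _ _ _ _ _ _ _)
  have hx : quasiHopf.antipode x = -(x * g ^ 3) :=
    congrArg MulOpposite.unop (lift_x _ _ _ _ _ _ _ _ _)
  have hy : quasiHopf.antipode y = -(g * y) :=
    congrArg MulOpposite.unop (lift_y _ _ _ _ _ _ _ _ _)
  have h1 : quasiHopf.antipode 1 = 1 := congrArg MulOpposite.unop (map_one antipode)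
  refine QuasiHopfData.antipodeRight_comul_of_generators h.isQuasiBialgebra adjoin_eq_top h1
    (fun a b => congrArg MulOpposite.unop (map_mul antipode a b)) ?_ a
  rintro a (rfl | rfl | rfl)
  · rw [h.comul_g, QuasiHopfData.antipodeRight_tmul, hg, h.counit_g, mul_one, one_smul,
      g_mul_g_cube]
  · rw [h.comul_x, map_add, QuasiHopfData.antipodeRight_tmul, QuasiHopfData.antipodeRight_tmul,
      hg, hx, h.counit_x, mul_one, one_mul, zero_smul, one_mul, add_neg_cancel]
  · rw [h.comul_y, map_add, QuasiHopfData.antipodeRight_tmul, QuasiHopfData.antipodeRight_tmul,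
      h1, hy, h.counit_y, mul_one, mul_one, mul_one, zero_smul, mul_neg, ← mul_assoc,
      show g ^ (4 - 1) * g = 1 from g_cube_mul_g, one_mul, add_neg_cancel]

theorem skewMonomial_mem_grade (b c : ℕ) (a : ZMod 4) :
    skewMonomial g x y b a c ∈ grade (b + c) := by
  rw [skewTriple.skewMonomial_eq]
  exact Submodule.smul_mem _ _ (Submodule.subset_span ⟨_, _, _, rfl, rfl⟩)

end Book

/-! ### The two cases of the theorem. -/

theorem theorem4p4 {H : Type*} [Ring H] [Algebra ℂ H] [FiniteDimensional ℂ H]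
    (Q : QuasiHopfData H) (hQ : Q.IsQuasiHopf) (hH : IsBasicAlgebra H) :
    (∀ (n : ℕ) (hn : 2 ≤ n) (q : ℂ) (hq : IsPrimitiveRoot q (n ^ 2)),
      (QuasiHopfData.gr hQ (hQ.radicalIsQuasiHopfIdeal hH)).Isomorphic
          (Taft.quasiHopf (pow_ne_zero 2 (Nat.ne_zero_of_lt hn)) hq) →
        ∃ F : (Taft (n ^ 2) q ⊗[ℂ] Taft (n ^ 2) q)ˣ,
          (Taft.quasiHopf (pow_ne_zero 2 (Nat.ne_zero_of_lt hn)) hq).IsTwist F ∧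
          (F : Taft (n ^ 2) q ⊗[ℂ] Taft (n ^ 2) q) - 1 ∈ higherDegree (Taft.grade (n ^ 2) q) ∧
          Q.Isomorphic
            ((Taft.quasiHopf (pow_ne_zero 2 (Nat.ne_zero_of_lt hn)) hq).twist F)) ∧
    ((QuasiHopfData.gr hQ (hQ.radicalIsQuasiHopfIdeal hH)).Isomorphic Book.quasiHopf →
      ∃ F : (Book ⊗[ℂ] Book)ˣ,
        Book.quasiHopf.IsTwist F ∧
        (F : Book ⊗[ℂ] Book) - 1 ∈ higherDegree Book.grade ∧
        Q.Isomorphic (Book.quasiHopf.twist F)) := by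
  refine ⟨fun n hn q hq hiso => ?_, fun hiso => ?_⟩
  · have hN : n ^ 2 ≠ 0 := pow_ne_zero 2 (Nat.ne_zero_of_lt hn)
    have h3 : 3 ≤ n ^ 2 := by nlinarith
    have : NeZero (n ^ 2) := ⟨hN⟩
    obtain ⟨F, hF, hF1, e⟩ := (Taft.isBookAlgebra hN h3 hq).exists_twist rfl rfl
      (Taft.antipodeRight_comul hN h3 hq) (Submodule.zero_mem _) hQ hH _ hiso
    exact ⟨F, hF, IsBookAlgebra.tensorFiltration_le_higherDegree
      (Taft.skewMonomial_mem_grade hq) hF1, e⟩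
  · obtain ⟨F, hF, hF1, e⟩ := Book.isBookAlgebra.exists_twist rfl rfl Book.antipodeRight_comul
      IsBookAlgebra.y_mem hQ hH _ hiso
    exact ⟨F, hF, IsBookAlgebra.tensorFiltration_le_higherDegree Book.skewMonomial_mem_grade hF1, e⟩
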